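/- Let $n\ge 1$, $[n]=\{1,\dots,n\}$, and let $\mathcal A=\{A_1,\dots,A_r\}$ be a partition of $[n]$ into nonempty parts. A set $X\subseteq[n]$ *cuts* $A_p$ if $\emptyset\ne X\cap A_p\ne A_p$; it is an *$\mathcal A$-cut* if it cuts at least two parts. Let $\langle X\rangle$ be the union of the parts cut by $X$. Two sets are *$\mathcal A$-equivalent*, $X\sim Y$, if $\{\langle X\rangle\cap X,\langle X\rangle\setminus X\}=\{\langle Y\rangle\cap Y,\langle Y\rangle\setminus Y\}$; two families of $\mathcal A$-cuts are $\mathcal A$-equivalent, $\mathcal F\sim\mathcal G$, if they meet the same equivalence classes; a family is *non-redundant* if it has no two distinct equivalent members, *laminar* if any two members are nested or disjoint, and *laminarizable* if it is equivalent to a laminar family of $\mathcal A$-cuts. The problem LAMINARIZATION is: given a non-redundant family $\mathcal F$ of $\mathcal A$-cuts, decide whether it is laminarizable and, if so, find a non-redundant laminar family $\mathcal L$ of $\mathcal A$-cuts with $\mathcal L\sim\mathcal F$. *Notation.* $X,Y$ are *crossing on* $A$ if $X\cap Y\cap A$, $A\setminus(X\cup Y)$, $(X\setminus Y)\cap A$,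 $(Y\setminus X)\cap A$ are all nonempty; a family is *cross-free (on $A$)* if no two members are crossing on the ground set (on $A$), and *2-locally cross-free* if no two members $X,Y$ are crossing on $\langle X\rangle\cup\langle Y\rangle$. Write $\langle XY\rangle=\langle X\rangle\cap\langle Y\rangle$, $\overline X$ for the complement of $X$, "$X\subseteq Y$ on $A$" for $X\cap A\subseteq Y\cap A$, and call $\{X\cap A,\overline X\cap A\}$ the *line* of $X$ on $A$. An *LC-labeling* of $\mathcal F$ assigns $s(XY)\in\{0,1\}$ to each ordered pair of distinct members such that: (i) if $\langle XY\rangle\ne\emptyset$, then $(s(XY),s(YX))$ is $(0,0)$, $(0,1)$, $(1,0)$, $(1,1)$ when on $\langle XY\rangle$ one has $X\subsetneq\overline Y$, $X\subsetneq Y$, $X\supsetneq Y$, $X\supsetneq\overline Y$, respectively; (ii) if $\langle XY\rangle\ne\emptyset$, then $s(XY)=s(YX)$ when $X\subseteq\overline Y$ or $X\supseteq\overline Y$ on $\langle XY\rangle$, and $s(XY)=1-s(YX)$ when $X\subseteq Y$ or $X\supseteq Y$ on $\langle XY\rangle$; (iii) $s(XY)=s(XZ)$ when $\langle YZ\rangle\setminus\langle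 X\rangle\ne\emptyset$. Then $X^s$ arises from $X$ by adding every part contained in $\langle Y\rangle\setminus\langle X\rangle$ for some $Y\in\mathcal F$ with $s(XY)=1$ and deleting every such part for $Y$ with $s(XY)=0$, and $\mathcal F^s=\{X^s\mid X\in\mathcal F\}$. The *LC-graph* has as nodes the ordered pairs $XY$ of distinct members of $\mathcal F$; its edges are the *swapped* edges $\{XY,YX\}$ with $\langle XY\rangle\ne\emptyset$ and the *prefixed* edges $\{XY,XZ\}$ with $Y\ne Z$, $\langle YZ\rangle\setminus\langle X\rangle\ne\emptyset$. A node $XY$ with $\langle XY\rangle\neq\emptyset$ is *special* if $\langle XZ\rangle=\langle XY\rangle$ for each $XZ$ with $\langle XZ\rangle\ne\emptyset$ reachable from $XY$ along prefixed edges, and *fixed* if $X$ and $Y$ have different lines on $\langle XY\rangle$. A connected component is *special with center $A$* if it contains $XY$ and $YX$, both special, with $\langle XY\rangle=A$; it is *free* if it has no fixed node. If at least two special components have center $A$, then the free ones among them are classified by the common line on $A$ of the members $Z,W$ for their nodes $ZW$ with $\langle ZW\rangle\ne\emptyset$; each nonempty class is a *free flower*. *Representatives* of a free flower are distinct $X_1,\dots,X_q\in\mathcal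 F$ such that the flower consists of the components of the nodes $X_iX_j$, $i<j$. *Algorithm 5.* If no 2-locally cross-free family of $\mathcal A$-cuts is equivalent to $\mathcal F$, answer "not laminarizable". Otherwise output $\mathcal F^s$ for an LC-labeling $s$ chosen such that, for each free flower, with some representatives $X_1,\dots,X_q$, the family $\{X_1^s,\dots,X_q^s\}$ is cross-free on $\bigcup_i\langle X_i\rangle$; all other choices are arbitrary. *Algorithm 4.* While the current family $\mathcal G$ has a crossing pair, choose any such pair $X,Y$ and replace it with $X\cap Y,\ X\cup Y$ if $X\subseteq Y$ or $Y\subseteq X$ on $\langle X\rangle\cup\langle Y\rangle$, and with $X\setminus Y,\ Y\setminus X$ if $X\subseteq\overline Y$ or $\overline Y\subseteq X$ on $\langle X\rangle\cup\langle Y\rangle$. *Combined procedure.* Answer "not laminarizable" if $|\mathcal F|>2n$, or if there are distinct $X,Y\in\mathcal F$ with $\langle XY\rangle\ne\emptyset$ such that none of $X\subseteq Y$, $X\subseteq\overline Y$, $X\supseteq Y$, $X\supseteq\overline Y$ holds on $\langle XY\rangle$. Otherwise add, for each $X\in\mathcal F$, a new part $A_X$ with two elements to the partition and one of these two elements to $X$;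 apply Algorithm 5 to the resulting family and, unless it answers "not laminarizable", apply Algorithm 4 to its output; restrict the members of the resulting family to $[n]$; finally choose $e\in[n]$ and replace each member containing $e$ with its complement in $[n]$. **Theorem.** The combination of Algorithms 4 and 5 solves LAMINARIZATION in $O(n^4)$ time. Precisely: (1) On every non-redundant family $\mathcal F$ of $\mathcal A$-cuts the combined procedure has a run; whatever choices are made, Algorithm 4 does not get stuck and stops after $O(n^2)$ replacements, and the answer of every run is correct: if it is "not laminarizable", then $\mathcal F$ is not laminarizable, and otherwise it is a non-redundant laminar family $\mathcal L$ of $\mathcal A$-cuts with $\mathcal L\sim\mathcal F$. (2) The procedure can be implemented in $O(n^4)$ time: there are a constant $C$ and a program for a unit-cost random access machine (with registers and two-dimensional arrays of natural numbers, comparisons, and successor and predecessor as its only arithmetic operations) that, given $n$, $r$, $|\mathcal F|$, the part of each element of $[n]$ and the characteristic vectors of the members of a non-redundant family $\mathcal F$ of $\mathcal A$-cuts, halts after at most $C n^4$ steps and outputs the result of a run of the combined procedure, and hence a correct answer. -/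

import Mathlib

/-! ### Cuts, equivalence, laminarity

A partition of the ground set `V` is given by the map `part : V → ι` that sends an element to the
index of its part; the parts are the fibres `A_p = part ⁻¹' {p}`. -/

namespace CutFamily

variable {V ι : Type*}

/-- `X` cuts the part `A_p`: both `X` and its complement meet `A_p`. -/
def CutsPart (part : V → ι) (X : Set V) (p : ι) : Prop :=
  (∃ v ∈ X, part v = p) ∧ (∃ v ∉ X, part v = p)

/-- An `𝒜`-cut is a set that cuts at least two parts. -/
def IsCut (part : V → ι) (X : Set V) : Prop :=
  ∃ p q, p ≠ q ∧ CutsPart part X p ∧ CutsPart part X q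

/-- The cutting support `⟨X⟩`: the union of the parts cut by `X`. -/
def supp (part : V → ι) (X : Set V) : Set V :=
  {v | CutsPart part X (part v)}

/-- `𝒜`-equivalence of sets: the same bipartition of the same cutting support. -/
def Equivalent (part : V → ι) (X Y : Set V) : Prop :=
  ({supp part X ∩ X, supp part X \ X} : Set (Set V)) = {supp part Y ∩ Y, supp part Y \ Y}

/-- A family of `𝒜`-cuts. -/
def IsCutFamily (part : V → ι) (F : Set (Set V)) : Prop :=
  ∀ X ∈ F, IsCut part X

/-- `𝒜`-equivalence of families: they meet the same equivalence classes. -/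
def FamilyEquivalent (part : V → ι) (F G : Set (Set V)) : Prop :=
  (∀ X ∈ F, ∃ Y ∈ G, Equivalent part X Y) ∧ (∀ Y ∈ G, ∃ X ∈ F, Equivalent part X Y)

/-- No two distinct members are `𝒜`-equivalent. -/
def NonRedundant (part : V → ι) (F : Set (Set V)) : Prop :=
  ∀ X ∈ F, ∀ Y ∈ F, Equivalent part X Y → X = Y

/-- Any two members are nested or disjoint. -/
def Laminar (F : Set (Set V)) : Prop :=
  ∀ X ∈ F, ∀ Y ∈ F, X ⊆ Y ∨ Y ⊆ X ∨ X ∩ Y = ∅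

/-- Some laminar family of `𝒜`-cuts is `𝒜`-equivalent to `F`. -/
def Laminarizable (part : V → ι) (F : Set (Set V)) : Prop :=
  ∃ L, IsCutFamily part L ∧ Laminar L ∧ FamilyEquivalent part F L

/-- A correct answer to the problem Laminarization for the input `F`: `none` stands for the answer
"not laminarizable" and `some L` for the output family `L`. -/
def SolvesLaminarization (part : V → ι) (F : Set (Set V)) : Option (Set (Set V)) → Prop
  | none => ¬ Laminarizable part F
  | some L => IsCutFamily part L ∧ NonRedundant part L ∧ Laminar L ∧ FamilyEquivalent part F L

/-! ### Crossing pairs -/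

/-- `X` and `Y` are crossing on `A`. -/
def CrossingOn (A X Y : Set V) : Prop :=
  ((X ∩ Y) ∩ A).Nonempty ∧ (A \ (X ∪ Y)).Nonempty ∧ ((X \ Y) ∩ A).Nonempty ∧
    ((Y \ X) ∩ A).Nonempty

/-- `G` is cross-free on `A`. -/
def CrossFreeOn (A : Set V) (G : Set (Set V)) : Prop :=
  ∀ X ∈ G, ∀ Y ∈ G, ¬ CrossingOn A X Y

/-- `G` is cross-free. -/
def CrossFree (G : Set (Set V)) : Prop := CrossFreeOn Set.univ G

/-- No two members are crossing on the union of their cutting supports. -/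
def TwoLocallyCrossFree (part : V → ι) (G : Set (Set V)) : Prop :=
  ∀ X ∈ G, ∀ Y ∈ G, ¬ CrossingOn (supp part X ∪ supp part Y) X Y

/-- `X ⊆ Y` on `A`. -/
def SubOn (A X Y : Set V) : Prop := X ∩ A ⊆ Y ∩ A

/-- `X ⊊ Y` on `A`. -/
def SSubOn (A X Y : Set V) : Prop := X ∩ A ⊂ Y ∩ A

/-- `⟨XY⟩ = ⟨X⟩ ∩ ⟨Y⟩`. -/
def supp₂ (part : V → ι) (X Y : Set V) : Set V := supp part X ∩ supp part Y

/-- The partition line of `X` on `A`. -/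
def line (A X : Set V) : Set (Set V) := {X ∩ A, Xᶜ ∩ A}

/-- On the common cutting support of two members, if it is nonempty, each of them is comparable with
the other or with its complement. -/
def PairwiseComparable (part : V → ι) (F : Set (Set V)) : Prop :=
  ∀ X ∈ F, ∀ Y ∈ F, X ≠ Y → (supp₂ part X Y).Nonempty →
    SubOn (supp₂ part X Y) X Y ∨ SubOn (supp₂ part X Y) X Yᶜ ∨
      SubOn (supp₂ part X Y) Y X ∨ SubOn (supp₂ part X Y) Yᶜ X

/-! ### Labelings and the LC-graph -/

/-- `s` is an LC-labeling for `F`; the label of the ordered pair `XY` is `s X Y`, with `false` for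
`0` and `true` for `1` (values at other pairs than those of distinct members of `F` are ignored). -/
structure IsLCLabeling (part : V → ι) (F : Set (Set V)) (s : Set V → Set V → Bool) : Prop where
  fixed : ∀ X ∈ F, ∀ Y ∈ F, X ≠ Y → (supp₂ part X Y).Nonempty →
    (SSubOn (supp₂ part X Y) X Yᶜ → s X Y = false ∧ s Y X = false) ∧
    (SSubOn (supp₂ part X Y) X Y → s X Y = false ∧ s Y X = true) ∧
    (SSubOn (supp₂ part X Y) Y X → s X Y = true ∧ s Y X = false) ∧
    (SSubOn (supp₂ part X Y) Yᶜ X → s X Y = true ∧ s Y X = true)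
  swapped : ∀ X ∈ F, ∀ Y ∈ F, X ≠ Y → (supp₂ part X Y).Nonempty →
    (SubOn (supp₂ part X Y) X Yᶜ ∨ SubOn (supp₂ part X Y) Yᶜ X → s X Y = s Y X) ∧
    (SubOn (supp₂ part X Y) X Y ∨ SubOn (supp₂ part X Y) Y X → s X Y = !(s Y X))
  prefixed : ∀ X ∈ F, ∀ Y ∈ F, ∀ Z ∈ F, X ≠ Y → X ≠ Z →
    (supp₂ part Y Z \ supp part X).Nonempty → s X Y = s X Z

/-- `X^s`: for every part contained in `⟨Y⟩ \ ⟨X⟩` for some member `Y`, the part is added to `X` if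
`s X Y = 1` and deleted from `X` if `s X Y = 0`; nothing else is changed. -/
def relabel (part : V → ι) (F : Set (Set V)) (s : Set V → Set V → Bool) (X : Set V) : Set V :=
  {v | (∃ Y ∈ F, v ∈ supp part Y \ supp part X ∧ s X Y = true) ∨
       ((∀ Y ∈ F, v ∉ supp part Y \ supp part X) ∧ v ∈ X)}

/-- The nodes of the LC-graph: ordered pairs of distinct members of `F`. -/
abbrev LCNode (F : Set (Set V)) : Type _ :=
  {a : Set V × Set V // a.1 ∈ F ∧ a.2 ∈ F ∧ a.1 ≠ a.2}

/-- The node `YX` for the node `XY`. -/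
def LCNode.swap {F : Set (Set V)} (a : LCNode F) : LCNode F :=
  ⟨(a.1.2, a.1.1), a.2.2.1, a.2.1, a.2.2.2.symm⟩

/-- `⟨XY⟩` for the node `XY`. -/
def LCNode.supp (part : V → ι) {F : Set (Set V)} (a : LCNode F) : Set V :=
  supp₂ part a.1.1 a.1.2

/-- The graph of the prefixed edges `{XY, XZ}`, where `Y ≠ Z` and `⟨YZ⟩ \ ⟨X⟩ ≠ ∅`. -/
def prefixedGraph (part : V → ι) (F : Set (Set V)) : SimpleGraph (LCNode F) where
  Adj a b := a ≠ b ∧ a.1.1 = b.1.1 ∧ (supp₂ part a.1.2 b.1.2 \ supp part a.1.1).Nonempty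
  symm := ⟨by
    rintro a b ⟨h1, h2, h3⟩
    refine ⟨h1.symm, h2.symm, ?_⟩
    rw [← h2]
    simpa only [supp₂, Set.inter_comm] using h3⟩
  loopless := ⟨fun _ h => h.1 rfl⟩

/-- The graph of the swapped edges `{XY, YX}`, where `⟨XY⟩ ≠ ∅`. -/
def swappedGraph (part : V → ι) (F : Set (Set V)) : SimpleGraph (LCNode F) where
  Adj a b := b = a.swap ∧ (a.supp part).Nonempty
  symm := ⟨by
    rintro a b ⟨rfl, h⟩
    exact ⟨rfl, by simpa only [LCNode.supp, LCNode.swap, supp₂, Set.inter_comm] using h⟩⟩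
  loopless := ⟨fun a h => a.2.2.2 (congrArg (fun b : LCNode F => b.1.1) h.1)⟩

/-- The LC-graph of `F`. -/
def lcGraph (part : V → ι) (F : Set (Set V)) : SimpleGraph (LCNode F) :=
  swappedGraph part F ⊔ prefixedGraph part F

/-- The node `XY` is special: `⟨XY⟩ ≠ ∅`, and `⟨XZ⟩ = ⟨XY⟩` for each node `XZ` with `⟨XZ⟩ ≠ ∅` that
is reached from `XY` along prefixed edges. -/
def LCNode.IsSpecial (part : V → ι) {F : Set (Set V)} (a : LCNode F) : Prop :=
  (a.supp part).Nonempty ∧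
    ∀ b, (prefixedGraph part F).Reachable a b → (b.supp part).Nonempty → b.supp part = a.supp part

/-- The node `XY` is fixed: `⟨XY⟩ ≠ ∅` and `X`, `Y` have different partition lines on it. -/
def LCNode.IsFixed (part : V → ι) {F : Set (Set V)} (a : LCNode F) : Prop :=
  (a.supp part).Nonempty ∧ line (a.supp part) a.1.1 ≠ line (a.supp part) a.1.2

/-- The connected components of the LC-graph. -/
abbrev LCComponent (part : V → ι) (F : Set (Set V)) : Type _ :=
  (lcGraph part F).ConnectedComponent

/-- The component `c` is special with center `A`: it is `v(XY)` for some `X`, `Y` such that `XY` and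
`YX` are special and `⟨XY⟩ = A`. -/
def LCComponent.IsSpecialWithCenter {part : V → ι} {F : Set (Set V)} (c : LCComponent part F)
    (A : Set V) : Prop :=
  ∃ a : LCNode F, (lcGraph part F).connectedComponentMk a = c ∧
    a.IsSpecial part ∧ a.swap.IsSpecial part ∧ a.supp part = A

/-- The component `c` is free: it has no fixed node. -/
def LCComponent.IsFree {part : V → ι} {F : Set (Set V)} (c : LCComponent part F) : Prop :=
  ∀ a : LCNode F, (lcGraph part F).connectedComponentMk a = c → ¬ a.IsFixed part

/-- The common partition line on `A` of the members `Z`, `W`, for the nodes `ZW` of `c` with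
`⟨ZW⟩ ≠ ∅`, is `l`. -/
def LCComponent.HasLine {part : V → ι} {F : Set (Set V)} (c : LCComponent part F)
    (A : Set V) (l : Set (Set V)) : Prop :=
  ∀ a : LCNode F, (lcGraph part F).connectedComponentMk a = c → (a.supp part).Nonempty →
    line A a.1.1 = l ∧ line A a.1.2 = l

/-- `C` is a free flower with center `A`: at least two special components have center `A`, and `C`
consists of all free ones among them with a given partition line on `A`. -/
def IsFreeFlower (part : V → ι) (F : Set (Set V)) (A : Set V) (C : Set (LCComponent part F)) :
    Prop :=
  C.Nonempty ∧ {c : LCComponent part F | c.IsSpecialWithCenter A}.Nontrivial ∧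
    ∃ l, C = {c : LCComponent part F | c.IsSpecialWithCenter A ∧ c.IsFree ∧ c.HasLine A l}

/-- `X 0, …, X (q - 1)` are representatives of `C`, that is, `C = {v(X i X j) | i < j}`. -/
def Represents (part : V → ι) (F : Set (Set V)) (C : Set (LCComponent part F)) {q : ℕ}
    (X : Fin q → Set V) : Prop :=
  Function.Injective X ∧ (∀ i, X i ∈ F) ∧
    C = {c | ∃ a : LCNode F, (∃ i j, i < j ∧ a.1 = (X i, X j)) ∧
      (lcGraph part F).connectedComponentMk a = c}

/-! ### The algorithms

The algorithms make arbitrary choices. They are described by the relation between their inputs and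
the outputs that they can produce. -/

/-- Algorithm 5. If no 2-locally cross-free family is equivalent to `F`, it answers `none`.
Otherwise it outputs `F^s = {X^s | X ∈ F}` for an LC-labeling `s` of the following kind: it is as
prescribed on the components with a fixed node; on each further component it is determined by its
value at one node, which is arbitrary except on the free flowers; on each free flower it is such
that, for representatives `X i`, the family of the `(X i)^s` is cross-free on the union of the
cutting supports of the `X i`. -/
inductive Algorithm5 (part : V → ι) (F : Set (Set V)) : Option (Set (Set V)) → Prop
  | reject
      (h : ¬ ∃ G, IsCutFamily part G ∧ TwoLocallyCrossFree part G ∧ FamilyEquivalent part F G) :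
      Algorithm5 part F none
  | output (s : Set V → Set V → Bool)
      (h : ∃ G, IsCutFamily part G ∧ TwoLocallyCrossFree part G ∧ FamilyEquivalent part F G)
      (hs : IsLCLabeling part F s)
      (hflower : ∀ A C, IsFreeFlower part F A C →
        ∃ (q : ℕ) (X : Fin q → Set V), Represents part F C X ∧
          CrossFreeOn (⋃ i, supp part (X i)) (Set.range fun i => relabel part F s (X i))) :
      Algorithm5 part F (some (relabel part F s '' F))

/-- One uncrossing operation, applied to a crossing pair of members of `G`. -/
inductive UncrossStep (part : V → ι) (G : Set (Set V)) : Set (Set V) → Prop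
  | nested (X Y : Set V) (hX : X ∈ G) (hY : Y ∈ G) (hXY : CrossingOn Set.univ X Y)
      (h : SubOn (supp part X ∪ supp part Y) X Y ∨ SubOn (supp part X ∪ supp part Y) Y X) :
      UncrossStep part G ((G \ {X, Y}) ∪ {X ∩ Y, X ∪ Y})
  | disjoint (X Y : Set V) (hX : X ∈ G) (hY : Y ∈ G) (hXY : CrossingOn Set.univ X Y)
      (h : SubOn (supp part X ∪ supp part Y) X Yᶜ ∨ SubOn (supp part X ∪ supp part Y) Yᶜ X) :
      UncrossStep part G ((G \ {X, Y}) ∪ {X \ Y, Y \ X})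

/-- Algorithm 4: uncrossing operations are applied to crossing pairs until there are none. -/
def Algorithm4 (part : V → ι) (G G' : Set (Set V)) : Prop :=
  Relation.ReflTransGen (UncrossStep part) G G' ∧ CrossFree G'

/-- Whatever crossing pairs are chosen, Algorithm 4 on the input `G` stops after at most `N`
uncrossing operations, and it does not get stuck before it has reached a cross-free family. -/
def Algorithm4StopsWithin (part : V → ι) (G : Set (Set V)) (N : ℕ) : Prop :=
  (∀ (k : ℕ) (H : ℕ → Set (Set V)), H 0 = G → (∀ i < k, UncrossStep part (H i) (H (i + 1))) →
    k ≤ N) ∧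
  (∀ H, Relation.ReflTransGen (UncrossStep part) G H → ¬ CrossFree H → ∃ H', UncrossStep part H H')

/-- The partition after the preprocessing: for each `X ∈ F` there is a new part `A_X`, consisting of
the two elements `(X, true)` and `(X, false)`. -/
def extPart (part : V → ι) (F : Set (Set V)) : V ⊕ (F × Bool) → ι ⊕ F :=
  Sum.map part Prod.fst

/-- The family after the preprocessing: one of the two elements of `A_X` is added to each `X`. -/
def extFamily (F : Set (Set V)) : Set (Set (V ⊕ (F × Bool))) :=
  Set.range fun X : F => Sum.inl '' (X : Set V) ∪ {Sum.inr (X, true)}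

/-- Restriction of a family to the original ground set. -/
def restrict {F : Set (Set V)} (G : Set (Set (V ⊕ (F × Bool)))) : Set (Set V) :=
  (fun X => Sum.inl ⁻¹' X) '' G

/-- The members that contain `e` are replaced with their complements. -/
def switchAt (e : V) (G : Set (Set V)) : Set (Set V) :=
  {Z | ∃ X ∈ G, (e ∉ X ∧ Z = X) ∨ (e ∈ X ∧ Z = Xᶜ)}

/-- The combination of Algorithms 5 and 4, with the pre- and postprocessing: `F` is rejected if it
has more than `2 |V|` members or is not pairwise comparable; then Algorithm 5 and, if it does not
reject, Algorithm 4 are applied to the preprocessed family; the resulting cross-free family is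
restricted to the original ground set and made laminar by complementing the members that contain
some fixed element. -/
inductive Run (part : V → ι) (F : Set (Set V)) : Option (Set (Set V)) → Prop
  | tooMany (h : 2 * Nat.card V < F.ncard) : Run part F none
  | incomparable (h : ¬ PairwiseComparable part F) : Run part F none
  | noLabeling (hcard : F.ncard ≤ 2 * Nat.card V) (hcomp : PairwiseComparable part F)
      (h5 : Algorithm5 (extPart part F) (extFamily F) none) : Run part F none
  | success (hcard : F.ncard ≤ 2 * Nat.card V) (hcomp : PairwiseComparable part F)
      (G G' : Set (Set (V ⊕ (F × Bool))))
      (h5 : Algorithm5 (extPart part F) (extFamily F) (some G))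
      (h4 : Algorithm4 (extPart part F) G G') (e : V) :
      Run part F (some (switchAt e (restrict G')))

end CutFamily

/-! ### A machine model with a step count

A structured random access machine with unit costs. It has registers and arrays, two-dimensional
and initially zero outside the input, whose cells hold natural numbers. Its only arithmetic
operations are successor and predecessor, so that a number that arises within `t` steps exceeds the
largest number of the program and of the input by at most `t`; hence unit costs cannot be abused by
packing much information into one cell. -/

namespace RAM

/-- Memory contents. -/
structure Store where
  reg : ℕ → ℕ
  arr : ℕ → ℕ → ℕ → ℕ

/-- Expressions: constants, registers, array cells, successor, predecessor (`0` at `0`). -/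
inductive Expr where
  | const (k : ℕ)
  | reg (x : ℕ)
  | cell (a : ℕ) (i j : Expr)
  | succ (e : Expr)
  | pred (e : Expr)

/-- The value of an expression. -/
def Expr.val (σ : Store) : Expr → ℕ
  | const k => k
  | reg x => σ.reg x
  | cell a i j => σ.arr a (i.val σ) (j.val σ)
  | succ e => e.val σ + 1
  | pred e => e.val σ - 1

/-- The number of steps for evaluating an expression: one for each node. -/
def Expr.cost : Expr → ℕ
  | const _ => 1
  | reg _ => 1
  | cell _ i j => i.cost + j.cost + 1
  | succ e => e.cost + 1
  | pred e => e.cost + 1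

/-- Tests: comparisons of two expressions. -/
inductive Test where
  | eq (e f : Expr)
  | lt (e f : Expr)

/-- The truth of a test. -/
def Test.Holds (σ : Store) : Test → Prop
  | eq e f => e.val σ = f.val σ
  | lt e f => e.val σ < f.val σ

/-- The number of steps for a test. -/
def Test.cost : Test → ℕ
  | eq e f => e.cost + f.cost + 1
  | lt e f => e.cost + f.cost + 1

/-- Programs. -/
inductive Prog where
  | skip
  | assign (x : ℕ) (e : Expr)
  | store (a : ℕ) (i j e : Expr)
  | seq (P Q : Prog)
  | ite (b : Test) (P Q : Prog)
  | loop (b : Test) (P : Prog)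

/-- The store after `reg x := k`. -/
def Store.setReg (σ : Store) (x k : ℕ) : Store :=
  { σ with reg := Function.update σ.reg x k }

/-- The store after `arr a i j := k`. -/
def Store.setCell (σ : Store) (a i j k : ℕ) : Store :=
  { σ with
    arr := Function.update σ.arr a
      (Function.update (σ.arr a) i (Function.update (σ.arr a i) j k)) }

/-- `Exec P σ τ t`: the program `P`, started with memory `σ`, halts with memory `τ` after `t`
steps. Here `loop b P` repeats `P` while `b` holds. -/
inductive Exec : Prog → Store → Store → ℕ → Prop
  | skip (σ : Store) : Exec .skip σ σ 1
  | assign (σ : Store) (x : ℕ) (e : Expr) :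
      Exec (.assign x e) σ (σ.setReg x (e.val σ)) (e.cost + 1)
  | store (σ : Store) (a : ℕ) (i j e : Expr) :
      Exec (.store a i j e) σ (σ.setCell a (i.val σ) (j.val σ) (e.val σ))
        (i.cost + j.cost + e.cost + 1)
  | seq {P Q : Prog} {σ τ υ : Store} {t u : ℕ} (hP : Exec P σ τ t) (hQ : Exec Q τ υ u) :
      Exec (.seq P Q) σ υ (t + u)
  | iteTrue {b : Test} {P Q : Prog} {σ τ : Store} {t : ℕ} (hb : b.Holds σ) (hP : Exec P σ τ t) :
      Exec (.ite b P Q) σ τ (b.cost + t)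
  | iteFalse {b : Test} {P Q : Prog} {σ τ : Store} {t : ℕ} (hb : ¬ b.Holds σ)
      (hQ : Exec Q σ τ t) : Exec (.ite b P Q) σ τ (b.cost + t)
  | loopDone {b : Test} {P : Prog} {σ : Store} (hb : ¬ b.Holds σ) :
      Exec (.loop b P) σ σ b.cost
  | loopStep {b : Test} {P : Prog} {σ τ υ : Store} {t u : ℕ} (hb : b.Holds σ)
      (hP : Exec P σ τ t) (hloop : Exec (.loop b P) τ υ u) :
      Exec (.loop b P) σ υ (b.cost + t + u)

open Classical in
/-- The input: `n`, the number `r` of parts and the number `m` of members of the family are in the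
registers `0`, `1`, `2`; row `0` of the array `0` holds the indices of the parts of the elements;
row `k` of the array `1` is the characteristic vector of the `k`-th member. -/
noncomputable def input {n r m : ℕ} (part : Fin n → Fin r) (X : Fin m → Set (Fin n)) : Store where
  reg x := if x = 0 then n else if x = 1 then r else if x = 2 then m else 0
  arr a k i :=
    if hi : i < n then
      if a = 0 ∧ k = 0 then (part ⟨i, hi⟩ : ℕ)
      else if hk : k < m then
        if a = 1 ∧ (⟨i, hi⟩ : Fin n) ∈ X ⟨k, hk⟩ then 1 else 0
      else 0
    else 0

/-- The output: if register `0` holds `0`, the answer is `none`; otherwise it is the family whose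
members are given by the rows of the array `2` with index less than register `1`. -/
def output (n : ℕ) (σ : Store) : Option (Set (Set (Fin n))) :=
  if σ.reg 0 = 0 then none
  else some {Z | ∃ k < σ.reg 1, Z = {i : Fin n | σ.arr 2 k i = 1}}

end RAM

/-!
The theorem has a combinatorial half, the correctness of every run, and a computational half, the
time bound. Both rest on one notion.

**Good families.** Call a family *good* (`Good`) if no two members cross on the union of their
cutting supports, the cutting supports are distinct, and there is no *cyclic triple*: three members
that cut a common part and have orientations (each set or its complement) with `P ⊆ Q ⊆ R ⊆ P`, each
inclusion on the union of the two supports. If `P ⊆ Q` on `⟨P⟩ ∪ ⟨Q⟩`, replacing `P` by `P ∩ Q` could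
spoil the family only through a member `R` that cuts a part in `P` outside of `Q`; by
`cyc_or_disjoint` such an `R` either meets the two members in no common cut part, or closes a cyclic
triple. Hence uncrossing a good family keeps it good and equivalent to the original family, and each
operation decreases the number of crossing pairs (`Good.uncrossStep`). As one of the two operations is
always applicable, Algorithm 4 neither gets stuck nor makes more than quadratically many replacements
(`Good.algorithm4StopsWithin`). The preprocessing gives each member a part that it alone cuts, so
that no cutting support contains another.

**Algorithm 5.** An LC-labeling is the same thing as a locally cross-free equivalent family
(`IsLCLabeling.localModel`, `LocalModel.exists_labeling`). A cyclic triple of such a family gives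
components of the LC-graph that belong to a free flower (`IsCyclicTriple.component`), and the property
`NodeInv` carries the cyclic triple along the edges of the LC-graph to the representatives of that
flower, which then cross; so the condition on free flowers excludes cyclic triples
(`not_isCyclicTriple_of_flower`), and every output of Algorithm 5 is good. Conversely, if a labeling
has no cyclic triple, then every free flower has representatives that satisfy the condition
(`exists_representatives`). A laminar family has few members (`ncard_le_of_laminar`), and a laminar
family equivalent to `F` extends to the preprocessed ground set
(`Laminarizable.exists_localModel_ext`); so negative answers are correct, too.

**Running time.** A labeling without cyclic triples is found without any inspection of the flowers:
fix an order of the members, propagate labels from the prescribed ones, and whenever this stops, give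
the label `false` to the first unlabeled node `XY` with `⟨XY⟩ ≠ ∅`. If `X, Y, Z` were a cyclic triple
with `X` as early as possible, then the first nodes of the components of `XY` and `XZ` would have the
form `XY'` and `XZ'` with `X, Y', Z'` a cyclic triple again, but in a cyclic triple the labels of these
two nodes differ (`not_isCyclicTriple_of_rooted`). The labels form a system of equations between pairs
of Boolean unknowns, and `SignedGraph.Partial` is the invariant of this greedy method. For the
implementation, programs are written in a small language with bounded quantifiers and loops whose
bounds are `O(n)`; the time is polynomial with the nesting depth as exponent (`HProg.exec_compile`).
Depth four suffices: for each of the quadratically many propagation or uncrossing operations, a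
quadratic search finds the place, and an update takes at most quadratic time.
-/

namespace CutFamily

variable {W κ : Type*} {part : W → κ}

/-! ### Cutting supports and noncrossing pairs -/

theorem mem_supp_iff {X : Set W} {v : W} :
    v ∈ supp part X ↔ (∃ u ∈ X, part u = part v) ∧ ∃ u ∉ X, part u = part v := Iff.rfl

theorem mem_supp_congr {X : Set W} {u v : W} (h : part u = part v) :
    u ∈ supp part X ↔ v ∈ supp part X := by
  simp only [mem_supp_iff, h]

@[simp] theorem supp_compl (X : Set W) : supp part Xᶜ = supp part X := by
  ext v
  simp only [mem_supp_iff, Set.mem_compl_iff, not_not]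
  exact and_comm

theorem mem_congr_of_notMem_supp {X : Set W} {u v : W} (hv : v ∉ supp part X)
    (h : part u = part v) : u ∈ X ↔ v ∈ X := by
  simp only [mem_supp_iff] at hv
  push Not at hv
  constructor
  · intro hu
    by_contra hx
    exact hx (by_contra fun hx => hv ⟨u, hu, h⟩ v hx rfl)
  · intro hx
    by_contra hu
    exact hv ⟨v, hx, rfl⟩ u hu h

theorem supp_eq_of_forall {X Y : Set W} (h : ∀ v ∈ supp part X, v ∈ X ↔ v ∈ Y)
    (h' : ∀ u v, part u = part v → v ∉ supp part X → (u ∈ Y ↔ v ∈ Y)) :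
    supp part Y = supp part X := by
  ext v
  by_cases hv : v ∈ supp part X
  · simp only [hv, iff_true]
    obtain ⟨⟨a, ha, hav⟩, ⟨b, hb, hbv⟩⟩ := hv
    have hv : v ∈ supp part X := ⟨⟨a, ha, hav⟩, ⟨b, hb, hbv⟩⟩
    exact ⟨⟨a, (h a ((mem_supp_congr hav).2 hv)).1 ha, hav⟩,
      ⟨b, fun hbY => hb ((h b ((mem_supp_congr hbv).2 hv)).2 hbY), hbv⟩⟩
  · simp only [hv, iff_false]
    rintro ⟨⟨a, ha, hav⟩, ⟨b, hb, hbv⟩⟩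
    exact hb ((h' b v hbv hv).2 ((h' a v hav hv).1 ha))

theorem subOn_iff {A X Y : Set W} : SubOn A X Y ↔ ∀ v ∈ A, v ∈ X → v ∈ Y :=
  ⟨fun h _ hv hx => (h ⟨hx, hv⟩).1, fun h _ hv => ⟨h _ hv.2 hv.1, hv.2⟩⟩

theorem subOn_compl {A X Y : Set W} : SubOn A Xᶜ Yᶜ ↔ SubOn A Y X := by
  simp only [subOn_iff, Set.mem_compl_iff]
  exact forall₂_congr fun _ _ => not_imp_not

/-- `P` is an orientation of `X`: the set `X` itself or its complement. -/
def IsOrient (P X : Set W) : Prop := P = X ∨ P = Xᶜ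

theorem IsOrient.refl (X : Set W) : IsOrient X X := Or.inl rfl

theorem IsOrient.compl {P X : Set W} (h : IsOrient P X) : IsOrient Pᶜ X := by
  rcases h with rfl | rfl
  · exact Or.inr rfl
  · exact Or.inl (compl_compl _)

theorem IsOrient.supp_eq {P X : Set W} (h : IsOrient P X) : supp part P = supp part X := by
  rcases h with rfl | rfl <;> simp

theorem IsOrient.symm {P X : Set W} (h : IsOrient P X) : IsOrient X P := by
  rcases h with rfl | rfl
  · exact Or.inl rfl
  · exact Or.inr (compl_compl _).symm

theorem IsOrient.trans {P Q X : Set W} (h : IsOrient P Q) (h' : IsOrient Q X) : IsOrient P X := by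
  rcases h with rfl | rfl
  · exact h'
  · exact h'.compl

theorem IsOrient.eq_or_compl {P Q X : Set W} (h : IsOrient P X) (h' : IsOrient Q X) :
    P = Q ∨ P = Qᶜ := h.trans h'.symm

theorem notCrossingOn_iff {A X Y : Set W} :
    ¬ CrossingOn A X Y ↔ ∃ P Q, IsOrient P X ∧ IsOrient Q Y ∧ SubOn A P Q := by
  constructor
  · intro h
    by_contra hc
    push Not at hc
    have h1 := hc _ _ (.refl X) (.refl Y)
    have h2 := hc _ _ (.refl X) (IsOrient.refl Y).compl
    have h3 := hc _ _ (IsOrient.refl X).compl (.refl Y)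
    have h4 := hc _ _ (IsOrient.refl X).compl (IsOrient.refl Y).compl
    simp only [subOn_iff, Set.mem_compl_iff] at h1 h2 h3 h4
    push Not at h1 h2 h3 h4
    obtain ⟨a, ha⟩ := h1
    obtain ⟨b, hb⟩ := h2
    obtain ⟨c, hc⟩ := h3
    obtain ⟨d, hd⟩ := h4
    exact h ⟨⟨b, ⟨hb.2.1, hb.2.2⟩, hb.1⟩, ⟨c, hc.1, fun h => h.elim hc.2.1 hc.2.2⟩,
      ⟨a, ⟨ha.2.1, ha.2.2⟩, ha.1⟩, ⟨d, ⟨hd.2.2, hd.2.1⟩, hd.1⟩⟩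
  · rintro ⟨P, Q, hP, hQ, h⟩ ⟨⟨b, hb⟩, ⟨c, hc⟩, ⟨a, ha⟩, ⟨d, hd⟩⟩
    rw [subOn_iff] at h
    rcases hP with rfl | rfl <;> rcases hQ with rfl | rfl
    · exact ha.1.2 (h a ha.2 ha.1.1)
    · exact h b hb.2 hb.1.1 hb.1.2
    · exact hc.2 (Or.inr (h c hc.1 fun h => hc.2 (Or.inl h)))
    · exact h d hd.2 hd.1.2 hd.1.1

theorem CrossingOn.symm {A X Y : Set W} (h : CrossingOn A X Y) : CrossingOn A Y X := by
  obtain ⟨h1, h2, h3, h4⟩ := h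
  exact ⟨by rwa [Set.inter_comm Y X], by rwa [Set.union_comm Y X], h4, h3⟩

theorem CrossingOn.orient {A X Y P Q : Set W} (h : CrossingOn A X Y) (hP : IsOrient P X)
    (hQ : IsOrient Q Y) : CrossingOn A P Q := by
  by_contra hc
  obtain ⟨P', Q', hP', hQ', hs⟩ := notCrossingOn_iff.1 hc
  exact notCrossingOn_iff.2 ⟨P', Q', hP'.trans hP, hQ'.trans hQ, hs⟩ h

theorem CrossingOn.mono {A B X Y : Set W} (hAB : A ⊆ B) (h : CrossingOn A X Y) :
    CrossingOn B X Y :=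
  ⟨h.1.mono (Set.inter_subset_inter_right _ hAB), h.2.1.mono (Set.sdiff_subset_sdiff_left hAB),
    h.2.2.1.mono (Set.inter_subset_inter_right _ hAB),
    h.2.2.2.mono (Set.inter_subset_inter_right _ hAB)⟩

theorem CrossingOn.congr {A X Y P Q : Set W} (h : CrossingOn A X Y)
    (hP : ∀ v ∈ A, v ∈ X ↔ v ∈ P) (hQ : ∀ v ∈ A, v ∈ Y ↔ v ∈ Q) : CrossingOn A P Q := by
  obtain ⟨⟨b, hb⟩, ⟨c, hc⟩, ⟨a, ha⟩, ⟨d, hd⟩⟩ := h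
  refine ⟨⟨b, ⟨(hP b hb.2).1 hb.1.1, (hQ b hb.2).1 hb.1.2⟩, hb.2⟩,
    ⟨c, hc.1, fun h => hc.2 (h.imp (hP c hc.1).2 (hQ c hc.1).2)⟩,
    ⟨a, ⟨(hP a ha.2).1 ha.1.1, fun h => ha.1.2 ((hQ a ha.2).2 h)⟩, ha.2⟩,
    ⟨d, ⟨(hQ d hd.2).1 hd.1.1, fun h => hd.1.2 ((hP d hd.2).2 h)⟩, hd.2⟩⟩

theorem not_crossingOn_self (A X : Set W) : ¬ CrossingOn A X X :=
  fun h => h.2.2.1.elim fun _ hv => hv.1.2 hv.1.1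

/-- If `P ⊆ Q` locally, then outside of `⟨P⟩` every part of `⟨Q⟩` avoids `P`. -/
theorem SubOn.notMem_left {P Q : Set W} (h : SubOn (supp part P ∪ supp part Q) P Q) {v : W}
    (hv : v ∈ supp part Q) (hP : v ∉ supp part P) : v ∉ P := by
  intro hvP
  obtain ⟨u, hu, huv⟩ := hv.2
  refine hu (subOn_iff.1 h u (Or.inr ?_) ((mem_congr_of_notMem_supp hP huv).2 hvP))
  exact (mem_supp_congr huv).2 hv

/-- If `P ⊆ Q` locally, then outside of `⟨Q⟩` every part of `⟨P⟩` is contained in `Q`. -/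
theorem SubOn.mem_right {P Q : Set W} (h : SubOn (supp part P ∪ supp part Q) P Q) {v : W}
    (hv : v ∈ supp part P) (hQ : v ∉ supp part Q) : v ∈ Q := by
  obtain ⟨u, hu, huv⟩ := hv.1
  exact (mem_congr_of_notMem_supp hQ huv).1
    (subOn_iff.1 h u (Or.inl ((mem_supp_congr huv).2 hv)) hu)

theorem subOn_union_of {P Q : Set W} (h : SubOn (supp part P ∩ supp part Q) P Q)
    (h1 : ∀ v ∈ supp part Q, v ∉ supp part P → v ∉ P)
    (h2 : ∀ v ∈ supp part P, v ∉ supp part Q → v ∈ Q) :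
    SubOn (supp part P ∪ supp part Q) P Q := by
  rw [subOn_iff] at h ⊢
  intro v hv hvP
  by_cases ha : v ∈ supp part P
  · by_cases hb : v ∈ supp part Q
    · exact h v ⟨ha, hb⟩ hvP
    · exact h2 v ha hb
  · exact absurd hvP (h1 v (hv.resolve_left ha) ha)

/-- A set that is noncrossing with `Y` is constant on `⟨Y⟩ \ ⟨X⟩`. -/
theorem const_of_notCrossingOn {X Y : Set W}
    (h : ¬ CrossingOn (supp part X ∪ supp part Y) X Y) {u v : W}
    (hu : u ∈ supp part Y) (hu' : u ∉ supp part X) (hv : v ∈ supp part Y)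
    (hv' : v ∉ supp part X) : u ∈ X ↔ v ∈ X := by
  obtain ⟨P, Q, hP, hQ, hs⟩ := notCrossingOn_iff.1 h
  rw [← hP.supp_eq, ← hQ.supp_eq] at hs
  rw [← hP.supp_eq] at hu' hv'
  rw [← hQ.supp_eq] at hu hv
  have h1 := hs.notMem_left hu hu'
  have h2 := hs.notMem_left hv hv'
  rcases hP with rfl | rfl
  · simp [h1, h2]
  · simp only [Set.mem_compl_iff, not_not] at h1 h2
    simp [h1, h2]

/-- Two sets that are constant on the cutting supports of each other do not cross there. -/
theorem notCrossingOn_of_const {X Y : Set W}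
    (hX : ∀ u ∈ supp part Y, ∀ v ∈ supp part Y, u ∈ X ↔ v ∈ X)
    (hY : ∀ u ∈ supp part X, ∀ v ∈ supp part X, u ∈ Y ↔ v ∈ Y) :
    ¬ CrossingOn (supp part X ∪ supp part Y) X Y := by
  rw [notCrossingOn_iff]
  obtain ⟨P, hP, hP'⟩ : ∃ P, IsOrient P X ∧ ∀ v ∈ supp part Y, v ∉ P := by
    by_cases h : ∃ u ∈ supp part Y, u ∈ X
    · obtain ⟨u, hu, hu'⟩ := h
      exact ⟨Xᶜ, (IsOrient.refl X).compl, fun v hv h => h ((hX u hu v hv).1 hu')⟩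
    · push Not at h
      exact ⟨X, .refl X, h⟩
  obtain ⟨Q, hQ, hQ'⟩ : ∃ Q, IsOrient Q Y ∧ ∀ v ∈ supp part X, v ∈ Q := by
    by_cases h : ∃ u ∈ supp part X, u ∉ Y
    · obtain ⟨u, hu, hu'⟩ := h
      exact ⟨Yᶜ, (IsOrient.refl Y).compl, fun v hv h => hu' ((hY u hu v hv).2 h)⟩
    · push Not at h
      exact ⟨Y, .refl Y, h⟩
  refine ⟨P, Q, hP, hQ, ?_⟩
  rw [subOn_iff]
  rintro v (hv | hv) hvP
  · exact hQ' v hv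
  · exact absurd hvP (hP' v hv)

/-! ### Equivalence -/

theorem equivalent_iff {X Y : Set W} : Equivalent part X Y ↔ supp part X = supp part Y ∧
    ∃ P, IsOrient P Y ∧ ∀ v ∈ supp part X, v ∈ X ↔ v ∈ P := by
  have hu : ∀ Z : Set W, ⋃₀ ({supp part Z ∩ Z, supp part Z \ Z} : Set (Set W)) = supp part Z := by
    intro Z
    rw [Set.sUnion_pair, Set.inter_union_sdiff]
  constructor
  · intro h
    have hs : supp part X = supp part Y := by rw [← hu X, ← hu Y, h]
    refine ⟨hs, ?_⟩
    unfold Equivalent at h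
    rw [hs, Set.pair_eq_pair_iff] at h
    rw [hs]
    rcases h with ⟨h1, -⟩ | ⟨h1, -⟩
    · refine ⟨Y, .refl Y, fun v hv => ?_⟩
      simpa [hv] using Set.ext_iff.1 h1 v
    · refine ⟨Yᶜ, (IsOrient.refl Y).compl, fun v hv => ?_⟩
      simpa [hv] using Set.ext_iff.1 h1 v
  · rintro ⟨hs, P, hP, h⟩
    unfold Equivalent
    rw [Set.pair_eq_pair_iff, ← hs]
    rcases hP with rfl | rfl
    · left
      constructor <;> ext v <;> by_cases hv : v ∈ supp part X <;> simp [hv, h]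
    · right
      constructor <;> ext v <;> by_cases hv : v ∈ supp part X <;> simp [hv, h]

theorem Equivalent.refl (X : Set W) : Equivalent part X X := rfl

theorem Equivalent.symm {X Y : Set W} (h : Equivalent part X Y) : Equivalent part Y X :=
  Eq.symm h

theorem Equivalent.trans {X Y Z : Set W} (h : Equivalent part X Y) (h' : Equivalent part Y Z) :
    Equivalent part X Z := Eq.trans h h'

theorem Equivalent.supp_eq {X Y : Set W} (h : Equivalent part X Y) :
    supp part X = supp part Y := (equivalent_iff.1 h).1

theorem IsOrient.equivalent {X Y : Set W} (h : IsOrient X Y) : Equivalent part X Y :=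
  equivalent_iff.2 ⟨h.supp_eq, X, h, fun _ _ => Iff.rfl⟩

theorem isCut_iff {X : Set W} :
    IsCut part X ↔ ∃ u ∈ supp part X, ∃ v ∈ supp part X, part u ≠ part v := by
  constructor
  · rintro ⟨p, q, hpq, ⟨⟨u, hu, rfl⟩, hu'⟩, ⟨⟨v, hv, rfl⟩, hv'⟩⟩
    exact ⟨u, ⟨⟨u, hu, rfl⟩, hu'⟩, v, ⟨⟨v, hv, rfl⟩, hv'⟩, hpq⟩
  · rintro ⟨u, hu, v, hv, h⟩
    exact ⟨_, _, h, hu, hv⟩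

theorem IsCut.congr {X Y : Set W} (h : IsCut part X) (hs : supp part X = supp part Y) :
    IsCut part Y := by
  rw [isCut_iff] at h ⊢
  rwa [← hs]

theorem IsCut.supp_nonempty {X : Set W} (h : IsCut part X) : (supp part X).Nonempty := by
  obtain ⟨u, hu, -⟩ := isCut_iff.1 h
  exact ⟨u, hu⟩

/-! ### Cyclic triples -/

/-- `P ⊆ Q ⊆ R ⊆ P`, where each inclusion holds on the union of the two cutting supports. -/
structure Cyc (part : W → κ) (P Q R : Set W) : Prop where
  h12 : SubOn (supp part P ∪ supp part Q) P Q
  h23 : SubOn (supp part Q ∪ supp part R) Q R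
  h31 : SubOn (supp part R ∪ supp part P) R P

theorem Cyc.rotate {P Q R : Set W} (h : Cyc part P Q R) : Cyc part Q R P := ⟨h.h23, h.h31, h.h12⟩

theorem Cyc.reverse {P Q R : Set W} (h : Cyc part P Q R) : Cyc part Rᶜ Qᶜ Pᶜ :=
  ⟨by simpa [subOn_compl, Set.union_comm] using h.h23,
    by simpa [subOn_compl, Set.union_comm] using h.h12,
    by simpa [subOn_compl, Set.union_comm] using h.h31⟩

theorem Cyc.inter_subset {P Q R : Set W} (h : Cyc part P Q R) :
    supp part P ∩ supp part Q ⊆ supp part R := by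
  rintro v ⟨hP, hQ⟩
  by_contra hR
  exact h.h31.notMem_left hP hR (h.h23.mem_right hQ hR)

theorem Cyc.inter_eq {P Q R : Set W} (h : Cyc part P Q R) :
    supp part P ∩ supp part Q = supp part R ∩ supp part P := by
  apply Set.Subset.antisymm
  · exact fun v hv => ⟨h.inter_subset hv, hv.1⟩
  · exact fun v hv => ⟨hv.2, h.rotate.rotate.inter_subset hv⟩

theorem Cyc.mem_iff {P Q R : Set W} (h : Cyc part P Q R) {v : W} (hP : v ∈ supp part P) :
    v ∈ supp part Q → (v ∈ P ↔ v ∈ Q) := fun hQ =>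
  ⟨subOn_iff.1 h.h12 v (Or.inl hP), fun hv => subOn_iff.1 h.h31 v (Or.inr hP)
    (subOn_iff.1 h.h23 v (Or.inl hQ) hv)⟩

/-- Three sets that can be oriented to a cycle of local inclusions and that cut a common part. -/
def IsCyclicTriple (part : W → κ) (X Y Z : Set W) : Prop :=
  ((supp part X ∩ supp part Y) ∩ supp part Z).Nonempty ∧
    ∃ P Q R, IsOrient P X ∧ IsOrient Q Y ∧ IsOrient R Z ∧ Cyc part P Q R

theorem IsCyclicTriple.rotate {X Y Z : Set W} (h : IsCyclicTriple part X Y Z) :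
    IsCyclicTriple part Y Z X := by
  obtain ⟨⟨v, hv⟩, P, Q, R, hP, hQ, hR, hc⟩ := h
  exact ⟨⟨v, ⟨hv.1.2, hv.2⟩, hv.1.1⟩, Q, R, P, hQ, hR, hP, hc.rotate⟩

theorem IsCyclicTriple.reverse {X Y Z : Set W} (h : IsCyclicTriple part X Y Z) :
    IsCyclicTriple part Z Y X := by
  obtain ⟨⟨v, hv⟩, P, Q, R, hP, hQ, hR, hc⟩ := h
  exact ⟨⟨v, ⟨hv.2, hv.1.2⟩, hv.1.1⟩, _, _, _, hR.compl, hQ.compl, hP.compl, hc.reverse⟩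

theorem IsCyclicTriple.swap {X Y Z : Set W} (h : IsCyclicTriple part X Y Z) :
    IsCyclicTriple part Y X Z := h.reverse.rotate

theorem IsCyclicTriple.supp_inter_eq {X Y Z : Set W} (h : IsCyclicTriple part X Y Z) :
    supp part X ∩ supp part Y = supp part X ∩ supp part Z := by
  obtain ⟨-, P, Q, R, hP, hQ, hR, hc⟩ := h
  have := hc.inter_eq
  rwa [hP.supp_eq, hQ.supp_eq, hR.supp_eq, Set.inter_comm (supp part Z)] at this

/-- The key dichotomy behind uncrossing. Suppose that `P ⊆ Q` locally and that `R` crosses neither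
of them locally, but some part cut by `R` alone lies in `P` and not in `Q`. Then either `R` has no
common cut part with `P` or `Q`, or `P ⊆ Q ⊆ R' ⊆ P` is a cycle for an orientation `R'` of `R`. -/
theorem cyc_or_disjoint {P Q R : Set W} (hPQ : SubOn (supp part P ∪ supp part Q) P Q)
    (hPR : ¬ CrossingOn (supp part P ∪ supp part R) P R)
    (hQR : ¬ CrossingOn (supp part Q ∪ supp part R) Q R) {v : W} (hv : v ∈ supp part R)
    (hvP : v ∉ supp part P) (hvQ : v ∉ supp part Q) (hP : v ∈ P) (hQ : v ∉ Q) :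
    (supp part P ∩ supp part R = ∅ ∧ supp part Q ∩ supp part R = ∅) ∨
      ∃ R', IsOrient R' R ∧ Cyc part P Q R' := by
  obtain ⟨R₁, hR₁, h1⟩ : ∃ R', IsOrient R' R ∧ SubOn (supp part R' ∪ supp part P) R' P := by
    obtain ⟨P', R', hP', hR', hs⟩ := notCrossingOn_iff.1 hPR
    rw [← hP'.supp_eq, ← hR'.supp_eq] at hs
    rw [← hR'.supp_eq] at hv
    have hne : v ∉ P' := hs.notMem_left hv (by rwa [hP'.supp_eq])
    rcases hP' with rfl | rfl
    · exact absurd hP hne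
    · refine ⟨R'ᶜ, hR'.compl, ?_⟩
      rw [← subOn_compl, compl_compl, supp_compl, Set.union_comm]
      simpa using hs
  obtain ⟨R₂, hR₂, h2⟩ : ∃ R', IsOrient R' R ∧ SubOn (supp part Q ∪ supp part R') Q R' := by
    obtain ⟨Q', R', hQ', hR', hs⟩ := notCrossingOn_iff.1 hQR
    rw [← hQ'.supp_eq, ← hR'.supp_eq] at hs
    rw [← hR'.supp_eq] at hv
    have hne : v ∉ Q' := hs.notMem_left hv (by rwa [hQ'.supp_eq])
    rcases hQ' with rfl | rfl
    · exact ⟨R', hR', hs⟩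
    · exact absurd hQ hne
  rcases hR₂.eq_or_compl hR₁ with rfl | rfl
  · exact Or.inr ⟨R₂, hR₁, hPQ, h2, h1⟩
  · left
    have key : ∀ w, w ∈ supp part P → w ∈ supp part R → False := by
      intro w hwP hwR
      rw [← hR₁.supp_eq] at hwR
      by_cases hwQ : w ∈ supp part Q
      · obtain ⟨u, hu, huw⟩ := hwR.1
        have hu' : u ∈ supp part P := (mem_supp_congr huw).2 hwP
        have hu'' : u ∈ supp part Q := (mem_supp_congr huw).2 hwQ
        have h3 : u ∈ P := subOn_iff.1 h1 u (Or.inr hu') hu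
        have h4 : u ∈ Q := subOn_iff.1 hPQ u (Or.inl hu') h3
        exact subOn_iff.1 h2 u (Or.inl hu'') h4 hu
      · exact h2.notMem_left (by simpa using hwR) hwQ (hPQ.mem_right hwP hwQ)
    constructor
    · exact Set.eq_empty_of_forall_notMem fun w hw => key w hw.1 hw.2
    · refine Set.eq_empty_of_forall_notMem fun w hw => ?_
      by_cases hwP : w ∈ supp part P
      · exact key w hwP hw.2
      · have hwR := hw.2
        rw [← hR₁.supp_eq] at hwR
        exact hPQ.notMem_left hw.1 hwP (h1.mem_right hwR hwP)

/-! ### Good families -/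

/-- A locally cross-free family with distinct cutting supports and without cyclic triples: the
families on which uncrossing never gets stuck. -/
structure Good {I : Type*} (part : W → κ) (f : I → Set W) : Prop where
  supp_ne : ∀ i j, i ≠ j → supp part (f i) ≠ supp part (f j)
  two : ∀ i j, ¬ CrossingOn (supp part (f i) ∪ supp part (f j)) (f i) (f j)
  noCyc : ∀ i j k, i ≠ j → j ≠ k → i ≠ k → ¬ IsCyclicTriple part (f i) (f j) (f k)

end CutFamily

namespace CutFamily

variable {W κ : Type*} {part : W → κ}

/-! ### Uncrossing -/

/-- `f'` differs from `f` only by complementation and on parts that matter for no pair of members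
with a common cut part. -/
structure Refines {I : Type*} (part : W → κ) (f f' : I → Set W) : Prop where
  supp_eq : ∀ k, supp part (f' k) = supp part (f k)
  near : ∀ k, ∃ T, IsOrient T (f k) ∧ ∀ l, (supp part (f k) ∩ supp part (f l)).Nonempty →
    ∀ v ∈ supp part (f k) ∪ supp part (f l), v ∈ f' k ↔ v ∈ T
  const : ∀ k l, ∀ u ∈ supp part (f l), ∀ v ∈ supp part (f l), u ∉ supp part (f k) →
    v ∉ supp part (f k) → (u ∈ f' k ↔ v ∈ f' k)

theorem Refines.near_orient {I : Type*} {f f' : I → Set W} (h : Refines part f f') {k : I}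
    {P : Set W} (hP : IsOrient P (f' k)) :
    ∃ T, IsOrient T (f k) ∧ ∀ l, (supp part (f k) ∩ supp part (f l)).Nonempty →
      ∀ v ∈ supp part (f k) ∪ supp part (f l), v ∈ P ↔ v ∈ T := by
  obtain ⟨T, hT, h⟩ := h.near k
  rcases hP with rfl | rfl
  · exact ⟨T, hT, h⟩
  · exact ⟨Tᶜ, hT.compl, fun l hl v hv => not_congr (h l hl v hv)⟩

theorem Refines.equivalent {I : Type*} {f f' : I → Set W} (h : Refines part f f') (k : I) :
    Equivalent part (f k) (f' k) := by
  apply Equivalent.symm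
  rw [equivalent_iff]
  obtain ⟨T, hT, h'⟩ := h.near k
  refine ⟨h.supp_eq k, T, hT, fun v hv => ?_⟩
  rw [h.supp_eq] at hv
  exact h' k ⟨v, hv, hv⟩ v (Or.inl hv)

theorem Good.refines {I : Type*} {f f' : I → Set W} (hf : Good part f) (h : Refines part f f') :
    Good part f' := by
  refine ⟨fun i j hij => ?_, fun i j hc => ?_, ?_⟩
  · rw [h.supp_eq, h.supp_eq]
    exact hf.supp_ne i j hij
  · rcases Set.eq_empty_or_nonempty (supp part (f i) ∩ supp part (f j)) with he | hne
    · have hd : ∀ v, v ∈ supp part (f i) → v ∉ supp part (f j) := fun v hv hv' =>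
        (Set.ext_iff.1 he v).1 ⟨hv, hv'⟩
      refine notCrossingOn_of_const ?_ ?_ hc
      · rw [h.supp_eq]
        exact fun u hu v hv => h.const i j u hu v hv (fun h => hd _ h hu) (fun h => hd _ h hv)
      · rw [h.supp_eq]
        exact fun u hu v hv => h.const j i u hu v hv (hd u hu) (hd v hv)
    · obtain ⟨T, hT, h1⟩ := h.near i
      obtain ⟨S, hS, h2⟩ := h.near j
      rw [h.supp_eq, h.supp_eq] at hc
      refine hf.two i j ((hc.congr (h1 j hne) ?_).orient hT.symm hS.symm)
      intro v hv
      exact h2 i (by rwa [Set.inter_comm]) v (by rwa [Set.union_comm])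
  · rintro i j k hij hjk hik ⟨⟨v, hv⟩, P, Q, R, hP, hQ, hR, hc⟩
    obtain ⟨P', hP', h1⟩ := h.near_orient hP
    obtain ⟨Q', hQ', h2⟩ := h.near_orient hQ
    obtain ⟨R', hR', h3⟩ := h.near_orient hR
    simp only [h.supp_eq] at hv
    have key : ∀ {a b : I} {A B A' B' : Set W}, IsOrient A (f' a) → IsOrient B (f' b) →
        IsOrient A' (f a) → IsOrient B' (f b) → v ∈ supp part (f a) → v ∈ supp part (f b) →
        (∀ l, (supp part (f a) ∩ supp part (f l)).Nonempty →
          ∀ v ∈ supp part (f a) ∪ supp part (f l), v ∈ A ↔ v ∈ A') →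
        (∀ l, (supp part (f b) ∩ supp part (f l)).Nonempty →
          ∀ v ∈ supp part (f b) ∪ supp part (f l), v ∈ B ↔ v ∈ B') →
        SubOn (supp part A ∪ supp part B) A B → SubOn (supp part A' ∪ supp part B') A' B' := by
      intro a b A B A' B' hA hB hA' hB' ha hb h1 h2 hs
      rw [hA.supp_eq, hB.supp_eq, h.supp_eq, h.supp_eq, subOn_iff] at hs
      rw [hA'.supp_eq, hB'.supp_eq, subOn_iff]
      intro w hw hwA
      exact (h2 a ⟨v, hb, ha⟩ w hw.symm).1 (hs w hw ((h1 b ⟨v, ha, hb⟩ w hw).2 hwA))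
    exact hf.noCyc i j k hij hjk hik ⟨⟨v, hv⟩, P', Q', R', hP', hQ', hR',
      key hP hQ hP' hQ' hv.1.1 hv.1.2 h1 h2 hc.h12, key hQ hR hQ' hR' hv.1.2 hv.2 h2 h3 hc.h23,
      key hR hP hR' hP' hv.2 hv.1.1 h3 h1 hc.h31⟩

theorem supp_inter_eq {P Q : Set W} (hs : SubOn (supp part P ∪ supp part Q) P Q) :
    supp part (P ∩ Q) = supp part P := by
  apply supp_eq_of_forall
  · intro v hv
    exact ⟨fun h => ⟨h, subOn_iff.1 hs v (Or.inl hv) h⟩, fun h => h.1⟩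
  · intro u v huv hv
    have h1 := mem_congr_of_notMem_supp hv huv
    by_cases hvQ : v ∈ supp part Q
    · have h2 := hs.notMem_left hvQ hv
      exact ⟨fun h => absurd (h1.1 h.1) h2, fun h => absurd h.1 h2⟩
    · exact and_congr h1 (mem_congr_of_notMem_supp hvQ huv)

/-- In a good family, intersecting with a locally larger member changes nothing that matters. -/
theorem Good.inter_near {I : Type*} {f : I → Set W} (hf : Good part f) {i j : I} (hij : i ≠ j)
    {P Q : Set W} (hP : IsOrient P (f i)) (hQ : IsOrient Q (f j))
    (hs : SubOn (supp part P ∪ supp part Q) P Q) :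
    (∀ l, (supp part (f i) ∩ supp part (f l)).Nonempty →
      ∀ v ∈ supp part (f i) ∪ supp part (f l), v ∈ P ∩ Q ↔ v ∈ P) ∧
    ∀ l, ∀ u ∈ supp part (f l), ∀ v ∈ supp part (f l), u ∉ supp part (f i) →
      v ∉ supp part (f i) → (u ∈ P ∩ Q ↔ v ∈ P ∩ Q) := by
  have two : ∀ {a b : I} {A B : Set W}, IsOrient A (f a) → IsOrient B (f b) →
      ¬ CrossingOn (supp part A ∪ supp part B) A B := by
    intro a b A B hA hB hc
    rw [hA.supp_eq, hB.supp_eq] at hc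
    exact hf.two a b (hc.orient hA.symm hB.symm)
  have hPs := hP.supp_eq (part := part)
  constructor
  · intro l hl v hv
    refine ⟨fun h => h.1, fun hvP => ⟨hvP, ?_⟩⟩
    by_contra hvQ
    have hv1 : v ∉ supp part P := fun h => hvQ (subOn_iff.1 hs v (Or.inl h) hvP)
    have hv2 : v ∉ supp part Q := fun h => hvQ (subOn_iff.1 hs v (Or.inr h) hvP)
    have hvl : v ∈ supp part (f l) := hv.resolve_left (by rwa [← hPs])
    rcases cyc_or_disjoint hs (two hP (.refl _)) (two hQ (.refl _)) hvl hv1 hv2 hvP hvQ with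
      h | ⟨R, hR, hc⟩
    · rw [hPs] at h
      exact hl.ne_empty h.1
    · have hil : i ≠ l := by
        rintro rfl
        exact hv1 (by rwa [hPs])
      have hjl : j ≠ l := by
        rintro rfl
        exact hv2 (by rwa [hQ.supp_eq])
      obtain ⟨w, hw, hw'⟩ := hl
      have hwQ := hc.rotate.rotate.inter_subset
        (show w ∈ supp part R ∩ supp part P from ⟨by rwa [hR.supp_eq], by rwa [hPs]⟩)
      rw [hQ.supp_eq] at hwQ
      exact hf.noCyc i j l hij hjl hil ⟨⟨w, ⟨hw, hwQ⟩, hw'⟩, P, Q, R, hP, hQ, hR, hc⟩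
  · intro l u hu v hv hui hvi
    rw [← hPs] at hui hvi
    have h1 := const_of_notCrossingOn (two hP (.refl (f l))) hu hui hv hvi
    have h2 : u ∈ P → (u ∈ Q ↔ v ∈ Q) := fun huP =>
      const_of_notCrossingOn (two hQ (.refl (f l))) hu (fun h => hs.notMem_left h hui huP) hv
        (fun h => hs.notMem_left h hvi (h1.1 huP))
    constructor
    · exact fun h => ⟨h1.1 h.1, (h2 h.1).1 h.2⟩
    · exact fun h => ⟨h1.2 h.1, (h2 (h1.2 h.1)).2 h.2⟩

theorem Good.refines_uncross {I : Type*} {f f' : I → Set W} (hf : Good part f) {i j : I}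
    (hij : i ≠ j) {P Q : Set W} (hP : IsOrient P (f i)) (hQ : IsOrient Q (f j))
    (hs : SubOn (supp part P ∪ supp part Q) P Q) (hi : IsOrient (f' i) (P ∩ Q))
    (hj : IsOrient (f' j) (P ∪ Q)) (hk : ∀ k, k ≠ i → k ≠ j → f' k = f k) :
    Refines part f f' := by
  have hs' : SubOn (supp part Qᶜ ∪ supp part Pᶜ) Qᶜ Pᶜ := by
    rw [subOn_compl, supp_compl, supp_compl, Set.union_comm]
    exact hs
  have hj' : IsOrient (f' j) (Qᶜ ∩ Pᶜ) := by
    have : IsOrient (P ∪ Q) (Qᶜ ∩ Pᶜ) := by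
      right
      rw [Set.compl_inter, compl_compl, compl_compl, Set.union_comm]
    exact hj.trans this
  -- both sides of the uncrossing operation are intersections, up to complementation
  have key : ∀ {a b : I} {A B : Set W}, a ≠ b → IsOrient A (f a) → IsOrient B (f b) →
      SubOn (supp part A ∪ supp part B) A B → IsOrient (f' a) (A ∩ B) →
      supp part (f' a) = supp part (f a) ∧ (∃ T, IsOrient T (f a) ∧
        ∀ l, (supp part (f a) ∩ supp part (f l)).Nonempty →
          ∀ v ∈ supp part (f a) ∪ supp part (f l), v ∈ f' a ↔ v ∈ T) ∧
      ∀ l, ∀ u ∈ supp part (f l), ∀ v ∈ supp part (f l), u ∉ supp part (f a) →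
        v ∉ supp part (f a) → (u ∈ f' a ↔ v ∈ f' a) := by
    intro a b A B hab hA hB hs ha
    obtain ⟨h1, h2⟩ := hf.inter_near hab hA hB hs
    refine ⟨by rw [ha.supp_eq, supp_inter_eq hs, hA.supp_eq], ?_⟩
    rcases ha with ha | ha <;> rw [ha]
    · exact ⟨⟨A, hA, h1⟩, h2⟩
    · exact ⟨⟨Aᶜ, hA.compl, fun l hl v hv => not_congr (h1 l hl v hv)⟩,
        fun l u hu v hv hu' hv' => not_congr (h2 l u hu v hv hu' hv')⟩
  have hkey : ∀ k, supp part (f' k) = supp part (f k) ∧ (∃ T, IsOrient T (f k) ∧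
        ∀ l, (supp part (f k) ∩ supp part (f l)).Nonempty →
          ∀ v ∈ supp part (f k) ∪ supp part (f l), v ∈ f' k ↔ v ∈ T) ∧
      ∀ l, ∀ u ∈ supp part (f l), ∀ v ∈ supp part (f l), u ∉ supp part (f k) →
        v ∉ supp part (f k) → (u ∈ f' k ↔ v ∈ f' k) := by
    intro k
    by_cases h1 : k = i
    · subst h1
      exact key hij hP hQ hs hi
    by_cases h2 : k = j
    · subst h2
      exact key hij.symm hQ.compl hP.compl hs' hj'
    rw [hk k h1 h2]
    exact ⟨rfl, ⟨f k, .refl _, fun _ _ _ _ => Iff.rfl⟩,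
      fun l u hu v hv hu' hv' => const_of_notCrossingOn (hf.two k l) hu hu' hv hv'⟩
  exact ⟨fun k => (hkey k).1, fun k => (hkey k).2.1, fun k => (hkey k).2.2⟩

theorem crossing_univ_iff {X Y : Set W} : CrossingOn Set.univ X Y ↔
    (∃ v, v ∈ X ∧ v ∈ Y) ∧ (∃ v, v ∉ X ∧ v ∉ Y) ∧ (∃ v, v ∈ X ∧ v ∉ Y) ∧ ∃ v, v ∈ Y ∧ v ∉ X := by
  simp [CrossingOn, Set.Nonempty]

theorem crossing_inter_or {P Q R : Set W} (h : CrossingOn Set.univ P Q)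
    (hc : CrossingOn Set.univ R (P ∩ Q)) :
    CrossingOn Set.univ R P ∨ CrossingOn Set.univ R Q := by
  rw [crossing_univ_iff] at h hc
  by_contra hn
  push Not at hn
  obtain ⟨h1, h2⟩ := hn
  rw [crossing_univ_iff] at h1 h2
  obtain ⟨-, ⟨a, ha⟩, -⟩ := h
  obtain ⟨⟨b, hb⟩, ⟨c, hc⟩, ⟨d, hd⟩, ⟨e, he⟩⟩ := hc
  simp only [Set.mem_inter_iff] at hb hc hd he
  have hR1 : (∀ v, v ∈ R → v ∈ P) ∨ ∀ v, v ∉ R → v ∈ P := by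
    by_contra hx
    push Not at hx
    obtain ⟨⟨x, hx⟩, y, hy⟩ := hx
    exact h1 ⟨⟨b, hb.1, hb.2.1⟩, ⟨y, hy⟩, ⟨x, hx⟩, ⟨e, he.1.1, he.2⟩⟩
  have hR2 : (∀ v, v ∈ R → v ∈ Q) ∨ ∀ v, v ∉ R → v ∈ Q := by
    by_contra hx
    push Not at hx
    obtain ⟨⟨x, hx⟩, y, hy⟩ := hx
    exact h2 ⟨⟨b, hb.1, hb.2.2⟩, ⟨y, hy⟩, ⟨x, hx⟩, ⟨e, he.1.2, he.2⟩⟩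
  rcases hR1 with h3 | h3 <;> rcases hR2 with h4 | h4
  · exact hd.2 ⟨h3 d hd.1, h4 d hd.1⟩
  · exact (by_cases (fun h => ha.1 (h3 a h)) fun h => ha.2 (h4 a h) : False)
  · exact (by_cases (fun h => ha.2 (h4 a h)) fun h => ha.1 (h3 a h) : False)
  · exact hc.2 ⟨h3 c hc.1, h4 c hc.1⟩

theorem crossing_compl_right {X Y : Set W} :
    CrossingOn Set.univ X Yᶜ ↔ CrossingOn Set.univ X Y :=
  ⟨fun h => h.orient (.refl _) (IsOrient.symm (Or.inr rfl)),
    fun h => h.orient (.refl _) (Or.inr rfl)⟩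

theorem crossing_union_or {P Q R : Set W} (h : CrossingOn Set.univ P Q)
    (hc : CrossingOn Set.univ R (P ∪ Q)) :
    CrossingOn Set.univ R P ∨ CrossingOn Set.univ R Q := by
  rw [← crossing_compl_right, Set.compl_union] at hc
  simpa only [crossing_compl_right] using
    crossing_inter_or (h.orient (Or.inr rfl) (Or.inr rfl)) hc

theorem crossing_and_of_both {P Q R : Set W} (h1 : CrossingOn Set.univ R (P ∩ Q))
    (h2 : CrossingOn Set.univ R (P ∪ Q)) :
    CrossingOn Set.univ R P ∧ CrossingOn Set.univ R Q := by
  rw [crossing_univ_iff] at h1 h2 ⊢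
  rw [crossing_univ_iff]
  obtain ⟨⟨b, hb⟩, -, -, ⟨e, he⟩⟩ := h1
  obtain ⟨-, ⟨c, hc⟩, ⟨d, hd⟩, -⟩ := h2
  simp only [Set.mem_inter_iff, Set.mem_union, not_or] at hb hc hd he
  exact ⟨⟨⟨b, hb.1, hb.2.1⟩, ⟨c, hc.1, hc.2.1⟩, ⟨d, hd.1, hd.2.1⟩, ⟨e, he.1.1, he.2⟩⟩,
    ⟨⟨b, hb.1, hb.2.2⟩, ⟨c, hc.1, hc.2.2⟩, ⟨d, hd.1, hd.2.2⟩, ⟨e, he.1.2, he.2⟩⟩⟩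

open Classical in
/-- The indicator of a crossing pair. -/
noncomputable def crossInd (X Y : Set W) : ℕ := if CrossingOn Set.univ X Y then 1 else 0

theorem crossInd_comm (X Y : Set W) : crossInd X Y = crossInd Y X := by
  have : CrossingOn Set.univ X Y ↔ CrossingOn Set.univ Y X := ⟨.symm, .symm⟩
  unfold crossInd
  split_ifs <;> first | rfl | (exfalso; tauto)

theorem crossInd_self (X : Set W) : crossInd X X = 0 := if_neg (not_crossingOn_self _ _)

theorem crossInd_orient {X P Q : Set W} (h : IsOrient P Q) : crossInd X P = crossInd X Q := by
  rcases h with rfl | rfl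
  · rfl
  · have := @crossing_compl_right _ X Q
    unfold crossInd
    split_ifs <;> first | rfl | (exfalso; tauto)

theorem crossInd_uncross {P Q R : Set W} (h : CrossingOn Set.univ P Q) :
    crossInd R (P ∩ Q) + crossInd R (P ∪ Q) ≤ crossInd R P + crossInd R Q := by
  have h1 := @crossing_inter_or _ P Q R h
  have h2 := @crossing_union_or _ P Q R h
  have h3 := @crossing_and_of_both _ P Q R
  unfold crossInd
  split_ifs with ha hb hc hd hc hd <;> first | omega | (exfalso; tauto)

/-- The number of ordered crossing pairs. -/
noncomputable def crossCount {I : Type*} [Fintype I] (f : I → Set W) : ℕ :=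
  ∑ a, ∑ b, crossInd (f a) (f b)

theorem crossCount_le {I : Type*} [Fintype I] (f : I → Set W) :
    crossCount f ≤ Fintype.card I * Fintype.card I := by
  have h : ∀ X Y : Set W, crossInd X Y ≤ 1 := fun X Y => by
    unfold crossInd
    split_ifs <;> simp
  calc crossCount f ≤ ∑ _a : I, ∑ _b : I, 1 :=
        Finset.sum_le_sum fun a _ => Finset.sum_le_sum fun b _ => h _ _
    _ = _ := by simp

theorem crossCount_pos {I : Type*} [Fintype I] {f : I → Set W} {i j : I}
    (h : CrossingOn Set.univ (f i) (f j)) : 0 < crossCount f :=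
  Finset.sum_pos' (fun _ _ => Nat.zero_le _) ⟨i, Finset.mem_univ _,
    Finset.sum_pos' (fun _ _ => Nat.zero_le _) ⟨j, Finset.mem_univ _, by
      simp [crossInd, h]⟩⟩

theorem sum_sum_lt_of_pair {I : Type*} [Fintype I] {c d : I → I → ℕ} {i j : I} (hij : i ≠ j)
    (hc : ∀ a b, c a b = c b a) (hd : ∀ a b, d a b = d b a)
    (h0 : ∀ k, k ≠ i → k ≠ j → ∀ l, l ≠ i → l ≠ j → c k l = d k l)
    (h1 : ∀ k, k ≠ i → k ≠ j → c k i + c k j ≤ d k i + d k j)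
    (h2 : c i i + c i j + (c j i + c j j) < d i i + d i j + (d j i + d j j)) :
    ∑ a, ∑ b, c a b < ∑ a, ∑ b, d a b := by
  classical
  set S : Finset I := (Finset.univ.erase i).erase j with hS
  have split : ∀ g : I → ℕ, ∑ b, g b = g i + g j + ∑ b ∈ S, g b := by
    intro g
    rw [← Finset.add_sum_erase _ _ (Finset.mem_univ i), ← Finset.add_sum_erase (a := j), add_assoc]
    simp [hij.symm]
  have hmem : ∀ k ∈ S, k ≠ i ∧ k ≠ j := by
    intro k hk
    simp only [hS, Finset.mem_erase, Finset.mem_univ, and_true] at hk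
    exact ⟨hk.2, hk.1⟩
  have total : ∀ e : I → I → ℕ, (∀ a b, e a b = e b a) → ∑ a, ∑ b, e a b =
      (e i i + e i j + (e j i + e j j)) + 2 * ∑ k ∈ S, (e k i + e k j) +
        ∑ k ∈ S, ∑ l ∈ S, e k l := by
    intro e he
    rw [split]
    simp only [split]
    rw [Finset.sum_congr rfl fun b _ => he i b, Finset.sum_congr rfl fun b _ => he j b]
    simp only [Finset.sum_add_distrib]
    ring
  rw [total c hc, total d hd]
  have e1 : ∑ k ∈ S, ∑ l ∈ S, c k l = ∑ k ∈ S, ∑ l ∈ S, d k l :=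
    Finset.sum_congr rfl fun k hk => Finset.sum_congr rfl fun l hl =>
      h0 k (hmem k hk).1 (hmem k hk).2 l (hmem l hl).1 (hmem l hl).2
  have e2 : ∑ k ∈ S, (c k i + c k j) ≤ ∑ k ∈ S, (d k i + d k j) :=
    Finset.sum_le_sum fun k hk => h1 k (hmem k hk).1 (hmem k hk).2
  omega

theorem crossCount_uncross_lt {I : Type*} [Fintype I] {f f' : I → Set W} {i j : I}
    (hij : i ≠ j) {P Q : Set W} (hP : IsOrient P (f i)) (hQ : IsOrient Q (f j))
    (hc : CrossingOn Set.univ (f i) (f j)) (hi : IsOrient (f' i) (P ∩ Q))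
    (hj : IsOrient (f' j) (P ∪ Q)) (hk : ∀ k, k ≠ i → k ≠ j → f' k = f k) :
    crossCount f' < crossCount f := by
  refine sum_sum_lt_of_pair hij (fun _ _ => crossInd_comm _ _) (fun _ _ => crossInd_comm _ _)
    ?_ ?_ ?_
  · intro k h1 h2 l h3 h4
    rw [hk k h1 h2, hk l h3 h4]
  · intro k h1 h2
    rw [hk k h1 h2, crossInd_orient hi, crossInd_orient hj, ← crossInd_orient hP,
      ← crossInd_orient hQ]
    exact crossInd_uncross (hc.orient hP hQ)
  · have h1 : crossInd (f' i) (f' j) = 0 := by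
      rw [crossInd_orient hj, crossInd_comm, crossInd_orient hi]
      refine if_neg fun h => ?_
      obtain ⟨v, hv⟩ := h.2.2.2
      exact hv.1.2 (Or.inl hv.1.1.1)
    have h2 : crossInd (f i) (f j) = 1 := if_pos hc
    rw [crossInd_self, crossInd_self, crossInd_comm (f' j), h1, crossInd_comm (f j), h2]
    omega

theorem Good.injective {I : Type*} {f : I → Set W} (hf : Good part f) : Function.Injective f := by
  intro i j h
  by_contra hij
  exact hf.supp_ne i j hij (by rw [h])

/-- One uncrossing operation on an indexed family. The two new members are indexed in such a way
that each index keeps its cutting support. -/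
structure UncrossAt {I : Type*} (part : W → κ) (f f' : I → Set W) (i j : I) : Prop where
  crossing : CrossingOn Set.univ (f i) (f j)
  op : (SubOn (supp part (f i) ∪ supp part (f j)) (f i) (f j) ∧
      f' i = f i ∩ f j ∧ f' j = f i ∪ f j) ∨
    (SubOn (supp part (f i) ∪ supp part (f j)) (f j) (f i) ∧
      f' i = f i ∪ f j ∧ f' j = f i ∩ f j) ∨
    (SubOn (supp part (f i) ∪ supp part (f j)) (f i) (f j)ᶜ ∧
      f' i = f i \ f j ∧ f' j = f j \ f i) ∨
    (SubOn (supp part (f i) ∪ supp part (f j)) (f j)ᶜ (f i) ∧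
      f' i = f j \ f i ∧ f' j = f i \ f j)
  rest : ∀ k, k ≠ i → k ≠ j → f' k = f k

theorem UncrossAt.ne {I : Type*} {f f' : I → Set W} {i j : I} (h : UncrossAt part f f' i j) :
    i ≠ j := by
  rintro rfl
  exact not_crossingOn_self _ _ h.crossing

theorem Good.refines_of_uncrossAt {I : Type*} [Fintype I] {f f' : I → Set W} {i j : I}
    (hf : Good part f) (h : UncrossAt part f f' i j) :
    Refines part f f' ∧ crossCount f' < crossCount f := by
  have key : ∀ {a b : I} {P Q : Set W}, a ≠ b → IsOrient P (f a) →
      IsOrient Q (f b) → SubOn (supp part (f a) ∪ supp part (f b)) P Q →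
      CrossingOn Set.univ (f a) (f b) →
      IsOrient (f' a) (P ∩ Q) → IsOrient (f' b) (P ∪ Q) → (∀ k, k ≠ a → k ≠ b → f' k = f k) →
      Refines part f f' ∧ crossCount f' < crossCount f := by
    intro a b P Q hab hP hQ hs hc ha hb hk
    rw [← hP.supp_eq, ← hQ.supp_eq] at hs
    exact ⟨hf.refines_uncross hab hP hQ hs ha hb hk, crossCount_uncross_lt hab hP hQ hc ha hb hk⟩
  have hr : ∀ k, k ≠ j → k ≠ i → f' k = f k := fun k h1 h2 => h.rest k h2 h1
  -- all four cases are instances of `P, Q ↦ P ∩ Q, P ∪ Q` for orientations with `P ⊆ Q` locally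
  rcases h.op with ⟨hs, h1, h2⟩ | ⟨hs, h1, h2⟩ | ⟨hs, h1, h2⟩ | ⟨hs, h1, h2⟩
  · exact key h.ne (.refl _) (.refl _) hs h.crossing (Or.inl h1) (Or.inl h2) h.rest
  · refine key h.ne.symm (.refl _) (.refl _) (by rwa [Set.union_comm]) h.crossing.symm
      (Or.inl ?_) (Or.inl ?_) hr
    · rw [h2, Set.inter_comm]
    · rw [h1, Set.union_comm]
  · refine key h.ne (.refl _) (IsOrient.refl _).compl hs h.crossing (Or.inl h1) (Or.inr ?_) h.rest
    rw [h2, Set.compl_union, compl_compl, Set.inter_comm]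
    rfl
  · refine key h.ne.symm (IsOrient.refl _).compl (.refl _) (by rwa [Set.union_comm])
      h.crossing.symm (Or.inl ?_) (Or.inr ?_) hr
    · rw [h2, Set.inter_comm]
      rfl
    · rw [h1, Set.compl_union, compl_compl]
      rfl

theorem range_update_pair {I β : Type*} {f f' : I → β} (hf : Function.Injective f) {i j : I}
    (hk : ∀ k, k ≠ i → k ≠ j → f' k = f k) :
    (Set.range f \ {f i, f j}) ∪ {f' i, f' j} = Set.range f' := by
  ext Z
  constructor
  · rintro (⟨⟨k, rfl⟩, hk'⟩ | rfl | rfl)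
    · simp only [Set.mem_insert_iff, Set.mem_singleton_iff, not_or] at hk'
      exact ⟨k, hk k (fun h => hk'.1 (by rw [h])) fun h => hk'.2 (by rw [h])⟩
    · exact ⟨i, rfl⟩
    · exact ⟨j, rfl⟩
  · rintro ⟨k, rfl⟩
    by_cases h1 : k = i
    · exact Or.inr (Or.inl (by rw [h1]))
    by_cases h2 : k = j
    · exact Or.inr (Or.inr (by rw [h2]; rfl))
    · refine Or.inl ⟨⟨k, (hk k h1 h2).symm⟩, ?_⟩
      rw [hk k h1 h2]
      simp only [Set.mem_insert_iff, Set.mem_singleton_iff, not_or]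
      exact ⟨fun h => h1 (hf h), fun h => h2 (hf h)⟩

theorem UncrossAt.uncrossStep {I : Type*} {f f' : I → Set W} {i j : I}
    (hf : Function.Injective f) (h : UncrossAt part f f' i j) :
    UncrossStep part (Set.range f) (Set.range f') := by
  rw [← range_update_pair hf h.rest]
  rcases h.op with ⟨hs, h1, h2⟩ | ⟨hs, h1, h2⟩ | ⟨hs, h1, h2⟩ | ⟨hs, h1, h2⟩ <;> rw [h1, h2]
  · exact .nested _ _ ⟨i, rfl⟩ ⟨j, rfl⟩ h.crossing (Or.inl hs)
  · rw [Set.pair_comm (f i ∪ f j)]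
    exact .nested _ _ ⟨i, rfl⟩ ⟨j, rfl⟩ h.crossing (Or.inr hs)
  · exact .disjoint _ _ ⟨i, rfl⟩ ⟨j, rfl⟩ h.crossing (Or.inl hs)
  · rw [Set.pair_comm (f j \ f i)]
    exact .disjoint _ _ ⟨i, rfl⟩ ⟨j, rfl⟩ h.crossing (Or.inr hs)

theorem exists_uncrossAt_of_uncrossStep {I : Type*} {f : I → Set W}
    (hf : Function.Injective f) {H : Set (Set W)} (h : UncrossStep part (Set.range f) H) :
    ∃ f' i j, UncrossAt part f f' i j ∧ Set.range f' = H := by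
  classical
  have key : ∀ (i j : I) (A B : Set W), CrossingOn Set.univ (f i) (f j) →
      ∃ f' : I → Set W, f' i = A ∧ f' j = B ∧ ∀ k, k ≠ i → k ≠ j → f' k = f k := by
    intro i j A B hc
    have hij : i ≠ j := by
      rintro rfl
      exact not_crossingOn_self _ _ hc
    refine ⟨Function.update (Function.update f i A) j B, ?_, ?_, ?_⟩
    · rw [Function.update_of_ne hij, Function.update_self]
    · rw [Function.update_self]
    · intro k h1 h2
      rw [Function.update_of_ne h2, Function.update_of_ne h1]
  cases h with
  | nested X Y hX hY hXY h =>
    obtain ⟨i, rfl⟩ := hX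
    obtain ⟨j, rfl⟩ := hY
    rcases h with h | h
    · obtain ⟨f', h1, h2, h3⟩ := key i j (f i ∩ f j) (f i ∪ f j) hXY
      exact ⟨f', i, j, ⟨hXY, Or.inl ⟨h, h1, h2⟩, h3⟩, by rw [← range_update_pair hf h3, h1, h2]⟩
    · obtain ⟨f', h1, h2, h3⟩ := key i j (f i ∪ f j) (f i ∩ f j) hXY
      exact ⟨f', i, j, ⟨hXY, Or.inr (Or.inl ⟨h, h1, h2⟩), h3⟩,
        by rw [← range_update_pair hf h3, h1, h2, Set.pair_comm (f i ∪ f j)]⟩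
  | disjoint X Y hX hY hXY h =>
    obtain ⟨i, rfl⟩ := hX
    obtain ⟨j, rfl⟩ := hY
    rcases h with h | h
    · obtain ⟨f', h1, h2, h3⟩ := key i j (f i \ f j) (f j \ f i) hXY
      exact ⟨f', i, j, ⟨hXY, Or.inr (Or.inr (Or.inl ⟨h, h1, h2⟩)), h3⟩,
        by rw [← range_update_pair hf h3, h1, h2]⟩
    · obtain ⟨f', h1, h2, h3⟩ := key i j (f j \ f i) (f i \ f j) hXY
      exact ⟨f', i, j, ⟨hXY, Or.inr (Or.inr (Or.inr ⟨h, h1, h2⟩)), h3⟩,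
        by rw [← range_update_pair hf h3, h1, h2, Set.pair_comm (f j \ f i)]⟩

/-- In a locally cross-free family, one of the two uncrossing operations is always applicable. -/
theorem subOn_cases_of_notCrossingOn {A X Y : Set W} (h : ¬ CrossingOn A X Y) :
    (SubOn A X Y ∨ SubOn A Y X) ∨ (SubOn A X Yᶜ ∨ SubOn A Yᶜ X) := by
  obtain ⟨P, Q, rfl | rfl, rfl | rfl, hs⟩ := notCrossingOn_iff.1 h
  · exact Or.inl (Or.inl hs)
  · exact Or.inr (Or.inl hs)
  · refine Or.inr (Or.inr ?_)
    rw [← subOn_compl]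
    simpa using hs
  · exact Or.inl (Or.inr (subOn_compl.1 hs))

theorem Good.exists_uncrossStep {I : Type*} {f : I → Set W} (hf : Good part f)
    (h : ¬ CrossFree (Set.range f)) : ∃ H, UncrossStep part (Set.range f) H := by
  unfold CrossFree CrossFreeOn at h
  push Not at h
  obtain ⟨_, ⟨i, rfl⟩, _, ⟨j, rfl⟩, hc⟩ := h
  rcases subOn_cases_of_notCrossingOn (hf.two i j) with hs | hs
  · exact ⟨_, .nested _ _ ⟨i, rfl⟩ ⟨j, rfl⟩ hc hs⟩
  · exact ⟨_, .disjoint _ _ ⟨i, rfl⟩ ⟨j, rfl⟩ hc hs⟩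

theorem Good.uncrossStep {I : Type*} [Fintype I] {f : I → Set W} (hf : Good part f)
    {H : Set (Set W)} (h : UncrossStep part (Set.range f) H) :
    ∃ f', Set.range f' = H ∧ Refines part f f' ∧ crossCount f' < crossCount f := by
  obtain ⟨f', i, j, h1, rfl⟩ := exists_uncrossAt_of_uncrossStep hf.injective h
  exact ⟨f', rfl, hf.refines_of_uncrossAt h1⟩

/-- Whatever crossing pairs are chosen, uncrossing a good family keeps it good and equivalent. -/
theorem Good.reflTransGen {I : Type*} [Fintype I] {f : I → Set W} (hf : Good part f)
    {H : Set (Set W)} (h : Relation.ReflTransGen (UncrossStep part) (Set.range f) H) :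
    ∃ f', Set.range f' = H ∧ Good part f' ∧ ∀ k, Equivalent part (f k) (f' k) := by
  induction h with
  | refl => exact ⟨f, rfl, hf, fun k => .refl _⟩
  | tail _ hs ih =>
    obtain ⟨f', rfl, hf', he⟩ := ih
    obtain ⟨f'', rfl, hr, -⟩ := hf'.uncrossStep hs
    exact ⟨f'', rfl, hf'.refines hr, fun k => (he k).trans (hr.equivalent k)⟩

theorem Good.algorithm4StopsWithin {I : Type*} [Fintype I] {f : I → Set W} (hf : Good part f) :
    Algorithm4StopsWithin part (Set.range f) (Fintype.card I * Fintype.card I) := by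
  constructor
  · intro k H h0 hs
    have key : ∀ i ≤ k, ∃ f' : I → Set W, Set.range f' = H i ∧ Good part f' ∧
        crossCount f' + i ≤ crossCount f := by
      intro i
      induction i with
      | zero => exact fun _ => ⟨f, h0.symm, hf, le_rfl⟩
      | succ i ih =>
        intro hi
        obtain ⟨f', h1, h2, h3⟩ := ih (by omega)
        have := hs i (by omega)
        rw [← h1] at this
        obtain ⟨f'', h4, h5, h6⟩ := h2.uncrossStep this
        exact ⟨f'', h4, h2.refines h5, by omega⟩
    obtain ⟨f', -, -, h⟩ := key k le_rfl
    have := crossCount_le f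
    omega
  · intro H hH hc
    obtain ⟨f', rfl, hf', -⟩ := hf.reflTransGen hH
    exact hf'.exists_uncrossStep hc

end CutFamily

namespace CutFamily

variable {W κ : Type*} {part : W → κ}

/-! ### Labelings and locally cross-free families -/

/-- A family of cuts in which every member cuts a part that is not cut by a given other member. -/
structure Separated (part : W → κ) (E : Set (Set W)) : Prop where
  cut : IsCutFamily part E
  sep : ∀ X ∈ E, ∀ Y ∈ E, X ≠ Y → ∃ v ∈ supp part Y, v ∉ supp part X

/-- A locally cross-free family that is equivalent to `E`: the set `g X` agrees with `X` on `⟨X⟩`. -/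
structure LocalModel (part : W → κ) (E : Set (Set W)) (g : Set W → Set W) : Prop where
  supp_eq : ∀ X ∈ E, supp part (g X) = supp part X
  mem_iff : ∀ X ∈ E, ∀ v ∈ supp part X, v ∈ g X ↔ v ∈ X
  two : ∀ X ∈ E, ∀ Y ∈ E, ¬ CrossingOn (supp part X ∪ supp part Y) (g X) (g Y)

/-- The orientation of `X` that is given by a sign. -/
def orient (b : Bool) (X : Set W) : Set W := if b then X else Xᶜ

theorem mem_orient {b : Bool} {X : Set W} {v : W} : v ∈ orient b X ↔ (v ∈ X ↔ b = true) := by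
  cases b <;> simp [orient]

theorem isOrient_iff {P X : Set W} : IsOrient P X ↔ ∃ b, P = orient b X := by
  simp [IsOrient, orient, or_comm]

theorem isOrient_orient (b : Bool) (X : Set W) : IsOrient (orient b X) X :=
  isOrient_iff.2 ⟨b, rfl⟩

theorem sSubOn_iff {A X Y : Set W} : SSubOn A X Y ↔ SubOn A X Y ∧ ¬ SubOn A Y X := Iff.rfl

theorem subOn_compl_left {A X Y : Set W} : SubOn A Xᶜ Y ↔ SubOn A Yᶜ X := by
  rw [← subOn_compl, compl_compl]

theorem subOn_compl_right {A X Y : Set W} : SubOn A X Yᶜ ↔ SubOn A Y Xᶜ := by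
  rw [← subOn_compl, compl_compl]

/-- The two conditions on swapped pairs, for all orientations at once. -/
theorem isLCLabeling_iff {E : Set (Set W)} {s : Set W → Set W → Bool} :
    IsLCLabeling part E s ↔
      (∀ X ∈ E, ∀ Y ∈ E, X ≠ Y → (supp₂ part X Y).Nonempty → ∀ a b : Bool,
        SubOn (supp₂ part X Y) (orient a X) (orient b Y) →
          (s X Y = !a ∧ s Y X = b) ∨
          (SubOn (supp₂ part X Y) (orient b Y) (orient a X) ∧ s X Y = a ∧ s Y X = !b)) ∧
      (∀ X ∈ E, ∀ Y ∈ E, ∀ Z ∈ E, X ≠ Y → X ≠ Z →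
        (supp₂ part Y Z \ supp part X).Nonempty → s X Y = s X Z) := by
  constructor
  · intro h
    refine ⟨fun X hX Y hY hXY hne a b hs => ?_, h.prefixed⟩
    have h1 := h.fixed X hX Y hY hXY hne
    have h2 := h.swapped X hX Y hY hXY hne
    simp only [sSubOn_iff] at h1
    by_cases hr : SubOn (supp₂ part X Y) (orient b Y) (orient a X)
    · simp only [hr, true_and]
      cases a <;> cases b <;> simp only [orient, Bool.false_eq_true, if_true, if_false] at hs hr
      · have := h2.2 (Or.inr (subOn_compl.1 hs))
        rw [this]
        cases s Y X <;> simp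
      · have := h2.1 (Or.inr (subOn_compl_left.1 hs))
        rw [this]
        cases s Y X <;> simp
      · have := h2.1 (Or.inl hs)
        rw [this]
        cases s Y X <;> simp
      · have := h2.2 (Or.inl hs)
        rw [this]
        cases s Y X <;> simp
    · left
      cases a <;> cases b <;> simp only [orient, Bool.false_eq_true, if_true, if_false] at hs hr
      · exact h1.2.2.1 ⟨subOn_compl.1 hs, fun h => hr (subOn_compl.2 h)⟩
      · exact h1.2.2.2 ⟨subOn_compl_left.1 hs, fun h => hr (subOn_compl_right.1 h)⟩
      · exact h1.1 ⟨hs, hr⟩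
      · exact h1.2.1 ⟨hs, hr⟩
  · rintro ⟨h1, h2⟩
    refine ⟨fun X hX Y hY hXY hne => ?_, fun X hX Y hY hXY hne => ?_, h2⟩
    · have h := h1 X hX Y hY hXY hne
      simp only [sSubOn_iff]
      refine ⟨fun hs => ?_, fun hs => ?_, fun hs => ?_, fun hs => ?_⟩
      · have := h true false (by simpa [orient] using hs.1)
        simp only [orient, Bool.false_eq_true, if_true, if_false] at this
        simpa [hs.2] using this
      · have := h true true (by simpa [orient] using hs.1)
        simp only [orient, if_true] at this
        simpa [hs.2] using this
      · have := h false false (by simpa [orient, subOn_compl] using hs.1)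
        simp only [orient, Bool.false_eq_true, if_false, subOn_compl] at this
        simpa [hs.2] using this
      · have := h false true (by simpa [orient, subOn_compl_left] using hs.1)
        simp only [orient, Bool.false_eq_true, if_true, if_false,
          subOn_compl_right (X := Y)] at this
        simpa [hs.2] using this
    · have h := h1 X hX Y hY hXY hne
      constructor
      · rintro (hs | hs)
        · rcases h true false (by simpa [orient] using hs) with h | ⟨-, h⟩ <;> simp [h]
        · rcases h false true (by simpa [orient, subOn_compl_left] using hs) with h | ⟨-, h⟩ <;>
            simp [h]
      · rintro (hs | hs)
        · rcases h true true (by simpa [orient] using hs) with h | ⟨-, h⟩ <;> simp [h]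
        · rcases h false false (by simpa [orient, subOn_compl] using hs) with h | ⟨-, h⟩ <;>
            simp [h]

theorem PairwiseComparable.exists_orient {E : Set (Set W)} (h : PairwiseComparable part E)
    {X Y : Set W} (hX : X ∈ E) (hY : Y ∈ E) (hXY : X ≠ Y) (hne : (supp₂ part X Y).Nonempty) :
    ∃ a b, SubOn (supp₂ part X Y) (orient a X) (orient b Y) := by
  rcases h X hX Y hY hXY hne with h | h | h | h
  · exact ⟨true, true, by simpa [orient] using h⟩
  · exact ⟨true, false, by simpa [orient] using h⟩
  · exact ⟨false, false, by simpa [orient, subOn_compl] using h⟩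
  · exact ⟨false, true, by simpa [orient, subOn_compl_left] using h⟩

theorem mem_relabel_of_mem_supp {E : Set (Set W)} {s : Set W → Set W → Bool} {X : Set W} {v : W}
    (hv : v ∈ supp part X) : v ∈ relabel part E s X ↔ v ∈ X := by
  simp [relabel, hv]

theorem mem_relabel_iff {E : Set (Set W)} {s : Set W → Set W → Bool}
    (hs : IsLCLabeling part E s) {X Y : Set W} (hX : X ∈ E) (hY : Y ∈ E) {v : W}
    (hvY : v ∈ supp part Y) (hvX : v ∉ supp part X) :
    v ∈ relabel part E s X ↔ s X Y = true := by
  constructor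
  · rintro (⟨Z, hZ, hv, h⟩ | ⟨h, -⟩)
    · rw [← h]
      refine hs.prefixed X hX Y hY Z hZ ?_ ?_ ⟨v, ⟨hvY, hv.1⟩, hvX⟩
      · rintro rfl
        exact hvX hvY
      · rintro rfl
        exact hvX hv.1
    · exact absurd ⟨hvY, hvX⟩ (h Y hY)
  · exact fun h => Or.inl ⟨Y, hY, ⟨hvY, hvX⟩, h⟩

theorem supp_relabel {E : Set (Set W)} {s : Set W → Set W → Bool} {X : Set W} :
    supp part (relabel part E s X) = supp part X := by
  apply supp_eq_of_forall
  · exact fun v hv => (mem_relabel_of_mem_supp hv).symm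
  · intro u v huv hv
    have hu : u ∉ supp part X := fun h => hv ((mem_supp_congr huv).1 h)
    simp only [relabel, Set.mem_ofPred_eq, Set.mem_sdiff, hu, hv, not_false_eq_true, and_true,
      mem_supp_congr huv, mem_congr_of_notMem_supp hv huv]

/-- On a pair with comparable restrictions, an LC-labeling yields local containment. -/
theorem subOn_relabel {E : Set (Set W)} {s : Set W → Set W → Bool}
    (hs : IsLCLabeling part E s) {X Y : Set W} (hX : X ∈ E) (hY : Y ∈ E) {a b : Bool}
    (h : SubOn (supp₂ part X Y) (orient a X) (orient b Y)) (h1 : s X Y = !a) (h2 : s Y X = b) :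
    SubOn (supp part X ∪ supp part Y) (orient a (relabel part E s X))
      (orient b (relabel part E s Y)) := by
  have e1 : supp part (orient a (relabel part E s X)) = supp part X := by
    rw [(isOrient_orient _ _).supp_eq, supp_relabel]
  have e2 : supp part (orient b (relabel part E s Y)) = supp part Y := by
    rw [(isOrient_orient _ _).supp_eq, supp_relabel]
  have := @subOn_union_of _ _ part (orient a (relabel part E s X)) (orient b (relabel part E s Y))
  rw [e1, e2] at this
  apply this
  · rw [subOn_iff] at h ⊢
    intro v hv
    have := h v hv
    rwa [mem_orient, mem_orient, ← mem_relabel_of_mem_supp (E := E) (s := s) hv.1,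
      ← mem_relabel_of_mem_supp (E := E) (s := s) hv.2, ← mem_orient, ← mem_orient] at this
  · intro v hv hv'
    rw [mem_orient, mem_relabel_iff hs hX hY hv hv', h1]
    cases a <;> simp
  · intro v hv hv'
    rw [mem_orient, mem_relabel_iff hs hY hX hv hv', h2]

/-- LC-labelings describe locally cross-free families. -/
theorem IsLCLabeling.localModel {E : Set (Set W)} {s : Set W → Set W → Bool}
    (hs : IsLCLabeling part E s) (hc : PairwiseComparable part E) :
    LocalModel part E (relabel part E s) := by
  refine ⟨fun X _ => supp_relabel, fun X _ v hv => mem_relabel_of_mem_supp hv, ?_⟩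
  intro X hX Y hY
  rcases eq_or_ne X Y with rfl | hXY
  · exact not_crossingOn_self _ _
  rcases Set.eq_empty_or_nonempty (supp₂ part X Y) with he | hne
  · have hd : ∀ v, v ∈ supp part X → v ∉ supp part Y := fun v hv hv' =>
      (Set.ext_iff.1 he v).1 ⟨hv, hv'⟩
    have := @notCrossingOn_of_const _ _ part (relabel part E s X) (relabel part E s Y)
    rw [supp_relabel, supp_relabel] at this
    apply this
    · intro u hu v hv
      rw [mem_relabel_iff hs hX hY hu fun h => hd _ h hu,
        mem_relabel_iff hs hX hY hv fun h => hd _ h hv]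
    · intro u hu v hv
      rw [mem_relabel_iff hs hY hX hu (hd u hu), mem_relabel_iff hs hY hX hv (hd v hv)]
  · obtain ⟨a, b, hab⟩ := hc.exists_orient hX hY hXY hne
    rw [notCrossingOn_iff]
    rcases (isLCLabeling_iff.1 hs).1 X hX Y hY hXY hne a b hab with ⟨h1, h2⟩ | ⟨hr, h1, h2⟩
    · exact ⟨_, _, isOrient_orient a _, isOrient_orient b _, subOn_relabel hs hX hY hab h1 h2⟩
    · refine ⟨_, _, isOrient_orient (!a) _, isOrient_orient (!b) _, ?_⟩
      refine subOn_relabel hs hX hY ?_ (by simpa using h1) h2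
      rw [← subOn_compl]
      cases a <;> cases b <;> simpa [orient] using hr

theorem LocalModel.supp_orient {E : Set (Set W)} {g : Set W → Set W} (hg : LocalModel part E g)
    {X P : Set W} (hX : X ∈ E) (hP : IsOrient P (g X)) : supp part P = supp part X := by
  rw [hP.supp_eq, hg.supp_eq X hX]

theorem LocalModel.two_orient {E : Set (Set W)} {g : Set W → Set W} (hg : LocalModel part E g)
    {X Y P Q : Set W} (hX : X ∈ E) (hY : Y ∈ E) (hP : IsOrient P (g X)) (hQ : IsOrient Q (g Y)) :
    ¬ CrossingOn (supp part P ∪ supp part Q) P Q := by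
  rw [hg.supp_orient hX hP, hg.supp_orient hY hQ]
  exact fun h => hg.two X hX Y hY (h.orient hP.symm hQ.symm)

theorem exists_localModel {E : Set (Set W)}
    (h : ∃ G, IsCutFamily part G ∧ TwoLocallyCrossFree part G ∧ FamilyEquivalent part E G) :
    ∃ g, LocalModel part E g := by
  obtain ⟨G, -, h2, he, -⟩ := h
  have : ∀ X : Set W, ∃ P, X ∈ E → ∃ Y ∈ G, IsOrient P Y ∧ supp part X = supp part Y ∧
      ∀ v ∈ supp part X, v ∈ P ↔ v ∈ X := by
    intro X
    by_cases hX : X ∈ E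
    · obtain ⟨Y, hY, h⟩ := he X hX
      obtain ⟨h1, P, hP, h2⟩ := equivalent_iff.1 h
      exact ⟨P, fun _ => ⟨Y, hY, hP, h1, fun v hv => (h2 v hv).symm⟩⟩
    · exact ⟨∅, fun h => absurd h hX⟩
  choose g hg using this
  refine ⟨g, fun X hX => ?_, fun X hX v hv => ?_, fun X hX Y hY hc => ?_⟩
  · obtain ⟨Y, hY, hP, h1, -⟩ := hg X hX
    rw [hP.supp_eq, h1]
  · obtain ⟨Y, hY, hP, -, h2⟩ := hg X hX
    exact h2 v hv
  · obtain ⟨X', hX', hP, h1, -⟩ := hg X hX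
    obtain ⟨Y', hY', hQ, h3, -⟩ := hg Y hY
    rw [h1, h3] at hc
    exact h2 X' hX' Y' hY' (hc.orient hP.symm hQ.symm)

theorem LocalModel.exists_twoLocally {E : Set (Set W)} {g : Set W → Set W}
    (hg : LocalModel part E g) (hE : IsCutFamily part E) :
    ∃ G, IsCutFamily part G ∧ TwoLocallyCrossFree part G ∧ FamilyEquivalent part E G := by
  have he : ∀ X ∈ E, Equivalent part X (g X) := by
    intro X hX
    rw [equivalent_iff]
    exact ⟨(hg.supp_eq X hX).symm, g X, .refl _, fun v hv => (hg.mem_iff X hX v hv).symm⟩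
  refine ⟨g '' E, ?_, ?_, ?_, ?_⟩
  · rintro _ ⟨X, hX, rfl⟩
    exact (hE X hX).congr (hg.supp_eq X hX).symm
  · rintro _ ⟨X, hX, rfl⟩ _ ⟨Y, hY, rfl⟩
    rw [hg.supp_eq X hX, hg.supp_eq Y hY]
    exact hg.two X hX Y hY
  · exact fun X hX => ⟨_, ⟨X, hX, rfl⟩, he X hX⟩
  · rintro _ ⟨X, hX, rfl⟩
    exact ⟨X, hX, he X hX⟩

theorem LocalModel.exists_subOn {E : Set (Set W)} {g : Set W → Set W} (hg : LocalModel part E g)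
    {X Y : Set W} (hX : X ∈ E) (hY : Y ∈ E) :
    ∃ a b, SubOn (supp part X ∪ supp part Y) (orient a (g X)) (orient b (g Y)) := by
  obtain ⟨P, Q, hP, hQ, hs⟩ := notCrossingOn_iff.1 (hg.two X hX Y hY)
  obtain ⟨a, rfl⟩ := isOrient_iff.1 hP
  obtain ⟨b, rfl⟩ := isOrient_iff.1 hQ
  exact ⟨a, b, hs⟩

theorem LocalModel.pairwiseComparable {E : Set (Set W)} {g : Set W → Set W}
    (hg : LocalModel part E g) : PairwiseComparable part E := by
  intro X hX Y hY _ _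
  obtain ⟨a, b, hs⟩ := hg.exists_subOn hX hY
  have : SubOn (supp₂ part X Y) (orient a X) (orient b Y) := by
    rw [subOn_iff] at hs ⊢
    intro v hv
    have := hs v (Or.inl hv.1)
    rwa [mem_orient, mem_orient, hg.mem_iff X hX v hv.1, hg.mem_iff Y hY v hv.2, ← mem_orient,
      ← mem_orient] at this
  cases a <;> cases b <;> simp only [orient, Bool.false_eq_true, if_true, if_false] at this
  · exact Or.inr (Or.inr (Or.inl (subOn_compl.1 this)))
  · exact Or.inr (Or.inr (Or.inr (subOn_compl_left.1 this)))
  · exact Or.inr (Or.inl this)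
  · exact Or.inl this

/-- Every locally cross-free family yields an LC-labeling. -/
theorem LocalModel.exists_labeling {E : Set (Set W)} {g : Set W → Set W}
    (hg : LocalModel part E g) (hE : Separated part E) : ∃ s, IsLCLabeling part E s := by
  classical
  let s : Set W → Set W → Bool := fun X Y => decide (∃ v ∈ supp part Y, v ∉ supp part X ∧ v ∈ g X)
  have hs : ∀ X ∈ E, ∀ Y ∈ E, ∀ v ∈ supp part Y, v ∉ supp part X →
      (v ∈ g X ↔ s X Y = true) := by
    intro X hX Y hY v hv hv'
    simp only [s, decide_eq_true_eq]
    refine ⟨fun h => ⟨v, hv, hv', h⟩, ?_⟩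
    rintro ⟨u, hu, hu', h⟩
    have h2 := hg.two_orient hX hY (.refl _) (.refl _)
    rw [← hg.supp_eq X hX] at hu' hv'
    rw [← hg.supp_eq Y hY] at hu hv
    exact (const_of_notCrossingOn h2 hu hu' hv hv').1 h
  refine ⟨s, isLCLabeling_iff.2 ⟨fun X hX Y hY hXY hne a b hab => ?_,
    fun X hX Y hY Z hZ _ _ hne => ?_⟩⟩
  · obtain ⟨a', b', hs'⟩ := hg.exists_subOn hX hY
    have e1 : supp part (orient a' (g X)) = supp part X :=
      hg.supp_orient hX (isOrient_orient _ _)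
    have e2 : supp part (orient b' (g Y)) = supp part Y :=
      hg.supp_orient hY (isOrient_orient _ _)
    have l1 : s X Y = !a' := by
      obtain ⟨v, hv, hv'⟩ := hE.sep X hX Y hY hXY
      have := SubOn.notMem_left (part := part) (P := orient a' (g X)) (Q := orient b' (g Y))
        (by rwa [e1, e2]) (by rwa [e2]) (by rwa [e1])
      rw [mem_orient, hs X hX Y hY v hv hv'] at this
      cases h : s X Y <;> cases a' <;> simp_all
    have l2 : s Y X = b' := by
      obtain ⟨v, hv, hv'⟩ := hE.sep Y hY X hX hXY.symm
      have := SubOn.mem_right (part := part) (P := orient a' (g X)) (Q := orient b' (g Y))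
        (by rwa [e1, e2]) (by rwa [e1]) (by rwa [e2])
      rw [mem_orient, hs Y hY X hX v hv hv'] at this
      cases h : s Y X <;> cases b' <;> simp_all
    have hs2 : SubOn (supp₂ part X Y) (orient a' X) (orient b' Y) := by
      rw [subOn_iff] at hs' ⊢
      intro v hv
      have := hs' v (Or.inl hv.1)
      rwa [mem_orient, mem_orient, hg.mem_iff X hX v hv.1, hg.mem_iff Y hY v hv.2, ← mem_orient,
        ← mem_orient] at this
    obtain ⟨w, hwX, hwY⟩ := hne
    have inX : ∀ c, ∃ u ∈ supp₂ part X Y, u ∈ orient c X := by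
      intro c
      obtain ⟨⟨p, hp, hpw⟩, ⟨q, hq, hqw⟩⟩ := hwX
      have hwX : w ∈ supp part X := ⟨⟨p, hp, hpw⟩, ⟨q, hq, hqw⟩⟩
      cases c
      · exact ⟨q, ⟨(mem_supp_congr hqw).2 hwX, (mem_supp_congr hqw).2 hwY⟩,
          by simpa [orient] using hq⟩
      · exact ⟨p, ⟨(mem_supp_congr hpw).2 hwX, (mem_supp_congr hpw).2 hwY⟩,
          by simpa [orient] using hp⟩
    have outY : ∀ c, ∃ u ∈ supp₂ part X Y, u ∉ orient c Y := by
      intro c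
      obtain ⟨⟨p, hp, hpw⟩, ⟨q, hq, hqw⟩⟩ := hwY
      have hwY : w ∈ supp part Y := ⟨⟨p, hp, hpw⟩, ⟨q, hq, hqw⟩⟩
      cases c
      · exact ⟨p, ⟨(mem_supp_congr hpw).2 hwX, (mem_supp_congr hpw).2 hwY⟩,
          by simpa [orient] using hp⟩
      · exact ⟨q, ⟨(mem_supp_congr hqw).2 hwX, (mem_supp_congr hqw).2 hwY⟩,
          by simpa [orient] using hq⟩
    rw [subOn_iff] at hab hs2
    rw [l1, l2]
    rcases eq_or_ne a a' with rfl | ha <;> rcases eq_or_ne b b' with rfl | hb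
    · exact Or.inl ⟨rfl, rfl⟩
    · obtain ⟨u, hu, hu'⟩ := inX a
      have h1 := hab u hu hu'
      have h2 := hs2 u hu hu'
      rw [mem_orient] at h1 h2
      exact absurd (Bool.eq_iff_iff.2 (h1.symm.trans h2)) hb
    · obtain ⟨u, hu, hu'⟩ := outY b
      have h1 := fun h => hu' (hab u hu h)
      have h2 := fun h => hu' (hs2 u hu h)
      rw [mem_orient] at h1 h2
      cases a <;> cases a' <;> simp_all
    · right
      obtain rfl : a' = !a := by cases a <;> cases a' <;> simp_all
      obtain rfl : b' = !b := by cases b <;> cases b' <;> simp_all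
      refine ⟨?_, by simp, rfl⟩
      rw [subOn_iff]
      intro v hv hvb
      by_contra hva
      have h1 := hs2 v hv
      rw [mem_orient] at hvb hva
      rw [mem_orient, mem_orient] at h1
      cases a <;> cases b <;> simp_all
  · obtain ⟨v, ⟨hvY, hvZ⟩, hvX⟩ := hne
    exact Bool.eq_iff_iff.2 ((hs X hX Y hY v hvY hvX).symm.trans (hs X hX Z hZ v hvZ hvX))

/-! ### Cyclic triples in the LC-graph -/

theorem line_eq_of_orient {A X P : Set W} (hP : IsOrient P X) : line A P = line A X := by
  rcases hP with rfl | rfl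
  · rfl
  · simp [line, Set.pair_comm]

theorem line_eq_of_forall {A X Y : Set W} (h : ∀ v ∈ A, v ∈ X ↔ v ∈ Y) : line A X = line A Y := by
  have h1 : X ∩ A = Y ∩ A := by
    ext v
    simp only [Set.mem_inter_iff]
    exact and_congr_left fun hv => h v hv
  have h2 : Xᶜ ∩ A = Yᶜ ∩ A := by
    ext v
    simp only [Set.mem_inter_iff, Set.mem_compl_iff]
    exact and_congr_left fun hv => not_congr (h v hv)
  rw [line, line, h1, h2]

/-- The property that is propagated through the LC-graph from a node `XY` of a cyclic triple
`X, Y, Z` with `⟨XZ⟩ = A`, for fixed `Z`, to the other nodes `X'W` of the component. -/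
structure NodeInv (part : W → κ) (E : Set (Set W)) (g : Set W → Set W) (Z A : Set W)
    (X' U : Set W) : Prop where
  ne : X' ≠ Z
  supp_eq : supp₂ part X' Z = A
  loc : ∃ P R, IsOrient P (g X') ∧ IsOrient R (g Z) ∧ SubOn (supp part R ∪ supp part P) R P ∧
    (∀ v ∈ A, v ∈ P ↔ v ∈ R) ∧ ∃ v ∈ supp part U, v ∉ supp part X' ∧ v ∉ supp part Z ∧ v ∉ P ∧ v ∈ R
  cyc : ∃ Y' ∈ E, X' ≠ Y' ∧ Y' ≠ Z ∧ IsCyclicTriple part (g X') (g Y') (g Z)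

section

variable {E : Set (Set W)} {g : Set W → Set W} (hE : Separated part E)
  (hg : LocalModel part E g) {X Y Z : Set W} (hX : X ∈ E) (hY : Y ∈ E) (hZ : Z ∈ E)

include hg hX hY hZ in
theorem IsCyclicTriple.supp₂_eq (h : IsCyclicTriple part (g X) (g Y) (g Z)) :
    supp₂ part X Y = supp₂ part X Z := by
  have := h.supp_inter_eq
  rwa [hg.supp_eq X hX, hg.supp_eq Y hY, hg.supp_eq Z hZ] at this

include hE hg hX hY hZ in
theorem IsCyclicTriple.nodeInv (hXY : X ≠ Y) (hYZ : Y ≠ Z) (hXZ : X ≠ Z)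
    (h : IsCyclicTriple part (g X) (g Y) (g Z)) :
    NodeInv part E g Z (supp₂ part X Z) X Y := by
  refine ⟨hXZ, rfl, ?_, Y, hY, hXY, hYZ, h⟩
  obtain ⟨-, P, Q, R, hP, hQ, hR, hc⟩ := h
  have eP := hg.supp_orient hX hP
  have eQ := hg.supp_orient hY hQ
  have eR := hg.supp_orient hZ hR
  obtain ⟨v, hv, hvX⟩ := hE.sep X hX Y hY hXY
  rw [← eP] at hvX
  rw [← eQ] at hv
  have hvZ : v ∉ supp part R := fun h => hvX (hc.rotate.inter_subset ⟨hv, h⟩)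
  refine ⟨P, R, hP, hR, hc.h31, ?_, v, ?_, ?_, ?_, hc.h12.notMem_left hv hvX,
    hc.h23.mem_right hv hvZ⟩
  · intro v hv
    rw [supp₂, ← eP, ← eR] at hv
    exact (hc.rotate.rotate.mem_iff hv.2 hv.1).symm
  · rwa [← eQ]
  · rwa [← eP]
  · rwa [← eR]

include hg hX hY hZ in
/-- A node with a nonempty support that has the property belongs to a cyclic triple. -/
theorem NodeInv.isCyclicTriple {A : Set W} (h : NodeInv part E g Z A X Y)
    (hne : (supp₂ part X Y).Nonempty) :
    IsCyclicTriple part (g X) (g Y) (g Z) := by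
  obtain ⟨P, R, hP, hR, hs, -, v, hv, hvX, hvZ, hvP, hvR⟩ := h.loc
  have eP := hg.supp_orient hX hP
  have eR := hg.supp_orient hZ hR
  have eY := hg.supp_eq Y hY
  rcases cyc_or_disjoint hs (hg.two_orient hZ hY hR (.refl _))
    (hg.two_orient hX hY hP (.refl _)) (by rwa [eY]) (by rwa [eR]) (by rwa [eP]) hvR hvP with
    ⟨-, h2⟩ | ⟨Q, hQ, hc⟩
  · rw [eP, eY] at h2
    exact absurd h2 hne.ne_empty
  · obtain ⟨w, hw, hw'⟩ := hne
    have eQ := hg.supp_orient hY hQ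
    have hwR := hc.rotate.inter_subset (show w ∈ supp part P ∩ supp part Q from
      ⟨by rwa [eP], by rwa [eQ]⟩)
    rw [eR] at hwR
    refine ⟨⟨w, ⟨?_, ?_⟩, ?_⟩, P, Q, R, hP, hQ, hR, hc.rotate⟩
    · rwa [hg.supp_eq X hX]
    · rwa [eY]
    · rwa [hg.supp_eq Z hZ]

theorem NodeInv.ne' {A : Set W} (h : NodeInv part E g Z A X Y) : Y ≠ Z := by
  obtain ⟨P, R, hP, hR, hs, -, v, hv, hvX, hvZ, hvP, hvR⟩ := h.loc
  rintro rfl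
  exact hvZ hv

include hE hg hX hY hZ in
theorem NodeInv.swap {A : Set W} (h : NodeInv part E g Z A X Y) (hXY : X ≠ Y)
    (hne : (supp₂ part X Y).Nonempty) : NodeInv part E g Z A Y X := by
  have hc := h.isCyclicTriple hg hX hY hZ hne
  have h1 := hc.swap.nodeInv hE hg hY hX hZ hXY.symm h.ne h.ne'
  have h2 := hc.supp₂_eq hg hX hY hZ
  have h3 := hc.swap.supp₂_eq hg hY hX hZ
  rw [← h3, supp₂, Set.inter_comm] at h1
  rw [← supp₂, h2, h.supp_eq] at h1
  exact h1

include hg hX hY hZ in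
theorem NodeInv.prefix {A U : Set W} (h : NodeInv part E g Z A X Y)
    (hne : (supp₂ part Y U \ supp part X).Nonempty) : NodeInv part E g Z A X U := by
  refine ⟨h.ne, h.supp_eq, ?_, h.cyc⟩
  obtain ⟨P, R, hP, hR, hs, hA, v, hv, hvX, hvZ, hvP, hvR⟩ := h.loc
  obtain ⟨u, ⟨huY, huU⟩, huX⟩ := hne
  have eP := hg.supp_orient hX hP
  have eR := hg.supp_orient hZ hR
  have eY := hg.supp_eq Y hY
  have huZ : u ∉ supp part Z := by
    intro huZ
    rw [← eR] at huZ
    rcases cyc_or_disjoint hs (hg.two_orient hZ hY hR (.refl _))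
      (hg.two_orient hX hY hP (.refl _)) (by rwa [eY]) (by rwa [eR]) (by rwa [eP]) hvR hvP with
      ⟨h1, -⟩ | ⟨Q, hQ, hc⟩
    · exact (Set.ext_iff.1 h1 u).1 ⟨huZ, by rwa [eY]⟩
    · have := hc.rotate.rotate.inter_subset (show u ∈ supp part Q ∩ supp part R from
        ⟨by rwa [hQ.supp_eq, eY], huZ⟩)
      rw [eP] at this
      exact huX this
  refine ⟨P, R, hP, hR, hs, hA, u, huU, huX, huZ, ?_, ?_⟩
  · rw [const_of_notCrossingOn (hg.two_orient hX hY hP (.refl _)) (u := u) (v := v)] <;>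
      simpa only [eY, eP]
  · rw [const_of_notCrossingOn (hg.two_orient hZ hY hR (.refl _)) (u := u) (v := v)] <;>
      simpa only [eY, eR]

include hg hX hZ in
theorem NodeInv.line_eq {A : Set W} (h : NodeInv part E g Z A X Y) : line A X = line A Z := by
  obtain ⟨P, R, hP, hR, hs, hA, -⟩ := h.loc
  have hA' : ∀ v ∈ A, v ∈ supp part X ∧ v ∈ supp part Z := by
    intro v hv
    rw [← h.supp_eq] at hv
    exact hv
  rw [← line_eq_of_forall fun v hv => hg.mem_iff X hX v (hA' v hv).1,
    ← line_eq_of_forall fun v hv => hg.mem_iff Z hZ v (hA' v hv).2, ← line_eq_of_orient hP,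
    ← line_eq_of_orient hR]
  exact line_eq_of_forall hA

include hE hg hX hZ in
/-- Three members `X`, `Y`, `Z` with the property are not cross-free together. -/
theorem NodeInv.crossingOn {A B : Set W} (hA : A.Nonempty) (h : NodeInv part E g Z A X Y)
    (h1 : supp part X ⊆ B) (h2 : supp part Y ⊆ B) (h3 : supp part Z ⊆ B) :
    CrossingOn B (g X) (g Z) := by
  obtain ⟨P, R, hP, hR, hs, -, v, hv, hvX, hvZ, hvP, hvR⟩ := h.loc
  have eP := hg.supp_orient hX hP
  have eR := hg.supp_orient hZ hR
  have hPR : CrossingOn B P R := by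
    obtain ⟨w, hw⟩ := hA
    rw [← h.supp_eq] at hw
    rw [supp₂, ← eP, ← eR] at hw
    obtain ⟨p, hp, hpw⟩ := hw.2.1
    have hpR : p ∈ supp part R := (mem_supp_congr hpw).2 hw.2
    obtain ⟨q, hq, hqw⟩ := hw.1.2
    have hqP : q ∈ supp part P := (mem_supp_congr hqw).2 hw.1
    obtain ⟨u, huX, huZ⟩ := hE.sep Z hZ X hX h.ne.symm
    rw [← eP] at huX
    rw [← eR] at huZ
    obtain ⟨u', hu', hu'u⟩ := huX.1
    have hu'P : u' ∈ supp part P := (mem_supp_congr hu'u).2 huX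
    refine ⟨⟨p, ⟨subOn_iff.1 hs p (Or.inl hpR) hp, hp⟩, h3 (by rwa [← eR])⟩,
      ⟨q, h1 (by rwa [← eP]), ?_⟩, ⟨u', ⟨hu', ?_⟩, h1 (by rwa [← eP])⟩, ⟨v, ⟨hvR, hvP⟩, h2 hv⟩⟩
    · rintro (h | h)
      · exact hq h
      · exact hq (subOn_iff.1 hs q (Or.inr hqP) h)
    · exact hs.notMem_left hu'P fun h => huZ ((mem_supp_congr hu'u).1 h)
  exact hPR.orient hP.symm hR.symm

end

theorem reachable_induction {V : Type*} {G : SimpleGraph V} {p : V → Prop} {a b : V}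
    (h : G.Reachable a b) (ha : p a) (hp : ∀ c d, G.Adj c d → p c → p d) : p b := by
  rw [SimpleGraph.reachable_iff_reflTransGen] at h
  induction h with
  | refl => exact ha
  | tail _ hcd ih => exact hp _ _ hcd ih

section

variable {E : Set (Set W)} {g : Set W → Set W} (hE : Separated part E)
  (hg : LocalModel part E g) {X Y Z : Set W} (hX : X ∈ E) (hY : Y ∈ E) (hZ : Z ∈ E)
  (hXY : X ≠ Y) (hYZ : Y ≠ Z) (hXZ : X ≠ Z)

/-- The component `v(XY)` of a node. -/
abbrev nodeComp (part : W → κ) {E : Set (Set W)} (a : LCNode E) : LCComponent part E :=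
  (lcGraph part E).connectedComponentMk a

include hE hg hZ hYZ hXZ in
theorem IsCyclicTriple.nodeInv_of_reachable (h : IsCyclicTriple part (g X) (g Y) (g Z))
    {b : LCNode E} (hb : (lcGraph part E).Reachable ⟨(X, Y), hX, hY, hXY⟩ b) :
    NodeInv part E g Z (supp₂ part X Z) b.1.1 b.1.2 := by
  refine reachable_induction (p := fun b : LCNode E =>
    NodeInv part E g Z (supp₂ part X Z) b.1.1 b.1.2) hb
    (h.nodeInv hE hg hX hY hZ hXY hYZ hXZ) ?_
  rintro ⟨⟨c1, c2⟩, hc1, hc2, hc⟩ ⟨⟨d1, d2⟩, hd1, hd2, hd⟩ (⟨h1, h2⟩ | ⟨-, h1, h2⟩) hi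
  · simp only [LCNode.swap, Subtype.mk.injEq, Prod.mk.injEq] at h1
    obtain ⟨rfl, rfl⟩ := h1
    exact hi.swap hE hg hc1 hc2 hZ hc h2
  · dsimp only at h1
    subst h1
    exact hi.prefix hg hc1 hc2 hZ h2

theorem prefixedGraph_le {E : Set (Set W)} : prefixedGraph part E ≤ lcGraph part E := le_sup_right

include hE hg hZ hYZ hXZ in
/-- The component of a node of a cyclic triple belongs to a free flower. -/
theorem IsCyclicTriple.component (h : IsCyclicTriple part (g X) (g Y) (g Z)) :
    (nodeComp part ⟨(X, Y), hX, hY, hXY⟩).IsSpecialWithCenter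
        (supp₂ part X Z) ∧
      (nodeComp part ⟨(X, Y), hX, hY, hXY⟩).IsFree ∧
      (nodeComp part ⟨(X, Y), hX, hY, hXY⟩).HasLine
        (supp₂ part X Z) (line (supp₂ part X Z) Z) := by
  have hr : ∀ b : LCNode E, nodeComp part b =
      nodeComp part ⟨(X, Y), hX, hY, hXY⟩ →
      (b.supp part).Nonempty → b.supp part = supp₂ part X Z ∧
        line (supp₂ part X Z) b.1.1 = line (supp₂ part X Z) Z ∧
        line (supp₂ part X Z) b.1.2 = line (supp₂ part X Z) Z := by
    intro b hb hne
    have hi := h.nodeInv_of_reachable hE hg hX hY hZ hXY hYZ hXZ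
      (SimpleGraph.ConnectedComponent.exact hb.symm)
    have hc := hi.isCyclicTriple hg b.2.1 b.2.2.1 hZ hne
    refine ⟨?_, hi.line_eq hg b.2.1 hZ, (hi.swap hE hg b.2.1 b.2.2.1 hZ b.2.2.2 hne).line_eq hg
      b.2.2.1 hZ⟩
    rw [LCNode.supp, hc.supp₂_eq hg b.2.1 b.2.2.1 hZ, hi.supp_eq]
  have hne : (supp₂ part X Y).Nonempty := by
    obtain ⟨⟨v, hv⟩, -⟩ := h
    rw [hg.supp_eq X hX, hg.supp_eq Y hY] at hv
    exact ⟨v, hv.1⟩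
  set a : LCNode E := ⟨(X, Y), hX, hY, hXY⟩
  have ha : a.supp part = supp₂ part X Z := (hr a rfl hne).1
  have hswap : (lcGraph part E).Adj a a.swap := Or.inl ⟨rfl, hne⟩
  refine ⟨⟨a, rfl, ⟨hne, fun b hb hbne => ?_⟩, ⟨?_, fun b hb hbne => ?_⟩, ha⟩, ?_, ?_⟩
  · rw [ha]
    exact (hr b (SimpleGraph.ConnectedComponent.sound (hb.mono prefixedGraph_le).symm) hbne).1
  · have : a.swap.supp part = a.supp part := Set.inter_comm _ _
    rw [this]
    exact hne
  · have : a.swap.supp part = a.supp part := Set.inter_comm _ _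
    rw [this, ha]
    exact (hr b (SimpleGraph.ConnectedComponent.sound
      (hswap.reachable.trans (hb.mono prefixedGraph_le)).symm) hbne).1
  · rintro b hb ⟨hbne, hb'⟩
    obtain ⟨h1, h2, h3⟩ := hr b hb hbne
    rw [h1, h2, h3] at hb'
    exact hb' rfl
  · exact fun b hb hbne => (hr b hb hbne).2

include hE hg hX hY hZ hXY hYZ hXZ in
/-- Under the condition of the algorithm on free flowers, there are no cyclic triples. -/
theorem not_isCyclicTriple_of_flower
    (hflower : ∀ A C, IsFreeFlower part E A C → ∃ (q : ℕ) (X : Fin q → Set W),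
      Represents part E C X ∧
        CrossFreeOn (⋃ i, supp part (X i)) (Set.range fun i => g (X i))) :
    ¬ IsCyclicTriple part (g X) (g Y) (g Z) := by
  intro h
  set A := supp₂ part X Z with hA
  have hXYA : supp₂ part X Y = A := h.supp₂_eq hg hX hY hZ
  have hAne : A.Nonempty := by
    obtain ⟨⟨v, hv⟩, -⟩ := h
    rw [hg.supp_eq X hX, hg.supp_eq Z hZ] at hv
    exact ⟨v, hv.1.1, hv.2⟩
  have hl : line A X = line A Z :=
    (h.nodeInv hE hg hX hY hZ hXY hYZ hXZ).line_eq hg hX hZ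
  set C : Set (LCComponent part E) := {c : LCComponent part E | c.IsSpecialWithCenter A ∧
    c.IsFree ∧ c.HasLine A (line A Z)} with hC
  have h1 := h.component hE hg hX hY hZ hXY hYZ hXZ
  have hYX : supp₂ part Y X = A := by rw [supp₂, Set.inter_comm]; exact hXYA
  have h2 : nodeComp part ⟨(Y, Z), hY, hZ, hYZ⟩ ∈ C := by
    have := h.rotate.component hE hg hY hZ hX hYZ hXZ.symm hXY.symm
    rwa [hYX, hl] at this
  have hne : nodeComp part ⟨(X, Y), hX, hY, hXY⟩ ≠
      nodeComp part ⟨(Y, Z), hY, hZ, hYZ⟩ := by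
    intro he
    exact (h.nodeInv_of_reachable hE hg hX hY hZ hXY hYZ hXZ
      (SimpleGraph.ConnectedComponent.exact he)).ne' rfl
  obtain ⟨q, R, hR, hcf⟩ := hflower A C ⟨⟨_, h1⟩, ⟨_, h1.1, _, h2.1, hne⟩, _, rfl⟩
  obtain ⟨-, hRE, hRC⟩ := hR
  -- a representative `R i` that belongs to a cyclic triple `R i, Y', Z`
  have h3 : nodeComp part ⟨(X, Y), hX, hY, hXY⟩ ∈ C := h1
  rw [hRC] at h3
  obtain ⟨a, ⟨i, j, -, ha⟩, hac⟩ := h3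
  have hi := h.nodeInv_of_reachable hE hg hX hY hZ hXY hYZ hXZ
    (SimpleGraph.ConnectedComponent.exact hac.symm)
  rw [ha] at hi
  dsimp only at hi
  obtain ⟨Y', hY', hn1, hn2, hc⟩ := hi.cyc
  -- the flower contains the component of `Y'Z`, represented by another pair
  have hc' := hc.rotate
  have hs1 : supp₂ part Y' (R i) = A := by
    rw [supp₂, Set.inter_comm]
    exact (hc.supp₂_eq hg (hRE i) hY' hZ).trans hi.supp_eq
  have h4 : nodeComp part ⟨(Y', Z), hY', hZ, hn2⟩ ∈ C := by
    have := hc'.component hE hg hY' hZ (hRE i) hn2 hi.ne.symm hn1.symm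
    rwa [hs1, hi.line_eq hg (hRE i) hZ] at this
  rw [hRC] at h4
  obtain ⟨b, ⟨k, l, -, hb⟩, hbc⟩ := h4
  have hk := hc'.nodeInv_of_reachable hE hg hY' hZ (hRE i) hn2 hi.ne.symm hn1.symm
    (SimpleGraph.ConnectedComponent.exact hbc.symm)
  rw [hb, hs1] at hk
  dsimp only at hk
  exact hcf _ ⟨k, rfl⟩ _ ⟨i, rfl⟩ (hk.crossingOn hE hg (hRE k) (hRE i) hAne
    (Set.subset_iUnion (fun i => supp part (R i)) k)
    (Set.subset_iUnion (fun i => supp part (R i)) l)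
    (Set.subset_iUnion (fun i => supp part (R i)) i))

end

end CutFamily

namespace CutFamily

variable {W κ : Type*} {part : W → κ}

/-! ### Representatives of free flowers -/

/-- The members `X` and `Y` are connected in the hypergraph with the edges `⟨Z⟩ \ A`, `Z ∈ E`. -/
def Linked (part : W → κ) (E : Set (Set W)) (A X Y : Set W) : Prop :=
  Relation.ReflTransGen (fun U V => U ∈ E ∧ V ∈ E ∧ (supp₂ part U V \ A).Nonempty) X Y

/-- Every member that is connected with `X` cuts all parts in `A` or none. -/
def Clean (part : W → κ) (E : Set (Set W)) (A X : Set W) : Prop :=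
  ∀ U ∈ E, Linked part E A X U → (supp part U ∩ A = ∅ ∨ A ⊆ supp part U)

variable {E : Set (Set W)} {A X Y : Set W}

theorem Linked.refl (X : Set W) : Linked part E A X X := Relation.ReflTransGen.refl

theorem Linked.symm (h : Linked part E A X Y) : Linked part E A Y X := by
  induction h with
  | refl => exact Relation.ReflTransGen.refl
  | tail _ h ih =>
    exact Relation.ReflTransGen.head ⟨h.2.1, h.1, by rw [supp₂, Set.inter_comm]; exact h.2.2⟩ ih

theorem Linked.trans {Z : Set W} (h : Linked part E A X Y) (h' : Linked part E A Y Z) :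
    Linked part E A X Z := Relation.ReflTransGen.trans h h'

theorem Clean.congr (h : Clean part E A X) (hXY : Linked part E A X Y) : Clean part E A Y :=
  fun U hU hYU => h U hU (hXY.trans hYU)

theorem linked_of_mem (hX : X ∈ E) (hY : Y ∈ E) {v : W} (h1 : v ∈ supp part X)
    (h2 : v ∈ supp part Y) (h3 : v ∉ A) : Linked part E A X Y :=
  Relation.ReflTransGen.single ⟨hX, hY, v, ⟨h1, h2⟩, h3⟩

theorem prefixed_step {U V : Set W} (hX : X ∈ E) (hU : U ∈ E) (hV : V ∈ E) (hXU : X ≠ U)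
    {v : W} (h1 : v ∈ supp part U) (h2 : v ∈ supp part V) (h3 : v ∉ supp part X) :
    ∃ hXV : X ≠ V, (prefixedGraph part E).Reachable ⟨(X, U), hX, hU, hXU⟩
      ⟨(X, V), hX, hV, hXV⟩ := by
  have hXV : X ≠ V := by
    rintro rfl
    exact h3 h2
  refine ⟨hXV, ?_⟩
  rcases eq_or_ne U V with rfl | hUV
  · exact .rfl
  · exact SimpleGraph.Adj.reachable ⟨fun h => hUV (by simpa using h), rfl, v, ⟨h1, h2⟩, h3⟩

theorem reachable_of_linked_of_isSpecial (hX : X ∈ E) (hY : Y ∈ E) (hXY : X ≠ Y)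
    (h : LCNode.IsSpecial part (⟨(X, Y), hX, hY, hXY⟩ : LCNode E)) (hA : supp₂ part X Y = A)
    {U : Set W} (hU : Linked part E A Y U) :
    ∃ (hUE : U ∈ E) (hXU : X ≠ U), (prefixedGraph part E).Reachable ⟨(X, Y), hX, hY, hXY⟩
      ⟨(X, U), hX, hUE, hXU⟩ := by
  induction hU with
  | refl => exact ⟨hY, hXY, .rfl⟩
  | @tail U V _ hUV ih =>
    obtain ⟨hU, hXU, hr⟩ := ih
    obtain ⟨-, hV, v, hv, hvA⟩ := hUV
    have hvX : v ∉ supp part X := by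
      intro hvX
      have h1 := h.2 _ hr ⟨v, hvX, hv.1⟩
      have h2 : v ∈ supp₂ part X U := ⟨hvX, hv.1⟩
      rw [LCNode.supp, LCNode.supp] at h1
      dsimp only at h1
      rw [h1, hA] at h2
      exact hvA h2
    obtain ⟨hXV, hr'⟩ := prefixed_step hX hU hV hXU hv.1 hv.2 hvX
    exact ⟨hV, hXV, hr.trans hr'⟩

theorem clean_of_isSpecial (hX : X ∈ E) (hY : Y ∈ E) (hXY : X ≠ Y)
    (h : LCNode.IsSpecial part (⟨(X, Y), hX, hY, hXY⟩ : LCNode E)) (hA : supp₂ part X Y = A) :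
    Clean part E A Y ∧ ¬ Linked part E A Y X := by
  constructor
  · intro U _ hYU
    obtain ⟨hU, hXU, hr⟩ := reachable_of_linked_of_isSpecial hX hY hXY h hA hYU
    rcases Set.eq_empty_or_nonempty (supp part U ∩ A) with he | ⟨v, hv⟩
    · exact Or.inl he
    · right
      have hvX : v ∈ supp part X := by
        have := hv.2
        rw [← hA] at this
        exact this.1
      have h1 := h.2 _ hr ⟨v, hvX, hv.1⟩
      rw [LCNode.supp, LCNode.supp] at h1
      dsimp only at h1
      rw [hA] at h1
      rw [← h1]
      exact Set.inter_subset_right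
  · intro hYX
    obtain ⟨-, hXX, -⟩ := reachable_of_linked_of_isSpecial hX hY hXY h hA hYX
    exact hXX rfl

/-- Two components of the hypergraph with center `A`, given by members that cut all parts in `A`. -/
structure SpecialPair (part : W → κ) (E : Set (Set W)) (A X Y : Set W) : Prop where
  memX : X ∈ E
  memY : Y ∈ E
  subX : A ⊆ supp part X
  subY : A ⊆ supp part Y
  cleanX : Clean part E A X
  cleanY : Clean part E A Y
  notLinked : ¬ Linked part E A X Y

theorem SpecialPair.symm (h : SpecialPair part E A X Y) : SpecialPair part E A Y X :=
  ⟨h.memY, h.memX, h.subY, h.subX, h.cleanY, h.cleanX, fun hl => h.notLinked hl.symm⟩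

theorem SpecialPair.ne (h : SpecialPair part E A X Y) : X ≠ Y := by
  rintro rfl
  exact h.notLinked (.refl _)

/-- The node `XY` of a special pair. -/
def SpecialPair.node (h : SpecialPair part E A X Y) : LCNode E := ⟨(X, Y), h.memX, h.memY, h.ne⟩

theorem SpecialPair.congr {X' Y' : Set W} (h : SpecialPair part E A X Y) (hX' : X' ∈ E)
    (hY' : Y' ∈ E) (hsX : A ⊆ supp part X') (hsY : A ⊆ supp part Y')
    (hX : Linked part E A X X') (hY : Linked part E A Y Y') : SpecialPair part E A X' Y' :=
  ⟨hX', hY', hsX, hsY, h.cleanX.congr hX, h.cleanY.congr hY,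
    fun hl => h.notLinked ((hX.trans hl).trans hY.symm)⟩

theorem SpecialPair.supp₂_subset {U V : Set W} (h : SpecialPair part E A X Y) (hU : U ∈ E)
    (hV : V ∈ E) (hXU : Linked part E A X U) (hYV : Linked part E A Y V) :
    supp₂ part U V ⊆ A := by
  intro v hv
  by_contra hvA
  exact h.notLinked ((hXU.trans (linked_of_mem hU hV hv.1 hv.2 hvA)).trans hYV.symm)

theorem SpecialPair.supp₂_eq (h : SpecialPair part E A X Y) : supp₂ part X Y = A :=
  (h.supp₂_subset h.memX h.memY (.refl _) (.refl _)).antisymm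
    fun _ hv => ⟨h.subX hv, h.subY hv⟩

theorem SpecialPair.prefixed_reachable {U : Set W} (h : SpecialPair part E A X Y)
    (hYU : Linked part E A Y U) : ∃ (hU : U ∈ E) (hXU : X ≠ U),
      (prefixedGraph part E).Reachable h.node ⟨(X, U), h.memX, hU, hXU⟩ := by
  induction hYU with
  | refl => exact ⟨h.memY, h.ne, .rfl⟩
  | @tail U V hYU hUV ih =>
    obtain ⟨hU, hXU, hr⟩ := ih
    obtain ⟨-, hV, v, hv, hvA⟩ := hUV
    have hvX : v ∉ supp part X := fun hvX =>
      hvA (h.supp₂_subset h.memX hU (.refl _) hYU ⟨hvX, hv.1⟩)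
    obtain ⟨hXV, hr'⟩ := prefixed_step h.memX hU hV hXU hv.1 hv.2 hvX
    exact ⟨hV, hXV, hr.trans hr'⟩

theorem SpecialPair.nodeComp_swap (h : SpecialPair part E A X Y) (hA : A.Nonempty) :
    nodeComp part h.node = nodeComp part h.symm.node := by
  refine SimpleGraph.ConnectedComponent.sound (SimpleGraph.Adj.reachable (Or.inl ⟨rfl, ?_⟩))
  rw [LCNode.supp]
  exact h.supp₂_eq.symm ▸ hA

theorem SpecialPair.nodeComp_congr {X' Y' : Set W} (h : SpecialPair part E A X Y)
    (hA : A.Nonempty) (h' : SpecialPair part E A X' Y') (hX : Linked part E A X X')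
    (hY : Linked part E A Y Y') : nodeComp part h.node = nodeComp part h'.node := by
  have key : ∀ {X Y Y' : Set W} (h : SpecialPair part E A X Y) (h' : SpecialPair part E A X Y'),
      Linked part E A Y Y' → nodeComp part h.node = nodeComp part h'.node := by
    intro X Y Y' h h' hY
    obtain ⟨_, _, hr⟩ := h.prefixed_reachable hY
    exact SimpleGraph.ConnectedComponent.sound (hr.mono prefixedGraph_le)
  have h1 : SpecialPair part E A X Y' :=
    h.congr h.memX h'.memY h.subX h'.subY (.refl _) hY
  rw [key h h1 hY, h1.nodeComp_swap hA, h'.nodeComp_swap hA]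
  exact key _ _ hX

theorem SpecialPair.of_reachable (h : SpecialPair part E A X Y) {b : LCNode E}
    (hb : (lcGraph part E).Reachable h.node b) (hne : (b.supp part).Nonempty) :
    SpecialPair part E A b.1.1 b.1.2 ∧
      ((Linked part E A X b.1.1 ∧ Linked part E A Y b.1.2) ∨
        (Linked part E A Y b.1.1 ∧ Linked part E A X b.1.2)) := by
  have sub : ∀ {X Y U V : Set W}, SpecialPair part E A X Y → U ∈ E → V ∈ E →
      Linked part E A X U → Linked part E A Y V → (supp₂ part U V).Nonempty →
      A ⊆ supp part V := by
    intro X Y U V h hU hV hXU hYV ⟨v, hv⟩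
    refine (h.cleanY V hV hYV).resolve_left fun he => ?_
    exact (Set.ext_iff.1 he v).1 ⟨hv.2, h.supp₂_subset hU hV hXU hYV hv⟩
  let p : LCNode E → Prop := fun b => A ⊆ supp part b.1.1 ∧
    ((Linked part E A X b.1.1 ∧ Linked part E A Y b.1.2) ∨
        (Linked part E A Y b.1.1 ∧ Linked part E A X b.1.2))
  have hp : p b := by
    refine reachable_induction hb ⟨h.subX, Or.inl ⟨.refl _, .refl _⟩⟩ ?_
    rintro ⟨⟨c1, c2⟩, hc1, hc2, hc⟩ ⟨⟨d1, d2⟩, hd1, hd2, hd⟩ (⟨h1, h2⟩ | ⟨-, h1, h2⟩) ⟨hi, hi'⟩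
    · simp only [LCNode.swap, Subtype.mk.injEq, Prod.mk.injEq] at h1
      obtain ⟨rfl, rfl⟩ := h1
      rcases hi' with hi' | hi'
      · exact ⟨sub h hc1 hc2 hi'.1 hi'.2 h2, Or.inr ⟨hi'.2, hi'.1⟩⟩
      · exact ⟨sub h.symm hc1 hc2 hi'.1 hi'.2 h2, Or.inl ⟨hi'.2, hi'.1⟩⟩
    · dsimp only at h1
      subst h1
      obtain ⟨v, ⟨hv1, hv2⟩, hv3⟩ := h2
      have := linked_of_mem hc2 hd2 hv1 hv2 fun h => hv3 (hi h)
      exact ⟨hi, hi'.imp (fun h => ⟨h.1, h.2.trans this⟩) fun h => ⟨h.1, h.2.trans this⟩⟩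
  refine ⟨?_, hp.2⟩
  rcases hp.2 with hi | hi
  · exact h.congr b.2.1 b.2.2.1 hp.1 (sub h b.2.1 b.2.2.1 hi.1 hi.2 hne) hi.1 hi.2
  · exact h.symm.congr b.2.1 b.2.2.1 hp.1 (sub h.symm b.2.1 b.2.2.1 hi.1 hi.2 hne) hi.1 hi.2

theorem SpecialPair.isSpecialWithCenter (h : SpecialPair part E A X Y) (hA : A.Nonempty) :
    LCComponent.IsSpecialWithCenter (nodeComp part h.node) A := by
  have key : ∀ {X Y : Set W} (h : SpecialPair part E A X Y), h.node.IsSpecial part := by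
    intro X Y h
    have h0 : h.node.supp part = A := h.supp₂_eq
    refine ⟨h0.symm ▸ hA, fun b hb hne => ?_⟩
    rw [h0]
    exact (h.of_reachable (hb.mono prefixedGraph_le) hne).1.supp₂_eq
  exact ⟨h.node, rfl, key h, key h.symm, h.supp₂_eq⟩

theorem exists_specialPair {c : LCComponent part E} (hc : c.IsSpecialWithCenter A) :
    A.Nonempty ∧ ∃ X Y, ∃ h : SpecialPair part E A X Y, nodeComp part h.node = c := by
  obtain ⟨⟨⟨X, Y⟩, hX, hY, hXY⟩, ha, h1, h2, h3⟩ := hc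
  have h4 : supp₂ part Y X = A := by
    rw [← h3]
    exact Set.inter_comm _ _
  obtain ⟨c1, n1⟩ := clean_of_isSpecial hX hY hXY h1 h3
  obtain ⟨c2, -⟩ := clean_of_isSpecial hY hX hXY.symm h2 h4
  refine ⟨h3 ▸ h1.1, X, Y, ⟨hX, hY, ?_, ?_, c2, c1, fun h => n1 h.symm⟩, ha⟩
  · rw [← h3]
    exact Set.inter_subset_left
  · rw [← h3]
    exact Set.inter_subset_right

/-- In the absence of cyclic triples, members that pairwise cut the same parts in common are
cross-free together. -/
theorem crossFreeOn_of_noCyc {g : Set W → Set W} (hg : LocalModel part E g)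
    (hno : ∀ X ∈ E, ∀ Y ∈ E, ∀ Z ∈ E, X ≠ Y → Y ≠ Z → X ≠ Z →
      ¬ IsCyclicTriple part (g X) (g Y) (g Z)) (hA : A.Nonempty) {I : Type*} {X : I → Set W}
    (hXE : ∀ i, X i ∈ E) (hX : ∀ i, A ⊆ supp part (X i)) :
    CrossFreeOn (⋃ i, supp part (X i)) (Set.range fun i => g (X i)) := by
  rintro _ ⟨i, rfl⟩ _ ⟨j, rfl⟩ hc
  dsimp only at hc
  obtain ⟨P, Q, hP, hQ, hs⟩ := notCrossingOn_iff.1 (hg.two _ (hXE i) _ (hXE j))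
  have eP := hg.supp_orient (hXE i) hP
  have eQ := hg.supp_orient (hXE j) hQ
  rw [← eP, ← eQ] at hs
  obtain ⟨v, ⟨hvP, hvQ⟩, hv⟩ := (hc.orient hP hQ).2.2.1
  obtain ⟨k, hvk⟩ := Set.mem_iUnion.1 hv
  have hv1 : v ∉ supp part P := fun h => hvQ (subOn_iff.1 hs v (Or.inl h) hvP)
  have hv2 : v ∉ supp part Q := fun h => hvQ (subOn_iff.1 hs v (Or.inr h) hvP)
  have ek := hg.supp_eq _ (hXE k)
  obtain ⟨w, hw⟩ := hA
  rcases cyc_or_disjoint hs (hg.two_orient (hXE i) (hXE k) hP (.refl _))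
    (hg.two_orient (hXE j) (hXE k) hQ (.refl _)) (by rwa [ek]) hv1 hv2 hvP hvQ with
    ⟨h, -⟩ | ⟨R, hR, h⟩
  · rw [eP, ek] at h
    exact (Set.ext_iff.1 h w).1 ⟨hX i hw, hX k hw⟩
  · refine hno _ (hXE i) _ (hXE j) _ (hXE k) ?_ ?_ ?_ ⟨⟨w, ⟨?_, ?_⟩, ?_⟩, P, Q, R, hP, hQ, hR, h⟩
    · intro he
      rw [he] at hc
      exact not_crossingOn_self _ _ hc
    · intro he
      rw [eQ, he] at hv2
      exact hv2 hvk
    · intro he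
      rw [eP, he] at hv1
      exact hv1 hvk
    · rw [hg.supp_eq _ (hXE i)]
      exact hX i hw
    · rw [hg.supp_eq _ (hXE j)]
      exact hX j hw
    · rw [ek]
      exact hX k hw

/-- Every free flower has representatives, and if there are no cyclic triples, then they satisfy
the condition of the algorithm: one member for each hypergraph component in the flower. -/
theorem exists_representatives {g : Set W → Set W} (hfin : E.Finite) (hg : LocalModel part E g)
    (hno : ∀ X ∈ E, ∀ Y ∈ E, ∀ Z ∈ E, X ≠ Y → Y ≠ Z → X ≠ Z →
      ¬ IsCyclicTriple part (g X) (g Y) (g Z)) {C : Set (LCComponent part E)}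
    (hC : IsFreeFlower part E A C) : ∃ (q : ℕ) (X : Fin q → Set W), Represents part E C X ∧
      CrossFreeOn (⋃ i, supp part (X i)) (Set.range fun i => g (X i)) := by
  classical
  obtain ⟨⟨c₀, hc₀⟩, -, l, hl⟩ := hC
  have hA : A.Nonempty := by
    rw [hl] at hc₀
    exact (exists_specialPair hc₀.1).1
  let S : Set (Set W) := {X | ∃ Y, ∃ h : SpecialPair part E A X Y, nodeComp part h.node ∈ C}
  have hSE : S ⊆ E := fun X ⟨Y, h, _⟩ => h.memX
  have hline : ∀ {X U : Set W}, X ∈ S → U ∈ E → A ⊆ supp part U → Linked part E A X U →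
      line A U = l := by
    rintro X U ⟨Y, h, hc⟩ hU hs hXU
    have h' := h.congr hU h.memY hs h.subY hXU (.refl _)
    rw [h.nodeComp_congr hA h' hXU (.refl _), hl] at hc
    exact (hc.2.2 h'.node rfl (by rw [LCNode.supp]; exact h'.supp₂_eq.symm ▸ hA)).1
  have hpair : ∀ {X Y : Set W}, X ∈ S → Y ∈ S → ∀ h : SpecialPair part E A X Y,
      nodeComp part h.node ∈ C := by
    intro X Y hX hY h
    have hb : ∀ b : LCNode E, nodeComp part b = nodeComp part h.node → (b.supp part).Nonempty →
        b.supp part = A ∧ line A b.1.1 = l ∧ line A b.1.2 = l := by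
      intro b hb hne
      obtain ⟨hp, hp'⟩ := h.of_reachable (SimpleGraph.ConnectedComponent.exact hb.symm) hne
      refine ⟨hp.supp₂_eq, ?_⟩
      rcases hp' with ⟨h1, h2⟩ | ⟨h1, h2⟩
      · exact ⟨hline hX hp.memX hp.subX h1, hline hY hp.memY hp.subY h2⟩
      · exact ⟨hline hY hp.memX hp.subX h1, hline hX hp.memY hp.subY h2⟩
    rw [hl]
    refine ⟨h.isSpecialWithCenter hA, ?_, fun b hbc hne => (hb b hbc hne).2⟩
    rintro b hbc ⟨hne, hf⟩
    obtain ⟨h1, h2, h3⟩ := hb b hbc hne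
    rw [h1, h2, h3] at hf
    exact hf rfl
  let r : Setoid S := ⟨fun X Y => Linked part E A X Y, fun X => .refl _, Linked.symm, Linked.trans⟩
  have : Finite S := (hfin.subset hSE).to_subtype
  obtain ⟨q, ⟨e⟩⟩ := Finite.exists_equiv_fin (Quotient r)
  let R : Fin q → S := fun i => (e.symm i).out
  have hRne : ∀ i j, i ≠ j → ¬ Linked part E A (R i) (R j) := by
    intro i j hij h
    apply hij
    have : (⟦R i⟧ : Quotient r) = ⟦R j⟧ := Quotient.sound h
    simpa [R] using this
  have hRl : ∀ X : S, Linked part E A X (R (e ⟦X⟧)) := by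
    intro X
    have : (⟦R (e ⟦X⟧)⟧ : Quotient r) = ⟦X⟧ := by simp [R]
    exact Linked.symm (Quotient.exact this)
  have hSs : ∀ X : S, A ⊆ supp part (X : Set W) ∧ Clean part E A X := by
    rintro ⟨X, Y, h, -⟩
    exact ⟨h.subX, h.cleanX⟩
  have hRp : ∀ {i j}, i ≠ j → SpecialPair part E A (R i) (R j) := fun {i j} hij =>
    ⟨hSE (R i).2, hSE (R j).2, (hSs _).1, (hSs _).1, (hSs _).2, (hSs _).2, hRne i j hij⟩
  refine ⟨q, fun i => R i, ⟨?_, fun i => hSE (R i).2, ?_⟩,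
    crossFreeOn_of_noCyc hg hno hA (fun i => hSE (R i).2) fun i => (hSs _).1⟩
  · intro i j h
    by_contra hij
    exact hRne i j hij (by dsimp only at h; rw [h]; exact .refl _)
  · ext c
    constructor
    · intro hc
      have hc' := hc
      rw [hl] at hc'
      obtain ⟨-, X, Y, h, rfl⟩ := exists_specialPair hc'.1
      have hX : X ∈ S := ⟨Y, h, hc⟩
      have hY : Y ∈ S := ⟨X, h.symm, by rwa [← h.nodeComp_swap hA]⟩
      have h1 := hRl ⟨X, hX⟩
      have h2 := hRl ⟨Y, hY⟩
      set i := e ⟦⟨X, hX⟩⟧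
      set j := e ⟦⟨Y, hY⟩⟧
      have hij : i ≠ j := by
        intro hij
        rw [hij] at h1
        exact h.notLinked (h1.trans h2.symm)
      rcases lt_or_gt_of_ne hij with hlt | hlt
      · exact ⟨(hRp hij).node, ⟨i, j, hlt, rfl⟩, (h.nodeComp_congr hA _ h1 h2).symm⟩
      · refine ⟨(hRp hij.symm).node, ⟨j, i, hlt, rfl⟩, ?_⟩
        rw [h.nodeComp_swap hA]
        exact (h.symm.nodeComp_congr hA _ h2 h1).symm
    · rintro ⟨a, ⟨i, j, hij, ha⟩, rfl⟩
      have : a = (hRp hij.ne).node := Subtype.ext ha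
      rw [this]
      exact hpair (R i).2 (R j).2 _

end CutFamily

namespace CutFamily

/-! ### Laminar families are small -/

theorem subsingleton_of_laminar {V : Type*} {L : Set (Set V)} (hL : Laminar L)
    (hne : ∀ X ∈ L, X.Nonempty) (v : V) :
    {X | X ∈ L ∧ v ∈ X ∧ X \ {v} ∈ L}.Subsingleton := by
  have key : ∀ X ∈ L, ∀ Y ∈ L, v ∈ X → v ∈ Y → X \ {v} ∈ L → Y \ {v} ∈ L → X ⊆ Y → Y ⊆ X := by
    intro X hX Y hY hvX hvY hX' hY' hXY
    rcases hL X hX _ hY' with h | h | h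
    · exact absurd (h hvX).2 (by simp)
    · intro u hu
      by_cases huv : u = v
      · rwa [huv]
      · exact h ⟨hu, huv⟩
    · obtain ⟨u, hu⟩ := hne _ hX'
      exact absurd (show u ∈ X ∩ (Y \ {v}) from ⟨hu.1, hXY hu.1, hu.2⟩) (by simp [h])
  rintro X ⟨hX, hvX, hX'⟩ Y ⟨hY, hvY, hY'⟩
  rcases hL X hX Y hY with h | h | h
  · exact h.antisymm (key X hX Y hY hvX hvY hX' hY' h)
  · exact (key Y hY X hX hvY hvX hY' hX' h).antisymm h
  · exact absurd (show v ∈ X ∩ Y from ⟨hvX, hvY⟩) (by simp [h])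

/-- A laminar family of nonempty subsets of `U` has at most `2 |U|` members: deleting an element
`v` destroys at most `{v}` and identifies at most one pair of members. -/
theorem ncard_le_of_laminar {V : Type*} [Finite V] (U : Finset V) (L : Set (Set V))
    (hL : Laminar L) (hne : ∀ X ∈ L, X.Nonempty) (hU : ∀ X ∈ L, X ⊆ U) :
    L.ncard ≤ 2 * U.card := by
  classical
  induction U using Finset.induction_on generalizing L with
  | empty =>
    have : L = ∅ := by
      refine Set.eq_empty_of_forall_notMem fun X hX => ?_
      obtain ⟨v, hv⟩ := hne X hX
      simpa using hU X hX hv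
    simp [this]
  | insert v U hv ih =>
    set T := {X | X ∈ L ∧ v ∈ X ∧ X \ {v} ∈ L} with hT
    set M := L \ ({{v}} ∪ T) with hM
    have hinj : Set.InjOn (fun X : Set V => X \ {v}) M := by
      intro X hX Y hY h
      dsimp only at h
      have key : ∀ {X Y : Set V}, X ∈ M → Y ∈ M → X \ {v} = Y \ {v} → v ∈ X → v ∈ Y := by
        intro X Y hX hY h hvX
        by_contra hvY
        have h' : Y \ {v} = Y := by simp [hvY]
        exact hX.2 (Or.inr ⟨hX.1, hvX, by rw [h, h']; exact hY.1⟩)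
      ext u
      by_cases huv : u = v
      · subst huv
        exact ⟨key hX hY h, key hY hX h.symm⟩
      · simpa [huv] using Set.ext_iff.1 h u
    have h1 : M.ncard ≤ 2 * U.card := by
      rw [← hinj.ncard_image]
      apply ih
      · rintro _ ⟨X, hX, rfl⟩ _ ⟨Y, hY, rfl⟩
        rcases hL X hX.1 Y hY.1 with h | h | h
        · exact Or.inl (Set.sdiff_subset_sdiff_left h)
        · exact Or.inr (Or.inl (Set.sdiff_subset_sdiff_left h))
        · refine Or.inr (Or.inr (Set.eq_empty_of_forall_notMem fun u hu => ?_))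
          exact absurd (show u ∈ X ∩ Y from ⟨hu.1.1, hu.2.1⟩) (by simp [h])
      · rintro _ ⟨X, hX, rfl⟩
        obtain ⟨u, hu⟩ := hne X hX.1
        by_contra hc
        rw [Set.not_nonempty_iff_eq_empty, Set.sdiff_eq_empty] at hc
        exact hX.2 (Or.inl (hc.antisymm (by
          rintro _ rfl
          rw [← Set.mem_singleton_iff.1 (hc hu)]
          exact hu)))
      · rintro _ ⟨X, hX, rfl⟩ u hu
        have := hU X hX.1 hu.1
        simp only [Finset.coe_insert, Set.mem_insert_iff] at this
        exact this.resolve_left hu.2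
    have h2 : L.ncard ≤ M.ncard + ({{v}} ∪ T : Set (Set V)).ncard :=
      (Set.ncard_le_ncard (by rw [hM, Set.sdiff_union_self]; exact Set.subset_union_left)).trans
        (Set.ncard_union_le _ _)
    have h3 : ({{v}} ∪ T : Set (Set V)).ncard ≤ 2 := by
      refine (Set.ncard_union_le _ _).trans ?_
      have : T.ncard ≤ 1 := Set.ncard_le_one_iff_subsingleton.2 (subsingleton_of_laminar hL hne v)
      rw [Set.ncard_singleton]
      omega
    rw [Finset.card_insert_of_notMem hv]
    omega

variable {V ι : Type*} {part : V → ι} {F : Set (Set V)}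

theorem ncard_le_of_laminarizable [Finite V] (hF : NonRedundant part F)
    (h : Laminarizable part F) : F.ncard ≤ 2 * Nat.card V := by
  obtain ⟨L, hcut, hlam, he, -⟩ := h
  have : ∀ X : Set V, ∃ Y, X ∈ F → Y ∈ L ∧ Equivalent part X Y := by
    intro X
    by_cases hX : X ∈ F
    · obtain ⟨Y, hY⟩ := he X hX
      exact ⟨Y, fun _ => hY⟩
    · exact ⟨∅, fun h => absurd h hX⟩
  choose l hl using this
  have h1 : F.ncard ≤ L.ncard := by
    refine Set.ncard_le_ncard_of_injOn l (fun X hX => (hl X hX).1) ?_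
    intro X hX Y hY hXY
    refine hF X hX Y hY ((hl X hX).2.trans ?_)
    rw [hXY]
    exact (hl Y hY).2.symm
  have := Fintype.ofFinite V
  have h2 := ncard_le_of_laminar Finset.univ L hlam (fun X hX => ?_) (fun X _ => by simp)
  · rw [Finset.card_univ, ← Nat.card_eq_fintype_card] at h2
    exact h1.trans h2
  · obtain ⟨p, q, -, ⟨⟨v, hv, -⟩, -⟩, -⟩ := hcut X hX
    exact ⟨v, hv⟩

theorem notCrossingOn_of_laminar {L : Set (Set V)} (hL : Laminar L) {X Y : Set V} (hX : X ∈ L)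
    (hY : Y ∈ L) : ¬ CrossingOn Set.univ X Y := by
  rw [crossing_univ_iff]
  rintro ⟨⟨a, ha⟩, -, ⟨b, hb⟩, ⟨c, hc⟩⟩
  rcases hL X hX Y hY with h | h | h
  · exact hb.2 (h hb.1)
  · exact hc.2 (h hc.1)
  · exact absurd (show a ∈ X ∩ Y from ha) (by simp [h])

/-- The members of a laminar family, oriented as the members of `F` that they are equivalent to. -/
theorem Laminarizable.exists_orient (h : Laminarizable part F) : ∃ l : Set V → Set V,
    (∀ X ∈ F, supp part (l X) = supp part X ∧ ∀ v ∈ supp part X, v ∈ l X ↔ v ∈ X) ∧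
    ∀ X ∈ F, ∀ Y ∈ F, ¬ CrossingOn Set.univ (l X) (l Y) := by
  obtain ⟨L, -, hlam, he, -⟩ := h
  have : ∀ X : Set V, ∃ P, X ∈ F → ∃ Y ∈ L, IsOrient P Y ∧ supp part X = supp part Y ∧
      ∀ v ∈ supp part X, v ∈ P ↔ v ∈ X := by
    intro X
    by_cases hX : X ∈ F
    · obtain ⟨Y, hY, h⟩ := he X hX
      obtain ⟨h1, P, hP, h2⟩ := equivalent_iff.1 h
      exact ⟨P, fun _ => ⟨Y, hY, hP, h1, fun v hv => (h2 v hv).symm⟩⟩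
    · exact ⟨∅, fun h => absurd h hX⟩
  choose l hl using this
  refine ⟨l, fun X hX => ?_, fun X hX Y hY hc => ?_⟩
  · obtain ⟨Y, hY, hP, h1, h2⟩ := hl X hX
    exact ⟨by rw [hP.supp_eq, h1], h2⟩
  · obtain ⟨X', hX', hP, -⟩ := hl X hX
    obtain ⟨Y', hY', hQ, -⟩ := hl Y hY
    exact notCrossingOn_of_laminar hlam hX' hY' (hc.orient hP.symm hQ.symm)

theorem Laminarizable.localModel {l : Set V → Set V}
    (h1 : ∀ X ∈ F, supp part (l X) = supp part X ∧ ∀ v ∈ supp part X, v ∈ l X ↔ v ∈ X)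
    (h2 : ∀ X ∈ F, ∀ Y ∈ F, ¬ CrossingOn Set.univ (l X) (l Y)) : LocalModel part F l :=
  ⟨fun X hX => (h1 X hX).1, fun X hX => (h1 X hX).2,
    fun X hX Y hY hc => h2 X hX Y hY (hc.mono (Set.subset_univ _))⟩

theorem Laminarizable.pairwiseComparable (h : Laminarizable part F) :
    PairwiseComparable part F := by
  obtain ⟨l, h1, h2⟩ := h.exists_orient
  exact (Laminarizable.localModel h1 h2).pairwiseComparable

/-! ### The preprocessed family -/

/-- The member of the preprocessed family that arises from `X`. -/
def extSet (F : Set (Set V)) (X : F) : Set (V ⊕ (F × Bool)) :=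
  Sum.inl '' (X : Set V) ∪ {Sum.inr (X, true)}

theorem extFamily_eq : extFamily F = Set.range (extSet F) := rfl

@[simp] theorem inl_mem_extSet {X : F} {v : V} :
    (Sum.inl v : V ⊕ (F × Bool)) ∈ extSet F X ↔ v ∈ (X : Set V) := by
  simp [extSet]

@[simp] theorem inr_mem_extSet {X Y : F} {b : Bool} :
    (Sum.inr (Y, b) : V ⊕ (F × Bool)) ∈ extSet F X ↔ Y = X ∧ b = true := by
  simp [extSet]

theorem inl_mem_supp_iff {Z : Set (V ⊕ (F × Bool))} {v : V} :
    Sum.inl v ∈ supp (extPart part F) Z ↔ v ∈ supp part (Sum.inl ⁻¹' Z) := by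
  simp [mem_supp_iff, extPart]

theorem inr_mem_supp_iff {Z : Set (V ⊕ (F × Bool))} {Y : F} {b : Bool} :
    Sum.inr (Y, b) ∈ supp (extPart part F) Z ↔
      ¬ (Sum.inr (Y, true) ∈ Z ↔ Sum.inr (Y, false) ∈ Z) := by
  simp only [mem_supp_iff, extPart, Sum.exists, Sum.map_inl, Sum.map_inr, reduceCtorEq, and_false,
    exists_false, false_or, Sum.inr.injEq, Prod.exists, Bool.exists_bool]
  constructor
  · rintro ⟨⟨Y', h1⟩, ⟨Y'', h2⟩⟩
    rcases h1 with ⟨h1, rfl⟩ | ⟨h1, rfl⟩ <;> rcases h2 with ⟨h2, rfl⟩ | ⟨h2, rfl⟩ <;> tauto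
  · intro h
    by_cases h1 : Sum.inr (Y, true) ∈ Z
    · exact ⟨⟨Y, Or.inr ⟨h1, rfl⟩⟩, Y, Or.inl ⟨fun h2 => h ⟨fun _ => h2, fun _ => h1⟩, rfl⟩⟩
    · exact ⟨⟨Y, Or.inl ⟨by tauto, rfl⟩⟩, Y, Or.inr ⟨h1, rfl⟩⟩

theorem preimage_extSet (X : F) : Sum.inl ⁻¹' extSet F X = (X : Set V) := by
  ext v
  simp

@[simp] theorem inl_mem_supp_extSet {X : F} {v : V} :
    Sum.inl v ∈ supp (extPart part F) (extSet F X) ↔ v ∈ supp part (X : Set V) := by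
  rw [inl_mem_supp_iff, preimage_extSet]

@[simp] theorem inr_mem_supp_extSet {X Y : F} {b : Bool} :
    Sum.inr (Y, b) ∈ supp (extPart part F) (extSet F X) ↔ Y = X := by
  simp [inr_mem_supp_iff]

theorem extSet_injective : Function.Injective (extSet F) := by
  intro X Y h
  have : (Sum.inr (X, true) : V ⊕ (F × Bool)) ∈ extSet F Y := by
    rw [← h]
    simp
  simpa using this

theorem separated_extFamily (hF : IsCutFamily part F) :
    Separated (extPart part F) (extFamily F) := by
  constructor
  · rintro _ ⟨X, rfl⟩
    obtain ⟨u, hu, v, hv, h⟩ := isCut_iff.1 (hF X X.2)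
    refine isCut_iff.2 ⟨Sum.inl u, inl_mem_supp_extSet.2 hu, Sum.inl v, inl_mem_supp_extSet.2 hv, ?_⟩
    simpa [extPart] using h
  · rintro _ ⟨X, rfl⟩ _ ⟨Y, rfl⟩ h
    refine ⟨Sum.inr (Y, true), inr_mem_supp_extSet.2 rfl, fun h' => h ?_⟩
    rw [inr_mem_supp_extSet.1 h']

theorem Equivalent.preimage_inl {Z Z' : Set (V ⊕ (F × Bool))}
    (h : Equivalent (extPart part F) Z Z') :
    Equivalent part (Sum.inl ⁻¹' Z) (Sum.inl ⁻¹' Z') := by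
  rw [equivalent_iff] at h ⊢
  obtain ⟨h1, P, hP, h2⟩ := h
  refine ⟨?_, Sum.inl ⁻¹' P, ?_, fun v hv => h2 _ (inl_mem_supp_iff.2 hv)⟩
  · ext v
    rw [← inl_mem_supp_iff, ← inl_mem_supp_iff, h1]
  · rcases hP with rfl | rfl
    · exact .refl _
    · exact (IsOrient.refl _).compl

theorem orient_subset_comm {X Y : Set V} {a b : Bool} (h : orient a X ⊆ orient b Y) :
    orient (!b) Y ⊆ orient (!a) X := by
  intro v hv
  have := @h v
  rw [mem_orient, mem_orient] at this
  rw [mem_orient] at hv ⊢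
  cases a <;> cases b <;> simp_all

/-- A laminar family equivalent to `F` extends to a locally cross-free family equivalent to the
preprocessed family: the new part of `Y` belongs to the side of `X` that contains a side of `Y`. -/
theorem Laminarizable.exists_localModel_ext (hF : IsCutFamily part F) (hn : NonRedundant part F)
    (h : Laminarizable part F) : ∃ g, LocalModel (extPart part F) (extFamily F) g := by
  obtain ⟨l, h1, h2⟩ := h.exists_orient
  let e : F → Set (V ⊕ (F × Bool)) := fun X => {w | Sum.elim (fun v => v ∈ l X)
    (fun p => (p.1 ≠ X ∧ (l p.1 ⊆ l X ∨ (l p.1)ᶜ ⊆ l X)) ∨ (p.1 = X ∧ p.2 = true)) w}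
  have einl : ∀ (X : F) (v : V), Sum.inl v ∈ e X ↔ v ∈ l X := by
    intro X v
    simp [e]
  have einr : ∀ (X Y : F) (b : Bool), Y ≠ X →
      (Sum.inr (Y, b) ∈ e X ↔ (l Y ⊆ l X ∨ (l Y)ᶜ ⊆ l X)) := by
    intro X Y b hYX
    simp [e, hYX]
  have eself : ∀ (X : F) (b : Bool), Sum.inr (X, b) ∈ e X ↔ b = true := by
    intro X b
    simp [e]
  have esupp : ∀ X : F, supp (extPart part F) (e X) = supp (extPart part F) (extSet F X) := by
    intro X
    ext (v | ⟨Y, b⟩)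
    · have : Sum.inl ⁻¹' e X = l X := by
        ext v
        exact einl X v
      rw [inl_mem_supp_iff, this, inl_mem_supp_extSet, (h1 X X.2).1]
    · rw [inr_mem_supp_extSet, inr_mem_supp_iff]
      by_cases hYX : Y = X
      · subst hYX
        simp [eself]
      · simp only [einr X Y _ hYX, hYX, not_true_eq_false]
  have emem : ∀ X : F, ∀ w ∈ supp (extPart part F) (extSet F X), w ∈ e X ↔ w ∈ extSet F X := by
    rintro X (v | ⟨Y, b⟩) hw
    · rw [inl_mem_supp_extSet] at hw
      rw [einl, inl_mem_extSet]
      exact (h1 X X.2).2 v hw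
    · rw [inr_mem_supp_extSet] at hw
      subst hw
      rw [eself, inr_mem_extSet]
      simp
  -- the new part of `X` lies on the side of `Y` that contains a side of `X`
  have key : ∀ (X Y : F) (a b : Bool) (c : Bool), X ≠ Y → orient a (l X) ⊆ orient b (l Y) →
      Sum.inr (X, c) ∈ orient b (e Y) := by
    intro X Y a b c hXY hs
    cases b
    · rw [mem_orient, einr Y X c hXY]
      simp only [Bool.false_eq_true, iff_false, not_or]
      have hd : ∀ a', orient a' (l X) ⊆ l Y → False := by
        intro a' hs'
        replace hs : orient a (l X) ⊆ (l Y)ᶜ := hs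
        rcases eq_or_ne a' a with rfl | haa
        · obtain ⟨⟨p, hp, -⟩, ⟨q, hq, -⟩⟩ := ((hF X X.2).congr (h1 X X.2).1.symm).supp_nonempty.some_mem
          cases a'
          · exact hs hq (hs' hq)
          · exact hs hp (hs' hp)
        · have hor : IsOrient (l X) (l Y) := by
            have : l Y = orient a' (l X) := by
              refine Set.Subset.antisymm (fun v hv => ?_) hs'
              by_contra hv'
              refine hs (a := v) ?_ hv
              rw [mem_orient] at hv' ⊢
              clear h1 h2 hs hs' einl einr eself esupp emem
              cases a <;> cases a' <;> simp_all
            rw [this]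
            exact (isOrient_orient _ _).symm
          have h3 : ∀ Z : F, Equivalent part Z (l Z) := fun Z =>
            equivalent_iff.2 ⟨(h1 Z Z.2).1.symm, _, .refl _, fun v hv => ((h1 Z Z.2).2 v hv).symm⟩
          exact hXY (Subtype.ext (hn X X.2 Y Y.2
            ((h3 X).trans (hor.equivalent.trans (h3 Y).symm))))
      exact ⟨fun h => hd true (by simpa [orient] using h),
        fun h => hd false (by simpa [orient] using h)⟩
    · rw [mem_orient, einr Y X c hXY]
      simp only [iff_true]
      cases a
      · exact Or.inr (by simpa [orient] using hs)
      · exact Or.inl (by simpa [orient] using hs)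
  have hg : ∀ X, Function.extend (extSet F) e (fun _ => ∅) (extSet F X) = e X :=
    fun X => extSet_injective.extend_apply _ _ _
  refine ⟨Function.extend (extSet F) e fun _ => ∅, ?_, ?_, ?_⟩
  · rintro _ ⟨X, rfl⟩
    exact (hg X).symm ▸ esupp X
  · rintro _ ⟨X, rfl⟩ w hw
    exact (hg X).symm ▸ emem X w hw
  · rintro _ ⟨X, rfl⟩ _ ⟨Y, rfl⟩ hc
    change CrossingOn (supp _ (extSet F X) ∪ supp _ (extSet F Y))
      (Function.extend (extSet F) e _ (extSet F X)) (Function.extend (extSet F) e _ (extSet F Y)) at hc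
    rw [hg, hg] at hc
    rcases eq_or_ne X Y with rfl | hXY
    · exact not_crossingOn_self _ _ hc
    obtain ⟨P, Q, hP, hQ, hs⟩ := notCrossingOn_iff.1 (h2 X X.2 Y Y.2)
    obtain ⟨a, rfl⟩ := isOrient_iff.1 hP
    obtain ⟨b, rfl⟩ := isOrient_iff.1 hQ
    have hs' : orient a (l X) ⊆ orient b (l Y) := fun v hv => subOn_iff.1 hs v trivial hv
    refine notCrossingOn_iff.2 ⟨_, _, isOrient_orient a _, isOrient_orient b _, ?_⟩ hc
    rw [subOn_iff]
    rintro (v | ⟨Z, c⟩) hw hwX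
    · rw [mem_orient, einl, ← mem_orient] at hwX ⊢
      exact hs' hwX
    · rcases hw with hw | hw <;> rw [inr_mem_supp_extSet] at hw <;> subst hw
      · exact key _ _ a b c hXY hs'
      · have := key Z X (!b) (!a) c hXY.symm (orient_subset_comm hs')
        rw [mem_orient] at this hwX
        have := hwX.symm.trans this
        cases a <;> simp at this

/-! ### Correctness of every run -/

theorem LocalModel.equivalent {W κ : Type*} {part : W → κ} {E : Set (Set W)}
    {g : Set W → Set W} (hg : LocalModel part E g) {X : Set W} (hX : X ∈ E) :
    Equivalent part X (g X) :=
  equivalent_iff.2 ⟨(hg.supp_eq X hX).symm, g X, .refl _, fun v hv => (hg.mem_iff X hX v hv).symm⟩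

theorem LocalModel.good {W κ : Type*} {part : W → κ} {E : Set (Set W)} {g : Set W → Set W}
    (hE : Separated part E) (hg : LocalModel part E g)
    (hno : ∀ X ∈ E, ∀ Y ∈ E, ∀ Z ∈ E, X ≠ Y → Y ≠ Z → X ≠ Z →
      ¬ IsCyclicTriple part (g X) (g Y) (g Z)) : Good part fun X : E => g X := by
  refine ⟨fun X Y hXY he => ?_, fun X Y => ?_, fun X Y Z h1 h2 h3 => ?_⟩
  · rw [hg.supp_eq X X.2, hg.supp_eq Y Y.2] at he
    obtain ⟨v, hv, hv'⟩ := hE.sep X X.2 Y Y.2 fun h => hXY (Subtype.ext h)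
    rw [he] at hv'
    exact hv' hv
  · rw [hg.supp_eq X X.2, hg.supp_eq Y Y.2]
    exact hg.two X X.2 Y Y.2
  · exact hno X X.2 Y Y.2 Z Z.2 (fun h => h1 (Subtype.ext h)) (fun h => h2 (Subtype.ext h))
      fun h => h3 (Subtype.ext h)

/-- Every output of Algorithm 5 is a good family equivalent to the input. -/
theorem Algorithm5.exists_good {W κ : Type*} {part : W → κ} {E : Set (Set W)}
    (hE : Separated part E) {G : Set (Set W)} (h : Algorithm5 part E (some G)) :
    ∃ f : E → Set W, Set.range f = G ∧ Good part f ∧ ∀ X : E, Equivalent part (X : Set W) (f X) := by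
  cases h with
  | output s h hs hflower =>
    obtain ⟨g, hg⟩ := exists_localModel h
    have hg' := hs.localModel hg.pairwiseComparable
    refine ⟨fun X => relabel part E s X, ?_, hg'.good hE fun X hX Y hY Z hZ h1 h2 h3 =>
      not_isCyclicTriple_of_flower hE hg' hX hY hZ h1 h2 h3 hflower, fun X => hg'.equivalent X.2⟩
    exact (Set.image_eq_range _ _).symm

theorem IsOrient.eq_of_notMem {X Y Z : Set V} {e : V} (hX : IsOrient X Z) (hY : IsOrient Y Z)
    (h1 : e ∉ X) (h2 : e ∉ Y) : X = Y := by
  rcases hX.eq_or_compl hY with h | rfl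
  · exact h
  · exact absurd h2 h1

theorem mem_switchAt {e : V} {G : Set (Set V)} {Z : Set V} :
    Z ∈ switchAt e G ↔ e ∉ Z ∧ ∃ X ∈ G, IsOrient Z X := by
  constructor
  · rintro ⟨X, hX, ⟨h, rfl⟩ | ⟨h, rfl⟩⟩
    · exact ⟨h, Z, hX, .refl _⟩
    · exact ⟨fun h' => h' h, X, hX, (IsOrient.refl _).compl⟩
  · rintro ⟨h, X, hX, rfl | rfl⟩
    · exact ⟨Z, hX, Or.inl ⟨h, rfl⟩⟩
    · exact ⟨X, hX, Or.inr ⟨by simpa using h, rfl⟩⟩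

/-- A cross-free family equivalent to the preprocessed family yields a correct output. -/
theorem solves_of_crossFree (hF : IsCutFamily part F) (hn : NonRedundant part F)
    {f : extFamily F → Set (V ⊕ (F × Bool))}
    (he : ∀ X : extFamily F, Equivalent (extPart part F) (X : Set _) (f X))
    (hc : CrossFree (Set.range f)) (e : V) :
    SolvesLaminarization part F (some (switchAt e (restrict (Set.range f)))) := by
  set h : F → Set V := fun X => Sum.inl ⁻¹' f ⟨extSet F X, X, rfl⟩ with hh
  have hr : restrict (Set.range f) = Set.range h := by
    ext Z
    constructor
    · rintro ⟨_, ⟨⟨_, X, rfl⟩, rfl⟩, rfl⟩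
      exact ⟨X, rfl⟩
    · rintro ⟨X, rfl⟩
      exact ⟨_, ⟨⟨extSet F X, X, rfl⟩, rfl⟩, rfl⟩
  have hE : ∀ X : F, Equivalent part (X : Set V) (h X) := by
    intro X
    have := (he ⟨extSet F X, X, rfl⟩).preimage_inl
    rwa [preimage_extSet] at this
  rw [hr]
  refine ⟨?_, ?_, ?_, ?_, ?_⟩
  · intro Z hZ
    obtain ⟨-, _, ⟨X, rfl⟩, hZ⟩ := mem_switchAt.1 hZ
    exact (hF X X.2).congr (by rw [hZ.supp_eq, (hE X).supp_eq])
  · intro Z hZ Z' hZ' hZZ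
    obtain ⟨he1, _, ⟨X, rfl⟩, h1⟩ := mem_switchAt.1 hZ
    obtain ⟨he2, _, ⟨Y, rfl⟩, h2⟩ := mem_switchAt.1 hZ'
    have : X = Y := Subtype.ext (hn X X.2 Y Y.2 ((hE X).trans (h1.equivalent.symm.trans
      (hZZ.trans (h2.equivalent.trans (hE Y).symm)))))
    subst this
    exact h1.eq_of_notMem h2 he1 he2
  · intro Z hZ Z' hZ'
    obtain ⟨he1, _, ⟨X, rfl⟩, h1⟩ := mem_switchAt.1 hZ
    obtain ⟨he2, _, ⟨Y, rfl⟩, h2⟩ := mem_switchAt.1 hZ'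
    by_contra hcon
    push Not at hcon
    obtain ⟨h3, h4, h5⟩ := hcon
    obtain ⟨a, ha⟩ := Set.not_subset.1 h3
    obtain ⟨b, hb⟩ := Set.not_subset.1 h4
    obtain ⟨c, hc'⟩ := h5
    have hcr : CrossingOn Set.univ Z Z' :=
      crossing_univ_iff.2 ⟨⟨c, hc'⟩, ⟨e, he1, he2⟩, ⟨a, ha⟩, ⟨b, hb⟩⟩
    have := crossing_univ_iff.1 (hcr.orient h1.symm h2.symm)
    obtain ⟨⟨a, ha⟩, ⟨b, hb⟩, ⟨c, hc'⟩, ⟨d, hd⟩⟩ := this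
    exact hc _ ⟨_, rfl⟩ _ ⟨_, rfl⟩ (crossing_univ_iff.2
      ⟨⟨Sum.inl a, ha⟩, ⟨Sum.inl b, hb⟩, ⟨Sum.inl c, hc'⟩, ⟨Sum.inl d, hd⟩⟩)
  · intro X hX
    obtain ⟨P, hP, heP⟩ : ∃ P, IsOrient P (h ⟨X, hX⟩) ∧ e ∉ P := by
      by_cases hx : e ∈ h ⟨X, hX⟩
      · exact ⟨_, (IsOrient.refl _).compl, fun h => h hx⟩
      · exact ⟨_, .refl _, hx⟩
    exact ⟨P, mem_switchAt.2 ⟨heP, _, ⟨_, rfl⟩, hP⟩, (hE ⟨X, hX⟩).trans hP.equivalent.symm⟩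
  · intro Z hZ
    obtain ⟨-, _, ⟨X, rfl⟩, hZ⟩ := mem_switchAt.1 hZ
    exact ⟨X, X.2, (hE X).trans hZ.equivalent.symm⟩

theorem Run.solves [Finite V] (hF : IsCutFamily part F) (hn : NonRedundant part F)
    {out : Option (Set (Set V))} (h : Run part F out) : SolvesLaminarization part F out := by
  have := Fintype.ofFinite (extFamily F)
  cases h with
  | tooMany h => exact fun hl => absurd (ncard_le_of_laminarizable hn hl) (by omega)
  | incomparable h => exact fun hl => h hl.pairwiseComparable
  | noLabeling _ _ h5 =>
    intro hl
    obtain ⟨g, hg⟩ := hl.exists_localModel_ext hF hn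
    cases h5 with
    | reject h => exact h (hg.exists_twoLocally (separated_extFamily hF).cut)
  | success _ _ G G' h5 h4 e =>
    obtain ⟨f, rfl, hf, he⟩ := h5.exists_good (separated_extFamily hF)
    obtain ⟨f', rfl, -, he'⟩ := hf.reflTransGen h4.1
    exact solves_of_crossFree hF hn (fun X => (he X).trans (he' X)) h4.2 e

theorem algorithm4StopsWithin_of_algorithm5 [Finite V] (hF : IsCutFamily part F)
    (hcard : F.ncard ≤ 2 * Nat.card V) {G : Set (Set (V ⊕ (F × Bool)))}
    (h : Algorithm5 (extPart part F) (extFamily F) (some G)) :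
    Algorithm4StopsWithin (extPart part F) G (4 * Nat.card V ^ 2) := by
  have := Fintype.ofFinite (extFamily F)
  obtain ⟨f, rfl, hf, -⟩ := h.exists_good (separated_extFamily hF)
  have h1 : Fintype.card (extFamily F) ≤ 2 * Nat.card V := by
    refine le_trans ?_ hcard
    rw [← Nat.card_eq_fintype_card, ← Nat.card_coe_set_eq]
    exact Finite.card_range_le (extSet F)
  obtain ⟨h2, h3⟩ := hf.algorithm4StopsWithin
  refine ⟨fun k H h0 hs => (h2 k H h0 hs).trans ?_, h3⟩
  calc _ ≤ (2 * Nat.card V) * (2 * Nat.card V) := Nat.mul_le_mul h1 h1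
    _ = _ := by ring

end CutFamily

namespace RAM

/-! ### A structured language that compiles to the machine -/

/-- Formulas with bounded quantifiers. `ex b φ` says that `φ` holds for some value less than the
contents of the register `b`; at nesting depth `d`, the bound variable is the register
`101 + 2 * d`. -/
inductive Fml where
  | test (b : Test)
  | neg (φ : Fml)
  | and (φ ψ : Fml)
  | ex (b : ℕ) (φ : Fml)

/-- The truth of a formula at nesting depth `d`. -/
def Fml.Holds : ℕ → Store → Fml → Prop
  | _, σ, test b => b.Holds σ
  | d, σ, neg φ => ¬ Fml.Holds d σ φ
  | d, σ, and φ ψ => Fml.Holds d σ φ ∧ Fml.Holds d σ ψ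
  | d, σ, ex b φ => ∃ k < σ.reg b, Fml.Holds (d + 1) (σ.setReg (101 + 2 * d) k) φ

/-- A program that sets the register `100 + 2 * d` to the truth value of the formula. -/
def Fml.compile : ℕ → Fml → Prog
  | d, test b => .ite b (.assign (100 + 2 * d) (.const 1)) (.assign (100 + 2 * d) (.const 0))
  | d, neg φ => .seq (φ.compile d) (.ite (.eq (.reg (100 + 2 * d)) (.const 1))
      (.assign (100 + 2 * d) (.const 0)) (.assign (100 + 2 * d) (.const 1)))
  | d, and φ ψ => .seq (φ.compile d)
      (.ite (.eq (.reg (100 + 2 * d)) (.const 1)) (ψ.compile d) .skip)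
  | d, ex b φ => .seq (.assign (100 + 2 * d) (.const 0)) (.seq (.assign (101 + 2 * d) (.const 0))
      (.loop (.lt (.reg (101 + 2 * d)) (.reg b)) (.seq (φ.compile (d + 1))
        (.seq (.ite (.eq (.reg (102 + 2 * d)) (.const 1))
          (.assign (100 + 2 * d) (.const 1)) .skip)
          (.assign (101 + 2 * d) (.succ (.reg (101 + 2 * d))))))))

/-- The registers that a formula at nesting depth `d` may mention: those below `100` and the
variables of the enclosing quantifiers. -/
def visible (d x : ℕ) : Bool := x < 100 || (x < 100 + 2 * d && x % 2 == 1)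

/-- The registers that may serve as bounds of loops and quantifiers. -/
def isBound (b : ℕ) : Bool := b == 3 || b == 4 || b == 5

/-- All registers that occur in the expression are visible at depth `d`. -/
def Expr.wf (d : ℕ) : Expr → Bool
  | const _ => true
  | reg x => visible d x
  | cell _ i j => i.wf d && j.wf d
  | succ e => e.wf d
  | pred e => e.wf d

/-- All registers that occur in the test are visible at depth `d`. -/
def Test.wf (d : ℕ) : Test → Bool
  | eq e f => e.wf d && f.wf d
  | lt e f => e.wf d && f.wf d

/-- All registers that occur in the formula are visible, and all bounds are admissible. -/
def Fml.wf : ℕ → Fml → Bool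
  | d, test b => b.wf d
  | d, neg φ => φ.wf d
  | d, and φ ψ => φ.wf d && ψ.wf d
  | d, ex b φ => isBound b && φ.wf (d + 1)

/-- The nesting depth of the quantifiers. -/
def Fml.deg : Fml → ℕ
  | test _ => 0
  | neg φ => φ.deg
  | and φ ψ => max φ.deg ψ.deg
  | ex _ φ => φ.deg + 1

/-- The constant in the bound `const * N ^ deg` for the evaluation time. -/
def Fml.coeff : Fml → ℕ
  | test b => b.cost + 2
  | neg φ => φ.coeff + 5
  | and φ ψ => φ.coeff + ψ.coeff + 4
  | ex _ φ => φ.coeff + 18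

/-- The two memories agree on the registers that are visible at depth `d` and on all arrays. -/
structure Agree (d : ℕ) (σ τ : Store) : Prop where
  reg : ∀ x, visible d x = true → σ.reg x = τ.reg x
  arr : σ.arr = τ.arr

/-- The contents of the bound registers are at most `N`. -/
def Bounded (N : ℕ) (σ : Store) : Prop := ∀ b, isBound b = true → σ.reg b ≤ N

@[simp] theorem setReg_reg (σ : Store) (x k y : ℕ) :
    (σ.setReg x k).reg y = if y = x then k else σ.reg y := by
  simp [Store.setReg, Function.update_apply]

@[simp] theorem setReg_arr (σ : Store) (x k : ℕ) : (σ.setReg x k).arr = σ.arr := rfl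

@[simp] theorem setCell_reg (σ : Store) (a i j k : ℕ) : (σ.setCell a i j k).reg = σ.reg := rfl

@[simp] theorem setCell_arr (σ : Store) (a i j k a' i' j' : ℕ) :
    (σ.setCell a i j k).arr a' i' j' =
      if a' = a ∧ i' = i ∧ j' = j then k else σ.arr a' i' j' := by
  simp only [Store.setCell, Function.update_apply]
  by_cases ha : a' = a
  · subst ha
    by_cases hi : i' = i
    · subst hi
      by_cases hj : j' = j <;> simp [hj]
    · simp [hi]
  · simp [ha]

theorem isBound_lt {b : ℕ} (h : isBound b = true) : b < 100 := by
  simp [isBound] at h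
  omega

theorem visible_of_lt {d x : ℕ} (h : x < 100) : visible d x = true := by
  simp [visible, h]

theorem visible_succ {d x : ℕ} : visible (d + 1) x = true ↔ visible d x = true ∨ x = 101 + 2 * d := by
  simp only [visible, Bool.or_eq_true, Bool.and_eq_true, decide_eq_true_eq, beq_iff_eq]
  omega

theorem Agree.trans {d : ℕ} {σ τ υ : Store} (h : Agree d σ τ) (h' : Agree d τ υ) :
    Agree d σ υ :=
  ⟨fun x hx => (h.reg x hx).trans (h'.reg x hx), h.arr.trans h'.arr⟩

theorem Expr.val_congr {d : ℕ} {σ τ : Store} (h : Agree d σ τ) {e : Expr} (he : e.wf d = true) :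
    e.val σ = e.val τ := by
  induction e with
  | const k => rfl
  | reg x => exact h.reg x he
  | cell a i j ihi ihj =>
    simp only [Expr.wf, Bool.and_eq_true] at he
    simp only [Expr.val, ihi he.1, ihj he.2, h.arr]
  | succ e ih => simp only [Expr.val, ih he]
  | pred e ih => simp only [Expr.val, ih he]

theorem Test.holds_congr {d : ℕ} {σ τ : Store} (h : Agree d σ τ) {b : Test} (hb : b.wf d = true) :
    b.Holds σ ↔ b.Holds τ := by
  cases b <;> simp only [Test.wf, Bool.and_eq_true] at hb <;>
    simp only [Test.Holds, Expr.val_congr h hb.1, Expr.val_congr h hb.2]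

/-- A loop that is controlled by a counter. -/
theorem exec_loop {b : Test} {P : Prog} (I : ℕ → Store → Prop) {M c : ℕ}
    (hb : ∀ k τ, I k τ → (b.Holds τ ↔ k < M))
    (hP : ∀ k τ, k < M → I k τ → ∃ υ t, Exec P τ υ t ∧ t ≤ c ∧ I (k + 1) υ) {σ : Store}
    (h0 : I 0 σ) :
    ∃ τ t, Exec (.loop b P) σ τ t ∧ t ≤ M * (b.cost + c) + b.cost ∧ I M τ := by
  have key : ∀ j k σ, k + j = M → I k σ →
      ∃ τ t, Exec (.loop b P) σ τ t ∧ t ≤ j * (b.cost + c) + b.cost ∧ I M τ := by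
    intro j
    induction j with
    | zero =>
      intro k σ hk hI
      obtain rfl : k = M := by omega
      exact ⟨σ, _, .loopDone (by rw [hb _ _ hI]; omega), by omega, hI⟩
    | succ j ih =>
      intro k σ hk hI
      obtain ⟨υ, t, h1, h2, h3⟩ := hP k σ (by omega) hI
      obtain ⟨τ, u, h4, h5, h6⟩ := ih (k + 1) υ (by omega) h3
      refine ⟨τ, _, .loopStep ((hb _ _ hI).2 (by omega)) h1 h4, ?_, h6⟩
      rw [Nat.succ_mul]
      omega
  exact key M 0 σ (by omega) h0

theorem mul_pow_max {K L d e N : ℕ} (hN : 1 ≤ N) :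
    K * N ^ d + L * N ^ e ≤ (K + L) * N ^ max d e := by
  rw [add_mul]
  exact add_le_add (Nat.mul_le_mul_left _ (Nat.pow_le_pow_right hN (le_max_left _ _)))
    (Nat.mul_le_mul_left _ (Nat.pow_le_pow_right hN (le_max_right _ _)))

theorem le_mul_pow {N d K : ℕ} (hN : 1 ≤ N) : K ≤ K * N ^ d :=
  Nat.le_mul_of_pos_right _ (Nat.pow_pos hN)

open Classical in
/-- The compiled formula evaluates the formula and changes only registers of its own depth. -/
theorem Fml.exec_compile {N : ℕ} (hN : 1 ≤ N) (φ : Fml) : ∀ (d : ℕ) (σ σ' : Store),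
    φ.wf d = true → Agree d σ σ' → Bounded N σ →
    ∃ τ t, Exec (φ.compile d) σ' τ t ∧ t ≤ φ.coeff * N ^ φ.deg ∧ τ.arr = σ'.arr ∧
      (∀ x < 100 + 2 * d, τ.reg x = σ'.reg x) ∧
      τ.reg (100 + 2 * d) = if φ.Holds d σ then 1 else 0 := by
  induction φ with
  | test b =>
    intro d σ σ' hw ha _
    have hb := Test.holds_congr ha hw
    by_cases h : b.Holds σ
    · refine ⟨_, _, .iteTrue (hb.1 h) (.assign _ _ _), ?_, rfl, ?_, ?_⟩
      · simp [Fml.coeff, Fml.deg, Expr.cost]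
      · intro x hx
        simp [hx.ne]
      · simp [Expr.val, Fml.Holds, h]
    · refine ⟨_, _, .iteFalse (fun h' => h (hb.2 h')) (.assign _ _ _), ?_, rfl, ?_, ?_⟩
      · simp [Fml.coeff, Fml.deg, Expr.cost]
      · intro x hx
        simp [hx.ne]
      · simp [Expr.val, Fml.Holds, h]
  | neg φ ih =>
    intro d σ σ' hw ha hbd
    obtain ⟨τ, t, h1, h2, h3, h4, h5⟩ := ih d σ σ' hw ha hbd
    have hc : t + (3 + 2) ≤ (Fml.neg φ).coeff * N ^ (Fml.neg φ).deg := by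
      simp only [Fml.coeff, Fml.deg, add_mul]
      have := @le_mul_pow N φ.deg 5 hN
      omega
    by_cases h : φ.Holds d σ
    · refine ⟨_, _, .seq h1 (.iteTrue ?_ (.assign _ _ _)), hc, h3, ?_, ?_⟩
      · simp [Test.Holds, Expr.val, h5, h]
      · intro x hx
        simp [hx.ne, h4 x hx]
      · simp [Expr.val, Fml.Holds, h]
    · refine ⟨_, _, .seq h1 (.iteFalse ?_ (.assign _ _ _)), hc, h3, ?_, ?_⟩
      · simp [Test.Holds, Expr.val, h5, h]
      · intro x hx
        simp [hx.ne, h4 x hx]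
      · simp [Expr.val, Fml.Holds, h]
  | and φ ψ ih1 ih2 =>
    intro d σ σ' hw ha hbd
    simp only [Fml.wf, Bool.and_eq_true] at hw
    obtain ⟨τ, t, h1, h2, h3, h4, h5⟩ := ih1 d σ σ' hw.1 ha hbd
    have ha' : Agree d σ τ := ha.trans ⟨fun x hx => by
      refine (h4 x ?_).symm
      simp only [visible, Bool.or_eq_true, Bool.and_eq_true, decide_eq_true_eq] at hx
      omega, h3.symm⟩
    have hm := @mul_pow_max φ.coeff ψ.coeff φ.deg ψ.deg N hN
    have hk := @le_mul_pow N (max φ.deg ψ.deg) 4 hN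
    by_cases h : φ.Holds d σ
    · obtain ⟨υ, u, g1, g2, g3, g4, g5⟩ := ih2 d σ τ hw.2 ha' hbd
      refine ⟨υ, _, .seq h1 (.iteTrue (by simp [Test.Holds, Expr.val, h5, h]) g1), ?_,
        g3.trans h3, fun x hx => (g4 x hx).trans (h4 x hx), ?_⟩
      · simp only [Fml.coeff, Fml.deg, Test.cost, Expr.cost, add_mul] at *
        omega
      · simp [g5, Fml.Holds, h]
    · refine ⟨τ, _, .seq h1 (.iteFalse (by simp [Test.Holds, Expr.val, h5, h]) (.skip _)), ?_,
        h3, h4, ?_⟩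
      · simp only [Fml.coeff, Fml.deg, Test.cost, Expr.cost, add_mul] at *
        omega
      · simp [h5, Fml.Holds, h]
  | ex b φ ih =>
    intro d σ σ' hw ha hbd
    simp only [Fml.wf, Bool.and_eq_true] at hw
    have hb : b < 100 := isBound_lt hw.1
    have hbσ : σ'.reg b = σ.reg b := (ha.reg b (visible_of_lt hb)).symm
    let I : ℕ → Store → Prop := fun k τ => τ.arr = σ'.arr ∧
      (∀ x < 100 + 2 * d, τ.reg x = σ'.reg x) ∧ τ.reg (101 + 2 * d) = k ∧
      τ.reg (100 + 2 * d) =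
        if ∃ j < k, Fml.Holds (d + 1) (σ.setReg (101 + 2 * d) j) φ then 1 else 0
    obtain ⟨τ, t, h1, h2, h3⟩ := exec_loop (b := .lt (.reg (101 + 2 * d)) (.reg b))
      (P := .seq (φ.compile (d + 1)) (.seq (.ite (.eq (.reg (102 + 2 * d)) (.const 1))
          (.assign (100 + 2 * d) (.const 1)) .skip)
          (.assign (101 + 2 * d) (.succ (.reg (101 + 2 * d)))))) I (M := σ.reg b)
      (c := φ.coeff * N ^ φ.deg + 8)
      (σ := (σ'.setReg (100 + 2 * d) 0).setReg (101 + 2 * d) 0) (by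
        rintro k τ ⟨-, h1, h2, -⟩
        simp only [Test.Holds, Expr.val, h2, h1 b (by omega), hbσ]) (by
        rintro k τ hk ⟨h1, h2, h3, h4⟩
        have hag : Agree (d + 1) (σ.setReg (101 + 2 * d) k) τ := by
          refine ⟨fun x hx => ?_, by rw [setReg_arr, ha.arr, h1]⟩
          rw [visible_succ] at hx
          by_cases hx' : x = 101 + 2 * d
          · simp [hx', h3]
          · have hv := hx.resolve_right hx'
            have hlt : x < 100 + 2 * d := by
              simp only [visible, Bool.or_eq_true, Bool.and_eq_true, decide_eq_true_eq] at hv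
              omega
            simp [hx', ha.reg x hv, h2 x hlt]
        have hbd' : Bounded N (σ.setReg (101 + 2 * d) k) := by
          intro b hb
          have := isBound_lt hb
          rw [setReg_reg, if_neg (by omega)]
          exact hbd b hb
        obtain ⟨υ, t, g1, g2, g3, g4, g5⟩ := ih (d + 1) _ τ hw.2 hag hbd'
        have e1 : 100 + 2 * (d + 1) = 102 + 2 * d := by omega
        rw [e1] at g4 g5
        by_cases hh : Fml.Holds (d + 1) (σ.setReg (101 + 2 * d) k) φ
        · refine ⟨_, _, .seq g1 (.seq (.iteTrue (by simp [Test.Holds, Expr.val, g5, hh])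
            (.assign _ _ _)) (.assign _ _ _)), ?_, ?_, ?_, ?_, ?_⟩
          · simp only [Test.cost, Expr.cost]
            omega
          · rw [setReg_arr, setReg_arr, g3, h1]
          · intro x hx
            simp only [setReg_reg]
            rw [if_neg (by omega), if_neg (by omega), g4 x (by omega), h2 x hx]
          · simp [Expr.val, g4, h3]
          · simp only [setReg_reg, Expr.val]
            rw [if_neg (by omega), if_pos trivial, if_pos ⟨k, by omega, hh⟩]
        · refine ⟨_, _, .seq g1 (.seq (.iteFalse (by simp [Test.Holds, Expr.val, g5, hh])
            (.skip _)) (.assign _ _ _)), ?_, ?_, ?_, ?_, ?_⟩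
          · simp only [Test.cost, Expr.cost]
            omega
          · rw [setReg_arr, g3, h1]
          · intro x hx
            simp only [setReg_reg]
            rw [if_neg (by omega), g4 x (by omega), h2 x hx]
          · simp [Expr.val, g4, h3]
          · simp only [setReg_reg]
            rw [if_neg (by omega), g4 _ (by omega), h4]
            have : (∃ j < k + 1, Fml.Holds (d + 1) (σ.setReg (101 + 2 * d) j) φ) ↔
                ∃ j < k, Fml.Holds (d + 1) (σ.setReg (101 + 2 * d) j) φ := by
              constructor
              · rintro ⟨j, hj, hj'⟩
                refine ⟨j, lt_of_le_of_ne (by omega) ?_, hj'⟩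
                rintro rfl
                exact hh hj'
              · rintro ⟨j, hj, hj'⟩
                exact ⟨j, by omega, hj'⟩
            simp only [this]) ⟨rfl, fun x hx => by
              simp only [setReg_reg]
              rw [if_neg (by omega), if_neg (by omega)], by simp, by simp⟩
    obtain ⟨g1, g2, -, g4⟩ := h3
    refine ⟨τ, _, .seq (.assign _ _ _) (.seq (.assign _ _ _) h1), ?_, g1, g2, by convert g4; exact Iff.rfl⟩
    have hM : σ.reg b ≤ N := hbd b hw.1
    simp only [Fml.coeff, Fml.deg, Test.cost, Expr.cost] at *
    have h5 : σ.reg b * (1 + 1 + 1 + (φ.coeff * N ^ φ.deg + 8)) ≤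
        N * (φ.coeff * N ^ φ.deg + 11) := Nat.mul_le_mul hM (by omega)
    have h6 : N * (φ.coeff * N ^ φ.deg + 11) + 7 ≤ (φ.coeff + 18) * N ^ (φ.deg + 1) := by
      have : N ≤ N ^ (φ.deg + 1) := Nat.le_self_pow (by omega) N
      calc _ = φ.coeff * N ^ (φ.deg + 1) + (11 * N + 7) := by ring
        _ ≤ φ.coeff * N ^ (φ.deg + 1) + 18 * N ^ (φ.deg + 1) := by omega
        _ = _ := by ring
    omega

/-- Structured programs: `forLt x b P` runs `P` for each value of the register `x` that is less than
the contents of the register `b`. -/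
inductive HProg where
  | skip
  | set (x : ℕ) (e : Expr)
  | put (a : ℕ) (i j e : Expr)
  | seq (P Q : HProg)
  | ite (φ : Fml) (P Q : HProg)
  | forLt (x b : ℕ) (P : HProg)

/-- The effect of the first `k` passes of a loop with the counter `x` and the body `f`. -/
def forRun (f : Store → Store) (x : ℕ) (σ : Store) : ℕ → Store
  | 0 => σ.setReg x 0
  | k + 1 => (f (forRun f x σ k)).setReg x (k + 1)

open Classical in
/-- The effect of a structured program. -/
noncomputable def HProg.run : HProg → Store → Store
  | skip, σ => σ
  | set x e, σ => σ.setReg x (e.val σ)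
  | put a i j e, σ => σ.setCell a (i.val σ) (j.val σ) (e.val σ)
  | seq P Q, σ => Q.run (P.run σ)
  | ite φ P Q, σ => if φ.Holds 0 σ then P.run σ else Q.run σ
  | .forLt x b P, σ => forRun P.run x σ (σ.reg b)

/-- The machine program for a structured program. -/
def HProg.compile : HProg → Prog
  | skip => .skip
  | set x e => .assign x e
  | put a i j e => .store a i j e
  | seq P Q => .seq P.compile Q.compile
  | ite φ P Q => .seq (φ.compile 0) (.ite (.eq (.reg 100) (.const 1)) P.compile Q.compile)
  | .forLt x b P => .seq (.assign x (.const 0))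
      (.loop (.lt (.reg x) (.reg b)) (.seq P.compile (.assign x (.succ (.reg x)))))

/-- The program assigns to the register `x`. -/
def HProg.writesReg (x : ℕ) : HProg → Bool
  | skip => false
  | set y _ => x == y
  | put _ _ _ _ => false
  | seq P Q => P.writesReg x || Q.writesReg x
  | ite _ P Q => P.writesReg x || Q.writesReg x
  | .forLt y _ P => x == y || P.writesReg x

/-- The program stores into the array `a`. -/
def HProg.writesArr (a : ℕ) : HProg → Bool
  | skip => false
  | set _ _ => false
  | put b _ _ _ => a == b
  | seq P Q => P.writesArr a || Q.writesArr a
  | ite _ P Q => P.writesArr a || Q.writesArr a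
  | .forLt _ _ P => P.writesArr a

/-- The program uses only registers below `100`, leaves the bound registers alone, and does not
interfere with the counters of its loops. -/
def HProg.wf : HProg → Bool
  | skip => true
  | set x e => x < 100 && !isBound x && e.wf 0
  | put _ i j e => i.wf 0 && j.wf 0 && e.wf 0
  | seq P Q => P.wf && Q.wf
  | ite φ P Q => φ.wf 0 && P.wf && Q.wf
  | .forLt x b P => x < 100 && !isBound x && isBound b && P.wf && !P.writesReg x

/-- The nesting depth of loops and quantifiers. -/
def HProg.deg : HProg → ℕ
  | skip => 0
  | set _ _ => 0
  | put _ _ _ _ => 0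
  | seq P Q => max P.deg Q.deg
  | ite φ P Q => max φ.deg (max P.deg Q.deg)
  | .forLt _ _ P => P.deg + 1

/-- The constant in the bound `const * N ^ deg` for the running time. -/
def HProg.coeff : HProg → ℕ
  | skip => 1
  | set _ e => e.cost + 1
  | put _ i j e => i.cost + j.cost + e.cost + 1
  | seq P Q => P.coeff + Q.coeff
  | ite φ P Q => (φ.coeff + 3) + (P.coeff + Q.coeff)
  | .forLt _ _ P => P.coeff + 11

theorem HProg.run_reg {P : HProg} {x : ℕ} (h : P.writesReg x = false) (σ : Store) :
    (P.run σ).reg x = σ.reg x := by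
  induction P generalizing σ with
  | skip => rfl
  | set y e =>
    simp only [HProg.writesReg, beq_eq_false_iff_ne] at h
    simp [HProg.run, h]
  | put a i j e => rfl
  | seq P Q ih1 ih2 =>
    simp only [HProg.writesReg, Bool.or_eq_false_iff] at h
    rw [HProg.run, ih2 h.2, ih1 h.1]
  | ite φ P Q ih1 ih2 =>
    simp only [HProg.writesReg, Bool.or_eq_false_iff] at h
    rw [HProg.run]
    split_ifs
    · exact ih1 h.1 σ
    · exact ih2 h.2 σ
  | forLt y b P ih =>
    simp only [HProg.writesReg, Bool.or_eq_false_iff, beq_eq_false_iff_ne] at h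
    rw [HProg.run]
    have : ∀ k, (forRun P.run y σ k).reg x = σ.reg x := by
      intro k
      induction k with
      | zero => simp [forRun, h.1]
      | succ k ihk => simp [forRun, h.1, ih h.2, ihk]
    exact this _

theorem HProg.run_arr {P : HProg} {a : ℕ} (h : P.writesArr a = false) (σ : Store) :
    (P.run σ).arr a = σ.arr a := by
  induction P generalizing σ with
  | skip => rfl
  | set y e => rfl
  | put b i j e =>
    simp only [HProg.writesArr, beq_eq_false_iff_ne] at h
    simp [HProg.run, Store.setCell, h]
  | seq P Q ih1 ih2 =>
    simp only [HProg.writesArr, Bool.or_eq_false_iff] at h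
    rw [HProg.run, ih2 h.2, ih1 h.1]
  | ite φ P Q ih1 ih2 =>
    simp only [HProg.writesArr, Bool.or_eq_false_iff] at h
    rw [HProg.run]
    split_ifs
    · exact ih1 h.1 σ
    · exact ih2 h.2 σ
  | forLt y b P ih =>
    rw [HProg.run]
    have : ∀ k, (forRun P.run y σ k).arr a = σ.arr a := by
      intro k
      induction k with
      | zero => rfl
      | succ k ihk => simp [forRun, ih h, ihk]
    exact this _

theorem HProg.writesReg_of_isBound {P : HProg} (hw : P.wf = true) {b : ℕ}
    (hb : isBound b = true) : P.writesReg b = false := by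
  induction P with
  | skip => rfl
  | set y e =>
    simp only [HProg.wf, Bool.and_eq_true, Bool.not_eq_true'] at hw
    simp only [HProg.writesReg, beq_eq_false_iff_ne]
    rintro rfl
    simp [hb] at hw
  | put a i j e => rfl
  | seq P Q ih1 ih2 =>
    simp only [HProg.wf, Bool.and_eq_true] at hw
    simp [HProg.writesReg, ih1 hw.1, ih2 hw.2]
  | ite φ P Q ih1 ih2 =>
    simp only [HProg.wf, Bool.and_eq_true] at hw
    simp [HProg.writesReg, ih1 hw.1.2, ih2 hw.2]
  | forLt y c P ih =>
    simp only [HProg.wf, Bool.and_eq_true, Bool.not_eq_true'] at hw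
    simp only [HProg.writesReg, ih hw.1.2, Bool.or_false, beq_eq_false_iff_ne]
    rintro rfl
    simp [hb] at hw

theorem HProg.run_bounded {P : HProg} (hw : P.wf = true) {N : ℕ} {σ : Store}
    (h : Bounded N σ) : Bounded N (P.run σ) := fun b hb => by
  rw [HProg.run_reg (HProg.writesReg_of_isBound hw hb)]
  exact h b hb

theorem Agree.setReg {σ τ : Store} (h : Agree 0 σ τ) (x k : ℕ) :
    Agree 0 (σ.setReg x k) (τ.setReg x k) := by
  refine ⟨fun y hy => ?_, h.arr⟩
  simp only [setReg_reg]
  split_ifs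
  · rfl
  · exact h.reg y hy

/-- The compiled program computes the effect of the structured program, up to the registers from
`100` on, in time `O(N ^ deg)`. -/
theorem HProg.exec_compile {N : ℕ} (hN : 1 ≤ N) (P : HProg) : ∀ σ σ' : Store, P.wf = true →
    Agree 0 σ σ' → Bounded N σ → ∃ τ t, Exec P.compile σ' τ t ∧ t ≤ P.coeff * N ^ P.deg ∧
      Agree 0 (P.run σ) τ := by
  induction P with
  | skip => exact fun σ σ' _ ha _ => ⟨σ', _, .skip _, by simp [HProg.coeff, HProg.deg], ha⟩
  | set x e =>
    intro σ σ' hw ha _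
    simp only [HProg.wf, Bool.and_eq_true] at hw
    refine ⟨_, _, .assign _ _ _, by simp [HProg.coeff, HProg.deg], ?_⟩
    rw [HProg.run, Expr.val_congr ha hw.2]
    exact ha.setReg _ _
  | put a i j e =>
    intro σ σ' hw ha _
    simp only [HProg.wf, Bool.and_eq_true] at hw
    refine ⟨_, _, .store _ _ _ _ _, by simp [HProg.coeff, HProg.deg], ?_⟩
    rw [HProg.run, Expr.val_congr ha hw.1.1, Expr.val_congr ha hw.1.2, Expr.val_congr ha hw.2]
    exact ⟨ha.reg, by simp only [Store.setCell, ha.arr]⟩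
  | seq P Q ih1 ih2 =>
    intro σ σ' hw ha hbd
    simp only [HProg.wf, Bool.and_eq_true] at hw
    obtain ⟨τ, t, h1, h2, h3⟩ := ih1 σ σ' hw.1 ha hbd
    obtain ⟨υ, u, h4, h5, h6⟩ := ih2 _ τ hw.2 h3 (HProg.run_bounded hw.1 hbd)
    refine ⟨υ, _, .seq h1 h4, ?_, h6⟩
    have := @mul_pow_max P.coeff Q.coeff P.deg Q.deg N hN
    simp only [HProg.coeff, HProg.deg]
    omega
  | ite φ P Q ih1 ih2 =>
    intro σ σ' hw ha hbd
    simp only [HProg.wf, Bool.and_eq_true] at hw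
    obtain ⟨τ, t, h1, h2, h3, h4, h5⟩ := φ.exec_compile hN 0 σ σ' hw.1.1 ha hbd
    have ha' : Agree 0 σ τ := ha.trans ⟨fun x hx => by
      refine (h4 x ?_).symm
      simp only [visible, Bool.or_eq_true, Bool.and_eq_true, decide_eq_true_eq] at hx
      omega, h3.symm⟩
    have hm := @mul_pow_max P.coeff Q.coeff P.deg Q.deg N hN
    have hm' := @mul_pow_max (φ.coeff + 3) (P.coeff + Q.coeff) φ.deg (max P.deg Q.deg) N hN
    have hk := @le_mul_pow N φ.deg 3 hN
    rw [add_mul φ.coeff] at hm'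
    by_cases h : φ.Holds 0 σ
    · obtain ⟨υ, u, g1, g2, g3⟩ := ih1 σ τ hw.1.2 ha' hbd
      refine ⟨υ, _, .seq h1 (.iteTrue (by simp [Test.Holds, Expr.val, h5, h]) g1), ?_, ?_⟩
      · simp only [HProg.coeff, HProg.deg, Test.cost, Expr.cost]
        omega
      · simpa [HProg.run, h] using g3
    · obtain ⟨υ, u, g1, g2, g3⟩ := ih2 σ τ hw.2 ha' hbd
      refine ⟨υ, _, .seq h1 (.iteFalse (by simp [Test.Holds, Expr.val, h5, h]) g1), ?_, ?_⟩
      · simp only [HProg.coeff, HProg.deg, Test.cost, Expr.cost]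
        omega
      · simpa [HProg.run, h] using g3
  | forLt x b P ih =>
    intro σ σ' hw ha hbd
    simp only [HProg.wf, Bool.and_eq_true, Bool.not_eq_true', decide_eq_true_eq] at hw
    obtain ⟨⟨⟨⟨hx, hxb⟩, hb⟩, hP⟩, hxP⟩ := hw
    have hxb' : b ≠ x := by
      rintro rfl
      simp [hb] at hxb
    have hbk : ∀ k, Bounded N (forRun P.run x σ k) ∧ (forRun P.run x σ k).reg b = σ.reg b := by
      have hne : ∀ c, isBound c = true → c ≠ x := by
        rintro c hc rfl
        simp [hc] at hxb
      intro k
      induction k with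
      | zero =>
        refine ⟨fun c hc => ?_, by simp [forRun, hxb']⟩
        simp only [forRun, setReg_reg, if_neg (hne c hc)]
        exact hbd c hc
      | succ k ihk =>
        refine ⟨fun c hc => ?_, ?_⟩
        · simp only [forRun, setReg_reg, if_neg (hne c hc)]
          exact HProg.run_bounded hP ihk.1 c hc
        · simp only [forRun, setReg_reg, if_neg hxb']
          rw [HProg.run_reg (HProg.writesReg_of_isBound hP hb), ihk.2]
    have hxk : ∀ k, (forRun P.run x σ k).reg x = k := by
      intro k
      cases k <;> simp [forRun]
    obtain ⟨τ, t, h1, h2, h3⟩ := exec_loop (b := .lt (.reg x) (.reg b))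
      (P := .seq P.compile (.assign x (.succ (.reg x))))
      (fun k τ => Agree 0 (forRun P.run x σ k) τ) (M := σ.reg b) (c := P.coeff * N ^ P.deg + 3)
      (σ := σ'.setReg x 0) (by
        intro k τ hk
        simp only [Test.Holds, Expr.val]
        rw [← hk.reg x (visible_of_lt hx), ← hk.reg b (visible_of_lt (isBound_lt hb)), hxk,
          (hbk k).2]) (by
        intro k τ _ hk
        obtain ⟨υ, t, g1, g2, g3⟩ := ih _ τ hP hk (hbk k).1
        refine ⟨_, _, .seq g1 (.assign _ _ _), ?_, ?_⟩
        · simp only [Expr.cost]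
          omega
        · have : (Expr.succ (.reg x)).val υ = k + 1 := by
            simp only [Expr.val]
            rw [← g3.reg x (visible_of_lt hx), HProg.run_reg hxP, hxk]
          rw [this]
          exact g3.setReg _ _) (ha.setReg _ _)
    refine ⟨τ, _, .seq (.assign _ _ _) h1, ?_, h3⟩
    have hM : σ.reg b ≤ N := hbd b hb
    simp only [HProg.coeff, HProg.deg, Test.cost, Expr.cost] at *
    have h5 : σ.reg b * (1 + 1 + 1 + (P.coeff * N ^ P.deg + 3)) ≤
        N * (P.coeff * N ^ P.deg + 6) := Nat.mul_le_mul hM (by omega)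
    have h6 : N * (P.coeff * N ^ P.deg + 6) + 5 ≤ (P.coeff + 11) * N ^ (P.deg + 1) := by
      have : N ≤ N ^ (P.deg + 1) := Nat.le_self_pow (by omega) N
      calc _ = P.coeff * N ^ (P.deg + 1) + (6 * N + 5) := by ring
        _ ≤ P.coeff * N ^ (P.deg + 1) + 11 * N ^ (P.deg + 1) := by omega
        _ = _ := by ring
    omega

end RAM

/-! ### Greedy labelings of signed graphs -/

/-- A graph with signed edges, some prescribed labels, and an order of preference on the vertices
(smaller keys first) from which a greedy labeling picks its starting points. -/
structure SignedGraph (V : Type*) where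
  adj : V → V → Bool → Prop
  fixed : V → Bool → Prop
  seed : V → Prop
  key : V → ℕ
  nodes : Finset V
  adj_symm : ∀ v w b, adj v w b → adj w v b
  adj_seed : ∀ v w, adj v w true → seed v
  mem_of_adj : ∀ v w b, adj v w b → w ∈ nodes
  mem_of_seed : ∀ v, seed v → v ∈ nodes
  mem_of_fixed : ∀ v b, fixed v b → v ∈ nodes

namespace SignedGraph

variable {V : Type*} {S : SignedGraph V} {L L' : V → Bool → Prop} {D D' : V → Prop} {v w : V}

/-- A labeling that agrees with the prescribed labels and changes along an edge exactly if the edge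
has the sign `true`. -/
def IsSolution (S : SignedGraph V) (s : V → Bool) : Prop :=
  (∀ v b, S.fixed v b → s v = b) ∧ ∀ v w b, S.adj v w b → s w = xor (s v) b

/-- Two vertices are joined by a path. -/
def Reach (S : SignedGraph V) : V → V → Prop :=
  Relation.ReflTransGen fun v w => ∃ b, S.adj v w b

/-- The component of `v` contains a prescribed label, or else a vertex that comes first among the
seeds of the component and has the label `false`. -/
def Rooted (S : SignedGraph V) (L : V → Bool → Prop) (v : V) : Prop :=
  (∃ u b, S.Reach v u ∧ S.fixed u b) ∨
    ∃ u, S.Reach v u ∧ S.seed u ∧ L u false ∧ ∀ w, S.Reach v w → S.seed w → S.key u ≤ S.key w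

/-- The invariant of the greedy labeling. The relation `L v b` says that `v` has received the
label `b`; the vertices in `D` are those whose neighbours have been labeled, too. -/
structure Partial (S : SignedGraph V) (L : V → Bool → Prop) (D : V → Prop) : Prop where
  mem : ∀ v b, L v b → v ∈ S.nodes
  fixed : ∀ v b, S.fixed v b → ∃ c, L v c
  lab_of_done : ∀ v, D v → ∃ c, L v c
  nbr_of_done : ∀ v, D v → ∀ w b, S.adj v w b → ∃ c, L w c
  extends_ : ∀ s, S.IsSolution s → ∃ s', S.IsSolution s' ∧ ∀ v b, L v b → s' v = b
  rooted : ∀ v c, L v c → S.Rooted L v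

/-- Every labeled vertex has been processed. -/
def Closed (L : V → Bool → Prop) (D : V → Prop) : Prop := ∀ v c, L v c → D v

/-- One step of the propagation of labels, from the vertex `v` to its neighbours. -/
structure Propagates (S : SignedGraph V) (L L' : V → Bool → Prop) (D D' : V → Prop) (v : V) :
    Prop where
  lab : ∃ c, L v c
  done : ∀ w, D' w ↔ D w ∨ w = v
  mono : ∀ w c, L w c → L' w c
  new : ∀ w c, L' w c → L w c ∨ ∃ b d, L v d ∧ S.adj v w b ∧ c = xor d b
  nbr : ∀ w b, S.adj v w b → ∃ c, L' w c

theorem Reach.symm (h : S.Reach v w) : S.Reach w v := by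
  induction h with
  | refl => exact .refl
  | tail _ h ih =>
    obtain ⟨b, hb⟩ := h
    exact .head ⟨b, S.adj_symm _ _ _ hb⟩ ih

theorem Rooted.mono (h : S.Rooted L v) (hL : ∀ w c, L w c → L' w c) : S.Rooted L' v := by
  rcases h with h | ⟨u, h1, h2, h3, h4⟩
  · exact Or.inl h
  · exact Or.inr ⟨u, h1, h2, hL _ _ h3, h4⟩

theorem Rooted.reach (h : S.Rooted L v) (hw : S.Reach w v) : S.Rooted L w := by
  rcases h with ⟨u, b, h1, h2⟩ | ⟨u, h1, h2, h3, h4⟩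
  · exact Or.inl ⟨u, b, hw.trans h1, h2⟩
  · exact Or.inr ⟨u, hw.trans h1, h2, h3, fun x hx => h4 x (hw.symm.trans hx)⟩

theorem Partial.propagate (h : S.Partial L D) (hp : S.Propagates L L' D D' v) :
    S.Partial L' D' where
  mem w c hw := by
    rcases hp.new w c hw with h' | ⟨b, d, -, hb, -⟩
    · exact h.mem w c h'
    · exact S.mem_of_adj _ _ _ hb
  fixed w b hw := (h.fixed w b hw).imp fun c => hp.mono w c
  lab_of_done w hw := by
    rcases (hp.done w).1 hw with h' | rfl
    · exact (h.lab_of_done w h').imp fun c => hp.mono w c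
    · exact hp.lab.imp fun c => hp.mono w c
  nbr_of_done w hw x b hx := by
    rcases (hp.done w).1 hw with h' | rfl
    · exact (h.nbr_of_done w h' x b hx).imp fun c => hp.mono x c
    · exact hp.nbr x b hx
  extends_ s hs := by
    obtain ⟨s', h1, h2⟩ := h.extends_ s hs
    refine ⟨s', h1, fun w c hw => ?_⟩
    rcases hp.new w c hw with h' | ⟨b, d, hd, hb, rfl⟩
    · exact h2 w c h'
    · rw [h1.2 v w b hb, h2 v d hd]
  rooted w c hw := by
    rcases hp.new w c hw with h' | ⟨b, d, hd, hb, -⟩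
    · exact (h.rooted w c h').mono hp.mono
    · exact ((h.rooted v d hd).mono hp.mono).reach (.single ⟨b, S.adj_symm _ _ _ hb⟩)

/-- If a vertex is unlabeled while every labeled vertex is done, then its whole component is
unlabeled. -/
theorem Partial.unlabeled_of_reach (h : S.Partial L D) (hc : Closed L D) (hv : ∀ c, ¬ L v c)
    (hw : S.Reach v w) : ∀ c, ¬ L w c := by
  induction hw with
  | refl => exact hv
  | tail _ hxw ih =>
    obtain ⟨b, hb⟩ := hxw
    intro c hc'
    obtain ⟨d, hd⟩ := h.nbr_of_done _ (hc _ _ hc') _ b (S.adj_symm _ _ _ hb)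
    exact ih d hd

/-- The first unlabeled seed may receive the label `false`: in any solution, the labels of all
unlabeled vertices may be negated. -/
theorem Partial.plant (h : S.Partial L D) (hc : Closed L D) (hv : S.seed v) (hv' : ∀ c, ¬ L v c)
    (hmin : ∀ w, S.seed w → (∀ c, ¬ L w c) → S.key v ≤ S.key w)
    (hL : ∀ w c, L' w c ↔ L w c ∨ (w = v ∧ c = false)) : S.Partial L' D where
  mem w c hw := by
    rcases (hL w c).1 hw with h' | ⟨rfl, -⟩
    · exact h.mem w c h'
    · exact S.mem_of_seed _ hv
  fixed w b hw := (h.fixed w b hw).imp fun c hc => (hL w c).2 (Or.inl hc)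
  lab_of_done w hw := (h.lab_of_done w hw).imp fun c hc => (hL w c).2 (Or.inl hc)
  nbr_of_done w hw x b hx := (h.nbr_of_done w hw x b hx).imp fun c hc => (hL x c).2 (Or.inl hc)
  extends_ s hs := by
    classical
    obtain ⟨s', h1, h2⟩ := h.extends_ s hs
    by_cases hsv : s' v = false
    · refine ⟨s', h1, fun w c hw => ?_⟩
      rcases (hL w c).1 hw with h' | ⟨rfl, rfl⟩
      · exact h2 w c h'
      · exact hsv
    · refine ⟨fun w => if ∃ c, L w c then s' w else !(s' w), ⟨fun w b hw => ?_,
        fun x w b hb => ?_⟩, fun w c hw => ?_⟩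
      · beta_reduce
        rw [if_pos (h.fixed w b hw)]
        exact h1.1 w b hw
      · have he : (∃ c, L x c) ↔ ∃ c, L w c :=
          ⟨fun ⟨c, hx⟩ => h.nbr_of_done x (hc _ _ hx) w b hb,
            fun ⟨c, hw⟩ => h.nbr_of_done w (hc _ _ hw) x b (S.adj_symm _ _ _ hb)⟩
        beta_reduce
        by_cases hx : ∃ c, L x c
        · rw [if_pos hx, if_pos (he.1 hx)]
          exact h1.2 x w b hb
        · rw [if_neg hx, if_neg (fun h => hx (he.2 h)), h1.2 x w b hb, Bool.not_xor]
      · beta_reduce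
        rcases (hL w c).1 hw with h' | ⟨rfl, rfl⟩
        · rw [if_pos ⟨c, h'⟩]
          exact h2 w c h'
        · rw [if_neg (fun ⟨c, hx⟩ => hv' c hx)]
          simpa using hsv
  rooted w c hw := by
    rcases (hL w c).1 hw with h' | ⟨rfl, -⟩
    · exact (h.rooted w c h').mono fun x d hx => (hL x d).2 (Or.inl hx)
    · exact Or.inr ⟨w, .refl, hv, (hL _ _).2 (Or.inr ⟨rfl, rfl⟩), fun x hx hs =>
        hmin x hs (h.unlabeled_of_reach hc hv' hx)⟩

/-- If nothing is left to do, then the labels are those of a solution, provided that there is one;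
all unlabeled vertices may receive the label `false`. -/
theorem Partial.isSolution (h : S.Partial L D) (hc : Closed L D)
    (hseed : ∀ v, S.seed v → ∃ c, L v c) {s₀ : V → Bool} (h0 : S.IsSolution s₀) {s : V → Bool}
    (hs : ∀ v, s v = true ↔ L v true) : S.IsSolution s := by
  obtain ⟨s', h1, h2⟩ := h.extends_ s₀ h0
  have hlab : ∀ v c, L v c → s v = s' v := by
    intro v c hv
    have hc' := h2 v c hv
    cases c with
    | true => rw [hc', (hs v).2 hv]
    | false =>
      rw [hc', Bool.eq_false_iff]
      intro ht
      rw [h2 v true ((hs v).1 ht)] at hc'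
      cases hc'
  have hun : ∀ v, (∀ c, ¬ L v c) → s v = false := fun v hv => by
    rw [Bool.eq_false_iff]
    exact fun ht => hv true ((hs v).1 ht)
  refine ⟨fun v b hv => ?_, fun v w b hb => ?_⟩
  · obtain ⟨c, hc⟩ := h.fixed v b hv
    rw [hlab v c hc]
    exact h1.1 v b hv
  · by_cases hv : ∃ c, L v c
    · obtain ⟨c, hvc⟩ := hv
      obtain ⟨d, hd⟩ := h.nbr_of_done v (hc _ _ hvc) w b hb
      rw [hlab v c hvc, hlab w d hd]
      exact h1.2 v w b hb
    · push Not at hv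
      rw [hun v hv, hun w (h.unlabeled_of_reach hc hv (.single ⟨b, hb⟩))]
      cases b with
      | false => rfl
      | true =>
        obtain ⟨c, hc⟩ := hseed v (S.adj_seed v w hb)
        exact absurd hc (hv c)

end SignedGraph

namespace CutFamily

variable {W κ : Type*} {part : W → κ}

/-! ### The labels of the LC-graph as a signed graph -/

/-- On the common cutting support of `X` and `Y` there is an element that belongs to `X` if and only
if `a = true`, and to `Y` if and only if `b = true`. -/
def Quadrant (part : W → κ) (X Y : Set W) (a b : Bool) : Prop :=
  ∃ v ∈ supp₂ part X Y, (v ∈ X ↔ a = true) ∧ (v ∈ Y ↔ b = true)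

variable {X Y : Set W}

theorem quadrant_swap {a b : Bool} : Quadrant part X Y a b ↔ Quadrant part Y X b a := by
  simp only [Quadrant, supp₂, Set.inter_comm (supp part X), and_comm]

theorem subOn_orient_iff {a b : Bool} :
    SubOn (supp₂ part X Y) (orient a X) (orient b Y) ↔ ¬ Quadrant part X Y a (!b) := by
  simp only [subOn_iff, Quadrant, mem_orient, not_exists, not_and]
  refine forall_congr' fun v => forall_congr' fun _ => forall_congr' fun _ => ?_
  cases b <;> simp

theorem Quadrant.nonempty {a b : Bool} (h : Quadrant part X Y a b) :
    (supp₂ part X Y).Nonempty := let ⟨v, hv, _⟩ := h; ⟨v, hv⟩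

theorem supp₂_nonempty_iff :
    (supp₂ part X Y).Nonempty ↔ ∃ a b, Quadrant part X Y a b := by
  classical
  refine ⟨fun ⟨v, hv⟩ => ⟨decide (v ∈ X), decide (v ∈ Y), v, hv, by simp, by simp⟩, ?_⟩
  rintro ⟨a, b, h⟩
  exact h.nonempty

theorem not_pairwiseComparable_iff {F : Set (Set W)} : ¬ PairwiseComparable part F ↔
    ∃ X ∈ F, ∃ Y ∈ F, ∀ a b, Quadrant part X Y a b := by
  have key : ∀ X Y : Set W, (SubOn (supp₂ part X Y) X Y ∨ SubOn (supp₂ part X Y) X Yᶜ ∨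
      SubOn (supp₂ part X Y) Y X ∨ SubOn (supp₂ part X Y) Yᶜ X) ↔
      ¬ ∀ a b, Quadrant part X Y a b := by
    intro X Y
    have h1 := @subOn_orient_iff _ _ part X Y true true
    have h2 := @subOn_orient_iff _ _ part X Y true false
    have h3 := @subOn_orient_iff _ _ part X Y false false
    have h4 := @subOn_orient_iff _ _ part X Y false true
    simp only [orient, if_true, Bool.false_eq_true, if_false, Bool.not_true,
      Bool.not_false] at h1 h2 h3 h4
    rw [subOn_compl] at h3
    rw [subOn_compl_left] at h4
    rw [h1, h2, h3, h4]
    simp only [Bool.forall_bool]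
    tauto
  constructor
  · intro h
    simp only [PairwiseComparable, key] at h
    push Not at h
    obtain ⟨X, hX, Y, hY, -, -, h⟩ := h
    exact ⟨X, hX, Y, hY, h⟩
  · rintro ⟨X, hX, Y, hY, h⟩ hc
    refine (key X Y).1 (hc X hX Y hY ?_ (h true true).nonempty) h
    rintro rfl
    obtain ⟨v, -, h1, h2⟩ := h true false
    simp [h1] at h2

/-- The pair of indices is a node of the LC-graph with a prescribed label. -/
def FixedLabel (part : W → κ) (X Y : Set W) (d : Bool) : Prop :=
  ∃ c, ¬ Quadrant part X Y (!d) c ∧ Quadrant part X Y d (!c)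

/-- The labels of `XY` and `YX` are equal for `b = false`, and different for `b = true`. -/
def SwapSign (part : W → κ) (X Y : Set W) (b : Bool) : Prop :=
  (supp₂ part X Y).Nonempty ∧ ∃ a, ¬ Quadrant part X Y a (xor a b)

theorem SwapSign.symm {b : Bool} (h : SwapSign part X Y b) : SwapSign part Y X b := by
  obtain ⟨⟨v, hv⟩, a, ha⟩ := h
  refine ⟨⟨v, hv.2, hv.1⟩, xor a b, fun h => ha ?_⟩
  rw [quadrant_swap] at h
  simpa using h

/-- The LC-graph of the family `f 0, …, f (m - 1)` as a signed graph. -/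
def lcSigned (part : W → κ) (f : ℕ → Set W) (m : ℕ) : SignedGraph (ℕ × ℕ) where
  adj p q b := (p.1 < m ∧ p.2 < m ∧ p.1 ≠ p.2) ∧ (q.1 < m ∧ q.2 < m ∧ q.1 ≠ q.2) ∧
    ((q = p.swap ∧ SwapSign part (f p.1) (f p.2) b) ∨
      (q.1 = p.1 ∧ b = false ∧ (supp₂ part (f p.2) (f q.2) \ supp part (f p.1)).Nonempty))
  fixed p b := (p.1 < m ∧ p.2 < m ∧ p.1 ≠ p.2) ∧ FixedLabel part (f p.1) (f p.2) b
  seed p := (p.1 < m ∧ p.2 < m ∧ p.1 ≠ p.2) ∧ (supp₂ part (f p.1) (f p.2)).Nonempty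
  key p := p.1
  nodes := (Finset.range m).offDiag
  adj_symm := by
    rintro ⟨i, j⟩ ⟨i', j'⟩ b ⟨h1, h2, h⟩
    refine ⟨h2, h1, ?_⟩
    rcases h with ⟨h, h'⟩ | ⟨h, h', h''⟩
    · simp only [Prod.swap_prod_mk, Prod.mk.injEq] at h
      obtain ⟨rfl, rfl⟩ := h
      exact Or.inl ⟨rfl, h'.symm⟩
    · dsimp only at *
      subst h
      exact Or.inr ⟨rfl, h', by rwa [supp₂, Set.inter_comm]⟩
  adj_seed := by
    rintro p q ⟨h1, -, ⟨-, h⟩ | ⟨-, h, -⟩⟩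
    · exact ⟨h1, h.1⟩
    · cases h
  mem_of_adj := by
    rintro p q b ⟨-, h, -⟩
    simp [h.1, h.2.1, h.2.2]
  mem_of_seed := by
    rintro p ⟨h, -⟩
    simp [h.1, h.2.1, h.2.2]
  mem_of_fixed := by
    rintro p b ⟨h, -⟩
    simp [h.1, h.2.1, h.2.2]

section

variable {f : ℕ → Set W} {m : ℕ} (hf : Set.InjOn f (Set.Iio m))

include hf in
/-- The solutions of the signed graph are the LC-labelings. -/
theorem isSolution_iff {s : Set W → Set W → Bool} :
    (lcSigned part f m).IsSolution (fun p => s (f p.1) (f p.2)) ↔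
      IsLCLabeling part (f '' Set.Iio m) s := by
  have hne : ∀ {i j}, i < m → j < m → (f i ≠ f j ↔ i ≠ j) := fun hi hj => (hf.ne_iff hi hj)
  rw [isLCLabeling_iff]
  simp only [subOn_orient_iff]
  constructor
  · rintro ⟨h1, h2⟩
    refine ⟨?_, ?_⟩
    · rintro _ ⟨i, hi, rfl⟩ _ ⟨j, hj, rfl⟩ hij hn a b hab
      rw [hne hi hj] at hij
      have e1 := h2 (i, j) (j, i) (xor a (!b)) ⟨⟨hi, hj, hij⟩, ⟨hj, hi, hij.symm⟩,
        Or.inl ⟨rfl, hn, a, by simpa using hab⟩⟩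
      dsimp only at e1
      by_cases hq : Quadrant part (f i) (f j) (!a) b
      · have e2 := h1 (i, j) (!a) ⟨⟨hi, hj, hij⟩, !b, by simpa using hab, by simpa using hq⟩
        dsimp only at e2
        left
        rw [e1, e2]
        cases a <;> cases b <;> simp
      · have hq' : SubOn (supp₂ part (f i) (f j)) (orient b (f j)) (orient a (f i)) := by
          rw [supp₂, Set.inter_comm, ← supp₂, subOn_orient_iff, ← quadrant_swap]
          exact hq
        rw [e1]
        cases h : s (f i) (f j) <;> cases a <;> cases b <;> simp [hq']
    · rintro _ ⟨i, hi, rfl⟩ _ ⟨j, hj, rfl⟩ _ ⟨k, hk, rfl⟩ hij hik hn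
      rw [hne hi hj] at hij
      rw [hne hi hk] at hik
      have := h2 (i, j) (i, k) false ⟨⟨hi, hj, hij⟩, ⟨hi, hk, hik⟩, Or.inr ⟨rfl, rfl, hn⟩⟩
      simpa using this.symm
  · rintro ⟨h1, h2⟩
    have h1' : ∀ {i j}, i < m → j < m → i ≠ j → (supp₂ part (f i) (f j)).Nonempty →
        ∀ a b, ¬ Quadrant part (f i) (f j) a (!b) →
          (s (f i) (f j) = !a ∧ s (f j) (f i) = b) ∨
          (¬ Quadrant part (f i) (f j) (!a) b ∧ s (f i) (f j) = a ∧ s (f j) (f i) = !b) := by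
      intro i j hi hj hij hn a b hab
      refine (h1 _ ⟨i, hi, rfl⟩ _ ⟨j, hj, rfl⟩ ((hne hi hj).2 hij) hn a b hab).imp_right ?_
      rintro ⟨h, h'⟩
      rw [supp₂, Set.inter_comm, ← supp₂, subOn_orient_iff, ← quadrant_swap] at h
      exact ⟨h, h'⟩
    constructor
    · rintro ⟨i, j⟩ d ⟨⟨hi, hj, hij⟩, c, hc, hc'⟩
      dsimp only at *
      rcases h1' hi hj hij hc'.nonempty (!d) (!c) (by simpa using hc) with h | h
      · simpa using h.1
      · exact absurd hc' (by simpa using h.1)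
    · rintro ⟨i, j⟩ ⟨i', j'⟩ b ⟨⟨hi, hj, hij⟩, ⟨hi', hj', hij'⟩, ⟨h, h'⟩ | ⟨h, rfl, h'⟩⟩
      · simp only [Prod.swap_prod_mk, Prod.mk.injEq] at h
        obtain ⟨rfl, rfl⟩ := h
        dsimp only at *
        obtain ⟨hn, a, ha⟩ := h'
        rcases h1' hi hj hij hn a (!(xor a b)) (by simpa using ha) with ⟨e1, e2⟩ | ⟨-, e1, e2⟩ <;>
          rw [e1, e2] <;> cases a <;> cases b <;> rfl
      · dsimp only at *
        subst h
        rw [h2 _ ⟨i', hi, rfl⟩ _ ⟨j, hj, rfl⟩ _ ⟨j', hj', rfl⟩ ((hne hi hj).2 hij)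
          ((hne hi hj').2 hij') h']
        simp

theorem FixedLabel.line_ne {d : Bool} (h : FixedLabel part X Y d) {A : Set W}
    (hA : supp₂ part X Y = A) : line A X ≠ line A Y := by
  subst hA
  obtain ⟨c, hc, v, hv, hvX, hvY⟩ := h
  intro he
  -- a common line means that the two members agree up to complementation
  have hX : X ∩ supp₂ part X Y ∈ line (supp₂ part X Y) Y := by
    rw [← he]
    exact Or.inl rfl
  -- a cut part contains an element on the other side of `X`
  have hu : ∃ u, part u = part v ∧ ¬ (u ∈ X ↔ v ∈ X) := by
    obtain ⟨⟨u, hu, hu'⟩, ⟨w, hw, hw'⟩⟩ := mem_supp_iff.1 hv.1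
    by_cases hvX' : v ∈ X
    · exact ⟨w, hw', by tauto⟩
    · exact ⟨u, hu', by tauto⟩
  obtain ⟨u, huv, hu⟩ := hu
  have huA : u ∈ supp₂ part X Y :=
    ⟨(mem_supp_congr huv).2 hv.1, (mem_supp_congr huv).2 hv.2⟩
  apply hc
  refine ⟨u, huA, ?_, ?_⟩
  · cases d <;> simp at hvX ⊢ <;> tauto
  · have h1 : ∀ w ∈ supp₂ part X Y, (w ∈ X ↔ w ∈ Y) ↔ (v ∈ X ↔ v ∈ Y) := by
      rcases hX with hX | hX
      · have : ∀ w ∈ supp₂ part X Y, w ∈ X ↔ w ∈ Y := fun w hw => by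
          have := Set.ext_iff.1 hX w
          simpa [hw] using this
        intro w hw
        simp [this w hw, this v hv]
      · have : ∀ w ∈ supp₂ part X Y, w ∈ X ↔ w ∉ Y := fun w hw => by
          have := Set.ext_iff.1 hX w
          simpa [hw] using this
        intro w hw
        simp [this w hw, this v hv]
    have := h1 u huA
    cases c <;> simp at hvY ⊢ <;> tauto

variable {g : Set W → Set W} (hE : Separated part (f '' Set.Iio m))
  (hg : LocalModel part (f '' Set.Iio m) g)

include hf hE hg in
theorem nodeInv_of_reach {i j k : ℕ} (hi : i < m) (hj : j < m) (hk : k < m) (hij : i ≠ j)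
    (hjk : j ≠ k) (hik : i ≠ k) (h : IsCyclicTriple part (g (f i)) (g (f j)) (g (f k)))
    {p : ℕ × ℕ} (hp : (lcSigned part f m).Reach (i, j) p) :
    (p.1 < m ∧ p.2 < m ∧ p.1 ≠ p.2) ∧
      NodeInv part (f '' Set.Iio m) g (f k) (supp₂ part (f i) (f k)) (f p.1) (f p.2) := by
  induction hp with
  | refl =>
    exact ⟨⟨hi, hj, hij⟩, h.nodeInv hE hg ⟨i, hi, rfl⟩ ⟨j, hj, rfl⟩ ⟨k, hk, rfl⟩
      (hf.ne hi hj hij) (hf.ne hj hk hjk) (hf.ne hi hk hik)⟩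
  | @tail p q _ hpq ih =>
    obtain ⟨hp, ih⟩ := ih
    obtain ⟨b, -, hq, hpq⟩ := hpq
    refine ⟨hq, ?_⟩
    rcases hpq with ⟨rfl, hpq⟩ | ⟨h1, -, h2⟩
    · exact ih.swap hE hg ⟨p.1, hp.1, rfl⟩ ⟨p.2, hp.2.1, rfl⟩ ⟨k, hk, rfl⟩
        (hf.ne hp.1 hp.2.1 hp.2.2) hpq.1
    · rw [h1]
      exact ih.prefix hg ⟨p.1, hp.1, rfl⟩ ⟨p.2, hp.2.1, rfl⟩ ⟨k, hk, rfl⟩ h2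

include hf hE hg in
/-- The first seed of the component of a node of a cyclic triple. -/
theorem exists_root_of_isCyclicTriple {L : ℕ × ℕ → Bool → Prop} {i j k : ℕ} (hi : i < m)
    (hj : j < m) (hk : k < m) (hij : i ≠ j) (hjk : j ≠ k) (hik : i ≠ k)
    (h : IsCyclicTriple part (g (f i)) (g (f j)) (g (f k)))
    (hL : ∀ p, (lcSigned part f m).seed p → (lcSigned part f m).Rooted L p) :
    ∃ i' j', i' ≤ i ∧ (i' < m ∧ j' < m ∧ i' ≠ j') ∧ j' ≠ k ∧ i' ≠ k ∧ L (i', j') false ∧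
      IsCyclicTriple part (g (f i')) (g (f j')) (g (f k)) := by
  have hi' : f i ∈ f '' Set.Iio m := ⟨i, hi, rfl⟩
  have hj' : f j ∈ f '' Set.Iio m := ⟨j, hj, rfl⟩
  have hk' : f k ∈ f '' Set.Iio m := ⟨k, hk, rfl⟩
  have hseed : (lcSigned part f m).seed (i, j) := by
    refine ⟨⟨hi, hj, hij⟩, ?_⟩
    obtain ⟨⟨v, hv⟩, -⟩ := h
    rw [hg.supp_eq _ hi', hg.supp_eq _ hj'] at hv
    exact ⟨v, hv.1⟩
  rcases hL _ hseed with ⟨p, d, hp, hpm, hd⟩ | ⟨p, hp, hps, hpL, hmin⟩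
  · exfalso
    obtain ⟨-, hinv⟩ := nodeInv_of_reach hf hE hg hi hj hk hij hjk hik h hp
    have h1 : f p.1 ∈ f '' Set.Iio m := ⟨_, hpm.1, rfl⟩
    have h2 : f p.2 ∈ f '' Set.Iio m := ⟨_, hpm.2.1, rfl⟩
    have hne : (supp₂ part (f p.1) (f p.2)).Nonempty := by
      obtain ⟨c, -, hc⟩ := hd
      exact hc.nonempty
    have hsw := hinv.swap hE hg h1 h2 hk' (hf.ne hpm.1 hpm.2.1 hpm.2.2) hne
    have hs := (hinv.isCyclicTriple hg h1 h2 hk' hne).supp₂_eq hg h1 h2 hk'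
    rw [hinv.supp_eq] at hs
    exact hd.line_ne hs ((hinv.line_eq hg h1 hk').trans (hsw.line_eq hg h2 hk').symm)
  · obtain ⟨-, hinv⟩ := nodeInv_of_reach hf hE hg hi hj hk hij hjk hik h hp
    obtain ⟨hpm, hne⟩ := hps
    exact ⟨p.1, p.2, hmin _ .refl hseed, hpm, fun he => hinv.ne' (congrArg f he),
      fun he => hinv.ne (congrArg f he), hpL,
      hinv.isCyclicTriple hg ⟨_, hpm.1, rfl⟩ ⟨_, hpm.2.1, rfl⟩ hk' hne⟩

end

/-- In a cyclic triple `P, Q, R` the labels of `PQ` and `PR` are different. -/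
theorem IsCyclicTriple.mem_iff_notMem {P Q R : Set W} (h : IsCyclicTriple part P Q R) {v w : W}
    (hv : v ∈ supp part Q) (hv' : v ∉ supp part P) (hw : w ∈ supp part R)
    (hw' : w ∉ supp part P) : v ∈ P ↔ w ∉ P := by
  obtain ⟨-, P', Q', R', hP, hQ, hR, hc⟩ := h
  rw [← hP.supp_eq] at hv' hw'
  rw [← hQ.supp_eq] at hv
  rw [← hR.supp_eq] at hw
  have h1 := hc.h12.notMem_left hv hv'
  have h2 := hc.h31.mem_right hw hw'
  rcases hP with rfl | rfl
  · tauto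
  · simp only [Set.mem_compl_iff] at h1 h2
    tauto

/-- A labeling whose components without prescribed labels have the label `false` at the node that
comes first admits no cyclic triple: for a cyclic triple `i`, `j`, `k` with the smallest `i`, the
first nodes in the components of `(i, j)` and `(i, k)` are of the form `(i, j')` and `(i, k')`,
where `i`, `j'`, `k'` is again a cyclic triple; but then their labels are different. -/
theorem not_isCyclicTriple_of_rooted {f : ℕ → Set W} {m : ℕ} (hf : Set.InjOn f (Set.Iio m))
    (hE : Separated part (f '' Set.Iio m)) {s : Set W → Set W → Bool}
    (hs : IsLCLabeling part (f '' Set.Iio m) s) (hc : PairwiseComparable part (f '' Set.Iio m))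
    {L : ℕ × ℕ → Bool → Prop}
    (hL : ∀ p, (lcSigned part f m).seed p → (lcSigned part f m).Rooted L p)
    (hsL : ∀ i < m, ∀ j < m, i ≠ j → L (i, j) false → s (f i) (f j) = false) :
    ∀ X ∈ f '' Set.Iio m, ∀ Y ∈ f '' Set.Iio m, ∀ Z ∈ f '' Set.Iio m, X ≠ Y → Y ≠ Z → X ≠ Z →
      ¬ IsCyclicTriple part (relabel part (f '' Set.Iio m) s X)
        (relabel part (f '' Set.Iio m) s Y) (relabel part (f '' Set.Iio m) s Z) := by
  set g := relabel part (f '' Set.Iio m) s with hgdef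
  have hg : LocalModel part (f '' Set.Iio m) g := hs.localModel hc
  have key : ∀ i, i < m → ∀ j < m, ∀ k < m, i ≠ j → j ≠ k → i ≠ k →
      ¬ IsCyclicTriple part (g (f i)) (g (f j)) (g (f k)) := by
    intro i
    induction i using Nat.strong_induction_on with
    | _ i ih =>
    intro hi j hj k hk hij hjk hik h
    obtain ⟨i1, q, h1, ⟨hi1, hq, hiq⟩, hqk, hik1, hl1, h'⟩ :=
      exists_root_of_isCyclicTriple hf hE hg hi hj hk hij hjk hik h hL
    obtain rfl : i1 = i := by
      by_contra hne
      exact ih i1 (by omega) hi1 q hq k hk hiq hqk hik1 h'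
    have h'' : IsCyclicTriple part (g (f i1)) (g (f k)) (g (f q)) := h'.swap.rotate
    obtain ⟨i2, r, h2, ⟨hi2, hr, hir⟩, hrq, hiq2, hl2, h3⟩ :=
      exists_root_of_isCyclicTriple hf hE hg hi1 hk hq hik1 hqk.symm hiq h'' hL
    obtain rfl : i2 = i1 := by
      by_contra hne
      exact ih i2 (by omega) hi2 r hr q hq hir hrq hiq2 h3
    have mi : f i2 ∈ f '' Set.Iio m := ⟨_, hi2, rfl⟩
    have mq : f q ∈ f '' Set.Iio m := ⟨_, hq, rfl⟩
    have mr : f r ∈ f '' Set.Iio m := ⟨_, hr, rfl⟩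
    obtain ⟨v, hv, hv'⟩ := hE.sep _ mi _ mr (hf.ne hi2 hr hir)
    obtain ⟨w, hw, hw'⟩ := hE.sep _ mi _ mq (hf.ne hi2 hq hiq)
    have := h3.mem_iff_notMem (v := v) (w := w) (by rwa [hg.supp_eq _ mr])
      (by rwa [hg.supp_eq _ mi]) (by rwa [hg.supp_eq _ mq]) (by rwa [hg.supp_eq _ mi])
    rw [hgdef, mem_relabel_iff hs mi mr hv hv', mem_relabel_iff hs mi mq hw hw',
      hsL _ hi2 _ hr hir hl2, hsL _ hi2 _ hq hiq hl1] at this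
    simp at this
  rintro _ ⟨i, hi, rfl⟩ _ ⟨j, hj, rfl⟩ _ ⟨k, hk, rfl⟩ hij hjk hik
  exact key i hi j hj k hk (fun h => hij (congrArg f h)) (fun h => hjk (congrArg f h))
    (fun h => hik (congrArg f h))

end CutFamily

namespace RAM

/-! ### Program schemes -/

/-- The memory `τ` differs from `σ` only in registers and arrays that are written by `P`. -/
structure Frame (P : HProg) (σ τ : Store) : Prop where
  reg : ∀ x, P.writesReg x = false → τ.reg x = σ.reg x
  arr : ∀ a, P.writesArr a = false → τ.arr a = σ.arr a

theorem frame_run (P : HProg) (σ : Store) : Frame P σ (P.run σ) :=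
  ⟨fun _ h => HProg.run_reg h σ, fun _ h => HProg.run_arr h σ⟩

/-- The invariant rule for loops. -/
theorem run_forLt {x b : ℕ} {P : HProg} {σ : Store} (I : ℕ → Store → Prop)
    (h0 : I 0 (σ.setReg x 0))
    (hs : ∀ k τ, k < σ.reg b → τ.reg x = k → Frame (.forLt x b P) σ τ → I k τ →
      I (k + 1) ((P.run τ).setReg x (k + 1))) :
    I (σ.reg b) ((HProg.forLt x b P).run σ) := by
  have key : ∀ k, k ≤ σ.reg b → (forRun P.run x σ k).reg x = k ∧
      Frame (.forLt x b P) σ (forRun P.run x σ k) ∧ I k (forRun P.run x σ k) := by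
    intro k
    induction k with
    | zero =>
      refine fun _ => ⟨by simp [forRun], ⟨fun y hy => ?_, fun _ _ => rfl⟩, h0⟩
      simp only [HProg.writesReg, Bool.or_eq_false_iff, beq_eq_false_iff_ne] at hy
      simp [forRun, hy.1]
    | succ k ih =>
      intro hk
      obtain ⟨h1, h2, h3⟩ := ih (by omega)
      refine ⟨by simp [forRun], ⟨fun y hy => ?_, fun a ha => ?_⟩, hs k _ (by omega) h1 h2 h3⟩
      · rw [← h2.reg y hy]
        simp only [HProg.writesReg, Bool.or_eq_false_iff, beq_eq_false_iff_ne] at hy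
        simp [forRun, hy.1, HProg.run_reg hy.2]
      · rw [← h2.arr a ha]
        simp only [HProg.writesArr] at ha
        simp [forRun, HProg.run_arr ha]
  exact (key _ le_rfl).2.2

/-- A double loop that stores one value for each pair of the counters. -/
theorem run_forLt_forLt {x y b c a : ℕ} {P : HProg} {σ : Store} (val : ℕ → ℕ → ℕ)
    (hc : c ≠ x ∧ P.writesReg c = false ∧ c ≠ y) (hx : x ≠ y ∧ P.writesReg x = false)
    (hP : ∀ i j τ, i < σ.reg b → j < σ.reg c → τ.reg x = i → τ.reg y = j →
      Frame (.forLt x b (.forLt y c P)) σ τ → ∀ i' j', (P.run τ).arr a i' j' =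
        if i' = i ∧ j' = j then val i j else τ.arr a i' j') (i j : ℕ) :
    ((HProg.forLt x b (.forLt y c P)).run σ).arr a i j =
      if i < σ.reg b ∧ j < σ.reg c then val i j else σ.arr a i j := by
  refine run_forLt (fun k τ => ∀ i j, τ.arr a i j = if i < k ∧ j < σ.reg c then val i j
    else σ.arr a i j) (by simp) ?_ i j
  intro k τ hk hxk hf hI
  have hcτ : τ.reg c = σ.reg c := hf.reg c (by
    simp [HProg.writesReg, hc.1, hc.2.1, hc.2.2])
  have h := run_forLt (x := y) (b := c) (P := P) (σ := τ) (fun l υ => ∀ i j, υ.arr a i j =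
    if i = k ∧ j < l then val i j else τ.arr a i j) (by simp) (by
      intro l υ hl hyl hg hJ i j
      rw [hcτ] at hl
      simp only [setReg_arr]
      have hxυ : υ.reg x = k := by
        rw [hg.reg x (by simp [HProg.writesReg, hx.1, hx.2]), hxk]
      rw [hP k l υ hk hl hxυ hyl ⟨fun z hz => ?_, fun z hz => ?_⟩ i j, hJ i j]
      · by_cases hi : i = k
        · subst hi
          by_cases hj : j = l
          · subst hj
            simp
          · have : j < l + 1 ↔ j < l := by omega
            simp [hj, this]
        · simp [hi]
      · rw [hg.reg z ?_, hf.reg z hz]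
        simp only [HProg.writesReg, Bool.or_eq_false_iff] at hz ⊢
        exact hz.2
      · rw [hg.arr z hz, hf.arr z hz])
  intro i j
  simp only [setReg_arr]
  rw [h i j, hI i j, hcτ]
  by_cases hi : i = k
  · subst hi
    simp
  · have : i < k + 1 ↔ i < k := by omega
    simp [hi, this]

/-- The array `a` becomes the characteristic matrix of the relation between the registers `10` and
`11` that is described by the formula. -/
def fill (a b c : ℕ) (φ : Fml) : HProg :=
  .forLt 10 b (.forLt 11 c (.ite φ (.put a (.reg 10) (.reg 11) (.const 1))
    (.put a (.reg 10) (.reg 11) (.const 0))))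

theorem run_fill {a b c : ℕ} {φ : Fml} {σ : Store} {Q : ℕ → ℕ → Prop} (hc : c ≠ 10 ∧ c ≠ 11)
    (hφ : ∀ i j τ, i < σ.reg b → j < σ.reg c → τ.reg 10 = i → τ.reg 11 = j →
      Frame (fill a b c φ) σ τ → (φ.Holds 0 τ ↔ Q i j)) {i j : ℕ} (hi : i < σ.reg b)
    (hj : j < σ.reg c) : ((fill a b c φ).run σ).arr a i j = 1 ↔ Q i j := by
  classical
  have := run_forLt_forLt (σ := σ) (a := a) (x := 10) (y := 11) (b := b) (c := c)
    (P := .ite φ (.put a (.reg 10) (.reg 11) (.const 1)) (.put a (.reg 10) (.reg 11) (.const 0)))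
    (fun i j => if Q i j then 1 else 0) ⟨hc.1, rfl, hc.2⟩ ⟨by decide, rfl⟩ (by
      intro i j τ hi hj h1 h2 hf i' j'
      by_cases hq : Q i j
      · simp [HProg.run, (hφ i j τ hi hj h1 h2 hf).2 hq, Expr.val, h1, h2, hq]
      · have hn : ¬ φ.Holds 0 τ := fun h => hq ((hφ i j τ hi hj h1 h2 hf).1 h)
        simp [HProg.run, hn, Expr.val, h1, h2, hq]) i j
  rw [fill, this, if_pos ⟨hi, hj⟩]
  split_ifs with h <;> simp [h]

/-- The search for the lexicographically first pair that satisfies the formula, with the counters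
`12` and `13`. The result is stored in the registers `21` and `22`, and the register `20` tells
whether the search has been successful. -/
def search (φ : Fml) : HProg :=
  .seq (.set 20 (.const 0)) (.forLt 12 4 (.forLt 13 4
    (.ite (.and (.test (.eq (.reg 20) (.const 0))) φ)
      (.seq (.set 20 (.const 1)) (.seq (.set 21 (.reg 12)) (.set 22 (.reg 13)))) .skip)))

/-- The outcome of a search. -/
def SearchResult (m : ℕ) (Q : ℕ → ℕ → Prop) (τ : Store) : Prop :=
  (τ.reg 20 = 0 ∧ ∀ i < m, ∀ j < m, ¬ Q i j) ∨
    (τ.reg 20 = 1 ∧ τ.reg 21 < m ∧ τ.reg 22 < m ∧ Q (τ.reg 21) (τ.reg 22) ∧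
      ∀ i < τ.reg 21, ∀ j < m, ¬ Q i j)

theorem run_search {φ : Fml} {σ : Store} {Q : ℕ → ℕ → Prop}
    (hφ : ∀ i j τ, i < σ.reg 4 → j < σ.reg 4 → τ.reg 12 = i → τ.reg 13 = j →
      Frame (search φ) σ τ → (φ.Holds 0 τ ↔ Q i j)) :
    SearchResult (σ.reg 4) Q ((search φ).run σ) := by
  classical
  set body : HProg := .ite (.and (.test (.eq (.reg 20) (.const 0))) φ)
      (.seq (.set 20 (.const 1)) (.seq (.set 21 (.reg 12)) (.set 22 (.reg 13)))) .skip
  set m := σ.reg 4 with hm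
  set σ' := σ.setReg 20 0 with hσ'
  have hm' : σ'.reg 4 = m := by simp [hσ', hm]
  -- the pairs before `(k, l)` have been searched
  let I : ℕ → ℕ → Store → Prop := fun k l τ =>
    (τ.reg 20 = 0 ∧ ∀ i < m, ∀ j < m, i < k ∨ (i = k ∧ j < l) → ¬ Q i j) ∨
      (τ.reg 20 = 1 ∧ τ.reg 21 < m ∧ τ.reg 22 < m ∧ Q (τ.reg 21) (τ.reg 22) ∧
        ∀ i < τ.reg 21, ∀ j < m, ¬ Q i j)
  have hI : ∀ k l τ x v, x ≠ 20 → x ≠ 21 → x ≠ 22 → I k l τ → I k l (τ.setReg x v) := by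
    intro k l τ x v h1 h2 h3 h
    simpa only [I, setReg_reg, h1.symm, h2.symm, h3.symm, if_false] using h
  have h := run_forLt (x := 12) (b := 4) (P := .forLt 13 4 body) (σ := σ')
    (fun k τ => I k 0 τ) (Or.inl ⟨by simp [hσ'], fun i _ j _ h => by omega⟩) (by
      intro k τ hk h12 hf hIk
      rw [hm'] at hk
      refine hI _ _ _ _ _ (by decide) (by decide) (by decide) ?_
      have h4 : τ.reg 4 = m := by rw [hf.reg 4 rfl, hm']
      have h' := run_forLt (x := 13) (b := 4) (P := body) (σ := τ) (fun l υ => I k l υ)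
        (hI _ _ _ _ _ (by decide) (by decide) (by decide) hIk) (by
          intro l υ hl h13 hg hIl
          rw [h4] at hl
          refine hI _ _ _ _ _ (by decide) (by decide) (by decide) ?_
          have h12' : υ.reg 12 = k := by rw [hg.reg 12 rfl, h12]
          have hφ' := hφ k l υ hk hl h12' h13 ⟨fun z hz => by
            have hz0 := hz
            simp only [search, HProg.writesReg, Bool.or_eq_false_iff, beq_eq_false_iff_ne] at hz
            rw [hg.reg z, hf.reg z]
            · simp [hσ', hz.1]
            · exact (Bool.or_eq_false_iff.1 hz0).2
            · have := (Bool.or_eq_false_iff.1 hz0).2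
              exact (Bool.or_eq_false_iff.1 this).2, fun z hz => by
            rw [hg.arr z rfl, hf.arr z rfl]
            rfl⟩
          rcases hIl with ⟨h0, hno⟩ | h1
          · by_cases hq : Q k l
            · right
              have hφ2 := hφ'.2 hq
              have : body.run υ = ((υ.setReg 20 1).setReg 21 k).setReg 22 l := by
                simp [body, HProg.run, Fml.Holds, Test.Holds, Expr.val, h0, hφ2, h12', h13]
              rw [this]
              simp only [setReg_reg]
              simp only [if_true, reduceIte, Nat.reduceEqDiff]
              refine ⟨trivial, hk, hl, hq, fun i hi j hj => ?_⟩
              exact hno i (hi.trans hk) j hj (Or.inl hi)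
            · left
              have hφ2 : ¬ φ.Holds 0 υ := fun h => hq (hφ'.1 h)
              have : body.run υ = υ := by
                simp [body, HProg.run, Fml.Holds, hφ2]
              rw [this]
              refine ⟨h0, fun i hi j hj hij => ?_⟩
              by_cases he : i = k ∧ j = l
              · rw [he.1, he.2]
                exact hq
              · exact hno i hi j hj (by omega)
          · right
            have : body.run υ = υ := by
              simp [body, HProg.run, Fml.Holds, Test.Holds, Expr.val, h1.1]
            rw [this]
            exact h1)
      rw [h4] at h'
      rcases h' with ⟨h0, hno⟩ | h1
      · exact Or.inl ⟨h0, fun i hi j hj hij => hno i hi j hj (by omega)⟩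
      · exact Or.inr h1)
  rw [hm'] at h
  have hrun : (search φ).run σ = (HProg.forLt 12 4 (.forLt 13 4 body)).run σ' := rfl
  rw [hrun]
  rcases h with ⟨h0, hno⟩ | h1
  · exact Or.inl ⟨h0, fun i hi j hj => hno i hi j hj (Or.inl hi)⟩
  · exact Or.inr h1

/-- The program is run as many times as there are pairs of members. -/
def iterate (P : HProg) : HProg := .forLt 8 4 (.forLt 9 4 P)

theorem run_iterate {P : HProg} {σ : Store} {m : ℕ} (I : ℕ → Store → Prop)
    (hm : ∀ k τ, I k τ → τ.reg 4 = m)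
    (hI : ∀ k τ x v, x = 8 ∨ x = 9 → I k τ → I k (τ.setReg x v)) (h0 : I 0 σ)
    (hP : ∀ k τ, I k τ → I (k + 1) (P.run τ)) : I (m * m) ((iterate P).run σ) := by
  have h := run_forLt (x := 8) (b := 4) (P := .forLt 9 4 P) (σ := σ) (fun k τ => I (k * m) τ)
    (by simpa using hI _ _ _ _ (Or.inl rfl) h0) (by
      intro k τ _ _ _ hk
      refine hI _ _ _ _ (Or.inl rfl) ?_
      have h' := run_forLt (x := 9) (b := 4) (P := P) (σ := τ) (fun l υ => I (k * m + l) υ)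
        (hI _ _ _ _ (Or.inr rfl) hk) (by
          intro l υ _ _ _ hl
          exact hI _ _ _ _ (Or.inr rfl) (hP _ _ hl))
      rw [hm _ _ hk] at h'
      rwa [Nat.succ_mul])
  rwa [hm _ _ h0] at h

/-- The cell of the array `a` with the indices in the registers `x` and `y` holds `k`. -/
def Fml.is (a x y k : ℕ) : Fml := .test (.eq (.cell a (.reg x) (.reg y)) (.const k))

/-- Disjunction. -/
def Fml.or (φ ψ : Fml) : Fml := .neg (.and (.neg φ) (.neg ψ))

@[simp] theorem Fml.holds_is {d : ℕ} {σ : Store} {a x y k : ℕ} :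
    (Fml.is a x y k).Holds d σ ↔ σ.arr a (σ.reg x) (σ.reg y) = k := Iff.rfl

@[simp] theorem Fml.holds_or {d : ℕ} {σ : Store} {φ ψ : Fml} :
    (Fml.or φ ψ).Holds d σ ↔ φ.Holds d σ ∨ ψ.Holds d σ := by
  simp only [Fml.or, Fml.Holds]
  tauto

@[simp] theorem Fml.holds_and {d : ℕ} {σ : Store} {φ ψ : Fml} :
    (Fml.and φ ψ).Holds d σ ↔ φ.Holds d σ ∧ ψ.Holds d σ := Iff.rfl

@[simp] theorem Fml.holds_neg {d : ℕ} {σ : Store} {φ : Fml} :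
    (Fml.neg φ).Holds d σ ↔ ¬ φ.Holds d σ := Iff.rfl

@[simp] theorem Fml.holds_ex {d : ℕ} {σ : Store} {b : ℕ} {φ : Fml} :
    (Fml.ex b φ).Holds d σ ↔ ∃ k < σ.reg b, φ.Holds (d + 1) (σ.setReg (101 + 2 * d) k) := Iff.rfl

/-- The registers `x` and `y` hold the same number. -/
def Fml.same (x y : ℕ) : Fml := .test (.eq (.reg x) (.reg y))

@[simp] theorem Fml.holds_same {d : ℕ} {σ : Store} {x y : ℕ} :
    (Fml.same x y).Holds d σ ↔ σ.reg x = σ.reg y := Iff.rfl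

/-- The assertion `φ` or its negation. -/
def Fml.signed (b : Bool) (φ : Fml) : Fml := if b then φ else .neg φ

@[simp] theorem Fml.holds_signed {d : ℕ} {σ : Store} {b : Bool} {φ : Fml} :
    (Fml.signed b φ).Holds d σ ↔ (φ.Holds d σ ↔ b = true) := by
  cases b <;> simp [Fml.signed]

@[simp] theorem run_seq (P Q : HProg) (σ : Store) : (HProg.seq P Q).run σ = Q.run (P.run σ) := rfl

@[simp] theorem run_put (a : ℕ) (i j e : Expr) (σ : Store) :
    (HProg.put a i j e).run σ = σ.setCell a (i.val σ) (j.val σ) (e.val σ) := rfl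

@[simp] theorem run_set (x : ℕ) (e : Expr) (σ : Store) :
    (HProg.set x e).run σ = σ.setReg x (e.val σ) := rfl

@[simp] theorem run_skip (σ : Store) : HProg.skip.run σ = σ := rfl

theorem run_ite_pos {φ : Fml} {P Q : HProg} {σ : Store} (h : φ.Holds 0 σ) :
    (HProg.ite φ P Q).run σ = P.run σ := by simp [HProg.run, h]

theorem run_ite_neg {φ : Fml} {P Q : HProg} {σ : Store} (h : ¬ φ.Holds 0 σ) :
    (HProg.ite φ P Q).run σ = Q.run σ := by simp [HProg.run, h]

end RAM

namespace RAM

open CutFamily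

variable {W κ : Type*} {part : W → κ} {f : ℕ → Set W} {m : ℕ} {enc : W → ℕ} {σ τ : Store}

/-! ### Cutting supports and quadrants on the machine -/

/-- The memory holds the family `f 0, …, f (m - 1)` of subsets of `W`: the elements of `W` are
numbered by `enc`, row `i` of the array `3` is the characteristic vector of `f i`, and the array `4`
tells which elements belong to the same part. -/
structure Encodes (part : W → κ) (f : ℕ → Set W) (m : ℕ) (enc : W → ℕ) (σ : Store) : Prop where
  reg4 : σ.reg 4 = m
  lt : ∀ w, enc w < σ.reg 5
  surj : ∀ v < σ.reg 5, ∃ w, enc w = v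
  inj : Function.Injective enc
  mem : ∀ i < m, ∀ w, σ.arr 3 i (enc w) = 1 ↔ w ∈ f i
  part_iff : ∀ u w, σ.arr 4 0 (enc u) = σ.arr 4 0 (enc w) ↔ part u = part w

/-- The array in which the quadrants of a given kind are recorded. -/
def quadArr : Bool → Bool → ℕ
  | true, true => 6
  | true, false => 7
  | false, true => 8
  | false, false => 9

/-- The cutting supports have been stored in the array `5` and the quadrants in the arrays `6` to
`9`. -/
structure Prepared (part : W → κ) (f : ℕ → Set W) (m : ℕ) (enc : W → ℕ) (σ : Store) : Prop
    extends Encodes part f m enc σ where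
  supp : ∀ i < m, ∀ w, σ.arr 5 i (enc w) = 1 ↔ w ∈ CutFamily.supp part (f i)
  quad : ∀ i < m, ∀ j < m, ∀ a b,
    σ.arr (quadArr a b) i j = 1 ↔ Quadrant part (f i) (f j) a b

theorem Encodes.exists_iff (h : Encodes part f m enc σ) {p : ℕ → Prop} :
    (∃ v < σ.reg 5, p v) ↔ ∃ w, p (enc w) := by
  constructor
  · rintro ⟨v, hv, hp⟩
    obtain ⟨w, rfl⟩ := h.surj v hv
    exact ⟨w, hp⟩
  · rintro ⟨w, hp⟩
    exact ⟨_, h.lt w, hp⟩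

theorem Encodes.frame (h : Encodes part f m enc σ) (h4 : τ.reg 4 = σ.reg 4)
    (h5 : τ.reg 5 = σ.reg 5) (a3 : τ.arr 3 = σ.arr 3) (a4 : τ.arr 4 = σ.arr 4) :
    Encodes part f m enc τ where
  reg4 := h4.trans h.reg4
  lt := h5 ▸ h.lt
  surj := h5 ▸ h.surj
  inj := h.inj
  mem := a3 ▸ h.mem
  part_iff := a4 ▸ h.part_iff

/-- The program does not write to the registers and arrays of the prepared data. -/
def keeps (P : HProg) : Bool :=
  !P.writesReg 4 && !P.writesReg 5 && !P.writesArr 3 && !P.writesArr 4 && !P.writesArr 5 &&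
    !P.writesArr 6 && !P.writesArr 7 && !P.writesArr 8 && !P.writesArr 9

theorem Prepared.frame {P : HProg} (h : Prepared part f m enc σ) (hP : keeps P = true)
    (hf : Frame P σ τ) : Prepared part f m enc τ := by
  simp only [keeps, Bool.and_eq_true, Bool.not_eq_true'] at hP
  obtain ⟨⟨⟨⟨⟨⟨⟨⟨h4, h5⟩, a3⟩, a4⟩, a5⟩, a6⟩, a7⟩, a8⟩, a9⟩ := hP
  refine { toEncodes := h.toEncodes.frame (hf.reg _ h4) (hf.reg _ h5) (hf.arr _ a3) (hf.arr _ a4)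
           supp := hf.arr _ a5 ▸ h.supp, quad := ?_ }
  intro i hi j hj a b
  rw [← h.quad i hi j hj a b, hf.arr]
  cases a <;> cases b <;> assumption

/-- The computation of the cutting supports. -/
def suppProg : HProg := fill 5 4 5 (.ex 5 (.and
  (.test (.eq (.cell 4 (.const 0) (.reg 101)) (.cell 4 (.const 0) (.reg 11))))
  (.or (.and (.is 3 10 101 1) (.neg (.is 3 10 11 1)))
    (.and (.neg (.is 3 10 101 1)) (.is 3 10 11 1)))))

theorem run_suppProg (h : Encodes part f m enc σ) :
    ∀ i < m, ∀ w, (suppProg.run σ).arr 5 i (enc w) = 1 ↔ w ∈ CutFamily.supp part (f i) := by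
  intro i hi w
  rw [suppProg, run_fill (Q := fun i v => ∃ u, σ.arr 4 0 (enc u) = σ.arr 4 0 v ∧
    (σ.arr 3 i (enc u) = 1 ∧ ¬ σ.arr 3 i v = 1 ∨ ¬ σ.arr 3 i (enc u) = 1 ∧ σ.arr 3 i v = 1))
    (by decide) ?_ (h.reg4 ▸ hi) (h.lt w)]
  · simp only [h.part_iff, h.mem i hi, mem_supp_iff]
    constructor
    · rintro ⟨u, hu, ⟨h1, h2⟩ | ⟨h1, h2⟩⟩
      · exact ⟨⟨u, h1, hu⟩, ⟨w, h2, rfl⟩⟩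
      · exact ⟨⟨w, h2, rfl⟩, ⟨u, h1, hu⟩⟩
    · rintro ⟨⟨u, h1, h2⟩, ⟨u', h3, h4⟩⟩
      by_cases hw : w ∈ f i
      · exact ⟨u', h4, Or.inr ⟨h3, hw⟩⟩
      · exact ⟨u, h2, Or.inl ⟨h1, hw⟩⟩
  · intro i j τ hi hj h10 h11 hf
    have h5 : τ.reg 5 = σ.reg 5 := hf.reg 5 rfl
    have a3 : τ.arr 3 = σ.arr 3 := hf.arr 3 rfl
    have a4 : τ.arr 4 = σ.arr 4 := hf.arr 4 rfl
    rw [Fml.holds_ex, h5, h.exists_iff]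
    simp [Fml.Holds, Test.Holds, Expr.val, h10, h11, a3, a4]

/-- The computation of the quadrants of one kind. -/
def quadProg (a b : Bool) : HProg := fill (quadArr a b) 4 4 (.ex 5 (.and
  (.and (.is 5 10 101 1) (.is 5 11 101 1))
  (.and (.signed a (.is 3 10 101 1)) (.signed b (.is 3 11 101 1)))))

theorem run_quadProg (h : Encodes part f m enc σ)
    (hs : ∀ i < m, ∀ w, σ.arr 5 i (enc w) = 1 ↔ w ∈ CutFamily.supp part (f i)) (a b : Bool) :
    ∀ i < m, ∀ j < m, ((quadProg a b).run σ).arr (quadArr a b) i j = 1 ↔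
      Quadrant part (f i) (f j) a b := by
  intro i hi j hj
  rw [quadProg, run_fill (Q := fun i j => Quadrant part (f i) (f j) a b)
    (by decide) ?_ (h.reg4 ▸ hi) (h.reg4 ▸ hj)]
  intro i j τ hi hj h10 h11 hf
  rw [h.reg4] at hi hj
  have h5 : τ.reg 5 = σ.reg 5 := hf.reg 5 rfl
  have a3 : τ.arr 3 = σ.arr 3 := hf.arr 3 (by cases a <;> cases b <;> rfl)
  have a5 : τ.arr 5 = σ.arr 5 := hf.arr 5 (by cases a <;> cases b <;> rfl)
  rw [Fml.holds_ex, h5, h.exists_iff]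
  simp [h10, h11, a3, a5, hs i hi, hs j hj, h.mem i hi, h.mem j hj, Quadrant, supp₂]

/-- The computation of the cutting supports and of the quadrants. -/
def prepProg : HProg := .seq suppProg (.seq (quadProg true true) (.seq (quadProg true false)
  (.seq (quadProg false true) (quadProg false false))))

theorem prepared_run (h : Encodes part f m enc σ) :
    Prepared part f m enc (prepProg.run σ) := by
  have hf := frame_run prepProg σ
  have step : ∀ {υ : Store} (P : HProg), P.writesReg 4 = false → P.writesReg 5 = false →
      P.writesArr 3 = false → P.writesArr 4 = false → Encodes part f m enc υ →
      Encodes part f m enc (P.run υ) := fun P h4 h5 a3 a4 h =>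
    have hf := frame_run P _
    h.frame (hf.reg 4 h4) (hf.reg 5 h5) (hf.arr 3 a3) (hf.arr 4 a4)
  have s0 := run_suppProg h
  have e0 := step suppProg rfl rfl rfl rfl h
  have q1 := run_quadProg e0 s0 true true
  have e1 := step (quadProg true true) rfl rfl rfl rfl e0
  have s1 := (frame_run (quadProg true true) _).arr 5 rfl ▸ s0
  have q2 := run_quadProg e1 s1 true false
  have e2 := step (quadProg true false) rfl rfl rfl rfl e1
  have s2 := (frame_run (quadProg true false) _).arr 5 rfl ▸ s1
  have q3 := run_quadProg e2 s2 false true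
  have e3 := step (quadProg false true) rfl rfl rfl rfl e2
  have s3 := (frame_run (quadProg false true) _).arr 5 rfl ▸ s2
  have q4 := run_quadProg e3 s3 false false
  have e4 := step (quadProg false false) rfl rfl rfl rfl e3
  have s4 := (frame_run (quadProg false false) _).arr 5 rfl ▸ s3
  refine { toEncodes := e4, supp := s4, quad := fun i hi j hj a b => ?_ }
  cases a <;> cases b
  · exact q4 i hi j hj
  · rw [← q3 i hi j hj, prepProg]
    simp only [run_seq]
    rw [(frame_run (quadProg false false) _).arr (quadArr false true) rfl]
  · rw [← q2 i hi j hj, prepProg]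
    simp only [run_seq]
    rw [(frame_run (quadProg false false) _).arr (quadArr true false) rfl,
      (frame_run (quadProg false true) _).arr (quadArr true false) rfl]
  · rw [← q1 i hi j hj, prepProg]
    simp only [run_seq]
    rw [(frame_run (quadProg false false) _).arr (quadArr true true) rfl,
      (frame_run (quadProg false true) _).arr (quadArr true true) rfl,
      (frame_run (quadProg true false) _).arr (quadArr true true) rfl]

/-- The quadrant of the given kind is nonempty. -/
def Fml.quad (x y : ℕ) (a b : Bool) : Fml := .is (quadArr a b) x y 1

/-- The two members have a common cut part. -/
def Fml.meets (x y : ℕ) : Fml := .or (.or (.quad x y true true) (.quad x y true false))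
  (.or (.quad x y false true) (.quad x y false false))

/-- The prescribed label is `d`. -/
def Fml.fixedLabel (x y : ℕ) (d : Bool) : Fml :=
  .or (.and (.neg (.quad x y (!d) true)) (.quad x y d false))
    (.and (.neg (.quad x y (!d) false)) (.quad x y d true))

/-- The sign of the swapped edge is `b`. -/
def Fml.swapSign (x y : ℕ) (b : Bool) : Fml :=
  .and (.meets x y) (.or (.neg (.quad x y true (!b))) (.neg (.quad x y false b)))

section

variable {x y d : ℕ}

theorem Prepared.holds_quad (h : Prepared part f m enc σ) (hx : σ.reg x < m) (hy : σ.reg y < m)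
    {a b : Bool} :
    (Fml.quad x y a b).Holds d σ ↔ Quadrant part (f (σ.reg x)) (f (σ.reg y)) a b :=
  h.quad _ hx _ hy a b

theorem Prepared.holds_meets (h : Prepared part f m enc σ) (hx : σ.reg x < m)
    (hy : σ.reg y < m) :
    (Fml.meets x y).Holds d σ ↔ (supp₂ part (f (σ.reg x)) (f (σ.reg y))).Nonempty := by
  simp only [Fml.meets, Fml.holds_or, h.holds_quad hx hy, supp₂_nonempty_iff, Bool.exists_bool]
  tauto

theorem Prepared.holds_fixedLabel (h : Prepared part f m enc σ) (hx : σ.reg x < m)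
    (hy : σ.reg y < m) {b : Bool} :
    (Fml.fixedLabel x y b).Holds d σ ↔ FixedLabel part (f (σ.reg x)) (f (σ.reg y)) b := by
  simp only [Fml.fixedLabel, Fml.holds_or, Fml.holds_and, Fml.holds_neg, h.holds_quad hx hy,
    FixedLabel, Bool.exists_bool, Bool.not_true, Bool.not_false]
  tauto

theorem Prepared.holds_swapSign (h : Prepared part f m enc σ) (hx : σ.reg x < m)
    (hy : σ.reg y < m) {b : Bool} :
    (Fml.swapSign x y b).Holds d σ ↔ SwapSign part (f (σ.reg x)) (f (σ.reg y)) b := by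
  simp only [Fml.swapSign, Fml.holds_or, Fml.holds_and, Fml.holds_neg, h.holds_quad hx hy,
    h.holds_meets hx hy, SwapSign, Bool.exists_bool, Bool.true_xor, Bool.false_xor]
  tauto

end

/-- Some pair of members is not comparable. -/
def Fml.incomparable : Fml := .ex 4 (.ex 4 (.and (.and (.quad 101 103 true true)
  (.quad 101 103 true false)) (.and (.quad 101 103 false true) (.quad 101 103 false false))))

theorem Prepared.holds_incomparable (h : Prepared part f m enc σ) :
    Fml.incomparable.Holds 0 σ ↔ ¬ PairwiseComparable part (f '' Set.Iio m) := by
  rw [not_pairwiseComparable_iff]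
  simp only [Fml.incomparable, Fml.holds_ex, Fml.holds_and, Fml.quad, Fml.holds_is, setReg_reg,
    setReg_arr]
  simp only [Nat.reduceAdd, Nat.reduceMul, Nat.reduceEqDiff, if_true, if_false, h.reg4,
    Set.exists_mem_image, Set.mem_Iio, Bool.forall_bool]
  refine exists_congr fun i => and_congr_right fun hi => exists_congr fun j =>
    and_congr_right fun hj => ?_
  rw [h.quad i hi j hj, h.quad i hi j hj, h.quad i hi j hj, h.quad i hi j hj]
  tauto

end RAM

namespace RAM

open CutFamily

variable {W κ : Type*} {part : W → κ} {f : ℕ → Set W} {m : ℕ} {enc : W → ℕ} {σ τ : Store}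

/-! ### The greedy labeling on the machine -/

/-- The number that stands for a label; `0` stands for the absence of a label. -/
def code (b : Bool) : ℕ := if b then 2 else 1

/-- The label of a node is stored in the array `10`. -/
def Lab (σ : Store) (p : ℕ × ℕ) (b : Bool) : Prop := σ.arr 10 p.1 p.2 = code b

/-- The array `11` tells which nodes have been processed. -/
def Don (σ : Store) (p : ℕ × ℕ) : Prop := σ.arr 11 p.1 p.2 = 1

theorem code_injective {a b : Bool} (h : code a = code b) : a = b := by
  cases a <;> cases b <;> simp [code] at h ⊢

theorem lab_congr (h : τ.arr 10 = σ.arr 10) : Lab τ = Lab σ := by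
  unfold Lab
  rw [h]

theorem don_congr (h : τ.arr 11 = σ.arr 11) : Don τ = Don σ := by
  unfold Don
  rw [h]

/-- A label is given to an unlabeled node. -/
theorem lab_setCell {i j : ℕ} {b : Bool} (h : ∀ c, ¬ Lab σ (i, j) c) (p : ℕ × ℕ) (c : Bool) :
    Lab (σ.setCell 10 i j (code b)) p c ↔ Lab σ p c ∨ (p = (i, j) ∧ c = b) := by
  obtain ⟨i', j'⟩ := p
  simp only [Lab, setCell_arr, true_and, Prod.mk.injEq]
  by_cases hp : i' = i ∧ j' = j
  · obtain ⟨rfl, rfl⟩ := hp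
    have := h c
    simp only [Lab] at this
    simp only [and_self, if_true, true_and, this, false_or]
    exact ⟨fun h => (code_injective h).symm, fun h => by rw [h]⟩
  · simp [hp]

/-- The node has a label. -/
def Fml.labeled (x y : ℕ) : Fml := .or (.is 10 x y 1) (.is 10 x y 2)

@[simp] theorem Fml.holds_labeled {d x y : ℕ} :
    (Fml.labeled x y).Holds d σ ↔ ∃ c, Lab σ (σ.reg x, σ.reg y) c := by
  simp [Fml.labeled, Lab, code]

/-- The prescribed labels are entered. -/
def labelInit : HProg := .forLt 10 4 (.forLt 11 4
  (.ite (.and (.neg (.same 10 11)) (.fixedLabel 10 11 true))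
    (.put 10 (.reg 10) (.reg 11) (.const 2))
    (.ite (.and (.neg (.same 10 11)) (.fixedLabel 10 11 false))
      (.put 10 (.reg 10) (.reg 11) (.const 1)) (.put 10 (.reg 10) (.reg 11) (.const 0)))))

theorem partial_labelInit (h : Prepared part f m enc σ) (h10 : σ.arr 10 = fun _ _ => 0)
    (h11 : σ.arr 11 = fun _ _ => 0) :
    (lcSigned part f m).Partial (Lab (labelInit.run σ)) (Don (labelInit.run σ)) := by
  classical
  have key := run_forLt_forLt (σ := σ) (a := 10) (x := 10) (y := 11) (b := 4) (c := 4)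
    (P := .ite (.and (.neg (.same 10 11)) (.fixedLabel 10 11 true))
      (.put 10 (.reg 10) (.reg 11) (.const 2))
      (.ite (.and (.neg (.same 10 11)) (.fixedLabel 10 11 false))
        (.put 10 (.reg 10) (.reg 11) (.const 1)) (.put 10 (.reg 10) (.reg 11) (.const 0))))
    (fun i j => if i ≠ j ∧ FixedLabel part (f i) (f j) true then 2 else
      if i ≠ j ∧ FixedLabel part (f i) (f j) false then 1 else 0)
    ⟨by decide, rfl, by decide⟩ ⟨by decide, rfl⟩ (by
      intro i j τ hi hj hr10 hr11 hf i' j'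
      rw [h.reg4] at hi hj
      have hτ : Prepared part f m enc τ := h.frame rfl hf
      have e : ∀ b, (Fml.and (.neg (.same 10 11)) (.fixedLabel 10 11 b)).Holds 0 τ ↔
          i ≠ j ∧ FixedLabel part (f i) (f j) b := fun b => by
        rw [Fml.holds_and, Fml.holds_neg, Fml.holds_same,
          hτ.holds_fixedLabel (hr10 ▸ hi) (hr11 ▸ hj), hr10, hr11]
      by_cases h1 : i ≠ j ∧ FixedLabel part (f i) (f j) true
      · rw [run_ite_pos ((e _).2 h1)]
        simp [Expr.val, hr10, hr11, h1]
      · rw [run_ite_neg (mt (e _).1 h1), if_neg h1]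
        by_cases h2 : i ≠ j ∧ FixedLabel part (f i) (f j) false
        · rw [run_ite_pos ((e _).2 h2)]
          simp [Expr.val, hr10, hr11, h2]
        · rw [run_ite_neg (mt (e _).1 h2), if_neg h2]
          simp [Expr.val, hr10, hr11])
  have key' : ∀ i j, (labelInit.run σ).arr 10 i j = if i < m ∧ j < m then
      (if i ≠ j ∧ FixedLabel part (f i) (f j) true then 2 else
        if i ≠ j ∧ FixedLabel part (f i) (f j) false then 1 else 0) else 0 := by
    intro i j
    rw [labelInit, key, h.reg4, h10]
  have hlab : ∀ p c, Lab (labelInit.run σ) p c → (lcSigned part f m).fixed p c := by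
    rintro ⟨i, j⟩ c hp
    simp only [Lab, key', code] at hp
    split_ifs at hp with h1 h2 h3 h4 h5 h6 h7
    all_goals first | omega | skip
    · subst h3
      exact ⟨⟨h1.1, h1.2, h2.1⟩, h2.2⟩
    · rw [Bool.not_eq_true] at h5
      subst h5
      exact ⟨⟨h1.1, h1.2, h4.1⟩, h4.2⟩
  have hfix : ∀ p c, (lcSigned part f m).fixed p c → ∃ c, Lab (labelInit.run σ) p c := by
    rintro ⟨i, j⟩ c ⟨⟨hi, hj, hij⟩, hc⟩
    dsimp only at hi hj hij hc
    by_cases h1 : FixedLabel part (f i) (f j) true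
    · exact ⟨true, by simp [Lab, key', hi, hj, hij, h1, code]⟩
    · cases c with
      | true => exact absurd hc h1
      | false => exact ⟨false, by simp [Lab, key', hi, hj, hij, h1, hc, code]⟩
  have hdon : ∀ p, ¬ Don (labelInit.run σ) p := by
    intro p
    rw [don_congr ((frame_run labelInit σ).arr 11 rfl), Don, h11]
    simp
  exact {
    mem := fun p c hp => (lcSigned part f m).mem_of_fixed _ _ (hlab p c hp)
    fixed := hfix
    lab_of_done := fun p hp => absurd hp (hdon p)
    nbr_of_done := fun p hp => absurd hp (hdon p)
    extends_ := fun s hs => ⟨s, hs, fun p c hp => hs.1 p c (hlab p c hp)⟩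
    rooted := fun p c hp => Or.inl ⟨p, c, .refl, hlab p c hp⟩ }

/-- The label of the node `(21, 22)` is passed on to the swapped node. -/
def swapStep : HProg := .ite (.and (.neg (.labeled 22 21)) (.meets 21 22))
  (.ite (.swapSign 21 22 false)
    (.put 10 (.reg 22) (.reg 21) (.cell 10 (.reg 21) (.reg 22)))
    (.ite (.is 10 21 22 1) (.put 10 (.reg 22) (.reg 21) (.const 2))
      (.put 10 (.reg 22) (.reg 21) (.const 1)))) .skip

/-- There is a prefixed edge between the nodes `(21, 22)` and `(21, 14)`. -/
def Fml.prefixed : Fml :=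
  .ex 5 (.and (.and (.is 5 22 101 1) (.is 5 14 101 1)) (.neg (.is 5 21 101 1)))

/-- The label of the node `(21, 22)` is passed on along the prefixed edges. -/
def prefixStep : HProg := .forLt 14 4 (.ite (.and (.and (.neg (.same 14 21))
    (.neg (.labeled 21 14))) .prefixed)
  (.put 10 (.reg 21) (.reg 14) (.cell 10 (.reg 21) (.reg 22))) .skip)

/-- The label of the node `(21, 22)` is passed on to its neighbours. -/
def propagate : HProg :=
  .seq (.put 11 (.reg 21) (.reg 22) (.const 1)) (.seq swapStep prefixStep)

section

variable (h : Prepared part f m enc σ) (hc : PairwiseComparable part (f '' Set.Iio m))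
  {i j : ℕ} (hi : i < m) (hj : j < m) (hij : i ≠ j) (h21 : σ.reg 21 = i) (h22 : σ.reg 22 = j)
  {d : Bool} (hd : Lab σ (i, j) d)

include h hc hi hj hij h21 h22 hd in
theorem run_swapStep :
    (∀ p c, Lab σ p c → Lab (swapStep.run σ) p c) ∧
    (∀ p c, Lab (swapStep.run σ) p c → Lab σ p c ∨
      ∃ b, (lcSigned part f m).adj (i, j) p b ∧ c = xor d b) ∧
    ((supp₂ part (f i) (f j)).Nonempty → ∃ c, Lab (swapStep.run σ) (j, i) c) := by
  have hm := h.holds_meets (d := 0) (h21 ▸ hi) (h22 ▸ hj)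
  have hs := h.holds_swapSign (d := 0) (h21 ▸ hi) (h22 ▸ hj) (b := false)
  rw [h21, h22] at hm hs
  have hval : σ.arr 10 i j = code d := hd
  by_cases hcond : (∀ c, ¬ Lab σ (j, i) c) ∧ (supp₂ part (f i) (f j)).Nonempty
  · -- the new label is correct
    have hrun : ∃ b, SwapSign part (f i) (f j) b ∧
        swapStep.run σ = σ.setCell 10 j i (code (xor d b)) := by
      rw [swapStep, run_ite_pos (by simp [h21, h22, hm, hcond])]
      by_cases hb : SwapSign part (f i) (f j) false
      · refine ⟨false, hb, ?_⟩
        rw [run_ite_pos (hs.2 hb)]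
        simp [Expr.val, h21, h22, hval]
      · refine ⟨true, ?_, ?_⟩
        · have hq : ¬ ∀ a b, Quadrant part (f i) (f j) a b := fun hq =>
            (not_pairwiseComparable_iff (F := f '' Set.Iio m)).2 ⟨f i, ⟨i, hi, rfl⟩, f j, ⟨j, hj, rfl⟩, hq⟩ hc
          push Not at hq
          obtain ⟨a, b, hq⟩ := hq
          refine ⟨hcond.2, a, ?_⟩
          obtain rfl | rfl : b = a ∨ b = !a := by cases a <;> cases b <;> simp
          · exact absurd ⟨hcond.2, b, by simpa using hq⟩ hb
          · simpa using hq
        · rw [run_ite_neg (fun h => hb (hs.1 h))]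
          cases d with
          | false =>
            rw [run_ite_pos (by simp [h21, h22, hval, code])]
            simp [Expr.val, h21, h22, code]
          | true =>
            rw [run_ite_neg (by simp [h21, h22, hval, code])]
            simp [Expr.val, h21, h22, code]
    obtain ⟨b, hb, hrun⟩ := hrun
    rw [hrun]
    refine ⟨fun p c hp => (lab_setCell hcond.1 p c).2 (Or.inl hp), fun p c hp => ?_,
      fun _ => ⟨xor d b, (lab_setCell hcond.1 (j, i) _).2 (Or.inr ⟨rfl, rfl⟩)⟩⟩
    rcases (lab_setCell hcond.1 p c).1 hp with h' | ⟨rfl, rfl⟩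
    · exact Or.inl h'
    · exact Or.inr ⟨b, ⟨⟨hi, hj, hij⟩, ⟨hj, hi, hij.symm⟩, Or.inl ⟨rfl, hb⟩⟩, rfl⟩
  · rw [swapStep, run_ite_neg (by simpa [h21, h22, hm] using hcond), run_skip]
    refine ⟨fun _ _ h => h, fun _ _ h => Or.inl h, fun hn => ?_⟩
    by_contra hno
    push Not at hno
    exact hcond ⟨hno, hn⟩

include h hi hj hij h21 h22 hd in
theorem run_prefixStep :
    (∀ p c, Lab σ p c → Lab (prefixStep.run σ) p c) ∧
    (∀ p c, Lab (prefixStep.run σ) p c → Lab σ p c ∨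
      ((lcSigned part f m).adj (i, j) p false ∧ c = d)) ∧
    (∀ k < m, k ≠ i → (supp₂ part (f j) (f k) \ supp part (f i)).Nonempty →
      ∃ c, Lab (prefixStep.run σ) (i, k) c) := by
  have hr := run_forLt (σ := σ) (x := 14) (b := 4) (P := .ite (.and (.and (.neg (.same 14 21))
      (.neg (.labeled 21 14))) .prefixed)
      (.put 10 (.reg 21) (.reg 14) (.cell 10 (.reg 21) (.reg 22))) .skip)
    (fun k τ => (∀ p c, Lab σ p c → Lab τ p c) ∧
      (∀ p c, Lab τ p c → Lab σ p c ∨ ((lcSigned part f m).adj (i, j) p false ∧ c = d)) ∧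
      (∀ k' < k, k' ≠ i → (supp₂ part (f j) (f k') \ supp part (f i)).Nonempty →
        ∃ c, Lab τ (i, k') c)) ⟨fun _ _ h => h, fun _ _ h => Or.inl h, by simp⟩ (by
      rintro k τ hk h14 hf ⟨hI1, hI2, hI3⟩
      rw [h.reg4] at hk
      have hτ : Prepared part f m enc τ := h.frame rfl hf
      have t21 : τ.reg 21 = i := (hf.reg 21 rfl).trans h21
      have t22 : τ.reg 22 = j := (hf.reg 22 rfl).trans h22
      have hval : τ.arr 10 i j = code d := hI1 _ _ hd
      have hpre : Fml.prefixed.Holds 0 τ ↔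
          (supp₂ part (f j) (f k) \ supp part (f i)).Nonempty := by
        rw [Fml.prefixed, Fml.holds_ex, hτ.exists_iff]
        simp [t21, t22, h14, hτ.supp i hi, hτ.supp j hj, hτ.supp k hk, supp₂, Set.Nonempty]
      have hsr : ∀ υ : Store, Lab (υ.setReg 14 (k + 1)) = Lab υ := fun υ => rfl
      rw [hsr]
      by_cases hcond : (k ≠ i ∧ ∀ c, ¬ Lab τ (i, k) c) ∧
          (supp₂ part (f j) (f k) \ supp part (f i)).Nonempty
      · rw [run_ite_pos (by simp [h14, t21, hpre, hcond])]
        have hrun : (HProg.put 10 (.reg 21) (.reg 14) (.cell 10 (.reg 21) (.reg 22))).run τ =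
            τ.setCell 10 i k (code d) := by
          simp [Expr.val, t21, t22, h14, hval]
        rw [hrun]
        have hset := lab_setCell (σ := τ) (b := d) hcond.1.2
        refine ⟨fun p c hp => (hset p c).2 (Or.inl (hI1 p c hp)), fun p c hp => ?_,
          fun k' hk' hne hp => ?_⟩
        · rcases (hset p c).1 hp with h' | ⟨rfl, rfl⟩
          · exact hI2 p c h'
          · exact Or.inr ⟨⟨⟨hi, hj, hij⟩, ⟨hi, hk, hcond.1.1.symm⟩,
              Or.inr ⟨rfl, rfl, hcond.2⟩⟩, rfl⟩
        · by_cases he : k' = k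
          · subst he
            exact ⟨d, (hset _ _).2 (Or.inr ⟨rfl, rfl⟩)⟩
          · exact (hI3 k' (by omega) hne hp).imp fun c hc => (hset _ _).2 (Or.inl hc)
      · rw [run_ite_neg (by simpa [h14, t21, hpre] using hcond), run_skip]
        refine ⟨hI1, hI2, fun k' hk' hne hp => ?_⟩
        by_cases he : k' = k
        · subst he
          by_contra hno
          push Not at hno
          exact hcond ⟨⟨hne, hno⟩, hp⟩
        · exact hI3 k' (by omega) hne hp)
  rw [h.reg4] at hr
  exact hr

include h hc hi hj hij h21 h22 hd in
theorem run_propagate : (lcSigned part f m).Propagates (Lab σ) (Lab (propagate.run σ)) (Don σ)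
    (Don (propagate.run σ)) (i, j) := by
  set σ₁ := (HProg.put 11 (.reg 21) (.reg 22) (.const 1)).run σ with hσ₁
  set σ₂ := swapStep.run σ₁ with hσ₂
  have hrun : propagate.run σ = prefixStep.run σ₂ := rfl
  have f1 : Frame (.put 11 (.reg 21) (.reg 22) (.const 1)) σ σ₁ := frame_run _ _
  have f2 : Frame swapStep σ₁ σ₂ := frame_run _ _
  have p1 : Prepared part f m enc σ₁ := h.frame rfl f1
  have l1 : Lab σ₁ = Lab σ := lab_congr (f1.arr 10 rfl)
  obtain ⟨a1, a2, a3⟩ := run_swapStep p1 hc hi hj hij ((f1.reg 21 rfl).trans h21)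
    ((f1.reg 22 rfl).trans h22) (l1 ▸ hd)
  rw [← hσ₂, l1] at a1 a2
  obtain ⟨b1, b2, b3⟩ := run_prefixStep (p1.frame rfl f2) hi hj hij
    ((f2.reg 21 rfl).trans ((f1.reg 21 rfl).trans h21))
    ((f2.reg 22 rfl).trans ((f1.reg 22 rfl).trans h22)) (a1 _ _ hd)
  rw [hrun]
  refine ⟨⟨d, hd⟩, fun p => ?_, fun p c hp => b1 p c (a1 p c hp), fun p c hp => ?_,
    fun p b hp => ?_⟩
  · rw [don_congr ((frame_run prefixStep σ₂).arr 11 rfl), don_congr (f2.arr 11 rfl)]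
    obtain ⟨i', j'⟩ := p
    simp only [hσ₁, Don, run_put, Expr.val, h21, h22, setCell_arr, true_and, Prod.mk.injEq]
    by_cases hp : i' = i ∧ j' = j <;> simp [hp]
  · rcases b2 p c hp with h' | ⟨h', rfl⟩
    · rcases a2 p c h' with h'' | ⟨b, hb, hc⟩
      · exact Or.inl h''
      · exact Or.inr ⟨b, d, hd, hb, hc⟩
    · exact Or.inr ⟨false, c, hd, h', by simp⟩
  · obtain ⟨i', j'⟩ := p
    obtain ⟨-, hp, ⟨h1, h2⟩ | ⟨h1, -, h2⟩⟩ := hp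
    · simp only [Prod.swap_prod_mk, Prod.mk.injEq] at h1
      obtain ⟨rfl, rfl⟩ := h1
      exact (a3 h2.1).imp fun c hc => b1 _ _ hc
    · dsimp only at h1
      subst h1
      exact b3 j' hp.2.1 hp.2.2.symm h2

end

/-- A label is passed on from a node that has not been processed yet; if there is no such node,
then the first unlabeled seed receives the label `false`, and it is passed on. -/
def labelBody : HProg :=
  .seq (search (.and (.labeled 12 13) (.neg (.is 11 12 13 1))))
    (.seq (.ite (.test (.eq (.reg 20) (.const 0)))
      (.seq (search (.and (.neg (.labeled 12 13)) (.and (.neg (.same 12 13)) (.meets 12 13))))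
        (.ite (.test (.eq (.reg 20) (.const 1)))
          (.put 10 (.reg 21) (.reg 22) (.const 1)) .skip)) .skip)
      (.ite (.test (.eq (.reg 20) (.const 1))) propagate .skip))

/-- All labels have been passed on, and all seeds are labeled. -/
def Finished (part : W → κ) (f : ℕ → Set W) (m : ℕ) (σ : Store) : Prop :=
  SignedGraph.Closed (Lab σ) (Don σ) ∧ ∀ p, (lcSigned part f m).seed p → ∃ c, Lab σ p c

theorem run_labelBody (h : Prepared part f m enc σ)
    (hc : PairwiseComparable part (f '' Set.Iio m))
    (hp : (lcSigned part f m).Partial (Lab σ) (Don σ)) :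
    (lcSigned part f m).Partial (Lab (labelBody.run σ)) (Don (labelBody.run σ)) ∧
      ((¬ Finished part f m σ ∧
          ∃ p, ¬ Don σ p ∧ ∀ q, Don (labelBody.run σ) q ↔ Don σ q ∨ q = p) ∨
        Finished part f m (labelBody.run σ)) := by
  set s1 := search (.and (.labeled 12 13) (.neg (.is 11 12 13 1))) with hs1
  set s2 := search (.and (.neg (.labeled 12 13)) (.and (.neg (.same 12 13)) (.meets 12 13)))
    with hs2
  set σ₁ := s1.run σ with hσ₁
  have f1 : Frame s1 σ σ₁ := frame_run _ _
  have p1 : Prepared part f m enc σ₁ := h.frame rfl f1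
  have l1 : Lab σ₁ = Lab σ := lab_congr (f1.arr 10 rfl)
  have d1 : Don σ₁ = Don σ := don_congr (f1.arr 11 rfl)
  have r1 : SearchResult m (fun i j => (∃ c, Lab σ (i, j) c) ∧ ¬ Don σ (i, j)) σ₁ := by
    rw [← h.reg4]
    refine run_search fun i j τ _ _ h12 h13 hf => ?_
    simp [h12, h13, Don, lab_congr (hf.arr 10 rfl), hf.arr 11 rfl]
  have hrun : ∀ {Q : Store}, (HProg.ite (.test (.eq (.reg 20) (.const 0)))
      (.seq s2 (.ite (.test (.eq (.reg 20) (.const 1)))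
          (.put 10 (.reg 21) (.reg 22) (.const 1)) .skip)) .skip).run σ₁ = Q →
      labelBody.run σ = (HProg.ite (.test (.eq (.reg 20) (.const 1))) propagate .skip).run Q :=
    fun h => h ▸ rfl
  rcases r1 with ⟨h20, hno⟩ | ⟨h20, hi, hj, ⟨⟨d, hd⟩, hnd⟩, -⟩
  · have hcl : SignedGraph.Closed (Lab σ) (Don σ) := fun p c hpc => by
      by_contra hnd
      have := hp.mem p c hpc
      simp only [lcSigned, Finset.mem_offDiag, Finset.mem_range] at this
      exact hno p.1 this.1 p.2 this.2.1 ⟨⟨c, hpc⟩, hnd⟩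
    set σ₂ := s2.run σ₁ with hσ₂
    have f2 : Frame s2 σ₁ σ₂ := frame_run _ _
    have p2 : Prepared part f m enc σ₂ := p1.frame rfl f2
    have l2 : Lab σ₂ = Lab σ := (lab_congr (f2.arr 10 rfl)).trans l1
    have d2 : Don σ₂ = Don σ := (don_congr (f2.arr 11 rfl)).trans d1
    have r2 : SearchResult m (fun i j => (∀ c, ¬ Lab σ (i, j) c) ∧ i ≠ j ∧
        (supp₂ part (f i) (f j)).Nonempty) σ₂ := by
      rw [← p1.reg4]
      refine run_search fun i j τ hi hj h12 h13 hf => ?_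
      rw [p1.reg4] at hi hj
      have hm := (p1.frame rfl hf).holds_meets (x := 12) (y := 13) (d := 0) (h12 ▸ hi) (h13 ▸ hj)
      rw [h12, h13] at hm
      simp [h12, h13, lab_congr (hf.arr 10 rfl), l1, hm]
    have hfirst : (HProg.ite (.test (.eq (.reg 20) (.const 0)))
      (.seq s2 (.ite (.test (.eq (.reg 20) (.const 1)))
          (.put 10 (.reg 21) (.reg 22) (.const 1)) .skip)) .skip).run σ₁ =
        (HProg.ite (.test (.eq (.reg 20) (.const 1)))
          (.put 10 (.reg 21) (.reg 22) (.const 1)) .skip).run σ₂ := by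
      rw [run_ite_pos (by exact h20)]
      rfl
    rcases r2 with ⟨g20, gno⟩ | ⟨g20, hi, hj, ⟨hun, hij, hne⟩, hmin⟩
    · have hne : ¬ (Fml.test (.eq (.reg 20) (.const 1))).Holds 0 σ₂ := by
        simp [Fml.Holds, Test.Holds, Expr.val, g20]
      rw [run_ite_neg hne, run_skip] at hfirst
      rw [hrun hfirst, run_ite_neg hne, run_skip, l2, d2]
      refine ⟨hp, Or.inr ⟨by rwa [l2, d2], fun p hps => ?_⟩⟩
      by_contra hlab
      rw [l2] at hlab
      push Not at hlab
      exact gno p.1 hps.1.1 p.2 hps.1.2.1 ⟨hlab, hps.1.2.2, hps.2⟩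
    · set i := σ₂.reg 21 with hi21
      set j := σ₂.reg 22 with hj22
      have he : (Fml.test (.eq (.reg 20) (.const 1))).Holds 0 σ₂ := g20
      rw [run_ite_pos he, run_put] at hfirst
      simp only [Expr.val, ← hi21, ← hj22] at hfirst
      set σ₃ := σ₂.setCell 10 i j 1 with hσ₃
      have l3 : ∀ p c, Lab σ₃ p c ↔ Lab σ p c ∨ (p = (i, j) ∧ c = false) := by
        rw [← l2] at hun ⊢
        exact lab_setCell (b := false) hun
      have f3 : Frame (.put 10 (.reg 21) (.reg 22) (.const 1)) σ₂ σ₃ := frame_run _ _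
      have d3 : Don σ₃ = Don σ := (don_congr (f3.arr 11 rfl)).trans d2
      have hp3 : (lcSigned part f m).Partial (Lab σ₃) (Don σ₃) := by
        rw [d3]
        refine hp.plant hcl (v := (i, j)) ⟨⟨hi, hj, hij⟩, hne⟩ hun (fun p hps hpl => ?_) l3
        by_contra hlt
        exact hmin p.1 (not_le.1 hlt) p.2 hps.1.2.1 ⟨hpl, hps.1.2.2, hps.2⟩
      have hpr := run_propagate (p2.frame rfl f3) hc hi hj hij (f3.reg 21 rfl) (f3.reg 22 rfl)
        ((l3 (i, j) false).2 (Or.inr ⟨rfl, rfl⟩))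
      rw [hrun hfirst, run_ite_pos (by exact g20)]
      refine ⟨hp3.propagate hpr, Or.inl ⟨fun hF => ?_, (i, j), fun hdon => ?_, fun q => ?_⟩⟩
      · obtain ⟨c, hc⟩ := hF.2 (i, j) ⟨⟨hi, hj, hij⟩, hne⟩
        exact hun c hc
      · obtain ⟨c, hc⟩ := hp.lab_of_done _ hdon
        exact hun c hc
      · rw [hpr.done, d3]
  · have hn : (HProg.ite (.test (.eq (.reg 20) (.const 0)))
      (.seq s2 (.ite (.test (.eq (.reg 20) (.const 1)))
          (.put 10 (.reg 21) (.reg 22) (.const 1)) .skip)) .skip).run σ₁ = σ₁ := by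
      rw [run_ite_neg (by simp [Fml.Holds, Test.Holds, Expr.val, h20]), run_skip]
    rw [hrun hn, run_ite_pos (by exact h20)]
    have hij := hp.mem _ _ hd
    simp only [lcSigned, Finset.mem_offDiag, Finset.mem_range] at hij
    have hpr := run_propagate p1 hc hi hj hij.2.2 rfl rfl (l1 ▸ hd)
    refine ⟨SignedGraph.Partial.propagate (by rw [l1, d1]; exact hp) hpr,
      Or.inl ⟨fun hF => hnd (hF.1 _ _ hd), _, hnd, fun q => ?_⟩⟩
    rw [hpr.done, d1]

/-- The greedy labeling ends after as many steps as there are pairs of members. -/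
theorem run_iterate_labelBody (h : Prepared part f m enc σ)
    (hc : PairwiseComparable part (f '' Set.Iio m))
    (hp : (lcSigned part f m).Partial (Lab σ) (Don σ)) :
    (lcSigned part f m).Partial (Lab ((iterate labelBody).run σ))
      (Don ((iterate labelBody).run σ)) ∧ Finished part f m ((iterate labelBody).run σ) := by
  have hfin : ∀ {τ}, (lcSigned part f m).Partial (Lab τ) (Don τ) →
      {p | Don τ p} ⊆ ((lcSigned part f m).nodes : Set (ℕ × ℕ)) := fun hτ p hp => by
    obtain ⟨c, hc⟩ := hτ.lab_of_done p hp
    exact hτ.mem p c hc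
  have hr := run_iterate (m := m) (P := labelBody) (σ := σ) (fun k τ =>
    Prepared part f m enc τ ∧ (lcSigned part f m).Partial (Lab τ) (Don τ) ∧
      (k ≤ {p | Don τ p}.ncard ∨ Finished part f m τ)) (fun k τ h => h.1.reg4)
    (by
      rintro k τ x v hx ⟨h1, h2, h3⟩
      refine ⟨?_, h2, h3⟩
      have : Frame (.set x (.const v)) τ (τ.setReg x v) := frame_run (.set x (.const v)) τ
      refine h1.frame ?_ this
      rcases hx with rfl | rfl <;> rfl)
    ⟨h, hp, Or.inl (Nat.zero_le _)⟩ (by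
      rintro k τ ⟨h1, h2, h3⟩
      obtain ⟨g1, g2⟩ := run_labelBody h1 hc h2
      refine ⟨h1.frame rfl (frame_run _ _), g1, ?_⟩
      rcases g2 with ⟨hF, p, hp, hq⟩ | g2
      · left
        have h3 := h3.resolve_right hF
        have : {q | Don (labelBody.run τ) q} = insert p {q | Don τ q} := by
          ext q
          simp [hq, or_comm]
        rw [this, Set.ncard_insert_of_notMem (a := p) (s := {q | Don τ q}) hp
          ((Finset.finite_toSet _).subset (hfin h2))]
        omega
      · exact Or.inr g2)
  obtain ⟨-, h2, h3⟩ := hr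
  refine ⟨h2, ?_⟩
  rcases h3 with h3 | h3
  · have hcard : ((lcSigned part f m).nodes : Set (ℕ × ℕ)).ncard ≤ m * m := by
      rw [Set.ncard_coe_finset]
      simp only [lcSigned, Finset.offDiag_card, Finset.card_range]
      exact Nat.sub_le _ _
    have heq := Set.eq_of_subset_of_ncard_le (hfin h2) (hcard.trans h3) (Finset.finite_toSet _)
    have hall : ∀ p ∈ (lcSigned part f m).nodes, Don ((iterate labelBody).run σ) p := by
      intro p hp
      have : p ∈ {p | Don ((iterate labelBody).run σ) p} := by
        rw [heq]
        exact hp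
      exact this
    exact ⟨fun p c hp => hall p (h2.mem p c hp), fun p hp =>
      h2.lab_of_done p (hall p ((lcSigned part f m).mem_of_seed p hp))⟩
  · exact h3

end RAM

namespace RAM

open CutFamily

variable {W κ : Type*} {part : W → κ} {f : ℕ → Set W} {m : ℕ} {enc : W → ℕ} {σ τ : Store}

/-! ### The test of the labels and the relabeled family -/

/-- Exactly one of the two formulas holds. -/
def Fml.xor (φ ψ : Fml) : Fml := .or (.and φ (.neg ψ)) (.and (.neg φ) ψ)

@[simp] theorem Fml.holds_xor {d : ℕ} {σ : Store} {φ ψ : Fml} :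
    (Fml.xor φ ψ).Holds d σ ↔ ¬ (φ.Holds d σ ↔ ψ.Holds d σ) := by
  simp only [Fml.xor, Fml.holds_or, Fml.holds_and, Fml.holds_neg]
  tauto

/-- The labels at the node `(101, 103)` violate a condition. -/
def Fml.badNode : Fml :=
  .or (.or (.and (.fixedLabel 101 103 true) (.neg (.is 10 101 103 2)))
      (.and (.fixedLabel 101 103 false) (.is 10 101 103 2)))
    (.or (.or (.and (.swapSign 101 103 false) (.xor (.is 10 101 103 2) (.is 10 103 101 2)))
        (.and (.swapSign 101 103 true) (.neg (.xor (.is 10 101 103 2) (.is 10 103 101 2)))))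
      (.ex 4 (.and (.neg (.same 105 101)) (.and (.xor (.is 10 101 103 2) (.is 10 101 105 2))
        (.ex 5 (.and (.and (.is 5 103 107 1) (.is 5 105 107 1)) (.neg (.is 5 101 107 1))))))))

/-- The labels violate a condition. -/
def Fml.badLabels : Fml := .ex 4 (.ex 4 (.and (.neg (.same 101 103)) .badNode))

theorem Prepared.setReg {x v : ℕ} (h : Prepared part f m enc σ) (h4 : x ≠ 4) (h5 : x ≠ 5) :
    Prepared part f m enc (σ.setReg x v) := by
  refine h.frame (P := .set x (.const v)) ?_ (frame_run (.set x (.const v)) σ)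
  simp [keeps, HProg.writesReg, HProg.writesArr, h4.symm, h5.symm]

theorem isSolution_congr {s s' : ℕ × ℕ → Bool} (h : ∀ i < m, ∀ j < m, s (i, j) = s' (i, j))
    (hs : (lcSigned part f m).IsSolution s) : (lcSigned part f m).IsSolution s' := by
  refine ⟨fun p b hp => ?_, fun p q b hpq => ?_⟩
  · rw [← h p.1 hp.1.1 p.2 hp.1.2.1]
    exact hs.1 p b hp
  · rw [← h p.1 hpq.1.1 p.2 hpq.1.2.1, ← h q.1 hpq.2.1.1 q.2 hpq.2.1.2.1]
    exact hs.2 p q b hpq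

open Classical in
theorem Prepared.holds_badLabels (h : Prepared part f m enc σ) :
    Fml.badLabels.Holds 0 σ ↔
      ¬ (lcSigned part f m).IsSolution fun p => decide (Lab σ p true) := by
  have key : ∀ i < m, ∀ j < m, Fml.badNode.Holds 2 ((σ.setReg 101 i).setReg 103 j) ↔
      ((FixedLabel part (f i) (f j) true ∧ ¬ Lab σ (i, j) true) ∨
        (FixedLabel part (f i) (f j) false ∧ Lab σ (i, j) true)) ∨
      ((SwapSign part (f i) (f j) false ∧ ¬ (Lab σ (i, j) true ↔ Lab σ (j, i) true)) ∨
        (SwapSign part (f i) (f j) true ∧ (Lab σ (i, j) true ↔ Lab σ (j, i) true))) ∨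
      ∃ k < m, k ≠ i ∧ ¬ (Lab σ (i, j) true ↔ Lab σ (i, k) true) ∧
        (supp₂ part (f j) (f k) \ CutFamily.supp part (f i)).Nonempty := by
    intro i hi j hj
    have h' : Prepared part f m enc ((σ.setReg 101 i).setReg 103 j) :=
      (h.setReg (by decide) (by decide)).setReg (by decide) (by decide)
    have e1 : ((σ.setReg 101 i).setReg 103 j).reg 101 = i := by simp
    have e2 : ((σ.setReg 101 i).setReg 103 j).reg 103 = j := by simp
    have hfl := fun b => h'.holds_fixedLabel (x := 101) (y := 103) (d := 2) (b := b)
      (e1.symm ▸ hi) (e2.symm ▸ hj)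
    have hsw := fun b => h'.holds_swapSign (x := 101) (y := 103) (d := 2) (b := b)
      (e1.symm ▸ hi) (e2.symm ▸ hj)
    rw [e1, e2] at hfl hsw
    have hpre : ∀ k < m, ((Fml.ex 5 (.and (.and (.is 5 103 107 1) (.is 5 105 107 1))
        (.neg (.is 5 101 107 1)))).Holds 3 (((σ.setReg 101 i).setReg 103 j).setReg 105 k) ↔
        (supp₂ part (f j) (f k) \ CutFamily.supp part (f i)).Nonempty) := by
      intro k hk
      rw [Fml.holds_ex, (h'.setReg (x := 105) (v := k) (by decide) (by decide)).exists_iff]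
      simp [h.supp i hi, h.supp j hj, h.supp k hk, supp₂, Set.Nonempty]
    simp only [Fml.badNode, Fml.holds_or, Fml.holds_and, Fml.holds_neg, hfl, hsw,
      Fml.holds_xor, Fml.holds_is, e1, e2, not_not]
    refine or_congr Iff.rfl (or_congr Iff.rfl ?_)
    rw [Fml.holds_ex]
    have hr4 : ((σ.setReg 101 i).setReg 103 j).reg 4 = m := h'.reg4
    rw [hr4]
    refine exists_congr fun k => and_congr_right fun hk => ?_
    rw [Fml.holds_and, Fml.holds_and, hpre k hk]
    simp [Lab, code]
  have hall : Fml.badLabels.Holds 0 σ ↔ ∃ i < m, ∃ j < m, i ≠ j ∧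
      Fml.badNode.Holds 2 ((σ.setReg 101 i).setReg 103 j) := by
    simp only [Fml.badLabels, Fml.holds_ex, Fml.holds_and, Fml.holds_neg, Fml.holds_same,
      setReg_reg]
    simp only [Nat.reduceAdd, Nat.reduceMul, Nat.reduceEqDiff, if_true, if_false, h.reg4]
  rw [hall]
  constructor
  · rintro ⟨i, hi, j, hj, hij, hb⟩ hs
    rw [key i hi j hj] at hb
    rcases hb with (⟨h1, h2⟩ | ⟨h1, h2⟩) | (⟨h1, h2⟩ | ⟨h1, h2⟩) | ⟨k, hk, hki, h1, h2⟩
    · simpa [h2] using hs.1 (i, j) true ⟨⟨hi, hj, hij⟩, h1⟩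
    · simpa [h2] using hs.1 (i, j) false ⟨⟨hi, hj, hij⟩, h1⟩
    · have := hs.2 (i, j) (j, i) false ⟨⟨hi, hj, hij⟩, ⟨hj, hi, hij.symm⟩, Or.inl ⟨rfl, h1⟩⟩
      simp only [Bool.xor_false, decide_eq_decide] at this
      exact h2 this.symm
    · have := hs.2 (i, j) (j, i) true ⟨⟨hi, hj, hij⟩, ⟨hj, hi, hij.symm⟩, Or.inl ⟨rfl, h1⟩⟩
      by_cases hl : Lab σ (i, j) true <;> simp [hl, h2.1, ← h2] at this
    · have := hs.2 (i, j) (i, k) false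
        ⟨⟨hi, hj, hij⟩, ⟨hi, hk, hki.symm⟩, Or.inr ⟨rfl, rfl, h2⟩⟩
      simp only [Bool.xor_false, decide_eq_decide] at this
      exact h1 this.symm
  · intro hs
    by_contra hno
    push Not at hno
    have hno' := fun i hi j hj hij => mt (key i hi j hj).2 (hno i hi j hj hij)
    refine hs ⟨?_, ?_⟩
    · rintro ⟨i, j⟩ b ⟨⟨hi, hj, hij⟩, hb⟩
      have := hno' i hi j hj hij
      dsimp only at hb
      cases b with
      | true =>
        rw [decide_eq_true_iff]
        by_contra hl
        exact this (Or.inl (Or.inl ⟨hb, hl⟩))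
      | false =>
        rw [decide_eq_false_iff_not]
        exact fun hl => this (Or.inl (Or.inr ⟨hb, hl⟩))
    · rintro ⟨i, j⟩ ⟨i', j'⟩ b ⟨⟨hi, hj, hij⟩, ⟨hi', hj', hij'⟩, ⟨h1, h2⟩ | ⟨h1, rfl, h2⟩⟩
      · simp only [Prod.swap_prod_mk, Prod.mk.injEq] at h1
        obtain ⟨rfl, rfl⟩ := h1
        have := hno' j' hi i' hj hij
        dsimp only at h2
        cases b with
        | true =>
          have h3 : ¬ (Lab σ (j', i') true ↔ Lab σ (i', j') true) := fun h3 =>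
            this (Or.inr (Or.inl (Or.inr ⟨h2, h3⟩)))
          by_cases hl : Lab σ (j', i') true <;> by_cases hl' : Lab σ (i', j') true <;>
            simp [hl, hl'] at h3 ⊢
        | false =>
          have h3 : Lab σ (j', i') true ↔ Lab σ (i', j') true := by
            by_contra h3
            exact this (Or.inr (Or.inl (Or.inl ⟨h2, h3⟩)))
          simp [h3]
      · dsimp only at *
        subst h1
        have h3 : Lab σ (i', j) true ↔ Lab σ (i', j') true := by
          by_contra h3
          exact hno' i' hi j hj hij (Or.inr (Or.inr ⟨j', hj', hij'.symm, h3, h2⟩))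
        simp [h3]

open Classical in
/-- The labeling of the family that is stored in the memory. -/
noncomputable def labels (f : ℕ → Set W) (m : ℕ) (σ : Store) (X Y : Set W) : Bool :=
  decide (∃ i < m, ∃ j < m, f i = X ∧ f j = Y ∧ Lab σ (i, j) true)

theorem labels_eq_true_iff (hf : Set.InjOn f (Set.Iio m)) {i j : ℕ} (hi : i < m) (hj : j < m) :
    labels f m σ (f i) (f j) = true ↔ Lab σ (i, j) true := by
  classical
  rw [labels, decide_eq_true_iff]
  constructor
  · rintro ⟨i', hi', j', hj', h1, h2, h3⟩
    rwa [hf hi' hi h1, hf hj' hj h2] at h3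
  · exact fun h => ⟨i, hi, j, hj, rfl, rfl, h⟩

theorem isLCLabeling_labels_iff (hf : Set.InjOn f (Set.Iio m))
    (h : Prepared part f m enc σ) :
    IsLCLabeling part (f '' Set.Iio m) (labels f m σ) ↔ ¬ Fml.badLabels.Holds 0 σ := by
  classical
  have he : ∀ i < m, ∀ j < m, (fun p : ℕ × ℕ => decide (Lab σ p true)) (i, j) =
      (fun p : ℕ × ℕ => labels f m σ (f p.1) (f p.2)) (i, j) := by
    intro i hi j hj
    beta_reduce
    rw [Bool.eq_iff_iff, labels_eq_true_iff hf hi hj, decide_eq_true_iff]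
  rw [h.holds_badLabels, not_not, ← isSolution_iff hf]
  exact ⟨isSolution_congr fun i hi j hj => (he i hi j hj).symm, isSolution_congr he⟩

theorem good_comp {I J : Type*} {g : J → Set W} (hg : Good part g) {e : I → J}
    (he : Function.Injective e) : Good part fun i => g (e i) :=
  ⟨fun _ _ hij => hg.supp_ne _ _ (he.ne hij), fun _ _ => hg.two _ _,
    fun _ _ _ h1 h2 h3 => hg.noCyc _ _ _ (he.ne h1) (he.ne h2) (he.ne h3)⟩

/-- If the labels pass the test, then the relabeled family is a possible outcome of Algorithm 5. -/
theorem algorithm5_of_labels (hf : Set.InjOn f (Set.Iio m))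
    (hE : Separated part (f '' Set.Iio m)) (hc : PairwiseComparable part (f '' Set.Iio m))
    (hp : (lcSigned part f m).Partial (Lab σ) (Don σ)) (hF : Finished part f m σ)
    (hs : IsLCLabeling part (f '' Set.Iio m) (labels f m σ)) :
    Algorithm5 part (f '' Set.Iio m)
      (some (relabel part (f '' Set.Iio m) (labels f m σ) '' (f '' Set.Iio m))) ∧
    Good part fun i : Fin m => relabel part (f '' Set.Iio m) (labels f m σ) (f i) := by
  have hg := hs.localModel hc
  have hno := not_isCyclicTriple_of_rooted hf hE hs hc (L := Lab σ)
    (fun p hps => let ⟨c, hc⟩ := hF.2 p hps; hp.rooted p c hc) (by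
      intro i hi j hj _ hl
      rw [Bool.eq_false_iff]
      intro ht
      rw [labels_eq_true_iff hf hi hj] at ht
      rw [Lab] at hl ht
      exact absurd (code_injective (hl.symm.trans ht)) (by decide))
  refine ⟨.output _ (hg.exists_twoLocally hE.cut) hs fun A C hC =>
    exists_representatives ((Set.finite_Iio m).image f) hg hno hC, ?_⟩
  exact good_comp (hg.good hE hno) (e := fun i : Fin m => ⟨f i, i, i.2, rfl⟩)
    fun i j hij => Fin.ext (hf i.2 j.2 (congrArg Subtype.val hij))

/-- If the labels do not pass the test, then Algorithm 5 rejects the family. -/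
theorem algorithm5_none (hf : Set.InjOn f (Set.Iio m)) (hE : Separated part (f '' Set.Iio m))
    (hp : (lcSigned part f m).Partial (Lab σ) (Don σ)) (hF : Finished part f m σ)
    (h : Prepared part f m enc σ) (hb : Fml.badLabels.Holds 0 σ) :
    Algorithm5 part (f '' Set.Iio m) none := by
  classical
  refine .reject fun hG => ?_
  obtain ⟨g, hg⟩ := exists_localModel hG
  obtain ⟨s, hs⟩ := hg.exists_labeling hE
  exact h.holds_badLabels.1 hb
    (hp.isSolution hF.1 hF.2 ((isSolution_iff hf).2 hs) fun p => decide_eq_true_iff)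

/-- The rows of the array `12` are the characteristic vectors of the sets `g i`. -/
def Rows (m : ℕ) (enc : W → ℕ) (g : ℕ → Set W) (σ : Store) : Prop :=
  ∀ i < m, ∀ w, σ.arr 12 i (enc w) = 1 ↔ w ∈ g i

/-- The members are relabeled. -/
def relabelProg : HProg := fill 12 4 5
  (.or (.ex 4 (.and (.and (.is 5 101 11 1) (.neg (.is 5 10 11 1))) (.is 10 10 101 2)))
    (.and (.neg (.ex 4 (.and (.is 5 101 11 1) (.neg (.is 5 10 11 1))))) (.is 3 10 11 1)))

theorem run_relabelProg (hf : Set.InjOn f (Set.Iio m)) (h : Prepared part f m enc σ) :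
    Rows m enc (fun i => relabel part (f '' Set.Iio m) (labels f m σ) (f i))
      (relabelProg.run σ) := by
  intro i hi w
  rw [relabelProg, run_fill (Q := fun i v =>
    (∃ k < m, (σ.arr 5 k v = 1 ∧ ¬ σ.arr 5 i v = 1) ∧ σ.arr 10 i k = 2) ∨
      ((¬ ∃ k < m, σ.arr 5 k v = 1 ∧ ¬ σ.arr 5 i v = 1) ∧ σ.arr 3 i v = 1))
    (by decide) ?_ (h.reg4 ▸ hi) (h.lt w)]
  · simp only [relabel, Set.mem_ofPred_eq, Set.exists_mem_image, Set.forall_mem_image, Set.mem_Iio,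
      Set.mem_sdiff, h.supp i hi, h.mem i hi]
    refine or_congr (exists_congr fun k => and_congr_right fun hk => ?_) (and_congr_left' ?_)
    · rw [h.supp k hk, labels_eq_true_iff hf hi hk]
      rfl
    · push Not
      refine forall_congr' fun k => forall_congr' fun hk => ?_
      rw [h.supp k hk]
  · intro i j τ hi hj h10 h11 hf
    have h4 : τ.reg 4 = m := (hf.reg 4 rfl).trans h.reg4
    simp [h4, h10, h11, hf.arr 3 rfl, hf.arr 5 rfl, hf.arr 10 rfl]

end RAM

namespace RAM

open CutFamily

variable {W κ : Type*} {part : W → κ} {f g : ℕ → Set W} {m : ℕ} {enc : W → ℕ} {σ τ : Store}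

/-! ### Uncrossing on the machine -/

theorem rows_congr (h : τ.arr 12 = σ.arr 12) (hr : Rows m enc g σ) : Rows m enc g τ := by
  unfold Rows
  rwa [h]

/-- Some element lies in the row `x` if and only if `a = true`, and in the row `y` if and only if
`b = true`. -/
def Fml.side (x y : ℕ) (a b : Bool) : Fml :=
  .ex 5 (.and (.signed a (.is 12 x 101 1)) (.signed b (.is 12 y 101 1)))

/-- The rows `x` and `y` are crossing. -/
def Fml.cross (x y : ℕ) : Fml := .and (.and (.side x y true true) (.side x y false false))
  (.and (.side x y true false) (.side x y false true))

theorem holds_cross (h : Encodes part f m enc σ) (hr : Rows m enc g σ) {x y i j : ℕ}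
    (hx : x ≠ 101) (hy : y ≠ 101) (hi : i < m) (hj : j < m) (hxi : σ.reg x = i)
    (hyj : σ.reg y = j) :
    (Fml.cross x y).Holds 0 σ ↔ CrossingOn Set.univ (g i) (g j) := by
  have key : ∀ a b, (Fml.side x y a b).Holds 0 σ ↔
      ∃ w, (w ∈ g i ↔ a = true) ∧ (w ∈ g j ↔ b = true) := by
    intro a b
    rw [Fml.side, Fml.holds_ex, h.exists_iff]
    simp [hx, hy, hxi, hyj, hr i hi, hr j hj]
  simp only [Fml.cross, Fml.holds_and, key, crossing_univ_iff, iff_true, Bool.false_eq_true,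
    iff_false]
  simp only [and_comm (a := _ ∉ g i)]
  tauto

/-- The crossing matrix in the array `13` is correct. -/
def Crossings (m : ℕ) (g : ℕ → Set W) (σ : Store) : Prop :=
  ∀ i < m, ∀ j < m, σ.arr 13 i j = 1 ↔ CrossingOn Set.univ (g i) (g j)

/-- The computation of the crossing matrix. -/
def crossProg : HProg := fill 13 4 4 (.cross 10 11)

theorem run_crossProg (h : Prepared part f m enc σ) (hr : Rows m enc g σ) :
    Crossings m g (crossProg.run σ) := by
  intro i hi j hj
  refine run_fill (Q := fun i j => CrossingOn Set.univ (g i) (g j)) (by decide) ?_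
    (h.reg4 ▸ hi) (h.reg4 ▸ hj)
  intro i j τ hi hj h10 h11 hf
  rw [h.reg4] at hi hj
  exact holds_cross (h.frame rfl hf).toEncodes (rows_congr (hf.arr 12 rfl) hr) (by decide)
    (by decide) hi hj h10 h11

/-- The row and the column `x` of the crossing matrix are computed anew. -/
def recompute (x : ℕ) : HProg := .forLt 14 4 (.ite (.cross x 14)
  (.seq (.put 13 (.reg x) (.reg 14) (.const 1)) (.put 13 (.reg 14) (.reg x) (.const 1)))
  (.seq (.put 13 (.reg x) (.reg 14) (.const 0)) (.put 13 (.reg 14) (.reg x) (.const 0))))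

theorem run_recompute (h : Prepared part f m enc σ) (hr : Rows m enc g σ) {x i : ℕ}
    (hx : x = 21 ∨ x = 22) (hi : i < m) (hxi : σ.reg x = i) :
    (∀ k < m, ((recompute x).run σ).arr 13 i k = 1 ↔ CrossingOn Set.univ (g i) (g k)) ∧
    (∀ k < m, ((recompute x).run σ).arr 13 k i = 1 ↔ CrossingOn Set.univ (g k) (g i)) ∧
    ∀ k l, k ≠ i → l ≠ i → ((recompute x).run σ).arr 13 k l = σ.arr 13 k l := by
  have hx14 : x ≠ 14 := by omega
  have hx101 : x ≠ 101 := by omega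
  have hsymm : ∀ X Y : Set W, CrossingOn Set.univ X Y ↔ CrossingOn Set.univ Y X :=
    fun X Y => ⟨CrossingOn.symm, CrossingOn.symm⟩
  have hkeep : keeps (recompute x) = true := by rcases hx with rfl | rfl <;> rfl
  have key := run_forLt (x := 14) (b := 4) (σ := σ) (P := .ite (.cross x 14)
    (.seq (.put 13 (.reg x) (.reg 14) (.const 1)) (.put 13 (.reg 14) (.reg x) (.const 1)))
    (.seq (.put 13 (.reg x) (.reg 14) (.const 0)) (.put 13 (.reg 14) (.reg x) (.const 0))))
    (fun c τ => (∀ k < c, τ.arr 13 i k = 1 ↔ CrossingOn Set.univ (g i) (g k)) ∧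
      (∀ k < c, τ.arr 13 k i = 1 ↔ CrossingOn Set.univ (g k) (g i)) ∧
      ∀ k l, k ≠ i → l ≠ i → τ.arr 13 k l = σ.arr 13 k l)
    ⟨by simp, by simp, fun _ _ _ _ => rfl⟩ (by
      rintro c τ hc h14 hf ⟨h1, h2, h3⟩
      rw [h.reg4] at hc
      have hτx : τ.reg x = i := by
        rw [hf.reg x (by rcases hx with rfl | rfl <;> rfl), hxi]
      have hcr := holds_cross (h.frame hkeep hf).toEncodes
        (rows_congr (hf.arr 12 rfl) hr) hx101 (by decide) hi hc hτx h14
      -- in both cases the two cells receive the same value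
      have hval : ∃ v, (v = 1 ↔ CrossingOn Set.univ (g i) (g c)) ∧
          (HProg.ite (.cross x 14)
            (.seq (.put 13 (.reg x) (.reg 14) (.const 1)) (.put 13 (.reg 14) (.reg x) (.const 1)))
            (.seq (.put 13 (.reg x) (.reg 14) (.const 0))
              (.put 13 (.reg 14) (.reg x) (.const 0)))).run τ =
            (τ.setCell 13 i c v).setCell 13 c i v := by
        by_cases hq : CrossingOn Set.univ (g i) (g c)
        · refine ⟨1, by simp [hq], ?_⟩
          rw [run_ite_pos (hcr.2 hq)]
          simp [Expr.val, hτx, h14]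
        · refine ⟨0, by simp [hq], ?_⟩
          rw [run_ite_neg (mt hcr.1 hq)]
          simp [Expr.val, hτx, h14]
      obtain ⟨v, hv, hrun⟩ := hval
      rw [hrun]
      simp only [setReg_arr, setCell_arr, true_and]
      refine ⟨fun k hk => ?_, fun k hk => ?_, fun k l hk hl => ?_⟩
      · by_cases hkc : k = c
        · subst hkc
          simpa using hv
        · rw [if_neg (by omega), if_neg (by omega)]
          exact h1 k (by omega)
      · by_cases hkc : k = c
        · subst hkc
          rw [if_pos (by simp), hv, hsymm]
        · rw [if_neg (by omega), if_neg (by omega)]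
          exact h2 k (by omega)
      · rw [if_neg (by omega), if_neg (by omega)]
        exact h3 k l hk hl)
  rw [h.reg4] at key
  exact key

/-- The rows `21` and `22` are replaced. The formulas describe the new rows in terms of the old
ones; the number of the element is in the register `15`. -/
def newRows (φ ψ : Fml) : HProg := .forLt 15 5
  (.seq (.ite φ (.set 23 (.const 1)) (.set 23 (.const 0)))
    (.seq (.ite ψ (.set 24 (.const 1)) (.set 24 (.const 0)))
      (.seq (.put 12 (.reg 21) (.reg 15) (.reg 23)) (.put 12 (.reg 22) (.reg 15) (.reg 24)))))

theorem run_newRows {φ ψ : Fml} {p q : Prop → Prop → Prop} {i j : ℕ}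
    (h : Encodes part f m enc σ) (hr : Rows m enc g σ)
    (hφ : ∀ τ, φ.Holds 0 τ ↔ p (τ.arr 12 (τ.reg 21) (τ.reg 15) = 1)
      (τ.arr 12 (τ.reg 22) (τ.reg 15) = 1))
    (hψ : ∀ τ, ψ.Holds 0 τ ↔ q (τ.arr 12 (τ.reg 21) (τ.reg 15) = 1)
      (τ.arr 12 (τ.reg 22) (τ.reg 15) = 1))
    (hi : i < m) (hj : j < m) (hij : i ≠ j) (h21 : σ.reg 21 = i) (h22 : σ.reg 22 = j) :
    Rows m enc (fun k => if k = i then {w | p (w ∈ g i) (w ∈ g j)} else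
      if k = j then {w | q (w ∈ g i) (w ∈ g j)} else g k) ((newRows φ ψ).run σ) := by
  classical
  have key := run_forLt (x := 15) (b := 5) (σ := σ)
    (P := .seq (.ite φ (.set 23 (.const 1)) (.set 23 (.const 0)))
      (.seq (.ite ψ (.set 24 (.const 1)) (.set 24 (.const 0)))
      (.seq (.put 12 (.reg 21) (.reg 15) (.reg 23)) (.put 12 (.reg 22) (.reg 15) (.reg 24)))))
    (fun c τ => (∀ v < c, (τ.arr 12 i v = 1 ↔ p (σ.arr 12 i v = 1) (σ.arr 12 j v = 1)) ∧
        (τ.arr 12 j v = 1 ↔ q (σ.arr 12 i v = 1) (σ.arr 12 j v = 1))) ∧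
      (∀ k v, (k ≠ i ∧ k ≠ j) ∨ c ≤ v → τ.arr 12 k v = σ.arr 12 k v))
    ⟨by simp, fun _ _ _ => rfl⟩ (by
      rintro c τ - h15 hf ⟨h1, h2⟩
      have t21 : τ.reg 21 = i := (hf.reg 21 rfl).trans h21
      have t22 : τ.reg 22 = j := (hf.reg 22 rfl).trans h22
      have ei : τ.arr 12 i c = σ.arr 12 i c := h2 i c (Or.inr le_rfl)
      have ej : τ.arr 12 j c = σ.arr 12 j c := h2 j c (Or.inr le_rfl)
      set P := p (σ.arr 12 i c = 1) (σ.arr 12 j c = 1) with hP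
      set Q := q (σ.arr 12 i c = 1) (σ.arr 12 j c = 1) with hQ
      have r1 : (HProg.ite φ (.set 23 (.const 1)) (.set 23 (.const 0))).run τ =
          τ.setReg 23 (if P then 1 else 0) := by
        have e : φ.Holds 0 τ ↔ P := by rw [hφ, t21, t22, h15, ei, ej]
        by_cases hp : P
        · rw [run_ite_pos (e.2 hp)]
          simp [Expr.val, hp]
        · rw [run_ite_neg (mt e.1 hp)]
          simp [Expr.val, hp]
      have r2 : (HProg.ite ψ (.set 24 (.const 1)) (.set 24 (.const 0))).run
          (τ.setReg 23 (if P then 1 else 0)) =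
          (τ.setReg 23 (if P then 1 else 0)).setReg 24 (if Q then 1 else 0) := by
        have e : ψ.Holds 0 (τ.setReg 23 (if P then 1 else 0)) ↔ Q := by
          rw [hψ]
          simp [t21, t22, h15, ei, ej, hQ]
        by_cases hq : Q
        · rw [run_ite_pos (e.2 hq)]
          simp [Expr.val, hq]
        · rw [run_ite_neg (mt e.1 hq)]
          simp [Expr.val, hq]
      rw [run_seq, r1, run_seq, r2]
      simp only [run_seq, run_put, Expr.val, setReg_reg, setCell_reg, setReg_arr, setCell_arr,
        Nat.reduceEqDiff, if_false, if_true, t21, t22, h15, true_and]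
      refine ⟨fun v hv => ?_, fun k v hkv => ?_⟩
      · by_cases hvc : v = c
        · subst hvc
          by_cases hp : P <;> by_cases hq : Q <;>
            simp only [hij, hp, hq, hij.symm, and_true, if_true, if_false,
              true_iff, false_iff, zero_ne_one] <;> exact ⟨hp, hq⟩
        · simp only [hvc, and_false, if_false]
          exact h1 v (by omega)
      · rw [if_neg (by omega), if_neg (by omega)]
        exact h2 k v (by omega))
  intro k hk w
  have hw := key.1 (enc w) (h.lt w)
  rw [hr i hi, hr j hj] at hw
  by_cases hki : k = i
  · subst hki
    simp only [if_true]
    exact hw.1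
  · by_cases hkj : k = j
    · subst hkj
      simp only [hki, if_false, if_true]
      exact hw.2
    · rw [newRows, key.2 k (enc w) (Or.inl ⟨hki, hkj⟩)]
      simpa [hki, hkj] using hr k hk w

/-- The inclusion of the row `21` or its complement (for `a = false`) in the row `22` or its
complement (for `b = false`) fails on the union of the cutting supports. -/
def Fml.notSub (a b : Bool) : Fml := .ex 5 (.and (.or (.is 5 21 101 1) (.is 5 22 101 1))
  (.and (.signed a (.is 12 21 101 1)) (.signed (!b) (.is 12 22 101 1))))

theorem holds_notSub (h : Prepared part f m enc σ) (hr : Rows m enc g σ)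
    (hs : ∀ i < m, CutFamily.supp part (g i) = CutFamily.supp part (f i)) {i j : ℕ} (hi : i < m)
    (hj : j < m) (h21 : σ.reg 21 = i) (h22 : σ.reg 22 = j) {a b : Bool} :
    (Fml.notSub a b).Holds 0 σ ↔ ¬ SubOn (CutFamily.supp part (g i) ∪ CutFamily.supp part (g j))
      (orient a (g i)) (orient b (g j)) := by
  rw [Fml.notSub, Fml.holds_ex, h.exists_iff, subOn_iff]
  push Not
  refine exists_congr fun w => ?_
  rw [hs i hi, hs j hj]
  simp only [Fml.holds_and, Fml.holds_or, Fml.holds_signed, Fml.holds_is, setReg_reg, setReg_arr,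
    Nat.reduceEqDiff, if_false, if_true, Nat.reduceAdd, Nat.reduceMul, h21, h22, h.supp i hi,
    h.supp j hj, hr i hi, hr j hj, Set.mem_union, mem_orient]
  cases b <;> simp

/-- The element `15` belongs to the row `21`. -/
def Fml.inFst : Fml := .is 12 21 15 1

/-- The element `15` belongs to the row `22`. -/
def Fml.inSnd : Fml := .is 12 22 15 1

/-- The uncrossing operation for the rows `21` and `22`. -/
def uncrossProg : HProg :=
  .ite (.notSub true true) (.ite (.notSub false false) (.ite (.notSub true false)
    (newRows (.and .inSnd (.neg .inFst)) (.and .inFst (.neg .inSnd)))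
    (newRows (.and .inFst (.neg .inSnd)) (.and .inSnd (.neg .inFst))))
    (newRows (.or .inFst .inSnd) (.and .inFst .inSnd)))
    (newRows (.and .inFst .inSnd) (.or .inFst .inSnd))

theorem run_uncrossProg (h : Prepared part f m enc σ) (hr : Rows m enc g σ)
    (hs : ∀ i < m, CutFamily.supp part (g i) = CutFamily.supp part (f i))
    (hg : Good part fun k : Fin m => g k) {i j : ℕ} (hi : i < m) (hj : j < m)
    (h21 : σ.reg 21 = i) (h22 : σ.reg 22 = j) (hc : CrossingOn Set.univ (g i) (g j)) :
    ∃ g', UncrossAt part (fun k : Fin m => g k) (fun k : Fin m => g' k) ⟨i, hi⟩ ⟨j, hj⟩ ∧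
      (∀ k, k ≠ i → k ≠ j → g' k = g k) ∧ Rows m enc g' (uncrossProg.run σ) := by
  have hij : i ≠ j := by
    rintro rfl
    exact not_crossingOn_self _ _ hc
  have hsub : ∀ a b, (Fml.notSub a b).Holds 0 σ ↔ ¬ SubOn _ _ _ := fun a b =>
    holds_notSub h hr hs hi hj h21 h22
  have s1 := hsub true true
  have s2 := hsub false false
  have s3 := hsub true false
  simp only [orient, if_true, if_false, Bool.false_eq_true] at s1 s2 s3
  rw [subOn_compl] at s2
  have fin : ∀ {p q : Prop → Prop → Prop} {φ ψ : Fml},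
      (∀ τ, φ.Holds 0 τ ↔ p (τ.arr 12 (τ.reg 21) (τ.reg 15) = 1)
        (τ.arr 12 (τ.reg 22) (τ.reg 15) = 1)) →
      (∀ τ, ψ.Holds 0 τ ↔ q (τ.arr 12 (τ.reg 21) (τ.reg 15) = 1)
        (τ.arr 12 (τ.reg 22) (τ.reg 15) = 1)) →
      uncrossProg.run σ = (newRows φ ψ).run σ →
      (∀ g' : ℕ → Set W, g' i = {w | p (w ∈ g i) (w ∈ g j)} →
        g' j = {w | q (w ∈ g i) (w ∈ g j)} → (∀ k, k ≠ i → k ≠ j → g' k = g k) →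
        UncrossAt part (fun k : Fin m => g k) (fun k : Fin m => g' k) ⟨i, hi⟩ ⟨j, hj⟩) →
      ∃ g', UncrossAt part (fun k : Fin m => g k) (fun k : Fin m => g' k) ⟨i, hi⟩ ⟨j, hj⟩ ∧
        (∀ k, k ≠ i → k ≠ j → g' k = g k) ∧ Rows m enc g' (uncrossProg.run σ) := by
    intro p q φ ψ hφ hψ hrun hU
    have hrest : ∀ k, k ≠ i → k ≠ j → (fun k => if k = i then {w | p (w ∈ g i) (w ∈ g j)} else
      if k = j then {w | q (w ∈ g i) (w ∈ g j)} else g k) k = g k := fun k h1 h2 => by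
        simp [h1, h2]
    refine ⟨fun k => if k = i then {w | p (w ∈ g i) (w ∈ g j)} else
      if k = j then {w | q (w ∈ g i) (w ∈ g j)} else g k, hU _ (by simp) (by simp [hij.symm])
      hrest, hrest, ?_⟩
    rw [hrun]
    exact run_newRows h.toEncodes hr hφ hψ hi hj hij h21 h22
  have rest : ∀ {g' : ℕ → Set W}, (∀ k, k ≠ i → k ≠ j → g' k = g k) →
      ∀ k : Fin m, k ≠ ⟨i, hi⟩ → k ≠ ⟨j, hj⟩ → g' k = g k := fun h k h1 h2 =>
    h k (fun he => h1 (Fin.ext he)) (fun he => h2 (Fin.ext he))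
  by_cases c1 : SubOn (CutFamily.supp part (g i) ∪ CutFamily.supp part (g j)) (g i) (g j)
  · exact fin (p := And) (q := Or) (φ := .and .inFst .inSnd) (ψ := .or .inFst .inSnd) (fun τ => by simp [Fml.inFst, Fml.inSnd])
      (fun τ => by simp [Fml.inFst, Fml.inSnd])
      (by rw [uncrossProg, run_ite_neg (by rw [s1]; exact not_not.2 c1)])
      fun g' e1 e2 e3 => ⟨hc, Or.inl ⟨c1, e1, e2⟩, rest e3⟩
  by_cases c2 : SubOn (CutFamily.supp part (g i) ∪ CutFamily.supp part (g j)) (g j) (g i)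
  · exact fin (p := Or) (q := And) (φ := .or .inFst .inSnd) (ψ := .and .inFst .inSnd) (fun τ => by simp [Fml.inFst, Fml.inSnd])
      (fun τ => by simp [Fml.inFst, Fml.inSnd])
      (by rw [uncrossProg, run_ite_pos (s1.2 c1), run_ite_neg (by rw [s2]; exact not_not.2 c2)])
      fun g' e1 e2 e3 => ⟨hc, Or.inr (Or.inl ⟨c2, e1, e2⟩), rest e3⟩
  by_cases c3 : SubOn (CutFamily.supp part (g i) ∪ CutFamily.supp part (g j)) (g i) (g j)ᶜ
  · exact fin (p := fun P Q => P ∧ ¬ Q) (q := fun P Q => Q ∧ ¬ P) (φ := .and .inFst (.neg .inSnd))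
      (ψ := .and .inSnd (.neg .inFst))
      (fun τ => by simp [Fml.inFst, Fml.inSnd]) (fun τ => by simp [Fml.inFst, Fml.inSnd])
      (by rw [uncrossProg, run_ite_pos (s1.2 c1), run_ite_pos (s2.2 c2),
            run_ite_neg (by rw [s3]; exact not_not.2 c3)])
      fun g' e1 e2 e3 => ⟨hc, Or.inr (Or.inr (Or.inl ⟨c3, e1, e2⟩)), rest e3⟩
  · have c4 : SubOn (CutFamily.supp part (g i) ∪ CutFamily.supp part (g j)) (g j)ᶜ (g i) := by
      rcases subOn_cases_of_notCrossingOn (hg.two ⟨i, hi⟩ ⟨j, hj⟩) with (h' | h') | (h' | h')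
      · exact absurd h' c1
      · exact absurd h' c2
      · exact absurd h' c3
      · exact h'
    exact fin (p := fun P Q => Q ∧ ¬ P) (q := fun P Q => P ∧ ¬ Q) (φ := .and .inSnd (.neg .inFst))
      (ψ := .and .inFst (.neg .inSnd))
      (fun τ => by simp [Fml.inFst, Fml.inSnd]) (fun τ => by simp [Fml.inFst, Fml.inSnd])
      (by rw [uncrossProg, run_ite_pos (s1.2 c1), run_ite_pos (s2.2 c2), run_ite_pos (s3.2 c3)])
      fun g' e1 e2 e3 => ⟨hc, Or.inr (Or.inr (Or.inr ⟨c4, e1, e2⟩)), rest e3⟩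

/-- If there is a crossing pair, then the first one is uncrossed. -/
def uncrossBody : HProg := .seq (search (.is 13 12 13 1))
  (.ite (.test (.eq (.reg 20) (.const 1)))
    (.seq uncrossProg (.seq (recompute 21) (recompute 22))) .skip)

theorem run_uncrossBody (h : Prepared part f m enc σ) (hr : Rows m enc g σ)
    (hs : ∀ i < m, CutFamily.supp part (g i) = CutFamily.supp part (f i))
    (hg : Good part fun k : Fin m => g k) (hc : Crossings m g σ) :
    (CrossFree (Set.range fun k : Fin m => g k) ∧ Rows m enc g (uncrossBody.run σ) ∧
      Crossings m g (uncrossBody.run σ)) ∨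
    ∃ g' i j, UncrossAt part (fun k : Fin m => g k) (fun k : Fin m => g' k) i j ∧
      Rows m enc g' (uncrossBody.run σ) ∧ Crossings m g' (uncrossBody.run σ) := by
  set s := search (.is 13 12 13 1) with hsdef
  set σ₁ := s.run σ with hσ₁
  have f1 : Frame s σ σ₁ := frame_run _ _
  have p1 : Prepared part f m enc σ₁ := h.frame rfl f1
  have hr1 : Rows m enc g σ₁ := rows_congr (f1.arr 12 rfl) hr
  have hc1 : Crossings m g σ₁ := by
    unfold Crossings
    rw [f1.arr 13 rfl]
    exact hc
  have r1 : SearchResult m (fun i j => σ.arr 13 i j = 1) σ₁ := by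
    rw [← h.reg4]
    refine run_search fun i j τ _ _ h12 h13 hf => ?_
    simp [h12, h13, hf.arr 13 rfl]
  rcases r1 with ⟨h20, hno⟩ | ⟨h20, hi, hj, hij, -⟩
  · left
    have hrun : uncrossBody.run σ = σ₁ := by
      have hne : ¬ (Fml.test (.eq (.reg 20) (.const 1))).Holds 0 σ₁ := by
        simp [Fml.Holds, Test.Holds, Expr.val, h20]
      rw [uncrossBody, run_seq, ← hsdef, ← hσ₁, run_ite_neg hne, run_skip]
    rw [hrun]
    refine ⟨?_, hr1, hc1⟩
    rintro _ ⟨k, rfl⟩ _ ⟨l, rfl⟩ hkl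
    exact hno k k.2 l l.2 ((hc k k.2 l l.2).2 hkl)
  · right
    set i := σ₁.reg 21 with hi21
    set j := σ₁.reg 22 with hj22
    obtain ⟨g', hU, hrest, hr2⟩ := run_uncrossProg p1 hr1 hs hg hi hj rfl rfl
      ((hc i hi j hj).1 hij)
    set σ₂ := uncrossProg.run σ₁ with hσ₂
    have f2 : Frame uncrossProg σ₁ σ₂ := frame_run _ _
    set σ₃ := (recompute 21).run σ₂ with hσ₃
    have f3 : Frame (recompute 21) σ₂ σ₃ := frame_run _ _
    have f4 : Frame (recompute 22) σ₃ ((recompute 22).run σ₃) := frame_run _ _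
    have hrun : uncrossBody.run σ = (recompute 22).run σ₃ := by
      rw [uncrossBody, run_seq, ← hsdef, ← hσ₁, run_ite_pos (by exact h20)]
      rfl
    have p2 : Prepared part f m enc σ₂ := p1.frame rfl f2
    have hr3 : Rows m enc g' σ₃ := rows_congr (f3.arr 12 rfl) hr2
    obtain ⟨a1, a2, a3⟩ := run_recompute p2 hr2 (Or.inl rfl) hi (f2.reg 21 rfl)
    obtain ⟨b1, b2, b3⟩ := run_recompute (p2.frame rfl f3) hr3 (Or.inr rfl) hj
      ((f3.reg 22 rfl).trans (f2.reg 22 rfl))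
    rw [hrun]
    refine ⟨g', _, _, hU, rows_congr (f4.arr 12 rfl) hr3, fun k hk l hl => ?_⟩
    by_cases hkj : k = j
    · rw [hkj]
      exact b1 l hl
    by_cases hlj : l = j
    · rw [hlj]
      exact b2 k hk
    rw [b3 k l hkj hlj]
    by_cases hki : k = i
    · rw [hki]
      exact a1 l hl
    by_cases hli : l = i
    · rw [hli]
      exact a2 k hk
    rw [a3 k l hki hli, f2.arr 13 rfl, hrest k hki hkj, hrest l hli hlj]
    exact hc1 k hk l hl

/-- After as many steps as there are pairs of members, no crossing pair is left. -/
theorem run_iterate_uncrossBody (h : Prepared part f m enc σ) (hr : Rows m enc g σ)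
    (hs : ∀ i < m, CutFamily.supp part (g i) = CutFamily.supp part (f i))
    (hg : Good part fun k : Fin m => g k) (hc : Crossings m g σ) :
    ∃ g', Rows m enc g' ((iterate uncrossBody).run σ) ∧
      Algorithm4 part (Set.range fun k : Fin m => g k) (Set.range fun k : Fin m => g' k) := by
  have key := run_iterate (m := m) (P := uncrossBody) (σ := σ) (fun c τ =>
    Prepared part f m enc τ ∧ ∃ g', Rows m enc g' τ ∧
      (∀ i < m, CutFamily.supp part (g' i) = CutFamily.supp part (f i)) ∧
      (Good part fun k : Fin m => g' k) ∧ Crossings m g' τ ∧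
      Relation.ReflTransGen (UncrossStep part) (Set.range fun k : Fin m => g k)
        (Set.range fun k : Fin m => g' k) ∧
      (c + crossCount (fun k : Fin m => g' k) ≤ m * m ∨
        CrossFree (Set.range fun k : Fin m => g' k))) (fun c τ h => h.1.reg4)
    (by
      rintro c τ x v hx ⟨h1, h2⟩
      exact ⟨h1.setReg (by omega) (by omega), h2⟩)
    ⟨h, g, hr, hs, hg, hc, .refl, Or.inl (by
      have := crossCount_le fun k : Fin m => g k
      simpa using this)⟩ (by
      rintro c τ ⟨h1, g', hr', hs', hg', hc', ht, hk⟩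
      refine ⟨h1.frame rfl (frame_run _ _), ?_⟩
      rcases run_uncrossBody h1 hr' hs' hg' hc' with ⟨hcf, hr2, hc2⟩ | ⟨g2, i, j, hU, hr2, hc2⟩
      · exact ⟨g', hr2, hs', hg', hc2, ht, Or.inr hcf⟩
      · obtain ⟨href, hlt⟩ := hg'.refines_of_uncrossAt hU
        refine ⟨g2, hr2, fun i hi => ?_, hg'.refines href, hc2,
          ht.tail (hU.uncrossStep hg'.injective), ?_⟩
        · rw [← hs' i hi]
          exact ((href.equivalent ⟨i, hi⟩).supp_eq).symm
        · rcases hk with hk | hk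
          · left
            omega
          · exact absurd hU.crossing (hk _ ⟨i, rfl⟩ _ ⟨j, rfl⟩))
  obtain ⟨-, g', hr', -, -, -, ht, hk⟩ := key
  refine ⟨g', hr', ht, ?_⟩
  rcases hk with hk | hk
  · rintro _ ⟨k, rfl⟩ _ ⟨l, rfl⟩ hkl
    have := crossCount_pos (f := fun k : Fin m => g' k) (i := k) (j := l) hkl
    omega
  · exact hk

/-- The output of the rows, complemented if they contain the element with the number `0`. -/
def outProg : HProg := .seq (fill 2 4 3 (.xor (.is 12 10 11 1)
  (.test (.eq (.cell 12 (.reg 10) (.const 0)) (.const 1)))))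
  (.seq (.set 0 (.const 1)) (.set 1 (.reg 4)))

theorem run_outProg {n : ℕ} (h3 : σ.reg 3 = n) (h4 : σ.reg 4 = m) :
    (outProg.run σ).reg 0 = 1 ∧ (outProg.run σ).reg 1 = m ∧ ∀ k < m, ∀ v < n,
      (outProg.run σ).arr 2 k v = 1 ↔ ¬ (σ.arr 12 k v = 1 ↔ σ.arr 12 k 0 = 1) := by
  set σ₁ := (fill 2 4 3 (.xor (.is 12 10 11 1)
    (.test (.eq (.cell 12 (.reg 10) (.const 0)) (.const 1))))).run σ with hσ₁
  have hrun : outProg.run σ = (σ₁.setReg 0 1).setReg 1 (σ₁.reg 4) := by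
    simp [outProg, ← hσ₁, Expr.val]
  have h4' : σ₁.reg 4 = m := ((frame_run _ σ).reg 4 rfl).trans h4
  rw [hrun]
  refine ⟨by simp, by simp [h4'], fun k hk v hv => ?_⟩
  simp only [setReg_arr]
  refine run_fill (Q := fun k v => ¬ (σ.arr 12 k v = 1 ↔ σ.arr 12 k 0 = 1)) (by decide) ?_
    (h4 ▸ hk) (h3 ▸ hv)
  intro i j τ _ _ h10 h11 hf
  rw [Fml.holds_xor]
  simp [Fml.Holds, Test.Holds, Expr.val, h10, h11, hf.arr 12 rfl]

end RAM

namespace RAM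

open CutFamily

variable {n r m : ℕ} {part : Fin n → Fin r} {X : Fin m → Set (Fin n)} {σ τ : Store}

/-! ### The whole program -/

/-- The memory when the main part of the program starts. -/
structure Loaded (part : Fin n → Fin r) (X : Fin m → Set (Fin n)) (σ : Store) : Prop where
  reg1 : σ.reg 1 = r
  reg3 : σ.reg 3 = n
  reg4 : σ.reg 4 = m
  reg5 : σ.reg 5 = n + 2 * m
  arr : σ.arr = (input part X).arr

theorem input_part (v : Fin n) : (input part X).arr 0 0 v = part v := by
  simp [input]

theorem input_char {k v : ℕ} (hk : k < m) :
    (input part X).arr 1 k v = 1 ↔ ∃ hv : v < n, (⟨v, hv⟩ : Fin n) ∈ X ⟨k, hk⟩ := by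
  by_cases hv : v < n <;> simp [input, hk, hv]

theorem input_zero {a : ℕ} (ha : 2 ≤ a) : (input part X).arr a = fun _ _ => 0 := by
  funext k v
  simp [input, show a ≠ 0 by omega, show a ≠ 1 by omega]

/-- The copies of the original sets and parts. -/
def copyProg : HProg := .seq (fill 3 4 5 (.is 1 10 11 1))
  (.forLt 10 3 (.put 4 (.const 0) (.reg 10) (.cell 0 (.const 0) (.reg 10))))

/-- The new parts: the elements of `A_X` for the `k`-th member `X` have the numbers `n + 2 * k`
and `n + 2 * k + 1`, and the former is added to `X`. -/
def newParts : HProg := .seq (.set 30 (.reg 3)) (.seq (.set 31 (.reg 1)) (.forLt 10 4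
  (.seq (.put 4 (.const 0) (.reg 30) (.reg 31)) (.seq (.put 3 (.reg 10) (.reg 30) (.const 1))
    (.seq (.put 4 (.const 0) (.succ (.reg 30)) (.reg 31))
      (.seq (.set 30 (.succ (.succ (.reg 30)))) (.set 31 (.succ (.reg 31)))))))))

theorem run_copyProg (h : Loaded part X σ) :
    (∀ v : Fin n, (copyProg.run σ).arr 4 0 v = part v) ∧
    ∀ i (hi : i < m), ∀ v < n + 2 * m, (copyProg.run σ).arr 3 i v = 1 ↔
      ∃ hv : v < n, (⟨v, hv⟩ : Fin n) ∈ X ⟨i, hi⟩ := by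
  set σ₁ := (fill 3 4 5 (.is 1 10 11 1)).run σ with hσ₁
  have f1 : Frame (fill 3 4 5 (.is 1 10 11 1)) σ σ₁ := frame_run _ _
  have hrun : copyProg.run σ =
    (HProg.forLt 10 3 (.put 4 (.const 0) (.reg 10) (.cell 0 (.const 0) (.reg 10)))).run σ₁ := rfl
  constructor
  · have := run_forLt (x := 10) (b := 3) (σ := σ₁)
      (P := .put 4 (.const 0) (.reg 10) (.cell 0 (.const 0) (.reg 10)))
      (fun k τ => ∀ v : Fin n, (v : ℕ) < k → τ.arr 4 0 v = part v) (by simp) (by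
        intro k τ hk h10 hf hI v hv
        have h0 : τ.arr 0 = (input part X).arr 0 := by
          rw [hf.arr 0 rfl, f1.arr 0 rfl, h.arr]
        simp only [run_put, Expr.val, h10, setReg_arr, setCell_arr, h0, true_and]
        by_cases hvk : (v : ℕ) = k
        · rw [if_pos hvk, ← hvk, input_part]
        · rw [if_neg hvk]
          exact hI v (by omega))
    rw [f1.reg 3 rfl, h.reg3] at this
    exact fun v => this v v.2
  · intro i hi v hv
    rw [hrun, (frame_run _ σ₁).arr 3 rfl]
    refine (run_fill (Q := fun i v => σ.arr 1 i v = 1) (by decide) ?_ (h.reg4 ▸ hi)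
      (h.reg5 ▸ hv)).trans ?_
    · intro i j τ _ _ h10 h11 hf
      simp [h10, h11, hf.arr 1 rfl]
    · rw [h.arr]
      exact input_char hi

theorem run_newParts (h1 : σ.reg 1 = r) (h3 : σ.reg 3 = n) (h4 : σ.reg 4 = m) :
    (∀ v < n, (newParts.run σ).arr 4 0 v = σ.arr 4 0 v) ∧
    (∀ k < m, (newParts.run σ).arr 4 0 (n + 2 * k) = r + k ∧
      (newParts.run σ).arr 4 0 (n + 2 * k + 1) = r + k) ∧
    ∀ i < m, ∀ v, (newParts.run σ).arr 3 i v = 1 ↔ σ.arr 3 i v = 1 ∨ v = n + 2 * i := by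
  have key := run_forLt (x := 10) (b := 4) (σ := (σ.setReg 30 n).setReg 31 r)
    (P := .seq (.put 4 (.const 0) (.reg 30) (.reg 31)) (.seq (.put 3 (.reg 10) (.reg 30) (.const 1))
    (.seq (.put 4 (.const 0) (.succ (.reg 30)) (.reg 31))
      (.seq (.set 30 (.succ (.succ (.reg 30)))) (.set 31 (.succ (.reg 31)))))))
    (fun c τ => τ.reg 30 = n + 2 * c ∧ τ.reg 31 = r + c ∧
      (∀ v < n, τ.arr 4 0 v = σ.arr 4 0 v) ∧
      (∀ k < c, τ.arr 4 0 (n + 2 * k) = r + k ∧ τ.arr 4 0 (n + 2 * k + 1) = r + k) ∧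
      ∀ i v, τ.arr 3 i v = 1 ↔ σ.arr 3 i v = 1 ∨ (i < c ∧ v = n + 2 * i))
    (by simp) (by
      rintro c τ - h10 - ⟨g1, g2, g3, g4, g5⟩
      simp only [run_seq, run_put, run_set, Expr.val, setReg_reg, setCell_reg, setReg_arr,
        setCell_arr, Nat.reduceEqDiff, if_false, if_true, g1, g2, h10, true_and, false_and]
      refine ⟨by ring, by ring, fun v hv => ?_, fun k hk => ?_, fun i v => ?_⟩
      · rw [if_neg (by omega), if_neg (by omega)]
        exact g3 v hv
      · by_cases hkc : k = c
        · subst hkc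
          simp
        · rw [if_neg (by omega), if_neg (by omega), if_neg (by omega), if_neg (by omega)]
          exact g4 k (by omega)
      · by_cases hic : i = c ∧ v = n + 2 * c
        · rw [if_pos hic, hic.1, hic.2]
          simp
        · rw [if_neg hic, g5]
          refine or_congr_right ⟨fun h => ⟨by omega, h.2⟩, fun h => ⟨?_, h.2⟩⟩
          have : i ≠ c := by
            rintro rfl
            exact hic ⟨rfl, h.2⟩
          omega)
  have hrun : newParts.run σ = (HProg.forLt 10 4
    (.seq (.put 4 (.const 0) (.reg 30) (.reg 31)) (.seq (.put 3 (.reg 10) (.reg 30) (.const 1))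
    (.seq (.put 4 (.const 0) (.succ (.reg 30)) (.reg 31))
      (.seq (.set 30 (.succ (.succ (.reg 30)))) (.set 31 (.succ (.reg 31)))))))).run
      ((σ.setReg 30 n).setReg 31 r) := by
    simp [newParts, Expr.val, h1, h3]
  have e4 : ((σ.setReg 30 n).setReg 31 r).reg 4 = m := by simp [h4]
  rw [e4, ← hrun] at key
  obtain ⟨-, -, g3, g4, g5⟩ := key
  exact ⟨g3, g4, fun i hi v => by rw [g5]; simp [hi]⟩

section

variable (hX : Function.Injective X)

/-- The number of an element of the extended ground set. -/
noncomputable def encode : Fin n ⊕ (Set.range X × Bool) → ℕ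
  | .inl v => v
  | .inr (x, b) => n + 2 * ((Equiv.ofInjective X hX).symm x : ℕ) + if b then 0 else 1

open Classical in
/-- The `i`-th member of the extended family. -/
noncomputable def extMember (X : Fin m → Set (Fin n)) (i : ℕ) :
    Set (Fin n ⊕ (Set.range X × Bool)) :=
  if h : i < m then extSet (Set.range X) ⟨X ⟨i, h⟩, Set.mem_range_self _⟩ else ∅

theorem extMember_image (X : Fin m → Set (Fin n)) :
    extMember X '' Set.Iio m = extFamily (Set.range X) := by
  rw [extFamily_eq]
  ext Z
  constructor
  · rintro ⟨i, hi, rfl⟩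
    exact ⟨⟨X ⟨i, hi⟩, Set.mem_range_self _⟩, by rw [extMember, dif_pos (Set.mem_Iio.1 hi)]⟩
  · rintro ⟨⟨_, ⟨i, rfl⟩⟩, rfl⟩
    exact ⟨i, i.2, by rw [extMember, dif_pos i.2]⟩

theorem extMember_injOn (hX : Function.Injective X) : Set.InjOn (extMember X) (Set.Iio m) := by
  intro i hi j hj h
  rw [extMember, extMember, dif_pos (Set.mem_Iio.1 hi), dif_pos (Set.mem_Iio.1 hj)] at h
  have := hX (congrArg Subtype.val (extSet_injective h))
  simpa using this

/-- The preprocessing of the family and the partition. -/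
def buildProg : HProg := .seq copyProg newParts

theorem encodes_run_buildProg (h : Loaded part X σ) :
    Encodes (extPart part (Set.range X)) (extMember X) m (encode hX) (buildProg.run σ) := by
  obtain ⟨c1, c2⟩ := run_copyProg h
  have fc : Frame copyProg σ (copyProg.run σ) := frame_run _ _
  obtain ⟨d1, d2, d3⟩ := run_newParts (σ := copyProg.run σ) ((fc.reg 1 rfl).trans h.reg1)
    ((fc.reg 3 rfl).trans h.reg3) ((fc.reg 4 rfl).trans h.reg4)
  have fb : Frame buildProg σ (buildProg.run σ) := frame_run _ _
  have hrun : newParts.run (copyProg.run σ) = buildProg.run σ := rfl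
  rw [hrun] at d1 d2 d3
  have e4 : ∀ w, (buildProg.run σ).arr 4 0 (encode hX w) = match w with
      | .inl v => (part v : ℕ)
      | .inr (x, _) => r + ((Equiv.ofInjective X hX).symm x : ℕ) := by
    rintro (v | ⟨x, b⟩)
    · dsimp only [encode]
      rw [d1 v v.2, c1 v]
    · have := d2 _ ((Equiv.ofInjective X hX).symm x).2
      cases b
      · simpa [encode] using this.2
      · simpa [encode] using this.1
  refine ⟨(fb.reg 4 rfl).trans h.reg4, ?_, ?_, ?_, ?_, ?_⟩
  · rw [fb.reg 5 rfl, h.reg5]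
    rintro (v | ⟨x, b⟩)
    · have := v.2
      dsimp only [encode]
      omega
    · have := ((Equiv.ofInjective X hX).symm x).2
      dsimp only [encode]
      split_ifs <;> omega
  · rw [fb.reg 5 rfl, h.reg5]
    intro v hv
    by_cases hvn : v < n
    · exact ⟨.inl ⟨v, hvn⟩, rfl⟩
    · have hk : (v - n) / 2 < m := by omega
      refine ⟨.inr (Equiv.ofInjective X hX ⟨(v - n) / 2, hk⟩, decide ((v - n) % 2 = 0)), ?_⟩
      simp only [encode, Equiv.symm_apply_apply, decide_eq_true_eq]
      split_ifs <;> omega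
  · rintro (v | ⟨x, b⟩) (w | ⟨y, c⟩) he
    · exact congrArg Sum.inl (Fin.ext he)
    · have := v.2
      dsimp only [encode] at he
      omega
    · have := w.2
      dsimp only [encode] at he
      omega
    · dsimp only [encode] at he
      have hb : b = c := by cases b <;> cases c <;> simp at he ⊢ <;> omega
      subst hb
      have : (Equiv.ofInjective X hX).symm x = (Equiv.ofInjective X hX).symm y :=
        Fin.ext (by omega)
      rw [(Equiv.ofInjective X hX).symm.injective this]
  · intro i hi w
    rw [d3 i hi, extMember, dif_pos hi]
    rcases w with v | ⟨x, b⟩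
    · have := v.2
      rw [c2 i hi _ (by dsimp only [encode]; omega), inl_mem_extSet]
      dsimp only [encode]
      constructor
      · rintro (⟨_, h⟩ | h)
        · exact h
        · omega
      · exact fun h => Or.inl ⟨v.2, h⟩
    · have hx := ((Equiv.ofInjective X hX).symm x).2
      rw [c2 i hi _ (by dsimp only [encode]; split_ifs <;> omega), inr_mem_extSet]
      have hxi : x = ⟨X ⟨i, hi⟩, Set.mem_range_self _⟩ ↔
          ((Equiv.ofInjective X hX).symm x : ℕ) = i := by
        have : (⟨X ⟨i, hi⟩, Set.mem_range_self _⟩ : Set.range X) =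
          Equiv.ofInjective X hX ⟨i, hi⟩ := rfl
        rw [this, ← Equiv.symm_apply_eq, Fin.ext_iff]
      dsimp only [encode]
      rw [hxi]
      constructor
      · rintro (⟨hv, -⟩ | hv)
        · exfalso
          split_ifs at hv <;> omega
        · cases b
          · simp only [Bool.false_eq_true, if_false] at hv
            omega
          · simp only [if_true] at hv
            exact ⟨by omega, rfl⟩
      · rintro ⟨rfl, rfl⟩
        exact Or.inr rfl
  · intro u w
    rw [e4, e4]
    rcases u with v | ⟨x, b⟩ <;> rcases w with w | ⟨y, c⟩
    · simp [extPart, Fin.ext_iff]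
    · have := (part v).2
      simp only [extPart, Sum.map_inl, Sum.map_inr, reduceCtorEq, iff_false]
      omega
    · have := (part w).2
      simp only [extPart, Sum.map_inl, Sum.map_inr, reduceCtorEq, iff_false]
      omega
    · simp [extPart, ← Fin.ext_iff]

end

theorem quadrant_extSet {V ι : Type*} {part : V → ι} {F : Set (Set V)} {Y Z : F} (h : Y ≠ Z)
    {a b : Bool} : Quadrant (extPart part F) (extSet F Y) (extSet F Z) a b ↔
      Quadrant part (Y : Set V) Z a b := by
  constructor
  · rintro ⟨v | ⟨x, c⟩, ⟨h1, h2⟩, h3, h4⟩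
    · rw [inl_mem_supp_extSet] at h1 h2
      rw [inl_mem_extSet] at h3 h4
      exact ⟨v, ⟨h1, h2⟩, h3, h4⟩
    · rw [inr_mem_supp_extSet] at h1 h2
      exact absurd (h1.symm.trans h2) h
  · rintro ⟨v, ⟨h1, h2⟩, h3, h4⟩
    exact ⟨.inl v, ⟨inl_mem_supp_extSet.2 h1, inl_mem_supp_extSet.2 h2⟩,
      inl_mem_extSet.trans h3, inl_mem_extSet.trans h4⟩

theorem ne_of_quadrant {V ι : Type*} {part : V → ι} {Y Z : Set V}
    (h : ∀ a b, Quadrant part Y Z a b) : Y ≠ Z := by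
  rintro rfl
  obtain ⟨v, -, h1, h2⟩ := h true false
  simp [h1] at h2

theorem pairwiseComparable_extFamily {V ι : Type*} {part : V → ι} {F : Set (Set V)} :
    PairwiseComparable (extPart part F) (extFamily F) ↔ PairwiseComparable part F := by
  rw [← not_iff_not, not_pairwiseComparable_iff, not_pairwiseComparable_iff, extFamily_eq]
  constructor
  · rintro ⟨_, ⟨Y, rfl⟩, _, ⟨Z, rfl⟩, h⟩
    have hYZ : Y ≠ Z := fun he => ne_of_quadrant h (congrArg _ he)
    exact ⟨Y, Y.2, Z, Z.2, fun a b => (quadrant_extSet hYZ).1 (h a b)⟩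
  · rintro ⟨Y, hY, Z, hZ, h⟩
    have hYZ : (⟨Y, hY⟩ : F) ≠ ⟨Z, hZ⟩ := fun he => ne_of_quadrant h (congrArg Subtype.val he)
    exact ⟨_, ⟨⟨Y, hY⟩, rfl⟩, _, ⟨⟨Z, hZ⟩, rfl⟩, fun a b => (quadrant_extSet hYZ).2 (h a b)⟩

theorem output_eq_some {W : Type*} (hn : 0 < n) {g : ℕ → Set (Fin n ⊕ W)} (h0 : σ.reg 0 ≠ 0)
    (h1 : σ.reg 1 = m) (h2 : ∀ k < m, ∀ v : Fin n, σ.arr 2 k v = 1 ↔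
      ¬ (Sum.inl v ∈ g k ↔ Sum.inl ⟨0, hn⟩ ∈ g k)) :
    output n σ = some {Z | ∃ Y ∈ (fun Y => Sum.inl ⁻¹' Y) '' (Set.range fun k : Fin m => g k),
      (⟨0, hn⟩ ∉ Y ∧ Z = Y) ∨ (⟨0, hn⟩ ∈ Y ∧ Z = Yᶜ)} := by
  rw [output, if_neg h0, h1]
  refine congrArg some (Set.ext fun Z => ?_)
  simp only [Set.mem_ofPred_eq]
  constructor
  · rintro ⟨k, hk, rfl⟩
    refine ⟨Sum.inl ⁻¹' g k, ⟨g k, ⟨⟨k, hk⟩, rfl⟩, rfl⟩, ?_⟩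
    by_cases he : Sum.inl ⟨0, hn⟩ ∈ g k
    · refine Or.inr ⟨he, ?_⟩
      ext v
      simp [h2 k hk, he]
    · refine Or.inl ⟨he, ?_⟩
      ext v
      simp [h2 k hk, he]
  · rintro ⟨_, ⟨_, ⟨k, rfl⟩, rfl⟩, h'⟩
    refine ⟨k, k.2, ?_⟩
    rcases h' with ⟨he, rfl⟩ | ⟨he, rfl⟩
    · ext v
      have he' : Sum.inl ⟨0, hn⟩ ∉ g k := he
      simp [h2 k k.2, he']
    · ext v
      have he' : Sum.inl ⟨0, hn⟩ ∈ g k := he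
      simp [h2 k k.2, he']

theorem output_run_outProg {W : Type*} {hn : 0 < n} {g : ℕ → Set (Fin n ⊕ W)} {enc : Fin n ⊕ W → ℕ}
    (h3 : σ.reg 3 = n) (h4 : σ.reg 4 = m) (henc : ∀ v, enc (Sum.inl v) = v)
    (hrow : Rows m enc g σ) :
    output n (outProg.run σ) = some {Z | ∃ Y ∈ (fun Y => Sum.inl ⁻¹' Y) ''
      (Set.range fun k : Fin m => g k), (⟨0, hn⟩ ∉ Y ∧ Z = Y) ∨ (⟨0, hn⟩ ∈ Y ∧ Z = Yᶜ)} := by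
  obtain ⟨o0, o1, o2⟩ := run_outProg h3 h4
  refine output_eq_some hn (by omega) o1 fun k hk v => ?_
  rw [o2 k hk v v.2, ← hrow k hk, ← hrow k hk, henc, henc]

/-- Relabelling, uncrossing and output. -/
def finishProg : HProg :=
  .seq relabelProg (.seq crossProg (.seq (iterate uncrossBody) outProg))

/-- The labelling, and what follows it. -/
def solveProg : HProg := .seq labelInit (.seq (iterate labelBody)
  (.ite .badLabels (.set 0 (.const 0)) finishProg))

/-- The program after the test of the number of members. The arrays `0` and `1` hold the input and
`2` the output; `3` and `4` the preprocessed family and partition, `5` to `9` the cutting supports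
and quadrants, `10` and `11` the labels and the processed nodes, `12` the rows of the current family,
and `13` its crossing pairs. -/
def mainProg : HProg := .seq buildProg (.seq prepProg
  (.ite .incomparable (.set 0 (.const 0)) solveProg))

theorem output_set_zero (n : ℕ) (σ : Store) :
    output n ((HProg.set 0 (.const 0)).run σ) = none := by
  simp [output, Expr.val]

section

variable {hX : Function.Injective X}

theorem run_finishProg (hn : 0 < n) (hcard : (Set.range X).ncard ≤ 2 * Nat.card (Fin n))
    (hpc : PairwiseComparable part (Set.range X))
    (p : Prepared (extPart part (Set.range X)) (extMember X) m (encode hX) σ) (h3 : σ.reg 3 = n)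
    (h5 : Algorithm5 (extPart part (Set.range X)) (extMember X '' Set.Iio m)
      (some (relabel (extPart part (Set.range X)) (extMember X '' Set.Iio m)
        (labels (extMember X) m σ) '' (extMember X '' Set.Iio m))))
    (hgood : Good (extPart part (Set.range X)) fun k : Fin m => relabel (extPart part (Set.range X))
      (extMember X '' Set.Iio m) (labels (extMember X) m σ) (extMember X k)) :
    Run part (Set.range X) (output n (finishProg.run σ)) := by
  have hrow := run_relabelProg (extMember_injOn hX) p
  have f3 : Frame relabelProg σ (relabelProg.run σ) := frame_run _ _
  have p4 := p.frame rfl f3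
  have h34 := (f3.reg 3 rfl).trans h3
  rw [finishProg, run_seq]
  generalize relabelProg.run σ = σ₃ at *
  have hcr := run_crossProg p4 hrow
  have f4 : Frame crossProg σ₃ (crossProg.run σ₃) := frame_run _ _
  have p5 := p4.frame rfl f4
  have h35 := (f4.reg 3 rfl).trans h34
  have hrow4 := rows_congr (f4.arr 12 rfl) hrow
  rw [run_seq]
  generalize crossProg.run σ₃ = σ₄ at *
  obtain ⟨g', hrow', h4⟩ := run_iterate_uncrossBody p5 hrow4
    (fun i hi => supp_relabel) hgood hcr
  have f5 : Frame (iterate uncrossBody) σ₄ ((iterate uncrossBody).run σ₄) := frame_run _ _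
  have h36 := (f5.reg 3 rfl).trans h35
  have h46 := (f5.reg 4 rfl).trans p5.reg4
  rw [run_seq]
  generalize (iterate uncrossBody).run σ₄ = σ₅ at *
  have hG : Set.range (fun k : Fin m => relabel (extPart part (Set.range X))
      (extMember X '' Set.Iio m) (labels (extMember X) m σ) (extMember X k)) =
      relabel (extPart part (Set.range X)) (extMember X '' Set.Iio m)
        (labels (extMember X) m σ) '' (extMember X '' Set.Iio m) := by
    ext Z
    constructor
    · rintro ⟨k, rfl⟩
      exact ⟨_, ⟨k, k.2, rfl⟩, rfl⟩
    · rintro ⟨_, ⟨k, hk, rfl⟩, rfl⟩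
      exact ⟨⟨k, hk⟩, rfl⟩
  rw [← hG] at h5
  rw [extMember_image] at h5 h4
  rw [output_run_outProg (hn := hn) h36 h46 (fun _ => rfl) hrow']
  exact .success hcard hpc _ _ h5 h4 _

theorem run_solveProg (hn : 0 < n) (hF : IsCutFamily part (Set.range X))
    (hcard : (Set.range X).ncard ≤ 2 * Nat.card (Fin n))
    (hpc : PairwiseComparable part (Set.range X))
    (p : Prepared (extPart part (Set.range X)) (extMember X) m (encode hX) σ) (h3 : σ.reg 3 = n)
    (h10 : σ.arr 10 = fun _ _ => 0) (h11 : σ.arr 11 = fun _ _ => 0) :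
    Run part (Set.range X) (output n (solveProg.run σ)) := by
  have hinj := extMember_injOn hX
  have hsep : Separated (extPart part (Set.range X)) (extMember X '' Set.Iio m) := by
    rw [extMember_image]
    exact separated_extFamily hF
  have hpc' : PairwiseComparable (extPart part (Set.range X)) (extMember X '' Set.Iio m) := by
    rw [extMember_image, pairwiseComparable_extFamily]
    exact hpc
  have hl0 := partial_labelInit p h10 h11
  have f1 : Frame labelInit σ (labelInit.run σ) := frame_run _ _
  have p2 := p.frame rfl f1
  have h32 := (f1.reg 3 rfl).trans h3
  rw [solveProg, run_seq]
  generalize labelInit.run σ = σ₁ at *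
  obtain ⟨hl, hfin⟩ := run_iterate_labelBody p2 hpc' hl0
  have f2 : Frame (iterate labelBody) σ₁ ((iterate labelBody).run σ₁) := frame_run _ _
  have p3 := p2.frame rfl f2
  have h33 := (f2.reg 3 rfl).trans h32
  rw [run_seq]
  generalize (iterate labelBody).run σ₁ = σ₂ at *
  by_cases hbad : Fml.badLabels.Holds 0 σ₂
  · rw [run_ite_pos hbad, output_set_zero]
    have := algorithm5_none hinj hsep hl hfin p3 hbad
    rw [extMember_image] at this
    exact .noLabeling hcard hpc this
  · have hs := (isLCLabeling_labels_iff hinj p3).2 hbad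
    obtain ⟨h5, hgood⟩ := algorithm5_of_labels hinj hsep hpc' hl hfin hs
    rw [run_ite_neg hbad]
    exact run_finishProg hn hcard hpc p3 h33 h5 hgood

end

theorem run_mainProg (hn : 0 < n) (hX : Function.Injective X)
    (hF : IsCutFamily part (Set.range X)) (hm : m ≤ 2 * n) (h : Loaded part X σ) :
    Run part (Set.range X) (output n (mainProg.run σ)) := by
  have hcard : (Set.range X).ncard ≤ 2 * Nat.card (Fin n) := by
    rw [Nat.card_fin, ← Set.image_univ, Set.ncard_image_of_injective _ hX, Set.ncard_univ,
      Nat.card_fin]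
    exact hm
  have p1 := prepared_run (encodes_run_buildProg hX h)
  have fb : Frame buildProg σ (buildProg.run σ) := frame_run _ _
  have fp : Frame prepProg (buildProg.run σ) (prepProg.run (buildProg.run σ)) := frame_run _ _
  have h3 := ((fp.reg 3 rfl).trans (fb.reg 3 rfl)).trans h.reg3
  have hz : ∀ a, 2 ≤ a → prepProg.writesArr a = false → buildProg.writesArr a = false →
      (prepProg.run (buildProg.run σ)).arr a = fun _ _ => 0 := fun a ha hp hb => by
    rw [fp.arr a hp, fb.arr a hb, h.arr, input_zero ha]
  have h10 := hz 10 (by decide) rfl rfl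
  have h11 := hz 11 (by decide) rfl rfl
  rw [mainProg, run_seq, run_seq]
  generalize prepProg.run (buildProg.run σ) = σ₁ at *
  have hinc := p1.holds_incomparable
  rw [extMember_image, pairwiseComparable_extFamily] at hinc
  by_cases hpc : PairwiseComparable part (Set.range X)
  · rw [run_ite_neg (mt hinc.1 (not_not.2 hpc))]
    exact run_solveProg hn hF hcard hpc p1 h3 h10 h11
  · rw [run_ite_pos (hinc.2 hpc), output_set_zero]
    exact .incomparable hpc

end RAM

namespace RAM

open CutFamily

variable {n r m : ℕ} {part : Fin n → Fin r} {X : Fin m → Set (Fin n)} {σ τ : Store}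

/-- Register `y` becomes `e` plus twice register `b`. -/
def addTwice (y b : ℕ) (e : Expr) : HProg :=
  .seq (.set y e) (.forLt 10 b (.set y (.succ (.succ (.reg y)))))

theorem run_addTwice {y b : ℕ} {e : Expr} (hy : y ≠ 10) (hb : b ≠ y) :
    ((addTwice y b e).run σ).reg y = e.val σ + 2 * σ.reg b := by
  have := run_forLt (x := 10) (b := b) (P := .set y (.succ (.succ (.reg y))))
    (σ := σ.setReg y (e.val σ)) (fun k τ => τ.reg y = e.val σ + 2 * k) (by simp [hy]) (by
      intro k τ _ _ _ h
      simp only [run_set, Expr.val, setReg_reg, if_neg hy, if_true, h]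
      ring)
  rw [setReg_reg, if_neg hb] at this
  exact this

theorem output_congr (h : Agree 0 σ τ) : output n σ = output n τ := by
  rw [output, output, h.reg 0 rfl, h.reg 1 rfl, h.arr]

/-- The program that implements the combined procedure. Register `3` receives `n`, register `4` the
number `m` of members, provided that `m ≤ 2 * n`, and register `5` the size `n + 2 * m` of the
extended ground set. -/
def laminarizeProg : Prog :=
  .seq (.assign 3 (.reg 0)) (.seq (addTwice 6 3 (.const 0)).compile
    (.ite (.lt (.reg 6) (.reg 2)) (.assign 0 (.const 0))
      (.seq (.assign 4 (.reg 2)) (.seq (addTwice 7 4 (.reg 3)).compile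
        (.seq (.assign 5 (.reg 7)) mainProg.compile)))))

theorem HProg.exec_compile_pow_four {N : ℕ} (hN : 1 ≤ N) {P : HProg} (hw : P.wf = true)
    (hd : P.deg ≤ 4) (h : Agree 0 σ τ) (hb : Bounded N σ) :
    ∃ υ t, Exec P.compile τ υ t ∧ t ≤ P.coeff * N ^ 4 ∧ Agree 0 (P.run σ) υ := by
  obtain ⟨υ, t, h1, h2, h3⟩ := HProg.exec_compile hN P σ τ hw h hb
  exact ⟨υ, t, h1, h2.trans (Nat.mul_le_mul_left _ (Nat.pow_le_pow_right hN hd)), h3⟩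

theorem bounded_iff {N : ℕ} : Bounded N σ ↔ σ.reg 3 ≤ N ∧ σ.reg 4 ≤ N ∧ σ.reg 5 ≤ N := by
  constructor
  · exact fun h => ⟨h 3 rfl, h 4 rfl, h 5 rfl⟩
  · rintro ⟨h3, h4, h5⟩ b hb
    simp only [isBound, Bool.or_eq_true, beq_iff_eq] at hb
    rcases hb with (rfl | rfl) | rfl <;> assumption

theorem wf_mainProg : mainProg.wf = true := by decide

theorem deg_mainProg_le : mainProg.deg ≤ 4 := by decide

/-- The program halts within `O(n ^ 4)` steps with the result of a run of the combined procedure. -/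
theorem exec_laminarizeProg : ∃ C, ∀ {n r m : ℕ} {part : Fin n → Fin r} {X : Fin m → Set (Fin n)},
    0 < n → Function.Injective X → IsCutFamily part (Set.range X) →
    ∃ τ t, Exec laminarizeProg (input part X) τ t ∧ t ≤ C * n ^ 4 ∧
      Run part (Set.range X) (output n τ) := by
  obtain ⟨a, ha⟩ : ∃ a, (addTwice 6 3 (.const 0)).coeff = a := ⟨_, rfl⟩
  obtain ⟨b, hb⟩ : ∃ b, (addTwice 7 4 (.reg 3)).coeff = b := ⟨_, rfl⟩
  obtain ⟨c, hc⟩ : ∃ c, mainProg.coeff = c := ⟨_, rfl⟩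
  -- The loops have bounds of at most `5 * n`, since `n + 2 * m ≤ 5 * n`; and `625 = 5 ^ 4`.
  refine ⟨(a + b + c + 11) * 625, fun {n r m part X} hn hX hF => ?_⟩
  have hN : 1 ≤ 5 * n := by omega
  have hpow : ∀ c, c * (5 * n) ^ 4 = c * 625 * n ^ 4 := fun c => by
    rw [mul_pow]
    ring
  have hone : 1 ≤ (5 * n) ^ 4 := Nat.one_le_pow _ _ hN
  rw [← hpow]
  have harith : ∀ {a b c K t u v : ℕ}, 1 ≤ K → t ≤ a * K → u ≤ b * K → v ≤ c * K →
      t + u + v + 11 ≤ (a + b + c + 11) * K := by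
    intro a b c K t u v h1 h2 h3 h4
    nlinarith
  set σ₁ := (input part X).setReg 3 n with hσ₁
  have e1 : Exec (.assign 3 (.reg 0)) (input part X) σ₁ 2 := .assign _ 3 (.reg 0)
  have i0 : ∀ x, (input part X).reg x =
    if x = 0 then n else if x = 1 then r else if x = 2 then m else 0 := fun _ => rfl
  obtain ⟨τ₂, t₂, e2, b2, a2⟩ := HProg.exec_compile_pow_four hN (P := addTwice 6 3 (.const 0))
    (by decide) (by decide) (σ := σ₁) ⟨fun _ _ => rfl, rfl⟩
    (bounded_iff.2 (by simp [hσ₁, i0]; omega))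
  have f2 : Frame (addTwice 6 3 (.const 0)) σ₁ ((addTwice 6 3 (.const 0)).run σ₁) := frame_run _ _
  have g2 : ((addTwice 6 3 (.const 0)).run σ₁).reg 6 = 2 * n := by
    rw [run_addTwice (by decide) (by decide)]
    simp [Expr.val, hσ₁]
  generalize (addTwice 6 3 (.const 0)).run σ₁ = σ₂ at *
  have h20 : σ₂.reg 0 = n := by rw [f2.reg 0 rfl]; simp [hσ₁, i0]
  have h21 : σ₂.reg 1 = r := by rw [f2.reg 1 rfl]; simp [hσ₁, i0]
  have h22 : σ₂.reg 2 = m := by rw [f2.reg 2 rfl]; simp [hσ₁, i0]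
  have h23 : σ₂.reg 3 = n := by rw [f2.reg 3 rfl]; simp [hσ₁]
  have h25 : σ₂.reg 5 = 0 := by rw [f2.reg 5 rfl]; simp [hσ₁, i0]
  have h2a : σ₂.arr = (input part X).arr := funext fun a => f2.arr a rfl
  have htest : (Test.lt (.reg 6) (.reg 2)).Holds τ₂ ↔ 2 * n < m := by
    rw [Test.Holds, Expr.val, Expr.val, ← a2.reg 6 rfl, ← a2.reg 2 rfl, g2, h22]
  by_cases hm : 2 * n < m
  · refine ⟨_, _, .seq e1 (.seq e2 (.iteTrue (htest.2 hm) (.assign _ _ _))), ?_, ?_⟩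
    · refine le_trans ?_ (harith hone (ha ▸ b2) (Nat.zero_le _) (Nat.zero_le _))
      simp only [Expr.cost, Test.cost]
      omega
    · have : output n (τ₂.setReg 0 ((Expr.const 0).val τ₂)) = none := by simp [output, Expr.val]
      rw [this]
      refine .tooMany ?_
      rw [Nat.card_fin, ← Set.image_univ, Set.ncard_image_of_injective _ hX, Set.ncard_univ,
        Nat.card_fin]
      exact hm
  have a3 := a2.setReg 4 m
  have e3 : Exec (.assign 4 (.reg 2)) τ₂ (τ₂.setReg 4 m) 2 := by
    have := Exec.assign τ₂ 4 (.reg 2)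
    rwa [Expr.val, ← a2.reg 2 rfl, h22] at this
  obtain ⟨τ₄, t₄, e4, b4, a4⟩ := HProg.exec_compile_pow_four hN (P := addTwice 7 4 (.reg 3))
    (by decide) (by decide) a3 (bounded_iff.2 (by simp [h23, h25]; omega))
  have f4 : Frame (addTwice 7 4 (.reg 3)) (σ₂.setReg 4 m)
    ((addTwice 7 4 (.reg 3)).run (σ₂.setReg 4 m)) := frame_run _ _
  have g4 : ((addTwice 7 4 (.reg 3)).run (σ₂.setReg 4 m)).reg 7 = n + 2 * m := by
    rw [run_addTwice (by decide) (by decide)]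
    simp [Expr.val, h23]
  generalize (addTwice 7 4 (.reg 3)).run (σ₂.setReg 4 m) = σ₄ at *
  have h41 : σ₄.reg 1 = r := by rw [f4.reg 1 rfl]; simp [h21]
  have h43 : σ₄.reg 3 = n := by rw [f4.reg 3 rfl]; simp [h23]
  have h44 : σ₄.reg 4 = m := by rw [f4.reg 4 rfl]; simp
  have h4a : σ₄.arr = (input part X).arr := (funext fun a => f4.arr a rfl).trans h2a
  have a5 := a4.setReg 5 (n + 2 * m)
  have e5 : Exec (.assign 5 (.reg 7)) τ₄ (τ₄.setReg 5 (n + 2 * m)) 2 := by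
    have := Exec.assign τ₄ 5 (.reg 7)
    rwa [Expr.val, ← a4.reg 7 rfl, g4] at this
  have hload : Loaded part X (σ₄.setReg 5 (n + 2 * m)) :=
    ⟨by simp [h41], by simp [h43], by simp [h44], by simp, h4a⟩
  obtain ⟨τ₆, t₆, e6, b6, a6⟩ := HProg.exec_compile_pow_four hN wf_mainProg deg_mainProg_le a5
    (bounded_iff.2 (by rw [hload.reg3, hload.reg4, hload.reg5]; omega))
  refine ⟨_, _, .seq e1 (.seq e2 (.iteFalse (mt htest.1 hm)
    (.seq e3 (.seq e4 (.seq e5 e6))))), ?_, ?_⟩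
  · refine le_trans ?_ (harith hone (ha ▸ b2) (hb ▸ b4) (hc ▸ b6))
    simp only [Expr.cost, Test.cost]
    omega
  · rw [← output_congr a6]
    exact run_mainProg hn hX hF (by omega) hload

end RAM

/-- Every family of cuts has a run, namely the one that the machine makes for some numbering of the
members. -/
theorem CutFamily.Run.exists {n r : ℕ} (hn : 0 < n) {part : Fin n → Fin r} {F : Set (Set (Fin n))}
    (hF : CutFamily.IsCutFamily part F) : ∃ out, CutFamily.Run part F out := by
  obtain ⟨m, ⟨e⟩⟩ := Finite.exists_equiv_fin F
  have hr : Set.range (fun k => (e.symm k : Set (Fin n))) = F := by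
    exact (e.symm.surjective.range_comp _).trans Subtype.range_coe
  obtain ⟨C, hC⟩ := RAM.exec_laminarizeProg
  obtain ⟨τ, -, -, -, h⟩ := hC hn
    (X := fun k => (e.symm k : Set (Fin n))) (Subtype.val_injective.comp e.symm.injective)
    (part := part) (by rwa [hr])
  rw [hr] at h
  exact ⟨_, h⟩

theorem mainTheorem5 :
    -- every run of the algorithms halts with a correct answer, whatever choices are made
    (∃ C : ℕ, ∀ (n r : ℕ), 0 < n → ∀ part : Fin n → Fin r, Function.Surjective part →
      ∀ F : Set (Set (Fin n)), CutFamily.IsCutFamily part F → CutFamily.NonRedundant part F →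
        (∃ out, CutFamily.Run part F out) ∧
        (∀ out, CutFamily.Run part F out → CutFamily.SolvesLaminarization part F out) ∧
        (F.ncard ≤ 2 * n → CutFamily.PairwiseComparable part F →
          ∀ G, CutFamily.Algorithm5 (CutFamily.extPart part F) (CutFamily.extFamily F) (some G) →
            CutFamily.Algorithm4StopsWithin (CutFamily.extPart part F) G (C * n ^ 2))) ∧
    -- an implementation takes `O(n ^ 4)` steps
    (∃ (P : RAM.Prog) (C : ℕ), ∀ (n r m : ℕ), 0 < n →
      ∀ part : Fin n → Fin r, Function.Surjective part →
      ∀ X : Fin m → Set (Fin n), Function.Injective X →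
        CutFamily.IsCutFamily part (Set.range X) → CutFamily.NonRedundant part (Set.range X) →
        ∃ (τ : RAM.Store) (t : ℕ), RAM.Exec P (RAM.input part X) τ t ∧ t ≤ C * n ^ 4 ∧
          CutFamily.Run part (Set.range X) (RAM.output n τ) ∧
          CutFamily.SolvesLaminarization part (Set.range X) (RAM.output n τ)) := by
  obtain ⟨C, hC⟩ := RAM.exec_laminarizeProg
  refine ⟨⟨4, fun n r hn part _ F hF hnr => ⟨CutFamily.Run.exists hn hF,
    fun out h => h.solves hF hnr, fun hcard _ G h5 => ?_⟩⟩,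
    RAM.laminarizeProg, C, fun n r m hn part _ X hX hF hnr => ?_⟩
  · have := CutFamily.algorithm4StopsWithin_of_algorithm5 hF (by rwa [Nat.card_fin]) h5
    rwa [Nat.card_fin] at this
  · obtain ⟨τ, t, h1, h2, h3⟩ := hC hn hX hF
    exact ⟨τ, t, h1, h2, h3, h3.solves hF hnr⟩
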